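/- Let $n\ge 2$, $0\le m\le n$, let $p_{jk}$ $(1\le j,k\le n)$ be real constants, and let $\overline\Pi=[0,1]\times\mathbb R$. Let $BC^1$ be the space of $C^1$-functions $f:\overline\Pi\to\mathbb R$ with $\|f\|_1=\|f\|_\infty+\|\partial_xf\|_\infty+\|\partial_tf\|_\infty<\infty$, where $\|f\|_\infty=\sup_{\overline\Pi}|f|$. Let $a_j,b_j\in BC^1$ $(1\le j\le n)$ and assume that for some $\Lambda_0>0$ one has $a_j\ge\Lambda_0$ on $\overline\Pi$ for $j\le m$ and $a_j\le-\Lambda_0$ on $\overline\Pi$ for $j>m$. For $\tilde b=(\tilde b_{jk})$ with entries in $BC^1$ consider the perturbed problem $$\partial_tu_j+a_j\partial_xu_j+b_ju_j+\sum_{k=1}^n\tilde b_{jk}u_k=0,\qquad u_j(x_j,t)=(Pu)_j(t),\qquad 1\le j\le n,$$ where $x_j=0$ for $j\le m$, $x_j=1$ for $j>m$, and $(Pu)_j(t)=\sum_{k\le m}p_{jk}u_k(1,t)+\sum_{k>m}p_{jk}u_k(0,t)$. An $L^2$-generalized solution on $[\tau,\infty)$ with initial value $\varphi\in L^2(0,1)^n$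 is a $u\in C([\tau,\infty),L^2(0,1)^n)$ such that, whenever $\varphi^l\in C_0^\infty(0,1)^n$ and $\varphi^l\to\varphi$ in $L^2$, the classical ($C^1$ on $[0,1]\times[\tau,\infty)$) solutions with initial values $\varphi^l$ at $t=\tau$ exist and converge to $u$ in $L^2(0,1)^n$, locally uniformly in $t\ge\tau$. An evolution family is a strongly continuous family $\{U(t,\tau)\}_{t\ge\tau}$ of bounded operators with $U(\tau,\tau)=I$ and $U(t,s)U(s,\tau)=U(t,\tau)$ for $t\ge s\ge\tau$; it is generated by the problem if $t\mapsto U(t,\tau)\varphi$ is the $L^2$-generalized solution with initial value $\varphi$ at time $\tau$, for all $\tau\in\mathbb R$ and $\varphi\in L^2(0,1)^n$. Powers $X^n$ carry the norm $\max_j\|u_j\|_X$, and $\|v\|_{C^1([0,1])}=\max|v|+\max|v'|$. Let $\xi\mapsto\omega_j(\xi,x,t)$ be the solution on $[0,1]$ of $\partial_\xi\omega_j=1/a_j(\xi,\omega_j)$, $\omega_j(x,x,t)=t$; let $c_j(\xi,x,t)=\exp\int_x^\xi(b_j/a_j)(\eta,\omega_j(\eta,x,t))\,d\eta$ and $(Cv)_j(x,t)=c_j(x_j,x,t)\,v_j(\omega_j(x_j,x,t))$.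 Assume the finite time extinction condition: there is $k\in\mathbb N$ such that $(CP)^ku\equiv0$ for all $u\in C(\overline\Pi)^n$. Then for every $\gamma>0$ there is $M\ge1$ such that the following holds. (i) There is $\varepsilon>0$ such that, whenever $\tilde b_{jk}\in BC^1$ and $\max_{j,k}\|\tilde b_{jk}\|_\infty<\varepsilon$, the perturbed problem generates an evolution family $\tilde U$ on $L^2(0,1)^n$, and $$\|\tilde U(t,\tau)\|_{\mathcal L(L^2(0,1)^n)}\le Me^{-\gamma(t-\tau)}\quad\text{for all }t\ge\tau.$$ (ii) There is $\varepsilon>0$ such that the following holds for the set $\mathcal B_\varepsilon$ of all $\tilde b$ such that $\tilde b_{jk}\in BC^1$, $\max_{j,k}\|\tilde b_{jk}\|_1<\varepsilon$, $\tilde b_{jj}\equiv0$, and for all $j\ne k$ there is $\beta_{jk}\in BC^1$ with $\tilde b_{jk}=\beta_{jk}(a_k-a_j)$. For each $\tilde b\in\mathcal B_\varepsilon$ the perturbed problem generates an evolution family $\tilde U$, and there are $M_1\ge M$ and $T_1>0$, independent of $t$ and $\tau$, such that $\tilde U(t,\tau)$ maps $L^2(0,1)^n$ into $C^1([0,1])^n$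 and $$\|\tilde U(t,\tau)\|_{\mathcal L(L^2(0,1)^n,C^1([0,1])^n)}\le M_1e^{-\gamma(t-\tau)}\quad\text{for all }t\ge\tau+T_1.$$ Here $M_1$ can be chosen the same for all $\tilde b\in\mathcal B_\varepsilon$ (with $T_1$ depending on $\tilde b$), and also $T_1$ can be chosen the same for all $\tilde b\in\mathcal B_\varepsilon$ (with $M_1$ depending on $\tilde b$). -/

import Mathlib

open MeasureTheory Set Filter Topology
open scoped ContDiff

namespace Hyp

noncomputable section

/-! A real function of `(x, t)` is a map `ℝ → ℝ → ℝ`; only its values for `0 ≤ x ≤ 1` matter.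
Components are indexed by `Fin n`; the index `j : Fin n` stands for the component number `j + 1`,
so the components `1, …, m` are those with `(j : ℕ) < m`. -/

/-- The closed strip `[0,1] × ℝ`. -/
def strip : Set (ℝ × ℝ) := Icc (0 : ℝ) 1 ×ˢ univ

/-- The closed half-strip `[0,1] × [τ,∞)`. -/
def halfStrip (τ : ℝ) : Set (ℝ × ℝ) := Icc (0 : ℝ) 1 ×ˢ Ici τ

/-- `∂ₓ f` on the closed strip (one-sided at `x = 0` and `x = 1`). -/
def dx (f : ℝ → ℝ → ℝ) (x t : ℝ) : ℝ := derivWithin (fun y => f y t) (Icc (0 : ℝ) 1) x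

/-- `∂ₜ f`. -/
def dt (f : ℝ → ℝ → ℝ) (x t : ℝ) : ℝ := deriv (fun s => f x s) t

/-- `BC¹`: continuously differentiable on the closed strip, bounded together with the first order
partial derivatives. -/
def IsBC1 (f : ℝ → ℝ → ℝ) : Prop :=
  ContDiffOn ℝ 1 (fun z : ℝ × ℝ => f z.1 z.2) strip ∧
    ∃ K : ℝ, ∀ x ∈ Icc (0 : ℝ) 1, ∀ t : ℝ, |f x t| ≤ K ∧ |dx f x t| ≤ K ∧ |dt f x t| ≤ K

/-- `‖f‖_∞`, the supremum of `|f|` over the strip (used for bounded `f` only). -/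
def supNorm (f : ℝ → ℝ → ℝ) : ℝ := ⨆ z : Icc (0 : ℝ) 1 × ℝ, |f z.1 z.2|

/-- `‖f‖_1 = ‖f‖_∞ + ‖∂ₓ f‖_∞ + ‖∂ₜ f‖_∞` (used for `f` in `BC¹` only). -/
def bc1Norm (f : ℝ → ℝ → ℝ) : ℝ := supNorm f + supNorm (dx f) + supNorm (dt f)

/-- Non-degeneracy: `a_j ≥ Λ₀` for `1 ≤ j ≤ m` and `a_j ≤ -Λ₀` for `m < j ≤ n`, for some
`Λ₀ > 0`. -/
def NonDegenerate {n : ℕ} (m : ℕ) (a : Fin n → ℝ → ℝ → ℝ) : Prop :=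
  ∃ Λ₀ : ℝ, 0 < Λ₀ ∧ ∀ j : Fin n, ∀ x ∈ Icc (0 : ℝ) 1, ∀ t : ℝ,
    ((j : ℕ) < m → Λ₀ ≤ a j x t) ∧ (m ≤ (j : ℕ) → a j x t ≤ -Λ₀)

/-- `w : [0,1] → ℝ` solves `w'(ξ) = 1 / a(ξ, w(ξ))`, `w(x) = t`. -/
def IsCharacteristic (a : ℝ → ℝ → ℝ) (x t : ℝ) (w : ℝ → ℝ) : Prop :=
  w x = t ∧ ∀ ξ ∈ Icc (0 : ℝ) 1, HasDerivWithinAt w (1 / a ξ (w ξ)) (Icc (0 : ℝ) 1) ξ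

open Classical in
/-- The characteristic `ξ ↦ ω(ξ, x, t)` of `∂ₜ + a ∂ₓ` through `(x, t)`. For `a` in `BC¹` bounded
away from zero, and `x ∈ [0,1]`, the initial value problem has exactly one solution on `[0,1]`. -/
def charCurve (a : ℝ → ℝ → ℝ) (ξ x t : ℝ) : ℝ :=
  if h : ∃ w : ℝ → ℝ, IsCharacteristic a x t w then h.choose ξ else t

/-- `c(ξ, x, t) = exp ∫_x^ξ (b / a)(η, ω(η, x, t)) dη`. -/
def charWeight (a b : ℝ → ℝ → ℝ) (ξ x t : ℝ) : ℝ :=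
  Real.exp (∫ η in x..ξ, b η (charCurve a η x t) / a η (charCurve a η x t))

/-- The endpoint `x_j` at which the `j`-th characteristics enter: `0` if `j ≤ m` and `1` if
`j > m`. -/
def inlet {n : ℕ} (m : ℕ) (j : Fin n) : ℝ := if (j : ℕ) < m then 0 else 1

/-- The reflection operator
`(P u)_j(t) = ∑_{k ≤ m} p_{jk} u_k(1,t) + ∑_{k > m} p_{jk} u_k(0,t)`. -/
def opP {n : ℕ} (m : ℕ) (p : Matrix (Fin n) (Fin n) ℝ) (u : Fin n → ℝ → ℝ → ℝ)
    (j : Fin n) (t : ℝ) : ℝ :=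
  ∑ k : Fin n, p j k * (if (k : ℕ) < m then u k 1 t else u k 0 t)

/-- The transport operator `(C v)_j(x,t) = c_j(x_j, x, t) v_j(ω_j(x_j, x, t))`. -/
def opC {n : ℕ} (m : ℕ) (a b : Fin n → ℝ → ℝ → ℝ) (v : Fin n → ℝ → ℝ)
    (j : Fin n) (x t : ℝ) : ℝ :=
  charWeight (a j) (b j) (inlet m j) x t * v j (charCurve (a j) (inlet m j) x t)

/-- Finite time extinction: there is `k` such that `(C P)^k u ≡ 0` for every `u` that is continuous
on the closed strip. -/
def FiniteExtinction {n : ℕ} (m : ℕ) (p : Matrix (Fin n) (Fin n) ℝ)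
    (a b : Fin n → ℝ → ℝ → ℝ) : Prop :=
  ∃ k : ℕ, ∀ u : Fin n → ℝ → ℝ → ℝ,
    (∀ j, ContinuousOn (fun z : ℝ × ℝ => u j z.1 z.2) strip) →
      ∀ j, ∀ x ∈ Icc (0 : ℝ) 1, ∀ t : ℝ, (fun w => opC m a b (opP m p w))^[k] u j x t = 0

/-- The Levy type condition: for `j ≠ k` there is `β_{jk}` in `BC¹` with
`b_{jk} = β_{jk} (a_k - a_j)`. -/
def LevyCondition {n : ℕ} (a : Fin n → ℝ → ℝ → ℝ) (b : Fin n → Fin n → ℝ → ℝ → ℝ) : Prop :=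
  ∀ j k, j ≠ k → ∃ β : ℝ → ℝ → ℝ, IsBC1 β ∧
    ∀ x ∈ Icc (0 : ℝ) 1, ∀ t : ℝ, b j k x t = β x t * (a k x t - a j x t)

/-- The full zero order coefficient matrix `b_d + b̃`, `b_d = diag(b_1, …, b_n)`. -/
def perturb {n : ℕ} (b : Fin n → ℝ → ℝ → ℝ) (bt : Fin n → Fin n → ℝ → ℝ → ℝ) :
    Fin n → Fin n → ℝ → ℝ → ℝ :=
  fun j k x t => (if j = k then b j x t else 0) + bt j k x t

/-- Classical solution, continuously differentiable on `[0,1] × [τ,∞)`, of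
`∂ₜu + a ∂ₓu + b u = 0` with the reflection boundary conditions and `u(·, τ) = φ`. -/
structure IsClassicalSolution {n : ℕ} (m : ℕ) (p : Matrix (Fin n) (Fin n) ℝ)
    (a : Fin n → ℝ → ℝ → ℝ) (b : Fin n → Fin n → ℝ → ℝ → ℝ) (τ : ℝ) (φ : Fin n → ℝ → ℝ)
    (u : Fin n → ℝ → ℝ → ℝ) : Prop where
  smooth : ∀ j, ContDiffOn ℝ 1 (fun z : ℝ × ℝ => u j z.1 z.2) (halfStrip τ)
  pde : ∀ j, ∀ x ∈ Ioo (0 : ℝ) 1, ∀ t, τ < t →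
    deriv (fun s => u j x s) t + a j x t * deriv (fun y => u j y t) x
      + ∑ k, b j k x t * u k x t = 0
  boundary : ∀ j, ∀ t, τ ≤ t → u j (inlet m j) t = opP m p u j t
  initial : ∀ j, ∀ x ∈ Icc (0 : ℝ) 1, u j x τ = φ j x

/-- Lebesgue measure on `(0,1)`. -/
abbrev μ01 : Measure ℝ := volume.restrict (Ioo (0 : ℝ) 1)

/-- `L²(0,1)ⁿ` with the norm `max_j ‖u_j‖_{L²}`. -/
abbrev L2 (n : ℕ) : Type := Fin n → Lp ℝ 2 μ01

/-- Smooth functions with compact support in `(0,1)`. -/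
def IsTest (f : ℝ → ℝ) : Prop :=
  ContDiff ℝ ∞ f ∧ HasCompactSupport f ∧ tsupport f ⊆ Ioo (0 : ℝ) 1

/-- `u : [τ,∞) → L²(0,1)ⁿ` is the `L²`-generalized solution with initial value `φ`: it is
continuous, and for each sequence of test functions `φˡ → φ` in `L²` the classical solutions `uˡ`
with initial values `φˡ` converge to `u` in `L²`, uniformly on `[τ,T]` for every `T > τ`. -/
def IsGeneralizedSolution {n : ℕ} (m : ℕ) (p : Matrix (Fin n) (Fin n) ℝ)
    (a : Fin n → ℝ → ℝ → ℝ) (b : Fin n → Fin n → ℝ → ℝ → ℝ) (τ : ℝ) (φ : L2 n)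
    (u : ℝ → L2 n) : Prop :=
  ContinuousOn u (Ici τ) ∧
    ∀ φl : ℕ → Fin n → ℝ → ℝ, (∀ l j, IsTest (φl l j)) →
      (∀ j, Tendsto (fun l => eLpNorm (fun x => φl l j x - φ j x) 2 μ01) atTop (𝓝 0)) →
      ∃ ul : ℕ → Fin n → ℝ → ℝ → ℝ,
        (∀ l, IsClassicalSolution m p a b τ (φl l) (ul l)) ∧
        ∀ T, τ < T → ∀ ε : ℝ, 0 < ε → ∀ᶠ l in atTop, ∀ θ ∈ Icc τ T, ∀ j,
          eLpNorm (fun x => u θ j x - ul l j x θ) 2 μ01 ≤ ENNReal.ofReal ε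

/-- Evolution families `{U(t,τ)}_{t ≥ τ}` of bounded operators on a Banach space (the values
`U t τ` for `t < τ` are irrelevant). -/
structure IsEvolutionFamily {X : Type*} [NormedAddCommGroup X] [NormedSpace ℝ X]
    (U : ℝ → ℝ → X →L[ℝ] X) : Prop where
  refl : ∀ τ, U τ τ = ContinuousLinearMap.id ℝ X
  comp : ∀ τ s t, τ ≤ s → s ≤ t → (U t s).comp (U s τ) = U t τ
  strong_cont : ∀ φ : X, ContinuousOn (fun q : ℝ × ℝ => U q.1 q.2 φ) {q | q.2 ≤ q.1}

/-- `U` is the evolution family on `L²(0,1)ⁿ` generated by `∂ₜu + a ∂ₓu + b u = 0` with the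
reflection boundary conditions: `t ↦ U(t,τ) φ` is the generalized solution starting at time `τ`
from `φ`. -/
def IsGenerated {n : ℕ} (m : ℕ) (p : Matrix (Fin n) (Fin n) ℝ)
    (a : Fin n → ℝ → ℝ → ℝ) (b : Fin n → Fin n → ℝ → ℝ → ℝ)
    (U : ℝ → ℝ → L2 n →L[ℝ] L2 n) : Prop :=
  IsEvolutionFamily U ∧
    ∀ (τ : ℝ) (φ : L2 n), IsGeneralizedSolution m p a b τ φ (fun t => U t τ φ)

/-- `‖v‖_{C¹[0,1]} = max |v| + max |v'|` (used for `v` in `C¹[0,1]` only). -/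
def c1Norm (v : ℝ → ℝ) : ℝ :=
  (⨆ x : Icc (0 : ℝ) 1, |v x|) + ⨆ x : Icc (0 : ℝ) 1, |derivWithin v (Icc (0 : ℝ) 1) x|

/-- `V` maps `L²(0,1)ⁿ` into `C¹([0,1])ⁿ` (normed by the maximum over the components), with
`‖V‖_{L(L², C¹)} ≤ K`. -/
def OpNormL2C1Le {n : ℕ} (V : L2 n →L[ℝ] L2 n) (K : ℝ) : Prop :=
  ∀ φ : L2 n, ∃ v : Fin n → ℝ → ℝ, ∀ j,
    ContDiffOn ℝ 1 (v j) (Icc (0 : ℝ) 1) ∧ V φ j =ᵐ[μ01] v j ∧ c1Norm (v j) ≤ K * ‖φ‖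

/-- The perturbations admitted for the smoothing estimate: entries in `BC¹` with `BC¹`-norm less
than `ε`, vanishing diagonal, and the Levy type condition. -/
structure AdmissibleC1 {n : ℕ} (a : Fin n → ℝ → ℝ → ℝ) (ε : ℝ)
    (bt : Fin n → Fin n → ℝ → ℝ → ℝ) : Prop where
  bc1 : ∀ j k, IsBC1 (bt j k)
  diag : ∀ j, ∀ x ∈ Icc (0 : ℝ) 1, ∀ t : ℝ, bt j j x t = 0
  levy : LevyCondition a bt
  small : ∀ j k, bc1Norm (bt j k) < ε

end

end Hyp

/-! The whole argument runs along characteristics, parametrised by the space variable. `Setting`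
records for each component the flow `y j ξ s` (time at which the characteristic entering at time `s`
reaches `ξ`) and its inverse `σ j x t` (entry time). Since `|a_j| ≥ Λ`, a characteristic crosses the
interval in time at most `1/Λ`.

Well-posedness. For test functions as data, `Setting.exists_classical` writes the system in
integrated form and sums a Neumann series in a weighted supremum norm, where
`Setting.exists_contraction` makes the transport operators contract however large the reflection
matrix is. `Setting.exists_energy` is an `L²` estimate with weights that are small at the inlet and
equal to one at the outlet. It also controls the outgoing traces, and its constants depend on the
zero order coefficients only through a bound for them. By density of test functions,
`exists_evolutionFamily` turns these solutions into an evolution family.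

Decay. For the decoupled system a solution satisfies `u = C P u` once a characteristic can be traced
back to the boundary without passing the initial time. Hence after `k` crossings it equals `(C P)^k`
of a continuous function, and extinction makes it vanish (`Setting.extinction`). A solution of the
perturbed problem differs from the decoupled one by a solution with zero initial value and a source
of size `ε`. So after a fixed time `T` the perturbed evolution has norm at most `C ε`
(`Setting.exists_small`). If `C ε ≤ exp (-γ T)`, the evolution law propagates this to the rate `γ`
(`Setting.exists_decay`). The rate is arbitrary because the limit problem dies out in finite time.

Smoothing. The Levy condition provides `e_{jk}` with `b̃_{jk} a_k = e_{jk} (a_k - a_j)`. The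
modified time derivative `z_j = ∂ₜ u_j + ∑ e_{jk} u_k` is chosen so that, when differentiated along
the `j`-th characteristic, all terms with derivatives of the other components cancel
(`LevyData.source_eq`). What remains is `z = K z + F`, where `K` is the transport operator for time
derivatives (`Setting.trans'`) and `F` contains only endpoint values and line integrals of `u`.
Extinction for functions implies that `K` is nilpotent: test functions with prescribed zeros and
slopes at finitely many points convert `(C P)^N = 0` into `K^(N+1) = 0`
(`Setting.trans'_nilpotent`). Therefore `z` is a finite sum of iterates of `K` applied to `F`, so
norms of `u` control the same norms of `∂ₜ u` at later times, with no loss of derivatives.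

This gain is used twice (`LevyData.exists_smoothing`). The energy estimate bounds the square mean in
time of `u` at every fixed `x`. The first use bounds the square mean of `∂ₜ u`, so the
one-dimensional Sobolev inequality in time bounds `u` uniformly. The second use bounds `∂ₜ u`
uniformly, and the equation gives `∂ₓ u`. Approximation by classical solutions transfers the bound
to the evolution family.

The smoothing time depends only on the unperturbed problem, while the smoothing constant depends on
the perturbation. Composing smoothing over the last stretch of time with decay before it gives a
common `T₁`. For a common `M₁` the decay with rate `γ + 1` is used: the surplus rate absorbs the
constant after a waiting time that may depend on the perturbation. -/

namespace Hyp

noncomputable section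

/-! ### Functions of two real variables -/

/-- Projection of the real line onto `[0,1]`. -/
def cl (x : ℝ) : ℝ := max 0 (min x 1)

lemma cl_mem (x : ℝ) : cl x ∈ Icc (0 : ℝ) 1 :=
  ⟨le_max_left _ _, max_le zero_le_one (min_le_right _ _)⟩

lemma cl_of_mem {x : ℝ} (hx : x ∈ Icc (0 : ℝ) 1) : cl x = x := by
  rw [cl, min_eq_left hx.2, max_eq_right hx.1]

@[fun_prop]
lemma continuous_cl : Continuous cl := by unfold cl; fun_prop

/-- `f` is jointly continuous and has the jointly continuous derivative `f'` in the second
variable. -/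
structure TC1 (f f' : ℝ → ℝ → ℝ) : Prop where
  cont : Continuous fun z : ℝ × ℝ => f z.1 z.2
  cont' : Continuous fun z : ℝ × ℝ => f' z.1 z.2
  deriv : ∀ x t, HasDerivAt (f x) (f' x t) t

namespace TC1

variable {f f' g g' : ℝ → ℝ → ℝ}

lemma comp_cont (h : TC1 f f') {X : Type*} [TopologicalSpace X] {u v : X → ℝ} (hu : Continuous u)
    (hv : Continuous v) : Continuous fun z => f (u z) (v z) :=
  h.cont.comp (hu.prodMk hv)

lemma comp_cont' (h : TC1 f f') {X : Type*} [TopologicalSpace X] {u v : X → ℝ} (hu : Continuous u)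
    (hv : Continuous v) : Continuous fun z => f' (u z) (v z) :=
  h.cont'.comp (hu.prodMk hv)

lemma zero : TC1 (fun _ _ => 0) (fun _ _ => 0) :=
  ⟨continuous_const, continuous_const, fun _ t => hasDerivAt_const t _⟩

lemma add (hf : TC1 f f') (hg : TC1 g g') :
    TC1 (fun x t => f x t + g x t) (fun x t => f' x t + g' x t) :=
  ⟨hf.cont.add hg.cont, hf.cont'.add hg.cont', fun x t => (hf.deriv x t).add (hg.deriv x t)⟩

lemma neg (hf : TC1 f f') : TC1 (fun x t => -f x t) (fun x t => -f' x t) :=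
  ⟨hf.cont.neg, hf.cont'.neg, fun x t => (hf.deriv x t).neg⟩

lemma mul (hf : TC1 f f') (hg : TC1 g g') :
    TC1 (fun x t => f x t * g x t) (fun x t => f' x t * g x t + f x t * g' x t) :=
  ⟨hf.cont.mul hg.cont, (hf.cont'.mul hg.cont).add (hf.cont.mul hg.cont'),
    fun x t => (hf.deriv x t).mul (hg.deriv x t)⟩

lemma inv (hf : TC1 f f') (h0 : ∀ x t, f x t ≠ 0) :
    TC1 (fun x t => (f x t)⁻¹) (fun x t => -f' x t / f x t ^ 2) :=
  ⟨hf.cont.inv₀ fun _ => h0 _ _, hf.cont'.neg.div (hf.cont.pow 2) fun _ => pow_ne_zero 2 (h0 _ _),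
    fun x t => (hf.deriv x t).inv (h0 x t)⟩

lemma sum {ι : Type*} (s : Finset ι) {F F' : ι → ℝ → ℝ → ℝ} (h : ∀ i ∈ s, TC1 (F i) (F' i)) :
    TC1 (fun x t => ∑ i ∈ s, F i x t) (fun x t => ∑ i ∈ s, F' i x t) :=
  ⟨continuous_finsetSum s fun i hi => (h i hi).cont,
    continuous_finsetSum s fun i hi => (h i hi).cont',
    fun x t => HasDerivAt.fun_sum fun i hi => (h i hi).deriv x t⟩

/-- A function of the first variable only. -/
lemma of_fst {c : ℝ → ℝ} (hc : Continuous c) : TC1 (fun x _ => c x) (fun _ _ => 0) :=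
  ⟨hc.comp continuous_fst, continuous_const, fun _ t => hasDerivAt_const t _⟩

/-- Substitution `t ↦ v x t`, `x ↦ u x`. -/
lemma comp (hf : TC1 f f') {v v' : ℝ → ℝ → ℝ} (hv : TC1 v v') {u : ℝ → ℝ} (hu : Continuous u) :
    TC1 (fun x t => f (u x) (v x t)) (fun x t => f' (u x) (v x t) * v' x t) :=
  ⟨hf.comp_cont (hu.comp continuous_fst) hv.cont,
    (hf.comp_cont' (hu.comp continuous_fst) hv.cont).mul hv.cont',
    fun x t => (hf.deriv (u x) (v x t)).comp t (hv.deriv x t)⟩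

lemma congr (hf : TC1 f f') (h : ∀ x t, g x t = f x t) (h' : ∀ x t, g' x t = f' x t) :
    TC1 g g' := by
  have e : g = f := funext fun x => funext fun t => h x t
  have e' : g' = f' := funext fun x => funext fun t => h' x t
  rw [e, e']; exact hf

/-- Differentiation under the integral sign. -/
lemma primitive (hf : TC1 f f') (x₀ : ℝ) :
    TC1 (fun x s => ∫ ξ in x₀..x, f ξ s) (fun x s => ∫ ξ in x₀..x, f' ξ s) := by
  have c1 : Continuous (Function.uncurry fun (z : ℝ × ℝ) (ξ : ℝ) => f ξ z.2) :=
    hf.comp_cont continuous_snd (continuous_snd.comp continuous_fst)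
  have c2 : Continuous (Function.uncurry fun (z : ℝ × ℝ) (ξ : ℝ) => f' ξ z.2) :=
    hf.comp_cont' continuous_snd (continuous_snd.comp continuous_fst)
  refine ⟨intervalIntegral.continuous_parametric_intervalIntegral_of_continuous c1 continuous_fst,
    intervalIntegral.continuous_parametric_intervalIntegral_of_continuous c2 continuous_fst, ?_⟩
  intro x s
  have hK : IsCompact (uIcc x₀ x ×ˢ Metric.closedBall s 1) :=
    isCompact_uIcc.prod (isCompact_closedBall s 1)
  obtain ⟨C, hC⟩ := hK.exists_bound_of_continuousOn hf.cont'.continuousOn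
  refine (intervalIntegral.hasDerivAt_integral_of_dominated_loc_of_deriv_le
    (F := fun s ξ => f ξ s) (F' := fun s ξ => f' ξ s) (bound := fun _ => C)
    (Metric.closedBall_mem_nhds s one_pos) ?_ ?_ ?_ ?_ ?_ ?_).2
  · exact Eventually.of_forall fun r =>
      (hf.comp_cont continuous_id continuous_const).aestronglyMeasurable
  · exact (hf.comp_cont continuous_id continuous_const).intervalIntegrable _ _
  · exact (hf.comp_cont' continuous_id continuous_const).aestronglyMeasurable
  · exact Eventually.of_forall fun ξ hξ r hr => hC (ξ, r) ⟨uIoc_subset_uIcc hξ, hr⟩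
  · exact intervalIntegrable_const
  · exact Eventually.of_forall fun ξ _ r _ => hf.deriv ξ r

end TC1

/-- A function on the plane with continuous partial derivatives is continuously differentiable. -/
lemma hasFDerivAt_of_partials {f f₁ f₂ : ℝ → ℝ → ℝ}
    (c₁ : Continuous fun z : ℝ × ℝ => f₁ z.1 z.2) (c₂ : Continuous fun z : ℝ × ℝ => f₂ z.1 z.2)
    (h₁ : ∀ x t, HasDerivAt (fun y => f y t) (f₁ x t) x)
    (h₂ : ∀ x t, HasDerivAt (fun s => f x s) (f₂ x t) t) (z : ℝ × ℝ) :
    HasFDerivAt (fun z : ℝ × ℝ => f z.1 z.2)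
      (f₁ z.1 z.2 • ContinuousLinearMap.fst ℝ ℝ ℝ + f₂ z.1 z.2 • ContinuousLinearMap.snd ℝ ℝ ℝ)
      z := by
  have key := hasStrictFDerivAt_uncurry_coprod (𝕜 := ℝ) (u := z) (f := f)
    (f₁ := fun x t => ContinuousLinearMap.toSpanSingleton ℝ (f₁ x t))
    (f₂ := fun x t => ContinuousLinearMap.toSpanSingleton ℝ (f₂ x t))
    (Eventually.of_forall fun v => (h₁ v.1 v.2).hasFDerivAt)
    (Eventually.of_forall fun v => (h₂ v.1 v.2).hasFDerivAt)
    (((ContinuousLinearMap.toSpanSingletonCLE (𝕜 := ℝ) (E := ℝ)).continuous.comp c₁).continuousAt)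
    (((ContinuousLinearMap.toSpanSingletonCLE (𝕜 := ℝ) (E := ℝ)).continuous.comp c₂).continuousAt)
  refine key.hasFDerivAt.congr_fderiv ?_
  ext <;> simp [Function.HasUncurry.uncurry]

lemma contDiff_of_partials {f f₁ f₂ : ℝ → ℝ → ℝ}
    (c₁ : Continuous fun z : ℝ × ℝ => f₁ z.1 z.2) (c₂ : Continuous fun z : ℝ × ℝ => f₂ z.1 z.2)
    (h₁ : ∀ x t, HasDerivAt (fun y => f y t) (f₁ x t) x)
    (h₂ : ∀ x t, HasDerivAt (fun s => f x s) (f₂ x t) t) :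
    ContDiff ℝ 1 fun z : ℝ × ℝ => f z.1 z.2 :=
  contDiff_one_iff_hasFDerivAt.2 ⟨_, by fun_prop, hasFDerivAt_of_partials c₁ c₂ h₁ h₂⟩

/-- Partial derivatives of a `C¹` function on `[0,1] × J`. -/
lemma exists_partials {J : Set ℝ} (hJ : UniqueDiffOn ℝ J) {f : ℝ → ℝ → ℝ}
    (hf : ContDiffOn ℝ 1 (fun z : ℝ × ℝ => f z.1 z.2) (Icc (0 : ℝ) 1 ×ˢ J)) :
    ∃ fx ft : ℝ → ℝ → ℝ,
      ContinuousOn (fun z : ℝ × ℝ => fx z.1 z.2) (Icc (0 : ℝ) 1 ×ˢ J) ∧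
      ContinuousOn (fun z : ℝ × ℝ => ft z.1 z.2) (Icc (0 : ℝ) 1 ×ˢ J) ∧
      ∀ x ∈ Icc (0 : ℝ) 1, ∀ t ∈ J, HasFDerivWithinAt (fun z : ℝ × ℝ => f z.1 z.2)
        (fx x t • ContinuousLinearMap.fst ℝ ℝ ℝ + ft x t • ContinuousLinearMap.snd ℝ ℝ ℝ)
        (Icc (0 : ℝ) 1 ×ˢ J) (x, t) := by
  have hU : UniqueDiffOn ℝ (Icc (0 : ℝ) 1 ×ˢ J) := (uniqueDiffOn_Icc zero_lt_one).prod hJ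
  have hc := hf.continuousOn_fderivWithin hU le_rfl
  refine ⟨fun x t => fderivWithin ℝ (fun z : ℝ × ℝ => f z.1 z.2) (Icc (0 : ℝ) 1 ×ˢ J) (x, t) (1, 0),
    fun x t => fderivWithin ℝ (fun z : ℝ × ℝ => f z.1 z.2) (Icc (0 : ℝ) 1 ×ˢ J) (x, t) (0, 1),
    hc.clm_apply continuousOn_const, hc.clm_apply continuousOn_const, ?_⟩
  intro x hx t ht
  refine ((hf.differentiableOn one_ne_zero (x, t) ⟨hx, ht⟩).hasFDerivWithinAt).congr_fderiv ?_
  ext <;> simp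

lemma hasDerivWithinAt_curve {J : Set ℝ} {f : ℝ → ℝ → ℝ} {x t p q : ℝ}
    (hd : HasFDerivWithinAt (fun z : ℝ × ℝ => f z.1 z.2)
      (p • ContinuousLinearMap.fst ℝ ℝ ℝ + q • ContinuousLinearMap.snd ℝ ℝ ℝ)
      (Icc (0 : ℝ) 1 ×ˢ J) (x, t)) {γ : ℝ → ℝ} {s : Set ℝ} {γ' : ℝ}
    (hγ : HasDerivWithinAt γ γ' s x) (hγx : γ x = t)
    (hs : MapsTo (fun ξ => (ξ, γ ξ)) s (Icc (0 : ℝ) 1 ×ˢ J)) :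
    HasDerivWithinAt (fun ξ => f ξ (γ ξ)) (p + q * γ') s x := by
  subst hγx
  have h := hd.comp_hasDerivWithinAt x ((hasDerivWithinAt_id x s).prodMk hγ) hs
  refine h.congr_deriv ?_
  simp

lemma hasDerivWithinAt_fst {J : Set ℝ} {f : ℝ → ℝ → ℝ} {x t p q : ℝ}
    (hd : HasFDerivWithinAt (fun z : ℝ × ℝ => f z.1 z.2)
      (p • ContinuousLinearMap.fst ℝ ℝ ℝ + q • ContinuousLinearMap.snd ℝ ℝ ℝ)
      (Icc (0 : ℝ) 1 ×ˢ J) (x, t)) (ht : t ∈ J) :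
    HasDerivWithinAt (fun y => f y t) p (Icc (0 : ℝ) 1) x := by
  have h := hasDerivWithinAt_curve hd (γ := fun _ => t) (s := Icc (0 : ℝ) 1)
    (hasDerivWithinAt_const x _ t) rfl (fun ξ hξ => ⟨hξ, ht⟩)
  simpa using h

lemma hasDerivWithinAt_snd {J : Set ℝ} {f : ℝ → ℝ → ℝ} {x t p q : ℝ}
    (hd : HasFDerivWithinAt (fun z : ℝ × ℝ => f z.1 z.2)
      (p • ContinuousLinearMap.fst ℝ ℝ ℝ + q • ContinuousLinearMap.snd ℝ ℝ ℝ)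
      (Icc (0 : ℝ) 1 ×ˢ J) (x, t)) (hx : x ∈ Icc (0 : ℝ) 1) :
    HasDerivWithinAt (fun s => f x s) q J t := by
  have h := hd.comp_hasDerivWithinAt t
    ((hasDerivWithinAt_const t J x).prodMk (hasDerivWithinAt_id t J)) (fun s hs => ⟨hx, hs⟩)
  refine h.congr_deriv ?_
  simp

end

end Hyp

namespace Hyp

noncomputable section

/-! ### Flows of scalar differential equations -/

/-- Two solutions on a compact interval that agree at one point agree everywhere. -/
lemma ode_eqOn_Icc {f : ℝ → ℝ → ℝ} {K : NNReal} (hL : ∀ ξ, LipschitzWith K (f ξ)) {a b x₀ : ℝ}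
    (hx₀ : x₀ ∈ Icc a b) {v w : ℝ → ℝ}
    (hv : ∀ ξ ∈ Icc a b, HasDerivWithinAt v (f ξ (v ξ)) (Icc a b) ξ)
    (hw : ∀ ξ ∈ Icc a b, HasDerivWithinAt w (f ξ (w ξ)) (Icc a b) ξ) (h : v x₀ = w x₀) :
    EqOn v w (Icc a b) := by
  have cv : ContinuousOn v (Icc a b) := fun ξ hξ => (hv ξ hξ).continuousWithinAt
  have cw : ContinuousOn w (Icc a b) := fun ξ hξ => (hw ξ hξ).continuousWithinAt
  have hl : Icc a x₀ ⊆ Icc a b := Icc_subset_Icc_right hx₀.2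
  have hr : Icc x₀ b ⊆ Icc a b := Icc_subset_Icc_left hx₀.1
  intro ξ hξ
  rcases le_total ξ x₀ with h' | h'
  · refine ODE_solution_unique_of_mem_Icc_left (v := f) (s := fun _ => univ) (K := K)
      (fun t _ => (hL t).lipschitzOnWith) (cv.mono hl) (fun t ht => ?_) (fun _ _ => trivial)
      (cw.mono hl) (fun t ht => ?_) (fun _ _ => trivial) h ⟨hξ.1, h'⟩
    · exact (hv t (hl ⟨ht.1.le, ht.2⟩)).mono_of_mem_nhdsWithin
        (mem_of_superset (Icc_mem_nhdsLE ht.1) (Icc_subset_Icc_right (ht.2.trans hx₀.2)))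
    · exact (hw t (hl ⟨ht.1.le, ht.2⟩)).mono_of_mem_nhdsWithin
        (mem_of_superset (Icc_mem_nhdsLE ht.1) (Icc_subset_Icc_right (ht.2.trans hx₀.2)))
  · refine ODE_solution_unique_of_mem_Icc_right (v := f) (s := fun _ => univ) (K := K)
      (fun t _ => (hL t).lipschitzOnWith) (cv.mono hr) (fun t ht => ?_) (fun _ _ => trivial)
      (cw.mono hr) (fun t ht => ?_) (fun _ _ => trivial) h ⟨h', hξ.2⟩
    · exact (hv t (hr ⟨ht.1, ht.2.le⟩)).mono_of_mem_nhdsWithin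
        (mem_of_superset (Icc_mem_nhdsGE ht.2) (Icc_subset_Icc_left (hx₀.1.trans ht.1)))
    · exact (hw t (hr ⟨ht.1, ht.2.le⟩)).mono_of_mem_nhdsWithin
        (mem_of_superset (Icc_mem_nhdsGE ht.2) (Icc_subset_Icc_left (hx₀.1.trans ht.1)))

/-- Global solutions of a scalar equation with bounded, Lipschitz right-hand side. -/
lemma exists_global_solution {f : ℝ → ℝ → ℝ} {K : NNReal} (hL : ∀ ξ, LipschitzWith K (f ξ))
    (hc : Continuous fun z : ℝ × ℝ => f z.1 z.2) {B : ℝ} (hB : ∀ ξ w, |f ξ w| ≤ B) (x t : ℝ) :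
    ∃ w : ℝ → ℝ, w x = t ∧ ∀ ξ, HasDerivAt w (f ξ (w ξ)) ξ := by
  have hB0 : 0 ≤ B := (abs_nonneg _).trans (hB 0 0)
  -- On an interval of radius `N + 1` a solution moves by at most `B (N + 1)`. The Lipschitz
  -- constant is global, so a ball of exactly this radius is admissible in Picard–Lindelöf and the
  -- length of the interval is not restricted.
  have loc : ∀ N : ℕ, ∃ w : ℝ → ℝ, w x = t ∧
      ∀ ξ ∈ Icc (x - (N + 1)) (x + (N + 1)),
        HasDerivWithinAt w (f ξ (w ξ)) (Icc (x - (N + 1)) (x + (N + 1))) ξ := by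
    intro N
    have hN : (0 : ℝ) ≤ N + 1 := by positivity
    have hp : IsPicardLindelof f (tmin := x - (N + 1)) (tmax := x + (N + 1))
        ⟨x, by constructor <;> linarith⟩ t ⟨B * (N + 1), by positivity⟩ 0 ⟨B, hB0⟩ K := by
      refine ⟨fun ξ _ => (hL ξ).lipschitzOnWith,
        fun w _ => (hc.comp (continuous_id.prodMk continuous_const)).continuousOn,
        fun ξ _ w _ => hB ξ w, ?_⟩
      simp only [add_sub_cancel_left, sub_sub_cancel, max_self, NNReal.coe_zero, sub_zero]
      exact le_rfl
    simpa using hp.exists_eq_forall_mem_Icc_hasDerivWithinAt₀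
  choose w hw0 hw using loc
  have mono : ∀ {M N : ℕ}, M ≤ N → EqOn (w M) (w N) (Icc (x - (M + 1)) (x + (M + 1))) := by
    intro M N hMN
    have hMN' : (M : ℝ) ≤ N := by exact_mod_cast hMN
    have hM : (0 : ℝ) ≤ M := by positivity
    have hsub : Icc (x - ((M : ℝ) + 1)) (x + (M + 1)) ⊆ Icc (x - (N + 1)) (x + (N + 1)) :=
      Icc_subset_Icc (by linarith) (by linarith)
    exact ode_eqOn_Icc hL (x₀ := x) ⟨by linarith, by linarith⟩ (hw M)
      (fun ξ hξ => (hw N ξ (hsub hξ)).mono hsub) ((hw0 M).trans (hw0 N).symm)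
  have mem : ∀ ξ {N : ℕ}, |ξ - x| ≤ N + 1 → ξ ∈ Icc (x - ((N : ℝ) + 1)) (x + (N + 1)) := by
    intro ξ N h
    rw [abs_le] at h
    constructor <;> linarith [h.1, h.2]
  have same : ∀ ξ (M N : ℕ), |ξ - x| ≤ M + 1 → |ξ - x| ≤ N + 1 → w M ξ = w N ξ := by
    intro ξ M N hM hN
    rcases le_total M N with h | h
    · exact mono h (mem ξ hM)
    · exact (mono h (mem ξ hN)).symm
  have hceil : ∀ ξ : ℝ, |ξ - x| ≤ (⌈|ξ - x|⌉₊ : ℝ) + 1 := fun ξ =>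
    (Nat.le_ceil _).trans (by linarith)
  -- The intervals have radius `N + 1` rather than `N`, so `ξ` is interior to the interval with
  -- index `⌈|ξ - x|⌉₊` and the one-sided derivative there is two-sided.
  refine ⟨fun ξ => w ⌈|ξ - x|⌉₊ ξ, ?_, fun ξ => ?_⟩
  · simp [hw0]
  · set N := ⌈|ξ - x|⌉₊ with hN
    have hlt : |ξ - x| < (N : ℝ) + 1 := (Nat.le_ceil _).trans_lt (by simp [hN])
    have hξ : ξ ∈ Ioo (x - ((N : ℝ) + 1)) (x + (N + 1)) := by
      rw [abs_lt] at hlt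
      constructor <;> linarith [hlt.1, hlt.2]
    have hd := (hw N ξ (Ioo_subset_Icc_self hξ)).hasDerivAt (Icc_mem_nhds hξ.1 hξ.2)
    refine hd.congr_of_eventuallyEq ?_
    filter_upwards [(isOpen_lt (by fun_prop : Continuous fun r : ℝ => |r - x|)
      continuous_const).mem_nhds hlt] with r hr
    exact same r _ _ (hceil r) (le_of_lt hr)

/-- The flow of `w' = f(ξ, w)`: `y ξ s` is the value at `ξ` of the solution that equals `s` at
`x₀`, and `σ x t` is the value at `x₀` of the solution that equals `t` at `x`. -/
structure IsFlow (f f' : ℝ → ℝ → ℝ) (x₀ : ℝ) (y ys σ σt : ℝ → ℝ → ℝ) : Prop where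
  base : ∀ s, y x₀ s = s
  ode : ∀ ξ s, HasDerivAt (fun ξ => y ξ s) (f ξ (y ξ s)) ξ
  ys_eq : ∀ ξ s, ys ξ s = Real.exp (∫ η in x₀..ξ, f' η (y η s))
  tc1_y : TC1 y ys
  left_inv : ∀ x s, σ x (y x s) = s
  right_inv : ∀ x t, y x (σ x t) = t
  tc1_σ : TC1 σ σt
  σt_eq : ∀ x t, σt x t = (ys x (σ x t))⁻¹
  σx : ∀ x t, HasDerivAt (fun x => σ x t) (-(f x t) * σt x t) x
  unique : ∀ a b, ∀ x ∈ Icc a b, ∀ t, ∀ w : ℝ → ℝ, w x = t →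
    (∀ ξ ∈ Icc a b, HasDerivWithinAt w (f ξ (w ξ)) (Icc a b) ξ) → ∀ ξ ∈ Icc a b, w ξ = y ξ (σ x t)

/-- The difference of two solutions solves a linear equation. -/
lemma sub_eq_exp_of_ode {f f' : ℝ → ℝ → ℝ} (hf : TC1 f f') {v w : ℝ → ℝ}
    (hv : ∀ ξ, HasDerivAt v (f ξ (v ξ)) ξ) (hw : ∀ ξ, HasDerivAt w (f ξ (w ξ)) ξ) (x₀ ξ : ℝ) :
    v ξ - w ξ = (v x₀ - w x₀) *
      Real.exp (∫ η in x₀..ξ, ∫ θ in (0 : ℝ)..1, f' η (w η + θ * (v η - w η))) := by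
  have cv : Continuous v := continuous_iff_continuousAt.2 fun ξ => (hv ξ).continuousAt
  have cw : Continuous w := continuous_iff_continuousAt.2 fun ξ => (hw ξ).continuousAt
  set g : ℝ → ℝ := fun η => ∫ θ in (0 : ℝ)..1, f' η (w η + θ * (v η - w η)) with hg
  have cg : Continuous g := by
    refine intervalIntegral.continuous_parametric_intervalIntegral_of_continuous' ?_ 0 1
    exact hf.comp_cont' (by fun_prop) (by fun_prop)
  have hmean : ∀ η, f η (v η) - f η (w η) = g η * (v η - w η) := by
    intro η
    have h1 : ∀ θ ∈ uIcc (0 : ℝ) 1, HasDerivAt (fun θ => f η (w η + θ * (v η - w η)))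
        (f' η (w η + θ * (v η - w η)) * (v η - w η)) θ := by
      intro θ _
      have h2 : HasDerivAt (fun θ : ℝ => w η + θ * (v η - w η)) (v η - w η) θ := by
        simpa using ((hasDerivAt_id θ).mul_const (v η - w η)).const_add (w η)
      exact (hf.deriv η _).comp θ h2
    have h3 := intervalIntegral.integral_eq_sub_of_hasDerivAt h1
      (((hf.comp_cont' continuous_const (by fun_prop)).mul continuous_const).intervalIntegrable _ _)
    rw [intervalIntegral.integral_mul_const] at h3
    simpa [hg] using h3.symm
  have hG : ∀ ξ, HasDerivAt (fun ξ => ∫ η in x₀..ξ, g η) (g ξ) ξ := fun ξ =>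
    intervalIntegral.integral_hasDerivAt_right (cg.intervalIntegrable _ _)
      (cg.stronglyMeasurableAtFilter _ _) cg.continuousAt
  set Φ : ℝ → ℝ := fun ξ => (v ξ - w ξ) * Real.exp (-∫ η in x₀..ξ, g η) with hΦ
  have hΦd : ∀ ξ, HasDerivAt Φ 0 ξ := by
    intro ξ
    have h := ((hv ξ).sub (hw ξ)).mul ((hG ξ).neg.exp)
    refine h.congr_deriv ?_
    have e := hmean ξ
    simp only [Pi.sub_apply]
    linear_combination (Real.exp (-∫ η in x₀..ξ, g η)) * e
  have hconst := is_const_of_deriv_eq_zero (fun ξ => (hΦd ξ).differentiableAt)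
    (fun ξ => (hΦd ξ).deriv) ξ x₀
  simp only [hΦ, intervalIntegral.integral_same, neg_zero, Real.exp_zero, mul_one] at hconst
  rw [← hconst, mul_assoc, ← Real.exp_add]
  simp

/-- By `sub_eq_exp_of_ode` the difference of two solutions is the initial difference times an
explicit exponential. This gives Lipschitz bounds from above and below, hence joint continuity of
the flow and of its inverse. Passing to the limit in the difference quotient identifies the
derivative in the initial value. The inverse is continuously differentiable by the inverse function
theorem for `(x, s) ↦ (x, y x s)`. -/
lemma exists_flow {f f' : ℝ → ℝ → ℝ} (hf : TC1 f f') {B K : ℝ} (hB : ∀ ξ w, |f ξ w| ≤ B)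
    (hK : ∀ ξ w, |f' ξ w| ≤ K) (x₀ : ℝ) : ∃ y ys σ σt, IsFlow f f' x₀ y ys σ σt := by
  have hK0 : 0 ≤ K := (abs_nonneg _).trans (hK 0 0)
  have hL : ∀ ξ, LipschitzWith ⟨K, hK0⟩ (f ξ) := fun ξ =>
    lipschitzWith_of_nnnorm_deriv_le (fun w => (hf.deriv ξ w).differentiableAt) fun w => by
      rw [(hf.deriv ξ w).deriv]; exact hK ξ w
  choose Y Y0 hY using exists_global_solution hL hf.cont hB
  have uniq : ∀ {v w : ℝ → ℝ}, (∀ ξ, HasDerivAt v (f ξ (v ξ)) ξ) →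
      (∀ ξ, HasDerivAt w (f ξ (w ξ)) ξ) → ∀ x, v x = w x → ∀ ξ, v ξ = w ξ := by
    intro v w hv hw x h ξ
    have := sub_eq_exp_of_ode hf hv hw x ξ
    rw [h, sub_self, zero_mul] at this
    linarith
  set y : ℝ → ℝ → ℝ := fun ξ s => Y x₀ s ξ with hy
  set σ : ℝ → ℝ → ℝ := fun x t => Y x t x₀ with hσ
  have yode : ∀ ξ s, HasDerivAt (fun ξ => y ξ s) (f ξ (y ξ s)) ξ := fun ξ s => hY x₀ s ξ
  have base : ∀ s, y x₀ s = s := fun s => Y0 x₀ s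
  have right_inv : ∀ x t, y x (σ x t) = t := by
    intro x t
    have := uniq (hY x₀ (σ x t)) (hY x t) x₀ (Y0 _ _) x
    rw [Y0] at this; exact this
  have left_inv : ∀ x s, σ x (y x s) = s := by
    intro x s
    have := uniq (hY x (y x s)) (hY x₀ s) x (Y0 _ _) x₀
    rw [Y0] at this; exact this
  have dif : ∀ ξ s r, y ξ s - y ξ r = (s - r) *
      Real.exp (∫ η in x₀..ξ, ∫ θ in (0 : ℝ)..1, f' η (y η r + θ * (y η s - y η r))) := by
    intro ξ s r
    have := sub_eq_exp_of_ode hf (hY x₀ s) (hY x₀ r) x₀ ξ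
    rwa [Y0, Y0] at this
  have expb : ∀ ξ s r, |∫ η in x₀..ξ, ∫ θ in (0 : ℝ)..1, f' η (y η r + θ * (y η s - y η r))|
      ≤ K * |ξ - x₀| := by
    intro ξ s r
    refine intervalIntegral.norm_integral_le_of_norm_le_const (E := ℝ) fun η _ => ?_
    have := intervalIntegral.norm_integral_le_of_norm_le_const (a := 0) (b := 1)
      (f := fun θ => f' η (y η r + θ * (y η s - y η r))) (C := K) fun θ _ => hK _ _
    simpa using this
  have lip : ∀ ξ s r, |y ξ s - y ξ r| ≤ |s - r| * Real.exp (K * |ξ - x₀|) := by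
    intro ξ s r
    rw [dif, abs_mul, Real.abs_exp]
    gcongr
    exact (le_abs_self _).trans (expb ξ s r)
  -- The reverse Lipschitz bound; inserted at points `σ x t` it yields continuity of `σ`.
  have exp_lower : ∀ ξ s r, |s - r| ≤ Real.exp (K * |ξ - x₀|) * |y ξ s - y ξ r| := by
    intro ξ s r
    rw [dif ξ s r, abs_mul, Real.abs_exp, mul_left_comm, ← Real.exp_add]
    refine le_mul_of_one_le_right (abs_nonneg _) (Real.one_le_exp ?_)
    linarith [neg_abs_le (∫ η in x₀..ξ, ∫ θ in (0 : ℝ)..1, f' η (y η r + θ * (y η s - y η r))),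
      expb ξ s r]
  have ycξ : ∀ s, Continuous fun ξ => y ξ s := fun s =>
    continuous_iff_continuousAt.2 fun ξ => (yode ξ s).continuousAt
  have ycont : Continuous fun z : ℝ × ℝ => y z.1 z.2 := by
    refine continuous_iff_continuousAt.2 fun z => ?_
    have h1 : Tendsto (fun q : ℝ × ℝ => |q.2 - z.2| * Real.exp (K * |q.1 - x₀|)
        + |y q.1 z.2 - y z.1 z.2|) (𝓝 z) (𝓝 0) := by
      have : Continuous fun q : ℝ × ℝ => |q.2 - z.2| * Real.exp (K * |q.1 - x₀|)
        + |y q.1 z.2 - y z.1 z.2| := by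
        have := (ycξ z.2).comp (continuous_fst (X := ℝ) (Y := ℝ))
        simp only [Function.comp_def] at this
        fun_prop
      have h := this.tendsto z
      simpa using h
    refine tendsto_iff_dist_tendsto_zero.2 (squeeze_zero (fun _ => dist_nonneg) (fun q => ?_) h1)
    rw [Real.dist_eq]
    calc |y q.1 q.2 - y z.1 z.2| ≤ |y q.1 q.2 - y q.1 z.2| + |y q.1 z.2 - y z.1 z.2| :=
          abs_sub_le _ _ _
      _ ≤ _ := by gcongr; exact lip _ _ _
  have ycomp : ∀ {X : Type} [TopologicalSpace X] {u v : X → ℝ}, Continuous u → Continuous v →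
      Continuous fun z => y (u z) (v z) := fun hu hv => ycont.comp (hu.prodMk hv)
  set ys : ℝ → ℝ → ℝ := fun ξ s => Real.exp (∫ η in x₀..ξ, f' η (y η s)) with hys
  have yscont : Continuous fun z : ℝ × ℝ => ys z.1 z.2 := by
    refine Real.continuous_exp.comp ?_
    refine intervalIntegral.continuous_parametric_intervalIntegral_of_continuous
      (f := fun (z : ℝ × ℝ) η => f' η (y η z.2)) ?_ continuous_fst
    exact hf.comp_cont' continuous_snd (ycomp continuous_snd (by fun_prop))
  have yder : ∀ ξ s, HasDerivAt (y ξ) (ys ξ s) s := by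
    intro ξ s
    rw [hasDerivAt_iff_tendsto_slope]
    have cts : Continuous fun r => Real.exp (∫ η in x₀..ξ, ∫ θ in (0 : ℝ)..1,
        f' η (y η s + θ * (y η r - y η s))) := by
      refine Real.continuous_exp.comp ?_
      refine intervalIntegral.continuous_parametric_intervalIntegral_of_continuous'
        (f := fun r η => ∫ θ in (0 : ℝ)..1, f' η (y η s + θ * (y η r - y η s))) ?_ _ _
      refine intervalIntegral.continuous_parametric_intervalIntegral_of_continuous'
        (f := fun (q : ℝ × ℝ) θ => f' q.2 (y q.2 s + θ * (y q.2 q.1 - y q.2 s))) ?_ _ _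
      have h1 : Continuous fun q : (ℝ × ℝ) × ℝ => y q.1.2 s := ycomp (by fun_prop) (by fun_prop)
      have h2 : Continuous fun q : (ℝ × ℝ) × ℝ => y q.1.2 q.1.1 :=
        ycomp (by fun_prop) (by fun_prop)
      exact hf.comp_cont' (by fun_prop) (by fun_prop)
    have lim := (cts.tendsto s).mono_left (nhdsWithin_le_nhds (s := {s}ᶜ))
    have e : Real.exp (∫ η in x₀..ξ, ∫ θ in (0 : ℝ)..1, f' η (y η s + θ * (y η s - y η s)))
        = ys ξ s := by simp [hys]
    rw [e] at lim
    refine lim.congr' ?_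
    filter_upwards [self_mem_nhdsWithin] with r hr
    have hr' : r - s ≠ 0 := sub_ne_zero.2 hr
    rw [slope_def_field, dif ξ r s]
    field_simp
  have tcy : TC1 y ys := ⟨ycont, yscont, yder⟩
  have σcont : Continuous fun z : ℝ × ℝ => σ z.1 z.2 := by
    refine continuous_iff_continuousAt.2 fun z => ?_
    have h1 : Tendsto (fun q : ℝ × ℝ => Real.exp (K * |q.1 - x₀|) * |q.2 - y q.1 (σ z.1 z.2)|)
        (𝓝 z) (𝓝 0) := by
      have : Continuous fun q : ℝ × ℝ =>
          Real.exp (K * |q.1 - x₀|) * |q.2 - y q.1 (σ z.1 z.2)| := by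
        have : Continuous fun q : ℝ × ℝ => y q.1 (σ z.1 z.2) := ycomp (by fun_prop) (by fun_prop)
        fun_prop
      have h := this.tendsto z
      simpa [right_inv] using h
    refine tendsto_iff_dist_tendsto_zero.2 (squeeze_zero (fun _ => dist_nonneg) (fun q => ?_) h1)
    rw [Real.dist_eq]
    have := exp_lower q.1 (σ q.1 q.2) (σ z.1 z.2)
    rwa [right_inv] at this
  have yspos : ∀ ξ s, 0 < ys ξ s := fun ξ s => Real.exp_pos _
  have fy : Continuous fun z : ℝ × ℝ => f z.1 (y z.1 z.2) := hf.comp_cont continuous_fst ycont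
  -- Keeping the first coordinate turns the family of bijections `y x` into one homeomorphism of the
  -- plane. Its derivative is triangular with entries `1` and `ys > 0`, so it is invertible
  -- everywhere.
  let Ψ : (ℝ × ℝ) ≃ₜ (ℝ × ℝ) :=
    { toFun := fun z => (z.1, y z.1 z.2)
      invFun := fun z => (z.1, σ z.1 z.2)
      left_inv := fun z => by simp [left_inv]
      right_inv := fun z => by simp [right_inv]
      continuous_toFun := continuous_fst.prodMk ycont
      continuous_invFun := continuous_fst.prodMk σcont }
  have Dy := hasFDerivAt_of_partials fy yscont yode yder
  let D : ℝ × ℝ → ((ℝ × ℝ) ≃L[ℝ] (ℝ × ℝ)) := fun z =>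
    ContinuousLinearEquiv.equivOfInverse
      ((ContinuousLinearMap.fst ℝ ℝ ℝ).prod (f z.1 (y z.1 z.2) • ContinuousLinearMap.fst ℝ ℝ ℝ +
        ys z.1 z.2 • ContinuousLinearMap.snd ℝ ℝ ℝ))
      ((ContinuousLinearMap.fst ℝ ℝ ℝ).prod ((ys z.1 z.2)⁻¹ • (ContinuousLinearMap.snd ℝ ℝ ℝ -
        f z.1 (y z.1 z.2) • ContinuousLinearMap.fst ℝ ℝ ℝ)))
      (fun v => by
        have := (yspos z.1 z.2).ne'
        ext <;> simp; field_simp)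
      (fun v => by
        have := (yspos z.1 z.2).ne'
        ext <;> simp; field_simp; ring)
  have hD : ∀ z, HasFDerivAt Ψ (D z : ℝ × ℝ →L[ℝ] ℝ × ℝ) z := fun z =>
    HasFDerivAt.prodMk hasFDerivAt_fst (Dy z)
  have CΨ : ContDiff ℝ 1 Ψ := contDiff_fst.prodMk (contDiff_of_partials fy yscont yode yder)
  have CΨs : ContDiff ℝ 1 Ψ.symm := Ψ.contDiff_symm hD CΨ
  have Cσ : ContDiff ℝ 1 fun z : ℝ × ℝ => σ z.1 z.2 := contDiff_snd.comp CΨs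
  have σd : ∀ x t, HasDerivAt (σ x) (ys x (σ x t))⁻¹ t := by
    intro x t
    refine HasDerivAt.of_local_left_inverse (f := y x) ?_ ?_ (yspos _ _).ne' ?_
    · exact (σcont.comp (continuous_const.prodMk continuous_id)).continuousAt
    · exact yder x (σ x t)
    · exact Eventually.of_forall fun r => right_inv x r
  have σtc : TC1 σ (fun x t => (ys x (σ x t))⁻¹) :=
    ⟨σcont, (yscont.comp (continuous_fst.prodMk σcont)).inv₀ fun _ => (yspos _ _).ne', σd⟩
  refine ⟨y, ys, σ, fun x t => (ys x (σ x t))⁻¹, base, yode, fun _ _ => rfl, tcy, left_inv,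
    right_inv, σtc, fun _ _ => rfl, ?_, ?_⟩
  · intro x t
    have hdiff : DifferentiableAt ℝ (fun z : ℝ × ℝ => σ z.1 z.2) (x, t) :=
      Cσ.differentiable one_ne_zero _
    obtain ⟨L, hLd⟩ : ∃ L, HasFDerivAt (fun z : ℝ × ℝ => σ z.1 z.2) L (x, t) :=
      ⟨_, hdiff.hasFDerivAt⟩
    have hx : HasDerivAt (fun x => σ x t) (L (1, 0)) x :=
      HasFDerivAt.comp_hasDerivAt (l := fun z : ℝ × ℝ => σ z.1 z.2) x hLd ((hasDerivAt_id' x).prodMk (hasDerivAt_const x t))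
    have ht : HasDerivAt (fun t => σ x t) (L (0, 1)) t :=
      HasFDerivAt.comp_hasDerivAt (l := fun z : ℝ × ℝ => σ z.1 z.2) t hLd
        ((hasDerivAt_const t x).prodMk (hasDerivAt_id' t))
    have et := ht.unique (σd x t)
    -- The entry time is constant along a trajectory. Differentiating this constant gives the
    -- transport equation for `σ`, and with it the derivative in `x`.
    have hxy : HasDerivAt (fun r => σ r (y r (σ x t))) (L (1, f x t)) x := by
      have h1 := (hasDerivAt_id x).prodMk (yode x (σ x t))
      rw [right_inv] at h1
      have hLd' : HasFDerivAt (fun z : ℝ × ℝ => σ z.1 z.2) L (id x, y x (σ x t)) := by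
        rw [right_inv]; exact hLd
      exact hLd'.comp_hasDerivAt x h1
    have h0 : HasDerivAt (fun r => σ r (y r (σ x t))) 0 x := by
      simp only [left_inv]; exact hasDerivAt_const _ _
    have e0 := hxy.unique h0
    have lin : L (1, f x t) = L (1, 0) + f x t * L (0, 1) := by
      have : ((1 : ℝ), f x t) = (1, 0) + f x t • ((0 : ℝ), (1 : ℝ)) := by ext <;> simp
      rw [this, map_add, map_smul, smul_eq_mul]
    have : L (1, 0) = -(f x t) * (ys x (σ x t))⁻¹ := by rw [← et]; linarith
    rwa [this] at hx
  · intro a b x hx t w hwx hw ξ hξ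
    refine ode_eqOn_Icc hL hx hw (fun η _ => (yode η (σ x t)).hasDerivWithinAt) ?_ hξ
    rw [right_inv]; exact hwx

end

end Hyp

namespace Hyp

noncomputable section

/-! ### Coefficients and characteristics -/

namespace IsBC1

variable {f g : ℝ → ℝ → ℝ}

lemma partials (hf : IsBC1 f) :
    ContinuousOn (fun z : ℝ × ℝ => dx f z.1 z.2) strip ∧
    ContinuousOn (fun z : ℝ × ℝ => dt f z.1 z.2) strip ∧
    ∀ x ∈ Icc (0 : ℝ) 1, ∀ t, HasFDerivWithinAt (fun z : ℝ × ℝ => f z.1 z.2)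
        (dx f x t • ContinuousLinearMap.fst ℝ ℝ ℝ + dt f x t • ContinuousLinearMap.snd ℝ ℝ ℝ)
        strip (x, t) := by
  obtain ⟨fx, ft, cx, ct, hd⟩ := exists_partials uniqueDiffOn_univ hf.1
  have ex : ∀ x ∈ Icc (0 : ℝ) 1, ∀ t, dx f x t = fx x t := fun x hx t =>
    (hasDerivWithinAt_fst (hd x hx t trivial) trivial).derivWithin
      (uniqueDiffOn_Icc zero_lt_one x hx)
  have et : ∀ x ∈ Icc (0 : ℝ) 1, ∀ t, dt f x t = ft x t := fun x hx t => by
    have := hasDerivWithinAt_snd (hd x hx t trivial) hx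
    rw [hasDerivWithinAt_univ] at this
    exact this.deriv
  refine ⟨cx.congr fun z hz => ex z.1 hz.1 z.2, ct.congr fun z hz => et z.1 hz.1 z.2, ?_⟩
  intro x hx t
  rw [ex x hx t, et x hx t]
  exact hd x hx t trivial

lemma hasDerivAt_dt (hf : IsBC1 f) {x : ℝ} (hx : x ∈ Icc (0 : ℝ) 1) (t : ℝ) :
    HasDerivAt (fun s => f x s) (dt f x t) t := by
  have := hasDerivWithinAt_snd (J := univ) (hf.partials.2.2 x hx t) hx
  rwa [hasDerivWithinAt_univ] at this

lemma tc1 (hf : IsBC1 f) : TC1 (fun x t => f (cl x) t) (fun x t => dt f (cl x) t) := by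
  have hm : ∀ z : ℝ × ℝ, (cl z.1, z.2) ∈ strip := fun z => ⟨cl_mem _, trivial⟩
  have hc : Continuous fun z : ℝ × ℝ => (cl z.1, z.2) := by fun_prop
  exact ⟨hf.1.continuousOn.comp_continuous hc hm, hf.partials.2.1.comp_continuous hc hm,
    fun x t => hf.hasDerivAt_dt (cl_mem x) t⟩

lemma contDiffOn_fst (hf : IsBC1 f) (t : ℝ) : ContDiffOn ℝ 1 (fun x => f x t) (Icc 0 1) :=
  hf.1.comp (contDiffOn_id.prodMk contDiffOn_const) fun _ hx => ⟨hx, trivial⟩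

lemma bddAbove (hf : IsBC1 f) : BddAbove (range fun z : Icc (0 : ℝ) 1 × ℝ => |f z.1 z.2|) := by
  obtain ⟨K, hK⟩ := hf.2
  exact ⟨K, by rintro _ ⟨z, rfl⟩; exact (hK z.1 z.1.2 z.2).1⟩

lemma abs_le_supNorm (hf : IsBC1 f) {x : ℝ} (hx : x ∈ Icc (0 : ℝ) 1) (t : ℝ) :
    |f x t| ≤ supNorm f :=
  le_ciSup hf.bddAbove (⟨x, hx⟩, t)

end IsBC1

lemma supNorm_nonneg (f : ℝ → ℝ → ℝ) : 0 ≤ supNorm f := Real.iSup_nonneg fun _ => abs_nonneg _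

lemma supNorm_le_bc1Norm (f : ℝ → ℝ → ℝ) : supNorm f ≤ bc1Norm f := by
  have := supNorm_nonneg (dx f)
  have := supNorm_nonneg (dt f)
  unfold bc1Norm; linarith

/-- Zero order coefficients: continuously differentiable on the strip with bounds on the function
and its time derivative. -/
structure IsCoef (b : ℝ → ℝ → ℝ) (b' : ℝ → ℝ → ℝ) (K : ℝ) : Prop where
  tc1 : TC1 (fun x t => b (cl x) t) (fun x t => b' (cl x) t)
  contDiffOn : ∀ t, ContDiffOn ℝ 1 (fun x => b x t) (Icc 0 1)
  bound : ∀ x ∈ Icc (0 : ℝ) 1, ∀ t, |b x t| ≤ K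
  bound' : ∀ x ∈ Icc (0 : ℝ) 1, ∀ t, |b' x t| ≤ K

lemma IsBC1.exists_isCoef {f : ℝ → ℝ → ℝ} (hf : IsBC1 f) : ∃ K, IsCoef f (dt f) K := by
  obtain ⟨K, hK⟩ := hf.2
  exact ⟨K, hf.tc1, hf.contDiffOn_fst, fun x hx t => (hK x hx t).1, fun x hx t => (hK x hx t).2.2⟩

lemma IsCoef.mono {b b' : ℝ → ℝ → ℝ} {K L : ℝ} (h : IsCoef b b' K) (hKL : K ≤ L) :
    IsCoef b b' L :=
  ⟨h.tc1, h.contDiffOn, fun x hx t => (h.bound x hx t).trans hKL,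
    fun x hx t => (h.bound' x hx t).trans hKL⟩

/-- The endpoint at which the `j`-th characteristics leave. -/
def outlet {n : ℕ} (m : ℕ) (j : Fin n) : ℝ := if (j : ℕ) < m then 1 else 0

lemma inlet_mem {n : ℕ} (m : ℕ) (j : Fin n) : inlet m j ∈ Icc (0 : ℝ) 1 := by
  unfold inlet; split_ifs <;> simp

lemma outlet_mem {n : ℕ} (m : ℕ) (j : Fin n) : outlet m j ∈ Icc (0 : ℝ) 1 := by
  unfold outlet; split_ifs <;> simp

lemma opP_eq {n : ℕ} (m : ℕ) (p : Matrix (Fin n) (Fin n) ℝ) (u : Fin n → ℝ → ℝ → ℝ)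
    (j : Fin n) (t : ℝ) : opP m p u j t = ∑ k, p j k * u k (outlet m k) t := by
  unfold opP outlet
  refine Finset.sum_congr rfl fun k _ => ?_
  split_ifs <;> rfl

/-- The velocities `a` together with their characteristics: `y j ξ s` is the time at which the
`j`-th characteristic that enters at time `s` passes `ξ`, and `σ j x t` is the time at which the
`j`-th characteristic through `(x, t)` enters. -/
structure Setting {n : ℕ} (m : ℕ) (a : Fin n → ℝ → ℝ → ℝ) where
  (Λ A D : ℝ)
  Λ_pos : 0 < Λ
  bc1 : ∀ j, IsBC1 (a j)
  pos : ∀ j : Fin n, (j : ℕ) < m → ∀ x ∈ Icc (0 : ℝ) 1, ∀ t, Λ ≤ a j x t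
  neg : ∀ j : Fin n, m ≤ (j : ℕ) → ∀ x ∈ Icc (0 : ℝ) 1, ∀ t, a j x t ≤ -Λ
  A_pos : 0 < A
  abs_a_le : ∀ j, ∀ x ∈ Icc (0 : ℝ) 1, ∀ t, |a j x t| ≤ A
  dx_le : ∀ j, ∀ x ∈ Icc (0 : ℝ) 1, ∀ t, |dx (a j) x t| ≤ A
  dt_le : ∀ j, ∀ x ∈ Icc (0 : ℝ) 1, ∀ t, |dt (a j) x t| ≤ A
  (y ys σ σt : Fin n → ℝ → ℝ → ℝ)
  flow : ∀ j, IsFlow (fun x t => (a j (cl x) t)⁻¹)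
    (fun x t => -dt (a j) (cl x) t / a j (cl x) t ^ 2) (inlet m j) (y j) (ys j) (σ j) (σt j)
  one_le_D : 1 ≤ D
  ys_le : ∀ j, ∀ x ∈ Icc (0 : ℝ) 1, ∀ s, ys j x s ≤ D
  inv_ys_le : ∀ j, ∀ x ∈ Icc (0 : ℝ) 1, ∀ s, (ys j x s)⁻¹ ≤ D

/-- The flow lemma applies to `1 / a_j` because `|a_j| ≥ Λ` bounds both this function and its time
derivative. The derivative of the flow is the exponential of an integral over a path of length at
most one, whence the two-sided bound with `D = exp (A / Λ²)`. -/
lemma exists_setting {n m : ℕ} {a : Fin n → ℝ → ℝ → ℝ} (ha : ∀ j, IsBC1 (a j))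
    (hnd : NonDegenerate m a) : Nonempty (Setting m a) := by
  obtain ⟨Λ, hΛ, hnd⟩ := hnd
  choose K hK using fun j => (ha j).2
  -- The summand `1` keeps `A` positive when all the bounds vanish or there are no components.
  set A : ℝ := ∑ j, |K j| + 1 with hA
  have hKA : ∀ j, K j ≤ A := fun j => by
    have := Finset.single_le_sum (f := fun j => |K j|) (fun i _ => abs_nonneg _)
      (Finset.mem_univ j)
    linarith [le_abs_self (K j)]
  have hA0 : 0 < A := by positivity
  have habs : ∀ j, ∀ x ∈ Icc (0 : ℝ) 1, ∀ t, Λ ≤ |a j x t| := by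
    intro j x hx t
    rcases lt_or_ge (j : ℕ) m with h | h
    · exact ((hnd j x hx t).1 h).trans (le_abs_self _)
    · have := (hnd j x hx t).2 h
      rw [abs_of_neg (by linarith)]; linarith
  have hne : ∀ j x t, a j (cl x) t ≠ 0 := fun j x t h => by
    have := habs j (cl x) (cl_mem x) t
    rw [h, abs_zero] at this; linarith
  have hB : ∀ j ξ w, |(a j (cl ξ) w)⁻¹| ≤ Λ⁻¹ := fun j ξ w => by
    rw [abs_inv]; exact inv_anti₀ hΛ (habs j _ (cl_mem ξ) w)
  have hK' : ∀ j ξ w, |-dt (a j) (cl ξ) w / a j (cl ξ) w ^ 2| ≤ A / Λ ^ 2 := fun j ξ w => by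
    rw [abs_div, abs_neg, abs_pow]
    exact div_le_div₀ hA0.le (((hK j _ (cl_mem ξ) w).2.2).trans (hKA j)) (by positivity)
      (pow_le_pow_left₀ hΛ.le (habs j _ (cl_mem ξ) w) 2)
  choose y ys σ σt hfl using fun j =>
    exists_flow ((ha j).tc1.inv (hne j)) (hB j) (hK' j) (inlet m j)
  have hex : ∀ j, ∀ x ∈ Icc (0 : ℝ) 1, ∀ s,
      |∫ η in inlet m j..x, -dt (a j) (cl η) (y j η s) / a j (cl η) (y j η s) ^ 2|
        ≤ A / Λ ^ 2 := by
    intro j x hx s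
    have h1 := intervalIntegral.norm_integral_le_of_norm_le_const (a := inlet m j) (b := x)
      (f := fun η => -dt (a j) (cl η) (y j η s) / a j (cl η) (y j η s) ^ 2) (C := A / Λ ^ 2)
      fun η _ => hK' j η _
    refine h1.trans (mul_le_of_le_one_right (by positivity) ?_)
    have := inlet_mem m j
    rw [abs_le]; constructor <;> linarith [hx.1, hx.2, this.1, this.2]
  refine ⟨
    { Λ := Λ
      A := A
      D := Real.exp (A / Λ ^ 2)
      Λ_pos := hΛ
      bc1 := ha
      pos := fun j hj x hx t => (hnd j x hx t).1 hj
      neg := fun j hj x hx t => (hnd j x hx t).2 hj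
      A_pos := hA0
      abs_a_le := fun j x hx t => (hK j x hx t).1.trans (hKA j)
      dx_le := fun j x hx t => (hK j x hx t).2.1.trans (hKA j)
      dt_le := fun j x hx t => (hK j x hx t).2.2.trans (hKA j)
      y := y
      ys := ys
      σ := σ
      σt := σt
      flow := hfl
      one_le_D := Real.one_le_exp (by positivity)
      ys_le := ?_
      inv_ys_le := ?_ }⟩
  · intro j x hx s
    rw [(hfl j).ys_eq, Real.exp_le_exp]
    exact (le_abs_self _).trans (hex j x hx s)
  · intro j x hx s
    rw [(hfl j).ys_eq, ← Real.exp_neg, Real.exp_le_exp]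
    exact (neg_le_abs _).trans (hex j x hx s)

namespace Setting

variable {n m : ℕ} {a : Fin n → ℝ → ℝ → ℝ}

/-- The direction of the `j`-th characteristics. -/
def sg {n : ℕ} (m : ℕ) (j : Fin n) : ℝ := if (j : ℕ) < m then 1 else -1

lemma sg_mul_a_ge (S : Setting m a) (j : Fin n) {x : ℝ} (hx : x ∈ Icc (0 : ℝ) 1) (t : ℝ) :
    S.Λ ≤ sg m j * a j x t := by
  unfold sg
  split_ifs with h
  · simpa using S.pos j h x hx t
  · have := S.neg j (not_lt.1 h) x hx t
    linarith

lemma abs_a_ge (S : Setting m a) (j : Fin n) {x : ℝ} (hx : x ∈ Icc (0 : ℝ) 1) (t : ℝ) : S.Λ ≤ |a j x t| := by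
  refine (S.sg_mul_a_ge j hx t).trans ((le_abs_self _).trans ?_)
  rw [abs_mul]; unfold sg; split_ifs <;> simp

lemma a_ne (S : Setting m a) (j : Fin n) {x : ℝ} (hx : x ∈ Icc (0 : ℝ) 1) (t : ℝ) : a j x t ≠ 0 := fun h => by
  have := S.abs_a_ge j hx t
  rw [h, abs_zero] at this; linarith [S.Λ_pos]

lemma abs_inv_a_le (S : Setting m a) (j : Fin n) {x : ℝ} (hx : x ∈ Icc (0 : ℝ) 1) (t : ℝ) :
    |(a j x t)⁻¹| ≤ S.Λ⁻¹ := by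
  rw [abs_inv]; exact inv_anti₀ S.Λ_pos (S.abs_a_ge j hx t)

lemma tc1_inv_a (S : Setting m a) (j : Fin n) : TC1 (fun x t => (a j (cl x) t)⁻¹)
    (fun x t => -dt (a j) (cl x) t / a j (cl x) t ^ 2) :=
  (S.bc1 j).tc1.inv fun x t => S.a_ne j (cl_mem x) t

lemma y_ode (S : Setting m a) (j : Fin n) {ξ : ℝ} (hξ : ξ ∈ Icc (0 : ℝ) 1) (s : ℝ) :
    HasDerivAt (fun ξ => S.y j ξ s) (a j ξ (S.y j ξ s))⁻¹ ξ := by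
  have := (S.flow j).ode ξ s
  rwa [cl_of_mem hξ] at this

/-- Travel times along characteristics. -/
lemma travel (S : Setting m a) (j : Fin n) {ξ x : ℝ} (hξ : ξ ∈ Icc (0 : ℝ) 1) (hx : x ∈ Icc (0 : ℝ) 1)
    (h : 0 ≤ sg m j * (x - ξ)) (s : ℝ) :
    sg m j * (x - ξ) / S.A ≤ S.y j x s - S.y j ξ s ∧
      S.y j x s - S.y j ξ s ≤ sg m j * (x - ξ) / S.Λ := by
  have hc : ContinuousOn (fun ξ => S.y j ξ s) (Icc (0 : ℝ) 1) := fun ξ hξ =>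
    (S.y_ode j hξ s).continuousAt.continuousWithinAt
  have hd : DifferentiableOn ℝ (fun ξ => S.y j ξ s) (interior (Icc (0 : ℝ) 1)) := fun ξ hξ =>
    (S.y_ode j (interior_subset hξ) s).differentiableAt.differentiableWithinAt
  have hde : ∀ η ∈ interior (Icc (0 : ℝ) 1),
      deriv (fun ξ => S.y j ξ s) η = (a j η (S.y j η s))⁻¹ := fun η hη =>
    (S.y_ode j (interior_subset hη) s).deriv
  have hAp := S.A_pos
  have hLp := S.Λ_pos
  unfold sg at *
  split_ifs at * with hj
  · have hle : ξ ≤ x := by linarith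
    have hb : ∀ η ∈ interior (Icc (0 : ℝ) 1), S.A⁻¹ ≤ (a j η (S.y j η s))⁻¹ ∧
        (a j η (S.y j η s))⁻¹ ≤ S.Λ⁻¹ := fun η hη => by
      have h1 := S.pos j hj η (interior_subset hη) (S.y j η s)
      have h2 := (le_abs_self _).trans (S.abs_a_le j η (interior_subset hη) (S.y j η s))
      exact ⟨inv_anti₀ (by linarith) h2, inv_anti₀ hLp h1⟩
    have l := (convex_Icc (0 : ℝ) 1).mul_sub_le_image_sub_of_le_deriv hc hd
      (C := S.A⁻¹) (fun η hη => by rw [hde η hη]; exact (hb η hη).1) ξ hξ x hx hle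
    have u := (convex_Icc (0 : ℝ) 1).image_sub_le_mul_sub_of_deriv_le hc hd
      (C := S.Λ⁻¹) (fun η hη => by rw [hde η hη]; exact (hb η hη).2) ξ hξ x hx hle
    rw [div_eq_inv_mul, div_eq_inv_mul, one_mul]
    exact ⟨l, u⟩
  · have hle : x ≤ ξ := by linarith
    have hb : ∀ η ∈ interior (Icc (0 : ℝ) 1), (a j η (S.y j η s))⁻¹ ≤ -S.A⁻¹ ∧
        -S.Λ⁻¹ ≤ (a j η (S.y j η s))⁻¹ := fun η hη => by
      have h1 := S.neg j (not_lt.1 hj) η (interior_subset hη) (S.y j η s)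
      have h2 := (neg_le_abs _).trans (S.abs_a_le j η (interior_subset hη) (S.y j η s))
      have e : (a j η (S.y j η s))⁻¹ = -(-a j η (S.y j η s))⁻¹ := by rw [inv_neg, neg_neg]
      rw [e]
      exact ⟨neg_le_neg (inv_anti₀ (by linarith) h2), neg_le_neg (inv_anti₀ hLp (by linarith))⟩
    have l := (convex_Icc (0 : ℝ) 1).mul_sub_le_image_sub_of_le_deriv hc hd
      (C := -S.Λ⁻¹) (fun η hη => by rw [hde η hη]; exact (hb η hη).2) x hx ξ hξ hle
    have u := (convex_Icc (0 : ℝ) 1).image_sub_le_mul_sub_of_deriv_le hc hd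
      (C := -S.A⁻¹) (fun η hη => by rw [hde η hη]; exact (hb η hη).1) x hx ξ hξ hle
    rw [div_eq_inv_mul, div_eq_inv_mul]
    constructor <;> linarith

lemma sg_inlet (j : Fin n) {x : ℝ} (hx : x ∈ Icc (0 : ℝ) 1) :
    sg m j * (x - inlet m j) = |x - inlet m j| := by
  unfold sg inlet
  split_ifs
  · rw [abs_of_nonneg] <;> linarith [hx.1]
  · rw [abs_of_nonpos] <;> linarith [hx.2]

lemma abs_sub_inlet_le (j : Fin n) {x : ℝ} (hx : x ∈ Icc (0 : ℝ) 1) : |x - inlet m j| ≤ 1 := by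
  have := inlet_mem m j
  rw [abs_le]; constructor <;> linarith [hx.1, hx.2, this.1, this.2]

lemma y_bounds (S : Setting m a) (j : Fin n) {x : ℝ} (hx : x ∈ Icc (0 : ℝ) 1) (s : ℝ) :
    s + |x - inlet m j| / S.A ≤ S.y j x s ∧ S.y j x s ≤ s + S.Λ⁻¹ := by
  have h := S.travel j (inlet_mem m j) hx (by rw [sg_inlet j hx]; exact abs_nonneg _) s
  rw [sg_inlet j hx, (S.flow j).base] at h
  have h2 : |x - inlet m j| / S.Λ ≤ S.Λ⁻¹ := by
    rw [div_eq_inv_mul]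
    exact mul_le_of_le_one_right (inv_nonneg.2 S.Λ_pos.le) (abs_sub_inlet_le j hx)
  constructor <;> linarith [h.1, h.2]

lemma le_y (S : Setting m a) (j : Fin n) {x : ℝ} (hx : x ∈ Icc (0 : ℝ) 1) (s : ℝ) : s ≤ S.y j x s := by
  have h := (S.y_bounds j hx s).1
  have : 0 ≤ |x - inlet m j| / S.A := div_nonneg (abs_nonneg _) S.A_pos.le
  linarith

lemma σ_bounds (S : Setting m a) (j : Fin n) {x : ℝ} (hx : x ∈ Icc (0 : ℝ) 1) (t : ℝ) :
    t - S.Λ⁻¹ ≤ S.σ j x t ∧ S.σ j x t ≤ t - |x - inlet m j| / S.A := by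
  have h := S.y_bounds j hx (S.σ j x t)
  rw [(S.flow j).right_inv] at h
  constructor <;> linarith [h.1, h.2]

lemma σ_le (S : Setting m a) (j : Fin n) {x : ℝ} (hx : x ∈ Icc (0 : ℝ) 1) (t : ℝ) : S.σ j x t ≤ t := by
  have h := S.le_y j hx (S.σ j x t)
  rwa [(S.flow j).right_inv] at h

lemma ys_pos (S : Setting m a) (j : Fin n) (x s : ℝ) : 0 < S.ys j x s := by
  rw [(S.flow j).ys_eq]; exact Real.exp_pos _

lemma σt_pos (S : Setting m a) (j : Fin n) (x t : ℝ) : 0 < S.σt j x t := by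
  rw [(S.flow j).σt_eq]; exact inv_pos.2 (S.ys_pos j _ _)

lemma σt_le (S : Setting m a) (j : Fin n) {x : ℝ} (hx : x ∈ Icc (0 : ℝ) 1) (t : ℝ) : S.σt j x t ≤ S.D := by
  rw [(S.flow j).σt_eq]; exact S.inv_ys_le j x hx _

lemma σ_inlet (S : Setting m a) (j : Fin n) (t : ℝ) : S.σ j (inlet m j) t = t := by
  have := (S.flow j).right_inv (inlet m j) t
  rwa [(S.flow j).base] at this

/-- `charCurve` picks some solution of the initial value problem; uniqueness identifies the chosen
one with the flow, so the extinction condition can be read in terms of `y` and `σ`. -/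
lemma charCurve_eq (S : Setting m a) (j : Fin n) {x ξ : ℝ} (hx : x ∈ Icc (0 : ℝ) 1) (hξ : ξ ∈ Icc (0 : ℝ) 1)
    (t : ℝ) : charCurve (a j) ξ x t = S.y j ξ (S.σ j x t) := by
  have hex : ∃ w : ℝ → ℝ, IsCharacteristic (a j) x t w := by
    refine ⟨fun ξ => S.y j ξ (S.σ j x t), (S.flow j).right_inv x t, fun ξ hξ => ?_⟩
    rw [one_div]
    exact (S.y_ode j hξ _).hasDerivWithinAt
  unfold charCurve
  rw [dif_pos hex]
  refine (S.flow j).unique 0 1 x hx t _ hex.choose_spec.1 (fun ξ hξ => ?_) ξ hξ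
  rw [cl_of_mem hξ, ← one_div]
  exact hex.choose_spec.2 ξ hξ

end Setting

end

end Hyp

namespace Hyp

noncomputable section

/-! ### Transport operators -/

/-- Bounded functions with bounded time derivative. -/
def BT (f : ℝ → ℝ → ℝ) : Prop :=
  ∃ f' C, TC1 f f' ∧ ∀ x t, |f x t| ≤ C ∧ |f' x t| ≤ C

namespace BT

variable {f g : ℝ → ℝ → ℝ}

lemma add (hf : BT f) (hg : BT g) : BT fun x t => f x t + g x t := by
  obtain ⟨f', C, h, hC⟩ := hf
  obtain ⟨g', E, k, hE⟩ := hg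
  exact ⟨_, C + E, h.add k, fun x t =>
    ⟨(abs_add_le _ _).trans (add_le_add (hC x t).1 (hE x t).1),
      (abs_add_le _ _).trans (add_le_add (hC x t).2 (hE x t).2)⟩⟩

lemma neg (hf : BT f) : BT fun x t => -f x t := by
  obtain ⟨f', C, h, hC⟩ := hf
  exact ⟨_, C, h.neg, fun x t => by rw [abs_neg, abs_neg]; exact hC x t⟩

lemma mul (hf : BT f) (hg : BT g) : BT fun x t => f x t * g x t := by
  obtain ⟨f', C, h, hC⟩ := hf
  obtain ⟨g', E, k, hE⟩ := hg
  have hC0 : 0 ≤ C := (abs_nonneg _).trans (hC 0 0).1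
  have hE0 : 0 ≤ E := (abs_nonneg _).trans (hE 0 0).1
  have hm : ∀ {u v : ℝ}, |u| ≤ C → |v| ≤ E → |u * v| ≤ C * E := fun hu hv => by
    rw [abs_mul]; exact mul_le_mul hu hv (abs_nonneg _) hC0
  refine ⟨_, C * E + C * E, h.mul k, fun x t => ⟨?_, ?_⟩⟩
  · exact (hm (hC x t).1 (hE x t).1).trans (by nlinarith)
  · exact (abs_add_le _ _).trans
      (add_le_add (hm (hC x t).2 (hE x t).1) (hm (hC x t).1 (hE x t).2))

lemma zero : BT fun _ _ => 0 := ⟨_, 0, TC1.zero, fun _ _ => by simp⟩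

lemma sum {ι : Type*} (s : Finset ι) {F : ι → ℝ → ℝ → ℝ} (h : ∀ i, BT (F i)) :
    BT fun x t => ∑ i ∈ s, F i x t := by
  classical
  induction s using Finset.induction_on with
  | empty => simpa using zero
  | insert i s hi ih => simpa [Finset.sum_insert hi] using (h i).add ih

lemma of_cl {c : ℝ → ℝ} (hc : ContinuousOn c (Icc 0 1)) : BT fun x _ => c (cl x) := by
  obtain ⟨C, hC⟩ := isCompact_Icc.exists_bound_of_continuousOn hc
  have hC0 : 0 ≤ C := (norm_nonneg _).trans (hC 0 (left_mem_Icc.2 zero_le_one))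
  exact ⟨_, C, TC1.of_fst (hc.comp_continuous continuous_cl cl_mem),
    fun x t => ⟨hC _ (cl_mem x), by simpa using hC0⟩⟩

end BT

lemma IsCoef.bt {b b' : ℝ → ℝ → ℝ} {K : ℝ} (h : IsCoef b b' K) : BT fun x t => b (cl x) t :=
  ⟨_, K, h.tc1, fun x t => ⟨h.bound _ (cl_mem x) t, h.bound' _ (cl_mem x) t⟩⟩

lemma Setting.bt_inv_a {n m : ℕ} {a : Fin n → ℝ → ℝ → ℝ} (S : Setting m a) (j : Fin n) :
    BT fun x t => (a j (cl x) t)⁻¹ := by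
  have hA := S.A_pos
  have hL := S.Λ_pos
  refine ⟨_, S.Λ⁻¹ + S.A / S.Λ ^ 2, S.tc1_inv_a j, fun x t => ⟨?_, ?_⟩⟩
  · have : 0 ≤ S.A / S.Λ ^ 2 := by positivity
    linarith [S.abs_inv_a_le j (cl_mem x) t]
  · have h : |-dt (a j) (cl x) t / a j (cl x) t ^ 2| ≤ S.A / S.Λ ^ 2 := by
      rw [abs_div, abs_neg, abs_pow]
      exact div_le_div₀ hA.le (S.dt_le j _ (cl_mem x) t) (by positivity)
        (pow_le_pow_left₀ hL.le (S.abs_a_ge j (cl_mem x) t) 2)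
    have : 0 ≤ S.Λ⁻¹ := by positivity
    linarith

/-- Differentiation under the integral sign for an integrand with a kink in time. -/
lemma tc1_truncated_primitive {γ γ' y ys : ℝ → ℝ → ℝ} (hγ : TC1 γ γ') (τ : ℝ) (hy : TC1 y ys)
    (hinj : ∀ s, Function.Injective fun ξ => y ξ s) (x₀ : ℝ) :
    TC1 (fun x s => ∫ ξ in x₀..x, γ ξ (max (y ξ s) τ))
      (fun x s => ∫ ξ in x₀..x, if τ < y ξ s then γ' ξ (y ξ s) * ys ξ s else 0) := by
  have hcy : ∀ s, Continuous fun ξ => y ξ s := fun s => hy.comp_cont continuous_id continuous_const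
  have hcs : ∀ ξ, Continuous fun s => y ξ s := fun ξ => hy.comp_cont continuous_const continuous_id
  -- The kink of `max · τ` is met at no more than one `ξ` for each `s`, because a characteristic
  -- passes each time only once. Away from this null set the integrand is differentiable in `s`.
  have hae : ∀ s, ∀ᵐ ξ, y ξ s ≠ τ := by
    intro s
    refine measure_mono_null (t := {ξ | y ξ s = τ}) (fun ξ hξ => not_not.1 hξ) ?_
    exact Set.Subsingleton.measure_zero (fun ξ hξ η hη => hinj s (hξ.trans hη.symm)) _
  have hcF : Continuous fun z : ℝ × ℝ => γ' z.1 (y z.1 z.2) * ys z.1 z.2 :=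
    (hγ.comp_cont' continuous_fst hy.cont).mul hy.cont'
  have hmeas : ∀ s, Measurable fun ξ => if τ < y ξ s then γ' ξ (y ξ s) * ys ξ s else 0 := fun s =>
    Measurable.ite (measurableSet_lt measurable_const (hcy s).measurable)
      (hcF.comp (continuous_id.prodMk continuous_const)).measurable measurable_const
  have hbnd : ∀ (I : Set ℝ), IsCompact I → ∀ s : ℝ, ∃ C, 0 ≤ C ∧
      ∀ ξ ∈ I, ∀ r ∈ Metric.closedBall s 1, |γ' ξ (y ξ r) * ys ξ r| ≤ C := by
    intro I hI s
    obtain ⟨C, hC⟩ := (hI.prod (isCompact_closedBall s 1)).exists_bound_of_continuousOn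
      hcF.continuousOn
    exact ⟨max C 0, le_max_right _ _, fun ξ hξ r hr => (hC (ξ, r) ⟨hξ, hr⟩).trans (le_max_left _ _)⟩
  have hcont : ∀ s ξ, y ξ s ≠ τ →
      ContinuousAt (fun s => if τ < y ξ s then γ' ξ (y ξ s) * ys ξ s else 0) s := by
    intro s ξ hne
    rcases lt_or_gt_of_ne hne with h | h
    · refine (continuousAt_const (y := (0 : ℝ))).congr ?_
      filter_upwards [(hcs ξ).continuousAt.eventually (gt_mem_nhds h)] with r hr
      rw [if_neg (not_lt.2 (le_of_lt hr))]
    · have hc : Continuous fun s => γ' ξ (y ξ s) * ys ξ s :=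
        hcF.comp (continuous_const.prodMk continuous_id)
      refine hc.continuousAt.congr ?_
      filter_upwards [(hcs ξ).continuousAt.eventually (lt_mem_nhds h)] with r hr
      rw [if_pos hr]
  refine ⟨?_, ?_, ?_⟩
  · refine intervalIntegral.continuous_parametric_intervalIntegral_of_continuous
      (f := fun (z : ℝ × ℝ) ξ => γ ξ (max (y ξ z.2) τ)) ?_ continuous_fst
    refine hγ.comp_cont continuous_snd ?_
    exact (hy.comp_cont continuous_snd (by fun_prop)).max continuous_const
  · refine continuous_iff_continuousAt.2 fun z => ?_
    set R : ℝ := max |z.1| |x₀| + 1 with hR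
    have h1 : ∀ r : ℝ, |r| ≤ max |z.1| |x₀| → r ∈ Ioo (-R) R := fun r hr => by
      rw [mem_Ioo, ← abs_lt]; linarith
    obtain ⟨C, hC0, hC⟩ := hbnd (Icc (-R) R) isCompact_Icc z.2
    have hRR : -R ≤ R := by
      have := (h1 z.1 (le_max_left _ _)); linarith [this.1, this.2]
    have key := intervalIntegral.continuousAt_parametric_primitive_of_dominated (μ := volume)
      (F := fun s ξ => if τ < y ξ s then γ' ξ (y ξ s) * ys ξ s else 0) (x₀ := z.2) (a₀ := x₀)
      (b₀ := z.1) (fun _ => C) (-R) R (fun s => (hmeas s).aestronglyMeasurable) ?_ (by simp) ?_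
      (h1 _ (le_max_right _ _)) (h1 _ (le_max_left _ _)) (by simp)
    · exact ContinuousAt.comp (f := fun q : ℝ × ℝ => (q.2, q.1)) key (by fun_prop)
    · filter_upwards [Metric.closedBall_mem_nhds z.2 one_pos] with r hr
      refine (ae_restrict_iff' measurableSet_uIoc).2 (Eventually.of_forall fun ξ hξ => ?_)
      rw [uIoc_of_le hRR] at hξ
      have := hC ξ (Ioc_subset_Icc_self hξ) r hr
      split_ifs
      · exact this
      · simpa using hC0
    · filter_upwards [ae_restrict_of_ae (hae z.2)] with ξ hξ using hcont z.2 ξ hξ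
  · intro x s
    have hKc : IsCompact (uIcc x₀ x ×ˢ Metric.closedBall s 1) :=
      isCompact_uIcc.prod (isCompact_closedBall s 1)
    obtain ⟨C₂, hC₂⟩ := hKc.exists_bound_of_continuousOn hy.cont'.continuousOn
    obtain ⟨R, hR⟩ := hKc.exists_bound_of_continuousOn hy.cont.continuousOn
    obtain ⟨C₁, hC₁⟩ := (isCompact_uIcc (a := x₀) (b := x)).prod
      (isCompact_Icc (a := -max R |τ|) (b := max R |τ|)) |>.exists_bound_of_continuousOn
      hγ.cont'.continuousOn
    refine (intervalIntegral.hasDerivAt_integral_of_dominated_loc_of_lip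
      (F := fun s ξ => γ ξ (max (y ξ s) τ)) (bound := fun _ => C₁ * C₂)
      (Metric.closedBall_mem_nhds s one_pos) ?_ ?_ (hmeas s).aestronglyMeasurable ?_ (by simp) ?_).2
    · exact Eventually.of_forall fun r => (hγ.comp_cont continuous_id
        ((hcy r).max continuous_const)).aestronglyMeasurable
    · exact (hγ.comp_cont continuous_id ((hcy s).max continuous_const)).intervalIntegrable _ _
    · refine Eventually.of_forall fun ξ hξ => ?_
      have hξ' := uIoc_subset_uIcc hξ
      have hC₁0 : 0 ≤ C₁ := (norm_nonneg _).trans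
        (hC₁ (ξ, 0) ⟨hξ', by rw [mem_Icc, ← abs_le, abs_zero]; positivity⟩)
      refine LipschitzOnWith.of_dist_le_mul fun r hr r' hr' => ?_
      have hmem : ∀ q ∈ Metric.closedBall s 1, max (y ξ q) τ ∈ Icc (-max R |τ|) (max R |τ|) := by
        intro q hq
        rw [mem_Icc, ← abs_le]
        exact abs_max_le_max_abs_abs.trans (max_le_max_right _ (hR (ξ, q) ⟨hξ', hq⟩))
      have h1 := (convex_Icc (-max R |τ|) (max R |τ|)).norm_image_sub_le_of_norm_hasDerivWithin_le
        (f := γ ξ) (f' := γ' ξ) (C := C₁) (fun q _ => (hγ.deriv ξ q).hasDerivWithinAt)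
        (fun q hq => hC₁ (ξ, q) ⟨hξ', hq⟩) (hmem r' hr') (hmem r hr)
      have h2 := (convex_closedBall s 1).norm_image_sub_le_of_norm_hasDerivWithin_le
        (f := y ξ) (f' := ys ξ) (C := C₂) (fun q _ => (hy.deriv ξ q).hasDerivWithinAt)
        (fun q hq => hC₂ (ξ, q) ⟨hξ', hq⟩) hr' hr
      rw [Real.dist_eq, Real.dist_eq, Real.coe_nnabs]
      calc |γ ξ (max (y ξ r) τ) - γ ξ (max (y ξ r') τ)|
          ≤ C₁ * |max (y ξ r) τ - max (y ξ r') τ| := h1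
        _ ≤ C₁ * |y ξ r - y ξ r'| := by
            refine mul_le_mul_of_nonneg_left ?_ hC₁0
            have h3 := abs_max_sub_max_le_max (y ξ r) τ (y ξ r') τ
            rwa [sub_self, abs_zero, max_eq_left (abs_nonneg (y ξ r - y ξ r'))] at h3
        _ ≤ C₁ * (C₂ * |r - r'|) := by gcongr; exact h2
        _ ≤ |C₁ * C₂| * |r - r'| := by
            rw [← mul_assoc]; gcongr; exact le_abs_self _
    · filter_upwards [hae s] with ξ hne _
      rcases lt_or_gt_of_ne hne with h | h
      · rw [if_neg (not_lt.2 h.le)]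
        refine (hasDerivAt_const s (γ ξ τ)).congr_of_eventuallyEq ?_
        filter_upwards [(hcs ξ).continuousAt.eventually (gt_mem_nhds h)] with r hr
        rw [max_eq_right (le_of_lt hr)]
      · rw [if_pos h]
        refine ((hγ.deriv ξ (y ξ s)).comp s (hy.deriv ξ s)).congr_of_eventuallyEq ?_
        filter_upwards [(hcs ξ).continuousAt.eventually (lt_mem_nhds h)] with r hr
        simp only [Function.comp]
        rw [max_eq_left (le_of_lt hr)]

end

end Hyp

/-! ### The integrated system and its weighted estimates. -/

namespace Hyp

noncomputable section

namespace Setting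

variable {n m : ℕ} {a : Fin n → ℝ → ℝ → ℝ}

lemma tc1_y (S : Setting m a) (j : Fin n) : TC1 (S.y j) (S.ys j) := (S.flow j).tc1_y

lemma tc1_σ (S : Setting m a) (j : Fin n) : TC1 (S.σ j) (S.σt j) := (S.flow j).tc1_σ

lemma y_injective (S : Setting m a) (j : Fin n) (s : ℝ) :
    Function.Injective fun ξ => S.y j ξ s := by
  rcases lt_or_ge (j : ℕ) m with hj | hj
  · refine StrictMono.injective (strictMono_of_deriv_pos fun ξ => ?_)
    rw [((S.flow j).ode ξ s).deriv, inv_pos]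
    exact S.Λ_pos.trans_le (S.pos j hj _ (cl_mem ξ) _)
  · refine StrictAnti.injective (strictAnti_of_deriv_neg fun ξ => ?_)
    rw [((S.flow j).ode ξ s).deriv, inv_neg'']
    have := S.neg j hj _ (cl_mem ξ) (S.y j ξ s)
    linarith [S.Λ_pos]

/-- Between the inlet and `x` the `j`-th characteristic through `(x, t)` passes before `t`. -/
lemma y_le (S : Setting m a) (j : Fin n) {x ξ : ℝ} (hx : x ∈ Icc (0 : ℝ) 1)
    (hξ : ξ ∈ uIcc (inlet m j) x) (s : ℝ) : S.y j ξ s ≤ S.y j x s := by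
  have hξ1 : ξ ∈ Icc (0 : ℝ) 1 := uIcc_subset_Icc (inlet_mem m j) hx hξ
  have h0 : 0 ≤ sg m j * (x - ξ) := by
    unfold inlet at hξ
    unfold sg
    split_ifs at hξ ⊢
    · rw [uIcc_of_le hx.1] at hξ; linarith [hξ.2]
    · rw [uIcc_of_ge hx.2] at hξ; linarith [hξ.1]
  have h := (S.travel j hξ1 hx h0 s).1
  have : 0 ≤ sg m j * (x - ξ) / S.A := div_nonneg h0 S.A_pos.le
  linarith

/-- Along a characteristic `|dξ| = |a| dt ≤ A dt`, and an exponential with exponent `r` integrates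
in time to `1 / r` times itself. The factor `A / r` is what makes integral terms small for large
`r`. -/
lemma abs_integral_le (S : Setting m a) (j : Fin n) {x : ℝ} (hx : x ∈ Icc (0 : ℝ) 1) (s τ C r : ℝ)
    (hr : 0 < r) (hC : 0 ≤ C) {I : ℝ → ℝ}
    (hI : ∀ ξ ∈ uIcc (inlet m j) x, |I ξ| ≤ C * Real.exp (r * (S.y j ξ s - τ))) :
    |∫ ξ in inlet m j..x, I ξ| ≤ C * (S.A / r) * Real.exp (r * (S.y j x s - τ)) := by
  have hsub : uIcc (inlet m j) x ⊆ Icc (0 : ℝ) 1 := uIcc_subset_Icc (inlet_mem m j) hx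
  have hcy : Continuous fun ξ => S.y j ξ s := (S.tc1_y j).comp_cont continuous_id continuous_const
  have hce : Continuous fun ξ => C * Real.exp (r * (S.y j ξ s - τ)) := by fun_prop
  have h1 : |∫ ξ in inlet m j..x, I ξ| ≤
      |∫ ξ in inlet m j..x, C * Real.exp (r * (S.y j ξ s - τ))| :=
    intervalIntegral.norm_integral_le_abs_of_norm_le (E := ℝ) (f := I) (μ := volume)
      ((ae_restrict_iff' measurableSet_uIoc).2
        (Eventually.of_forall fun ξ hξ => hI ξ (uIoc_subset_uIcc hξ)))
      (hce.intervalIntegrable _ _)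
  refine h1.trans ?_
  set e : ℝ → ℝ := fun ξ => Real.exp (r * (S.y j ξ s - τ)) with he
  have hA := S.A_pos
  have hder : ∀ ξ ∈ uIcc (inlet m j) x, HasDerivAt (fun ξ => C * (S.A / r) * e ξ)
      (C * S.A * (e ξ * (a j ξ (S.y j ξ s))⁻¹)) ξ := by
    intro ξ hξ
    have h := ((((S.y_ode j (hsub hξ) s).sub_const τ).const_mul r).exp).const_mul (C * (S.A / r))
    refine h.congr_deriv ?_
    simp only [he]
    field_simp
  have hcont' : ContinuousOn (fun ξ => C * S.A * (e ξ * (a j ξ (S.y j ξ s))⁻¹))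
      (uIcc (inlet m j) x) := by
    have : Continuous fun ξ => C * S.A * (e ξ * (a j (cl ξ) (S.y j ξ s))⁻¹) := by
      have := (S.tc1_inv_a j).comp_cont continuous_id hcy
      simp only [id] at this
      fun_prop
    refine this.continuousOn.congr fun ξ hξ => ?_
    simp only [cl_of_mem (hsub hξ)]
  have hint := hcont'.intervalIntegrable (μ := volume)
  have hFTC := intervalIntegral.integral_eq_sub_of_hasDerivAt hder hint
  have hpos : ∀ ξ, 0 < e ξ := fun ξ => Real.exp_pos _
  rcases lt_or_ge (j : ℕ) m with hj | hj
  · have h0 : inlet m j = 0 := if_pos hj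
    rw [h0] at hsub hint hFTC ⊢
    rw [abs_of_nonneg (intervalIntegral.integral_nonneg hx.1 fun ξ _ =>
      mul_nonneg hC (Real.exp_pos _).le)]
    calc ∫ ξ in (0 : ℝ)..x, C * e ξ ≤ ∫ ξ in (0 : ℝ)..x, C * S.A * (e ξ * (a j ξ (S.y j ξ s))⁻¹) := by
          refine intervalIntegral.integral_mono_on hx.1 (hce.intervalIntegrable _ _) hint
            fun ξ hξ => ?_
          have hξ1 := hsub (Icc_subset_uIcc hξ)
          have h2 := (le_abs_self _).trans (S.abs_a_le j ξ hξ1 (S.y j ξ s))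
          have h3 := S.Λ_pos.trans_le (S.pos j hj ξ hξ1 (S.y j ξ s))
          have h4 : 1 ≤ S.A * (a j ξ (S.y j ξ s))⁻¹ := by
            rw [← div_eq_mul_inv, le_div_iff₀ h3]; linarith
          have h5 : C * e ξ * 1 ≤ C * e ξ * (S.A * (a j ξ (S.y j ξ s))⁻¹) := by
            gcongr
          linarith
      _ = C * (S.A / r) * e x - C * (S.A / r) * e 0 := hFTC
      _ ≤ _ := by
          have : 0 ≤ C * (S.A / r) * e 0 := by have := hpos 0; positivity
          linarith
  · have h0 : inlet m j = 1 := if_neg (not_lt.2 hj)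
    rw [h0] at hsub hint hFTC ⊢
    rw [intervalIntegral.integral_symm, abs_neg,
      abs_of_nonneg (intervalIntegral.integral_nonneg hx.2 fun ξ _ =>
      mul_nonneg hC (Real.exp_pos _).le)]
    calc ∫ ξ in x..1, C * e ξ ≤ ∫ ξ in x..1, -(C * S.A * (e ξ * (a j ξ (S.y j ξ s))⁻¹)) := by
          refine intervalIntegral.integral_mono_on hx.2 (hce.intervalIntegrable _ _) hint.symm.neg
            fun ξ hξ => ?_
          have hξ1 := hsub (Icc_subset_uIcc' hξ)
          have h2 := (neg_le_abs _).trans (S.abs_a_le j ξ hξ1 (S.y j ξ s))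
          have h3 := S.neg j hj ξ hξ1 (S.y j ξ s)
          have h4 : 1 ≤ S.A * (-a j ξ (S.y j ξ s))⁻¹ := by
            rw [← div_eq_mul_inv, le_div_iff₀ (by linarith [S.Λ_pos])]; linarith
          have h5 : C * e ξ * 1 ≤ C * e ξ * (S.A * (-a j ξ (S.y j ξ s))⁻¹) := by
            gcongr
          rw [inv_neg] at h5
          linarith
      _ = C * (S.A / r) * e x - C * (S.A / r) * e 1 := by
          rw [intervalIntegral.integral_neg, intervalIntegral.integral_symm, neg_neg, hFTC]
      _ ≤ _ := by
          have : 0 ≤ C * (S.A / r) * e 1 := by have := hpos 1; positivity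
          linarith

/-- The right-hand side of the integrated system in characteristic coordinates, and its derivative
in the entrance time. -/
def kV (S : Setting m a) (p : Matrix (Fin n) (Fin n) ℝ) (β : Fin n → Fin n → ℝ → ℝ → ℝ)
    (w : Fin n → ℝ → ℝ → ℝ) (j : Fin n) (x s : ℝ) : ℝ :=
  ∑ k, p j k * w k (outlet m k) s +
    ∫ ξ in inlet m j..x, ∑ k, β j k ξ (S.y j ξ s) * w k (cl ξ) (S.y j ξ s)

def kV' (S : Setting m a) (p : Matrix (Fin n) (Fin n) ℝ) (β β' : Fin n → Fin n → ℝ → ℝ → ℝ)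
    (w z : Fin n → ℝ → ℝ → ℝ) (j : Fin n) (x s : ℝ) : ℝ :=
  ∑ k, p j k * z k (outlet m k) s +
    ∫ ξ in inlet m j..x, ∑ k, (β' j k ξ (S.y j ξ s) * w k (cl ξ) (S.y j ξ s) +
      β j k ξ (S.y j ξ s) * z k (cl ξ) (S.y j ξ s)) * S.ys j ξ s

/-- The same right-hand side in the original coordinates `(x, t)`; the fixed point problem is posed
for this operator, while differentiability in `x` is easier to see for `kV`. -/
def kop (S : Setting m a) (p : Matrix (Fin n) (Fin n) ℝ) (β : Fin n → Fin n → ℝ → ℝ → ℝ)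
    (w : Fin n → ℝ → ℝ → ℝ) (j : Fin n) (x t : ℝ) : ℝ := S.kV p β w j x (S.σ j x t)

def kop' (S : Setting m a) (p : Matrix (Fin n) (Fin n) ℝ) (β β' : Fin n → Fin n → ℝ → ℝ → ℝ)
    (w z : Fin n → ℝ → ℝ → ℝ) (j : Fin n) (x t : ℝ) : ℝ :=
  S.kV' p β β' w z j x (S.σ j x t) * S.σt j x t

lemma tc1_integrand (S : Setting m a) {β β' : Fin n → Fin n → ℝ → ℝ → ℝ}
    (hβ : ∀ j k, TC1 (β j k) (β' j k)) {w z : Fin n → ℝ → ℝ → ℝ} (hw : ∀ k, TC1 (w k) (z k))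
    (j : Fin n) :
    TC1 (fun ξ s => ∑ k, β j k ξ (S.y j ξ s) * w k (cl ξ) (S.y j ξ s))
      (fun ξ s => ∑ k, (β' j k ξ (S.y j ξ s) * w k (cl ξ) (S.y j ξ s) +
        β j k ξ (S.y j ξ s) * z k (cl ξ) (S.y j ξ s)) * S.ys j ξ s) := by
  have h := TC1.sum Finset.univ fun k _ =>
    ((hβ j k).comp (S.tc1_y j) continuous_id).mul ((hw k).comp (S.tc1_y j) continuous_cl)
  refine h.congr (fun x t => rfl) (fun x t => Finset.sum_congr rfl fun k _ => ?_)
  simp only [id]; ring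

lemma tc1_id : TC1 (fun _ t => t) (fun _ _ => 1) :=
  ⟨continuous_snd, continuous_const, fun _ t => hasDerivAt_id t⟩

lemma tc1_kV (S : Setting m a) (p : Matrix (Fin n) (Fin n) ℝ) {β β' : Fin n → Fin n → ℝ → ℝ → ℝ}
    (hβ : ∀ j k, TC1 (β j k) (β' j k)) {w z : Fin n → ℝ → ℝ → ℝ} (hw : ∀ k, TC1 (w k) (z k))
    (j : Fin n) : TC1 (S.kV p β w j) (S.kV' p β β' w z j) := by
  have h1 := TC1.sum Finset.univ fun k _ =>
    (TC1.of_fst (c := fun _ => p j k) continuous_const).mul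
      ((hw k).comp tc1_id (u := fun _ => outlet m k) continuous_const)
  refine (h1.add ((S.tc1_integrand hβ hw j).primitive (inlet m j))).congr (fun x t => rfl)
    (fun x t => ?_)
  simp [kV']

lemma tc1_kop (S : Setting m a) (p : Matrix (Fin n) (Fin n) ℝ) {β β' : Fin n → Fin n → ℝ → ℝ → ℝ}
    (hβ : ∀ j k, TC1 (β j k) (β' j k)) {w z : Fin n → ℝ → ℝ → ℝ} (hw : ∀ k, TC1 (w k) (z k))
    (j : Fin n) : TC1 (S.kop p β w j) (S.kop' p β β' w z j) :=
  (S.tc1_kV p hβ hw j).comp (S.tc1_σ j) continuous_id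

/-- The weight in which the transport operators contract. -/
def wt (m : ℕ) (r L τ : ℝ) (j : Fin n) (x t : ℝ) : ℝ :=
  Real.exp (r * (t - τ) - L * |x - inlet m j|)

def Bd (m : ℕ) (r L τ N : ℝ) (w : Fin n → ℝ → ℝ → ℝ) : Prop :=
  ∀ j, ∀ x ∈ Icc (0 : ℝ) 1, ∀ t, |w j x t| ≤ N * wt m r L τ j x t

lemma abs_outlet_sub_inlet (j : Fin n) : |outlet m j - inlet m j| = 1 := by
  unfold outlet inlet; split_ifs <;> simp

/-- The outlet lies at distance one from the inlet, so the weight has gained the full factor `exp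
(-L)` there. This compensates a reflection matrix of arbitrary size. -/
lemma Bd.outlet_le {r L τ N : ℝ} {w : Fin n → ℝ → ℝ → ℝ} (h : Bd m r L τ N w)
    (p : Matrix (Fin n) (Fin n) ℝ) {Q : ℝ} (hQ : ∀ j, ∑ k, |p j k| ≤ Q) (hN : 0 ≤ N)
    (j : Fin n) (s : ℝ) :
    |∑ k, p j k * w k (outlet m k) s| ≤ Q * (N * Real.exp (r * (s - τ) - L)) := by
  calc |∑ k, p j k * w k (outlet m k) s| ≤ ∑ k, |p j k * w k (outlet m k) s| :=
        Finset.abs_sum_le_sum_abs _ _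
    _ ≤ ∑ k, |p j k| * (N * Real.exp (r * (s - τ) - L)) := by
        refine Finset.sum_le_sum fun k _ => ?_
        rw [abs_mul]
        have := h k (outlet m k) (outlet_mem m k) s
        rw [wt, abs_outlet_sub_inlet, mul_one] at this
        gcongr
    _ ≤ _ := by
        rw [← Finset.sum_mul]
        have := Real.exp_pos (r * (s - τ) - L)
        exact mul_le_mul_of_nonneg_right (hQ j) (by positivity)

lemma Bd.le_exp {r L τ N : ℝ} {w : Fin n → ℝ → ℝ → ℝ} (h : Bd m r L τ N w) (hL : 0 ≤ L)
    (hN : 0 ≤ N) (j : Fin n) (x t : ℝ) : |w j (cl x) t| ≤ N * Real.exp (r * (t - τ)) := by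
  refine (h j _ (cl_mem x) t).trans ?_
  unfold wt
  gcongr
  have : 0 ≤ L * |cl x - inlet m j| := by positivity
  linarith

/-- The general estimate behind the contraction property. -/
lemma transport_bound (S : Setting m a) {r L τ N Q E C : ℝ} (hr : 0 < r) (hL : 0 ≤ L) (hQ : 0 ≤ Q)
    (hN : 0 ≤ N) (hC : 0 ≤ C) (hrL : L * S.A ≤ r)
    (hc : E * (Q * Real.exp (-L) + C * (S.A / r) * Real.exp L) ≤ 1 / 2) (j : Fin n) {x : ℝ}
    (hx : x ∈ Icc (0 : ℝ) 1) (t : ℝ) {u e : ℝ} {I : ℝ → ℝ} (he : |e| ≤ E)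
    (hu : |u| ≤ Q * (N * Real.exp (r * (S.σ j x t - τ) - L)))
    (hI : ∀ ξ ∈ uIcc (inlet m j) x, |I ξ| ≤ C * N * Real.exp (r * (S.y j ξ (S.σ j x t) - τ))) :
    |(u + ∫ ξ in inlet m j..x, I ξ) * e| ≤ N / 2 * wt m r L τ j x t := by
  have h1 := S.abs_integral_le j hx (S.σ j x t) τ (C * N) r hr (by positivity) hI
  rw [(S.flow j).right_inv] at h1
  have hA := S.A_pos
  set d := |x - inlet m j| with hd
  have hd1 : d ≤ 1 := abs_sub_inlet_le j hx
  have hd0 : 0 ≤ d := abs_nonneg _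
  -- The weight at `x` costs `L d`. It is paid by the travel time, which is at least `d / A`,
  -- because `L A ≤ r`.
  have h2 : Real.exp (r * (S.σ j x t - τ) - L) ≤ Real.exp (-L) * wt m r L τ j x t := by
    rw [wt, ← Real.exp_add, Real.exp_le_exp, ← hd]
    have h3 := (S.σ_bounds j hx t).2
    rw [← hd] at h3
    have h4 : L * d ≤ r * (d / S.A) := by
      rw [← mul_div_assoc, le_div_iff₀ hA]; nlinarith
    nlinarith
  -- The integral term loses a full factor `exp L`; `r` is chosen after `L`, so `A / r` repays it.
  have h3 : Real.exp (r * (t - τ)) ≤ Real.exp L * wt m r L τ j x t := by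
    rw [wt, ← Real.exp_add, Real.exp_le_exp, ← hd]
    nlinarith
  have hw0 : 0 ≤ wt m r L τ j x t := (Real.exp_pos _).le
  rw [abs_mul]
  calc |u + ∫ ξ in inlet m j..x, I ξ| * |e|
      ≤ (Q * (N * (Real.exp (-L) * wt m r L τ j x t)) +
          C * N * (S.A / r) * (Real.exp L * wt m r L τ j x t)) * E := by
        refine mul_le_mul ((abs_add_le _ _).trans (add_le_add (hu.trans ?_) (h1.trans ?_))) he
          (abs_nonneg _) (by have := Real.exp_pos L; have := Real.exp_pos (-L); positivity)
        · gcongr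
        · gcongr
    _ = (N * wt m r L τ j x t) * (E * (Q * Real.exp (-L) + C * (S.A / r) * Real.exp L)) := by ring
    _ ≤ (N * wt m r L τ j x t) * (1 / 2) := by gcongr
    _ = _ := by ring

end Setting

end

end Hyp

/-! ### Contraction and the Neumann series. -/

namespace Hyp

noncomputable section

namespace Setting

variable {n m : ℕ} {a : Fin n → ℝ → ℝ → ℝ}

/-- An exponential weight in time alone is not enough, since near the inlet the reflected signal
arrives without delay. The weight in `x` makes reflection contract once `L` is large, and then a
large `r` makes the integral term contract. -/
lemma exists_contraction (S : Setting m a) (p : Matrix (Fin n) (Fin n) ℝ)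
    {β β' : Fin n → Fin n → ℝ → ℝ → ℝ} {B : ℝ} (hB : ∀ j k x t, |β j k x t| ≤ B)
    (hB' : ∀ j k x t, |β' j k x t| ≤ B) :
    ∃ r L, 1 ≤ r ∧ 0 ≤ L ∧ ∀ (τ N : ℝ) (w z : Fin n → ℝ → ℝ → ℝ), 0 ≤ N → Bd m r L τ N w →
      Bd m r L τ N z → Bd m r L τ (N / 2) (S.kop p β w) ∧
        Bd m r L τ (N / 2) (S.kop' p β β' w z) := by
  have hD := S.one_le_D
  have hA := S.A_pos
  rcases isEmpty_or_nonempty (Fin n) with hemp | ⟨⟨i⟩⟩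
  · exact ⟨1, 0, le_rfl, le_rfl, fun τ N w z _ _ _ => ⟨fun j => isEmptyElim j, fun j => isEmptyElim j⟩⟩
  have hB0 : 0 ≤ B := (abs_nonneg _).trans (hB i i 0 0)
  set Q : ℝ := ∑ j, ∑ k, |p j k| with hQd
  have hQ0 : 0 ≤ Q := Finset.sum_nonneg fun j _ => Finset.sum_nonneg fun k _ => abs_nonneg _
  have hQ : ∀ j, ∑ k, |p j k| ≤ Q := fun j =>
    Finset.single_le_sum (f := fun j => ∑ k, |p j k|)
      (fun j _ => Finset.sum_nonneg fun k _ => abs_nonneg _) (Finset.mem_univ j)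
  -- One constant for both operators: the differentiated integrand has two products per component
  -- and the factor `ys ≤ D`.
  set C : ℝ := 2 * n * B * S.D with hC
  have hC0 : 0 ≤ C := by positivity
  -- Chosen so that `D Q exp (-L) ≤ 1/4`; the second summand of `r` below makes the integral
  -- contribution at most `1/4` as well.
  set L : ℝ := Real.log (4 * S.D * Q + 1) with hL
  have hDQ : 0 ≤ S.D * Q := by positivity
  have hL0 : 0 ≤ L := Real.log_nonneg (by linarith)
  have hexpL : Real.exp (-L) = (4 * S.D * Q + 1)⁻¹ := by
    rw [Real.exp_neg, hL, Real.exp_log (by linarith)]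
  set r : ℝ := max 1 (L * S.A) + 4 * S.D * C * S.A * Real.exp L with hr
  have hpos : 0 ≤ 4 * S.D * C * S.A * Real.exp L := by
    have := Real.exp_pos L; positivity
  have hr1 : 1 ≤ r := by have := le_max_left 1 (L * S.A); linarith
  have hrL : L * S.A ≤ r := by have := le_max_right 1 (L * S.A); linarith
  have hr0 : 0 < r := by linarith
  have hrE : 4 * S.D * C * S.A * Real.exp L ≤ r := by
    have := le_max_left 1 (L * S.A); linarith
  have hcon : S.D * (Q * Real.exp (-L) + C * (S.A / r) * Real.exp L) ≤ 1 / 2 := by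
    have e1 : S.D * (Q * Real.exp (-L)) ≤ 1 / 4 := by
      rw [hexpL, ← mul_assoc, ← div_eq_mul_inv, div_le_iff₀ (by linarith)]; linarith
    have e2 : S.D * (C * (S.A / r) * Real.exp L) ≤ 1 / 4 := by
      have : S.D * (C * (S.A / r) * Real.exp L) = (4 * S.D * C * S.A * Real.exp L) / r / 4 := by
        field_simp
      rw [this]
      have : (4 * S.D * C * S.A * Real.exp L) / r ≤ 1 := (div_le_one hr0).2 hrE
      linarith
    linarith
  refine ⟨r, L, hr1, hL0, fun τ N w z hN hw hz => ⟨?_, ?_⟩⟩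
  · intro j x hx t
    have := S.transport_bound hr0 hL0 hQ0 hN hC0 hrL hcon j hx t (e := 1)
      (by rw [abs_one]; exact hD) (hw.outlet_le p hQ hN j (S.σ j x t))
      (I := fun ξ => ∑ k, β j k ξ (S.y j ξ (S.σ j x t)) * w k (cl ξ) (S.y j ξ (S.σ j x t))) ?_
    · rwa [mul_one] at this
    · intro ξ hξ
      set e := Real.exp (r * (S.y j ξ (S.σ j x t) - τ)) with he
      have he0 : 0 < e := Real.exp_pos _
      calc |∑ k, β j k ξ (S.y j ξ (S.σ j x t)) * w k (cl ξ) (S.y j ξ (S.σ j x t))|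
          ≤ ∑ k : Fin n, B * (N * e) := by
            refine (Finset.abs_sum_le_sum_abs _ _).trans (Finset.sum_le_sum fun k _ => ?_)
            rw [abs_mul]
            exact mul_le_mul (hB _ _ _ _) (hw.le_exp hL0 hN k ξ _) (abs_nonneg _) hB0
        _ = n * B * 1 * N * e := by simp; ring
        _ ≤ C * N * e := by
            rw [hC]
            have : n * B * 1 ≤ 2 * n * B * S.D := by
              have : 0 ≤ n * B := by positivity
              nlinarith
            gcongr
  · intro j x hx t
    refine S.transport_bound hr0 hL0 hQ0 hN hC0 hrL hcon j hx t (e := S.σt j x t) ?_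
      (hz.outlet_le p hQ hN j (S.σ j x t)) ?_
    · rw [abs_of_pos (S.σt_pos j x t)]; exact S.σt_le j hx t
    · intro ξ hξ
      set e := Real.exp (r * (S.y j ξ (S.σ j x t) - τ)) with he
      have he0 : 0 < e := Real.exp_pos _
      have hξ1 : ξ ∈ Icc (0 : ℝ) 1 := uIcc_subset_Icc (inlet_mem m j) hx hξ
      have hys : |S.ys j ξ (S.σ j x t)| ≤ S.D := by
        rw [abs_of_pos (S.ys_pos j _ _)]; exact S.ys_le j ξ hξ1 _
      calc |∑ k, (β' j k ξ (S.y j ξ (S.σ j x t)) * w k (cl ξ) (S.y j ξ (S.σ j x t)) +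
              β j k ξ (S.y j ξ (S.σ j x t)) * z k (cl ξ) (S.y j ξ (S.σ j x t))) *
              S.ys j ξ (S.σ j x t)|
          ≤ ∑ k : Fin n, (B * (N * e) + B * (N * e)) * S.D := by
            refine (Finset.abs_sum_le_sum_abs _ _).trans (Finset.sum_le_sum fun k _ => ?_)
            rw [abs_mul]
            refine mul_le_mul ((abs_add_le _ _).trans (add_le_add ?_ ?_)) hys (abs_nonneg _)
              (by positivity)
            · rw [abs_mul]
              exact mul_le_mul (hB' _ _ _ _) (hw.le_exp hL0 hN k ξ _) (abs_nonneg _) hB0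
            · rw [abs_mul]
              exact mul_le_mul (hB _ _ _ _) (hz.le_exp hL0 hN k ξ _) (abs_nonneg _) hB0
        _ = C * N * e := by simp [hC]; ring

/-- Solution of the integrated system by a Neumann series. -/
lemma exists_fixed_point (S : Setting m a) (p : Matrix (Fin n) (Fin n) ℝ)
    {β β' : Fin n → Fin n → ℝ → ℝ → ℝ} (hβ : ∀ j k, TC1 (β j k) (β' j k)) {r L τ N : ℝ}
    (hr : 0 ≤ r) (hL : 0 ≤ L) (hN : 0 ≤ N)
    (hcon : ∀ (N : ℝ) (w z : Fin n → ℝ → ℝ → ℝ), 0 ≤ N → Bd m r L τ N w →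
      Bd m r L τ N z → Bd m r L τ (N / 2) (S.kop p β w) ∧
        Bd m r L τ (N / 2) (S.kop' p β β' w z))
    {d₀ e₀ : Fin n → ℝ → ℝ → ℝ} (h₀ : ∀ k, TC1 (d₀ k) (e₀ k)) (hd : Bd m r L τ N d₀)
    (he : Bd m r L τ N e₀) (hz : ∀ k, ∀ x ∈ Icc (0 : ℝ) 1, ∀ t ≤ τ, d₀ k x t = 0) :
    ∃ W Z : Fin n → ℝ → ℝ → ℝ, (∀ k, TC1 (W k) (Z k)) ∧
      (∀ k, ∀ x ∈ Icc (0 : ℝ) 1, ∀ t, W k x t = d₀ k x t + S.kop p β W k x t) ∧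
      ∀ k, ∀ x ∈ Icc (0 : ℝ) 1, ∀ t ≤ τ, W k x t = 0 := by
  set D : ℕ → (Fin n → ℝ → ℝ → ℝ) × (Fin n → ℝ → ℝ → ℝ) :=
    fun i => (fun q => (S.kop p β q.1, S.kop' p β β' q.1 q.2))^[i] (d₀, e₀) with hD
  have D0 : D 0 = (d₀, e₀) := rfl
  have Ds : ∀ i, D (i + 1) = (S.kop p β (D i).1, S.kop' p β β' (D i).1 (D i).2) := fun i => by
    simp only [hD, Function.iterate_succ_apply']
  clear_value D
  have Dtc : ∀ i k, TC1 ((D i).1 k) ((D i).2 k) := by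
    intro i
    induction i with
    | zero => rw [D0]; exact h₀
    | succ i ih => rw [Ds]; exact fun k => S.tc1_kop p hβ ih k
  have Dbd : ∀ i, Bd m r L τ (N / 2 ^ i) (D i).1 ∧ Bd m r L τ (N / 2 ^ i) (D i).2 := by
    intro i
    induction i with
    | zero => simpa [D0] using ⟨hd, he⟩
    | succ i ih =>
      rw [Ds, pow_succ, ← div_div]
      exact hcon _ _ _ (by positivity) ih.1 ih.2
  -- Causality: the operator at time `t` sees only times not later than `t`, so vanishing up to `τ`
  -- is inherited by all iterates.
  have Dz : ∀ i k, ∀ x ∈ Icc (0 : ℝ) 1, ∀ t ≤ τ, (D i).1 k x t = 0 := by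
    intro i
    induction i with
    | zero => rw [D0]; exact hz
    | succ i ih =>
      rw [Ds]
      intro k x hx t ht
      have hσ := (S.σ_le k hx t).trans ht
      simp only [kop, kV]
      rw [Finset.sum_eq_zero fun l _ => by rw [ih l _ (outlet_mem m l) _ hσ, mul_zero], zero_add]
      refine intervalIntegral.integral_zero_ae (Eventually.of_forall fun ξ hξ => ?_)
      refine Finset.sum_eq_zero fun l _ => ?_
      rw [ih l _ (cl_mem ξ) _ ?_, mul_zero]
      have := S.y_le k hx (uIoc_subset_uIcc hξ) (S.σ k x t)
      rw [(S.flow k).right_inv] at this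
      exact this.trans ht
  have sumN : Summable fun i : ℕ => N / 2 ^ i := by
    simp_rw [div_eq_mul_inv, ← inv_pow]
    exact (summable_geometric_of_lt_one (by norm_num) (by norm_num)).mul_left N
  have bnd : ∀ T i k x, ∀ t ≤ T, |(D i).1 k (cl x) t| ≤ N / 2 ^ i * Real.exp (r * (T - τ)) ∧
      |(D i).2 k (cl x) t| ≤ N / 2 ^ i * Real.exp (r * (T - τ)) := by
    intro T i k x t ht
    have hN' : 0 ≤ N / 2 ^ i := by positivity
    have : N / 2 ^ i * Real.exp (r * (t - τ)) ≤ N / 2 ^ i * Real.exp (r * (T - τ)) := by gcongr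
    exact ⟨((Dbd i).1.le_exp hL hN' k x t).trans this,
      ((Dbd i).2.le_exp hL hN' k x t).trans this⟩
  have sumT : ∀ T, Summable fun i : ℕ => N / 2 ^ i * Real.exp (r * (T - τ)) := fun T =>
    sumN.mul_right _
  have contsum : ∀ (F : ℕ → ℝ → ℝ → ℝ),
      (∀ i, Continuous fun z : ℝ × ℝ => F i z.1 z.2) →
      (∀ T i x, ∀ t ≤ T, |F i (cl x) t| ≤ N / 2 ^ i * Real.exp (r * (T - τ))) →
      Continuous fun z : ℝ × ℝ => ∑' i, F i (cl z.1) z.2 := by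
    intro F hF hFb
    refine continuous_iff_continuousAt.2 fun z => ?_
    have hopen : IsOpen {q : ℝ × ℝ | q.2 < z.2 + 1} := isOpen_lt continuous_snd continuous_const
    refine (continuousOn_tsum (s := {q : ℝ × ℝ | q.2 < z.2 + 1}) (fun i => ?_) (sumT (z.2 + 1))
      (fun i q hq => hFb (z.2 + 1) i q.1 q.2 (le_of_lt hq))).continuousAt
      (hopen.mem_nhds (by simp))
    exact ((hF i).comp (by fun_prop : Continuous fun q : ℝ × ℝ => (cl q.1, q.2))).continuousOn
  set W : Fin n → ℝ → ℝ → ℝ := fun k x t => ∑' i, (D i).1 k (cl x) t with hW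
  set Z : Fin n → ℝ → ℝ → ℝ := fun k x t => ∑' i, (D i).2 k (cl x) t with hZ
  have hsum : ∀ k x t, Summable fun i => (D i).1 k (cl x) t := fun k x t =>
    Summable.of_norm_bounded (sumT t) fun i => (bnd t i k x t le_rfl).1
  have Wtc : ∀ k, TC1 (W k) (Z k) := by
    intro k
    refine ⟨contsum (fun i => (D i).1 k) (fun i => (Dtc i k).cont)
      fun T i x t ht => (bnd T i k x t ht).1, contsum (fun i => (D i).2 k)
      (fun i => (Dtc i k).cont') fun T i x t ht => (bnd T i k x t ht).2, fun x t => ?_⟩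
    exact hasDerivAt_tsum_of_isPreconnected (sumT (t + 1)) (isOpen_Iio (a := t + 1))
      isPreconnected_Iio (fun i y _ => (Dtc i k).deriv (cl x) y)
      (fun i y hy => (bnd (t + 1) i k x y (le_of_lt hy)).2) (y₀ := t) (by simp) (hsum k x t)
      (by simp)
  refine ⟨W, Z, Wtc, ?_, ?_⟩
  · intro k x hx t
    have h1 : HasSum (fun i => S.kop p β (D i).1 k x t) (S.kop p β W k x t) := by
      simp only [kop, kV]
      set s := S.σ k x t with hs
      have hWs : ∀ l x t, HasSum (fun i => (D i).1 l (cl x) t) (W l x t) := fun l x t =>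
        (hsum l x t).hasSum
      have hyT : ∀ ξ ∈ uIoc (inlet m k) x, S.y k ξ s ≤ t := fun ξ hξ => by
        have := S.y_le k hx (uIoc_subset_uIcc hξ) s
        rwa [hs, (S.flow k).right_inv] at this
      have hcy : Continuous fun ξ => S.y k ξ s :=
        (S.tc1_y k).comp_cont continuous_id continuous_const
      obtain ⟨B, hB⟩ := (isCompact_uIcc (a := inlet m k) (b := x)).exists_bound_of_continuousOn
        (f := fun ξ => ∑ l, |β k l ξ (S.y k ξ s)|)
        (continuous_finsetSum _ fun l _ =>
          ((hβ k l).comp_cont continuous_id hcy).abs).continuousOn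
      refine HasSum.add ?_ ?_
      · refine hasSum_sum fun l _ => HasSum.mul_left _ ?_
        have := hWs l (outlet m l) s
        rwa [cl_of_mem (outlet_mem m l)] at this
      · refine intervalIntegral.hasSum_integral_of_dominated_convergence
          (fun i _ => B * (N / 2 ^ i * Real.exp (r * (t - τ)))) (fun i => ?_) (fun i => ?_) ?_ ?_ ?_
        · exact (continuous_finsetSum _ fun l _ => ((hβ k l).comp_cont continuous_id hcy).mul
            ((Dtc i l).comp_cont continuous_cl hcy)).aestronglyMeasurable
        · refine Eventually.of_forall fun ξ hξ => ?_
          have hb := hB ξ (uIoc_subset_uIcc hξ)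
          calc ‖∑ l, β k l ξ (S.y k ξ s) * (D i).1 l (cl ξ) (S.y k ξ s)‖
              ≤ ∑ l, |β k l ξ (S.y k ξ s)| * (N / 2 ^ i * Real.exp (r * (t - τ))) := by
                refine (Finset.abs_sum_le_sum_abs _ _).trans (Finset.sum_le_sum fun l _ => ?_)
                rw [abs_mul]
                gcongr
                exact (bnd t i l ξ _ (hyT ξ hξ)).1
            _ ≤ _ := by
                rw [← Finset.sum_mul]
                have h0 := Real.exp_pos (r * (t - τ))
                exact mul_le_mul_of_nonneg_right ((le_abs_self _).trans hb) (by positivity)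
        · exact Eventually.of_forall fun ξ _ => (sumT t).mul_left B
        · exact intervalIntegrable_const
        · refine Eventually.of_forall fun ξ _ => hasSum_sum fun l _ => HasSum.mul_left _ ?_
          have := hWs l (cl ξ) (S.y k ξ s)
          rw [cl_of_mem (cl_mem ξ)] at this
          exact this
    -- The operator shifts the series by one index; the missing term of index zero is `d₀`.
    have h2 : HasSum (fun i => (D (i + 1)).1 k x t) (S.kop p β W k x t) := by
      simpa only [Ds] using h1
    have h3 := (hasSum_nat_add_iff (f := fun i => (D i).1 k x t) 1).1 h2
    have h4 := (hsum k x t).hasSum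
    rw [cl_of_mem hx] at h4
    have h5 := h4.unique h3
    simp only [Finset.sum_range_one, D0] at h5
    show (∑' i, (D i).1 k (cl x) t) = _
    rw [cl_of_mem hx, h5, add_comm]
  · intro k x hx t ht
    simp only [hW]
    simp [cl_of_mem hx, fun i => Dz i k x hx t ht]

end Setting

end

end Hyp

namespace Hyp

noncomputable section

/-! ### Classical solutions with smooth initial data -/

lemma IsTest.eq_zero {f : ℝ → ℝ} (hf : IsTest f) {x : ℝ} (hx : x ∉ Ioo (0 : ℝ) 1) : f x = 0 :=
  image_eq_zero_of_notMem_tsupport fun h => hx (hf.2.2 h)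

lemma IsTest.deriv_eq_zero {f : ℝ → ℝ} (hf : IsTest f) {x : ℝ} (hx : x ∉ Ioo (0 : ℝ) 1) :
    deriv f x = 0 := by
  have h : x ∉ tsupport f := fun h => hx (hf.2.2 h)
  rw [notMem_tsupport_iff_eventuallyEq] at h
  rw [h.deriv_eq]; simp

lemma inlet_notMem {n : ℕ} (m : ℕ) (j : Fin n) : inlet m j ∉ Ioo (0 : ℝ) 1 := by
  unfold inlet; split_ifs <;> simp

lemma outlet_notMem {n : ℕ} (m : ℕ) (j : Fin n) : outlet m j ∉ Ioo (0 : ℝ) 1 := by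
  unfold outlet; split_ifs <;> simp

namespace Setting

variable {n m : ℕ} {a : Fin n → ℝ → ℝ → ℝ}

lemma contDiff_σ (S : Setting m a) (j : Fin n) : ContDiff ℝ 1 fun z : ℝ × ℝ => S.σ j z.1 z.2 :=
  contDiff_of_partials (f₁ := fun x t => -(a j (cl x) t)⁻¹ * S.σt j x t)
    ((S.tc1_inv_a j).cont.neg.mul (S.tc1_σ j).cont')
    (S.tc1_σ j).cont' (S.flow j).σx (S.tc1_σ j).deriv

/-- The contribution of a source that starts at time `τ`. -/
lemma source_bounds (S : Setting m a) (j : Fin n) {γ γ' : ℝ → ℝ → ℝ}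
    {τ G r L : ℝ} (hr : 1 ≤ r) (hL : 0 ≤ L) (hG : 0 ≤ G) (h0 : ∀ ξ, γ ξ τ = 0)
    (hb : ∀ ξ t, τ ≤ t → |γ ξ t| ≤ G * Real.exp (t - τ) ∧ |γ' ξ t| ≤ G * Real.exp (t - τ)) {x : ℝ}
    (hx : x ∈ Icc (0 : ℝ) 1) (t : ℝ) :
    (t ≤ τ → ∫ ξ in inlet m j..x, γ ξ (max (S.y j ξ (S.σ j x t)) τ) = 0) ∧
    |∫ ξ in inlet m j..x, γ ξ (max (S.y j ξ (S.σ j x t)) τ)| ≤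
      G * S.D * S.D * Real.exp L * wt m r L τ j x t ∧
    |(∫ ξ in inlet m j..x, if τ < S.y j ξ (S.σ j x t) then
      γ' ξ (S.y j ξ (S.σ j x t)) * S.ys j ξ (S.σ j x t) else 0) * S.σt j x t| ≤
      G * S.D * S.D * Real.exp L * wt m r L τ j x t := by
  set s := S.σ j x t with hs
  have hy : ∀ ξ ∈ uIoc (inlet m j) x, S.y j ξ s ≤ t := fun ξ hξ => by
    have := S.y_le j hx (uIoc_subset_uIcc hξ) s
    rwa [hs, (S.flow j).right_inv] at this
  have hD := S.one_le_D
  have hw0 : 0 < wt m r L τ j x t := Real.exp_pos _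
  have hd1 := abs_sub_inlet_le (m := m) j hx
  have hexp : τ ≤ t → Real.exp (t - τ) ≤ Real.exp L * wt m r L τ j x t := fun h => by
    rw [wt, ← Real.exp_add, Real.exp_le_exp]; nlinarith
  have hz : t ≤ τ → ∫ ξ in inlet m j..x, γ ξ (max (S.y j ξ s) τ) = 0 := fun ht =>
    intervalIntegral.integral_zero_ae (Eventually.of_forall fun ξ hξ => by
      rw [max_eq_right ((hy ξ hξ).trans ht), h0])
  have hz' : t ≤ τ → (∫ ξ in inlet m j..x, if τ < S.y j ξ s then
      γ' ξ (S.y j ξ s) * S.ys j ξ s else 0) = 0 := fun ht =>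
    intervalIntegral.integral_zero_ae (Eventually.of_forall fun ξ hξ => by
      rw [if_neg (not_lt.2 ((hy ξ hξ).trans ht))])
  refine ⟨hz, ?_, ?_⟩
  · rcases le_total t τ with ht | ht
    · rw [hz ht, abs_zero]; have := Real.exp_pos L; positivity
    · have h1 := intervalIntegral.norm_integral_le_of_norm_le_const (a := inlet m j) (b := x)
        (f := fun ξ => γ ξ (max (S.y j ξ s) τ)) (C := G * Real.exp (t - τ)) fun ξ hξ => by
          refine (hb ξ _ (le_max_right _ _)).1.trans ?_
          gcongr
          exact max_le (hy ξ hξ) ht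
      calc |∫ ξ in inlet m j..x, γ ξ (max (S.y j ξ s) τ)| ≤ G * Real.exp (t - τ) * 1 :=
            h1.trans (by gcongr)
        _ ≤ G * 1 * 1 * (Real.exp L * wt m r L τ j x t) := by
            have := hexp ht; nlinarith
        _ ≤ G * S.D * S.D * (Real.exp L * wt m r L τ j x t) := by
            have := Real.exp_pos L; gcongr
        _ = _ := by ring
  · rcases le_total t τ with ht | ht
    · rw [hz' ht, zero_mul, abs_zero]; have := Real.exp_pos L; positivity
    · have h1 := intervalIntegral.norm_integral_le_of_norm_le_const (a := inlet m j) (b := x)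
        (f := fun ξ => if τ < S.y j ξ s then γ' ξ (S.y j ξ s) * S.ys j ξ s else 0)
        (C := G * Real.exp (t - τ) * S.D) fun ξ hξ => by
          split_ifs with h
          · rw [Real.norm_eq_abs, abs_mul, abs_of_pos (S.ys_pos j _ _)]
            have hξ1 := uIcc_subset_Icc (inlet_mem m j) hx (uIoc_subset_uIcc hξ)
            refine mul_le_mul ((hb ξ _ h.le).2.trans ?_) (S.ys_le j ξ hξ1 s)
              (S.ys_pos j _ _).le (by positivity)
            gcongr
            exact hy ξ hξ
          · rw [norm_zero]; positivity
      rw [abs_mul, abs_of_pos (S.σt_pos j _ _)]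
      calc _ ≤ (G * Real.exp (t - τ) * S.D * 1) * S.D :=
            mul_le_mul (h1.trans (by gcongr)) (S.σt_le j hx t) (S.σt_pos j _ _).le
              (by positivity)
        _ = G * S.D * S.D * Real.exp (t - τ) := by ring
        _ ≤ G * S.D * S.D * (Real.exp L * wt m r L τ j x t) := by gcongr; exact hexp ht
        _ = _ := by ring

/-- The ansatz `u = φ + (t - τ) ψ + W`, with `ψ` the time derivative prescribed by the equation at
`τ`, leaves for `W` a source that vanishes at `t = τ`. Extended by zero to earlier times this source
has only a kink, so `W` is continuously differentiable and vanishes up to `τ`. Since `φ` and `ψ`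
vanish at both endpoints, the boundary conditions concern `W` only and no compatibility conditions
are left over. -/
theorem exists_classical (S : Setting m a) (p : Matrix (Fin n) (Fin n) ℝ)
    {b b' : Fin n → Fin n → ℝ → ℝ → ℝ} {K : Fin n → Fin n → ℝ}
    (hb : ∀ j k, IsCoef (b j k) (b' j k) (K j k)) (τ : ℝ)
    {φ : Fin n → ℝ → ℝ} (hφ : ∀ j, IsTest (φ j)) : ∃ u, IsClassicalSolution m p a b τ φ u := by
  have hφ1 : ∀ j, ContDiff ℝ 1 (φ j) := fun j => (hφ j).1.of_le (by exact_mod_cast le_top)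
  have hφd : ∀ j, ContDiff ℝ 1 (deriv (φ j)) := fun j =>
    ((contDiff_infty_iff_deriv.1 (hφ j).1).2).of_le (by exact_mod_cast le_top)
  set ψ : Fin n → ℝ → ℝ := fun j x => -(a j x τ * deriv (φ j) x + ∑ k, b j k x τ * φ k x) with hψ
  have hψc : ∀ j, ContDiffOn ℝ 1 (ψ j) (Icc 0 1) := fun j =>
    ((((S.bc1 j).contDiffOn_fst τ).mul (hφd j).contDiffOn).add
      (ContDiffOn.sum fun k _ => ((hb j k).contDiffOn τ).mul (hφ1 k).contDiffOn)).neg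
  set ψ' : Fin n → ℝ → ℝ := fun j => derivWithin (ψ j) (Icc 0 1) with hψ'
  have hψ'c : ∀ j, ContinuousOn (ψ' j) (Icc 0 1) := fun j =>
    (hψc j).continuousOn_derivWithin (uniqueDiffOn_Icc zero_lt_one) le_rfl
  -- coefficients of the integrated system
  set β : Fin n → Fin n → ℝ → ℝ → ℝ := fun j k x t => -(a j (cl x) t)⁻¹ * b j k (cl x) t with hβ
  have hβbt : ∀ j k, BT (β j k) := fun j k => (S.bt_inv_a j).neg.mul (hb j k).bt
  choose β' B hβ' hB using hβbt
  have hBs : ∀ j k, B j k ≤ ∑ j, ∑ k, |B j k| := fun j k =>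
    (le_abs_self _).trans ((Finset.single_le_sum (f := fun k => |B j k|) (fun k _ => abs_nonneg _)
      (Finset.mem_univ k)).trans (Finset.single_le_sum (f := fun j => ∑ k, |B j k|)
      (fun j _ => Finset.sum_nonneg fun k _ => abs_nonneg _) (Finset.mem_univ j)))
  obtain ⟨r, L, hr, hL, hcon⟩ := S.exists_contraction p (β := β) (β' := β')
    (fun j k x t => ((hB j k x t).1).trans (hBs j k))
    (fun j k x t => ((hB j k x t).2).trans (hBs j k))
  -- the source
  have hbta : ∀ j, BT fun x t => a j (cl x) t := fun j => by
    obtain ⟨C, hC⟩ := (S.bc1 j).exists_isCoef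
    exact hC.bt
  have hc₀ : ∀ j, BT fun x t => -(a j (cl x) t)⁻¹ * (ψ j (cl x) + a j (cl x) t * deriv (φ j) (cl x)
      + ∑ k, b j k (cl x) t * φ k (cl x)) := fun j =>
    (S.bt_inv_a j).neg.mul (((BT.of_cl (hψc j).continuousOn).add ((hbta j).mul
      (BT.of_cl (hφd j).continuous.continuousOn))).add (BT.sum _ fun k => (hb j k).bt.mul
        (BT.of_cl (hφ1 k).continuous.continuousOn)))
  have hc₁ : ∀ j, BT fun x t => -(a j (cl x) t)⁻¹ * (a j (cl x) t * ψ' j (cl x)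
      + ∑ k, b j k (cl x) t * ψ k (cl x)) := fun j =>
    (S.bt_inv_a j).neg.mul (((hbta j).mul (BT.of_cl (hψ'c j))).add
      (BT.sum _ fun k => (hb j k).bt.mul (BT.of_cl (hψc k).continuousOn)))
  choose c₀' C₀ hc₀' hC₀ using hc₀
  choose c₁' C₁ hc₁' hC₁ using hc₁
  -- The source divided by `a_j`. The part without the factor `t - τ` vanishes at `t = τ` by the
  -- choice of `ψ`; splitting in this way exhibits growth at most linear in time, which the weight
  -- absorbs.
  set γ : Fin n → ℝ → ℝ → ℝ := fun j x t =>
    -(a j (cl x) t)⁻¹ * (ψ j (cl x) + a j (cl x) t * deriv (φ j) (cl x)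
      + ∑ k, b j k (cl x) t * φ k (cl x)) + (t - τ) * (-(a j (cl x) t)⁻¹ *
      (a j (cl x) t * ψ' j (cl x) + ∑ k, b j k (cl x) t * ψ k (cl x))) with hγ
  have htτ : TC1 (fun _ t => t - τ) (fun _ _ => 1) :=
    ⟨by fun_prop, continuous_const, fun _ t => (hasDerivAt_id t).sub_const τ⟩
  have hγtc := fun j => (hc₀' j).add (htτ.mul (hc₁' j))
  set γ' : Fin n → ℝ → ℝ → ℝ := fun j x t => c₀' j x t + (1 * (-(a j (cl x) t)⁻¹ *
      (a j (cl x) t * ψ' j (cl x) + ∑ k, b j k (cl x) t * ψ k (cl x))) + (t - τ) * c₁' j x t)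
    with hγ'
  replace hγtc : ∀ j, TC1 (γ j) (γ' j) := hγtc
  have hγ0 : ∀ j ξ, γ j ξ τ = 0 := fun j ξ => by
    simp only [hγ, hψ, sub_self, zero_mul, add_zero]
    ring
  have hC₀0 : ∀ j, 0 ≤ C₀ j := fun j => (abs_nonneg _).trans (hC₀ j 0 0).1
  have hC₁0 : ∀ j, 0 ≤ C₁ j := fun j => (abs_nonneg _).trans (hC₁ j 0 0).1
  set G : ℝ := ∑ j, (C₀ j + 2 * C₁ j) with hG
  have hG0 : 0 ≤ G := Finset.sum_nonneg fun j _ => by linarith [hC₀0 j, hC₁0 j]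
  have hGj : ∀ j, C₀ j + 2 * C₁ j ≤ G := fun j =>
    Finset.single_le_sum (f := fun j => C₀ j + 2 * C₁ j)
      (fun j _ => by linarith [hC₀0 j, hC₁0 j]) (Finset.mem_univ j)
  have hγb : ∀ j ξ t, τ ≤ t →
      |γ j ξ t| ≤ G * Real.exp (t - τ) ∧ |γ' j ξ t| ≤ G * Real.exp (t - τ) := by
    intro j ξ t ht
    have e1 : 1 + (t - τ) ≤ Real.exp (t - τ) := by
      have := Real.add_one_le_exp (t - τ); linarith
    have ht' : 0 ≤ t - τ := by linarith
    have a0 := hC₀ j ξ t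
    have a1 := hC₁ j ξ t
    have q0 := hC₀0 j
    have q1 := hC₁0 j
    have fin : (C₀ j + 2 * C₁ j) * Real.exp (t - τ) ≤ G * Real.exp (t - τ) := by
      gcongr; exact hGj j
    constructor
    · refine ((abs_add_le _ _).trans (add_le_add (d := (t - τ) * C₁ j) a0.1 ?_)).trans
        (le_trans ?_ fin)
      · rw [abs_mul, abs_of_nonneg ht']; gcongr; exact a1.1
      · nlinarith
    · refine ((abs_add_le _ _).trans (add_le_add a0.2 ((abs_add_le _ _).trans
        (add_le_add (b := C₁ j) (d := (t - τ) * C₁ j) ?_ ?_)))).trans (le_trans ?_ fin)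
      · rw [one_mul]; exact a1.1
      · rw [abs_mul, abs_of_nonneg ht']; gcongr; exact a1.2
      · nlinarith
  set V₀ : Fin n → ℝ → ℝ → ℝ := fun j x s => ∫ ξ in inlet m j..x, γ j ξ (max (S.y j ξ s) τ) with hV₀
  set V₀' : Fin n → ℝ → ℝ → ℝ := fun j x s => ∫ ξ in inlet m j..x, if τ < S.y j ξ s then
    γ' j ξ (S.y j ξ s) * S.ys j ξ s else 0 with hV₀'
  have V₀tc : ∀ j, TC1 (V₀ j) (V₀' j) := fun j =>
    tc1_truncated_primitive (hγtc j) τ (S.tc1_y j) (S.y_injective j) (inlet m j)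
  have hsb := fun j (x : ℝ) (hx : x ∈ Icc (0 : ℝ) 1) t =>
    S.source_bounds j hr hL hG0 (hγ0 j) (hγb j) hx t
  obtain ⟨W, Z, hWtc, hWfix, hWz⟩ := S.exists_fixed_point p hβ' (r := r) (L := L) (τ := τ)
    (N := G * S.D * S.D * Real.exp L) (by linarith) hL
    (by have := S.one_le_D; have := Real.exp_pos L; positivity) (hcon τ)
    (d₀ := fun j x t => V₀ j x (S.σ j x t)) (e₀ := fun j x t => V₀' j x (S.σ j x t) * S.σt j x t)
    (fun j => (V₀tc j).comp (S.tc1_σ j) continuous_id) (fun j x hx t => (hsb j x hx t).2.1)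
    (fun j x hx t => (hsb j x hx t).2.2) (fun j x hx t ht => (hsb j x hx t).1 ht)
  -- the solution in characteristic coordinates
  set V : Fin n → ℝ → ℝ → ℝ := fun j x s => V₀ j x s + S.kV p β W j x s with hV
  have hVtc : ∀ j, TC1 (V j) (fun x s => V₀' j x s + S.kV' p β β' W Z j x s) := fun j =>
    (V₀tc j).add (S.tc1_kV p hβ' hWtc j)
  have hVW : ∀ j, ∀ x ∈ Icc (0 : ℝ) 1, ∀ t, V j x (S.σ j x t) = W j x t := fun j x hx t =>
    (hWfix j x hx t).symm
  have hycont : ∀ j, Continuous fun z : ℝ × ℝ => S.y j z.1 z.2 := fun j => (S.tc1_y j).cont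
  -- For a fixed entry time the variable `x` occurs only as a limit of integration, so the space
  -- derivative is the integrand. Differentiability in `(x, t)` then follows by composition with
  -- `σ`.
  have hVx : ∀ j x s, HasDerivAt (fun x => V j x s) (γ j x (max (S.y j x s) τ) +
      ∑ k, β j k x (S.y j x s) * W k (cl x) (S.y j x s)) x := by
    intro j x s
    have hcy : Continuous fun ξ => S.y j ξ s := (S.tc1_y j).comp_cont continuous_id continuous_const
    have k1 : Continuous fun ξ => γ j ξ (max (S.y j ξ s) τ) :=
      (hγtc j).comp_cont continuous_id (hcy.max continuous_const)
    have k2 : Continuous fun ξ => ∑ k, β j k ξ (S.y j ξ s) * W k (cl ξ) (S.y j ξ s) :=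
      (S.tc1_integrand hβ' hWtc j).comp_cont continuous_id continuous_const
    exact (k1.integral_hasStrictDerivAt _ x).hasDerivAt.add
      ((k2.integral_hasStrictDerivAt _ x).hasDerivAt.const_add _)
  have hVxc : ∀ j, Continuous fun z : ℝ × ℝ => γ j z.1 (max (S.y j z.1 z.2) τ) +
      ∑ k, β j k z.1 (S.y j z.1 z.2) * W k (cl z.1) (S.y j z.1 z.2) := fun j =>
    ((hγtc j).comp_cont continuous_fst ((hycont j).max continuous_const)).add
      (S.tc1_integrand hβ' hWtc j).cont
  have hVF := fun j => hasFDerivAt_of_partials (f := V j) (f₁ := fun x s =>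
    γ j x (max (S.y j x s) τ) + ∑ k, β j k x (S.y j x s) * W k (cl x) (S.y j x s))
    (hVxc j) (hVtc j).cont' (hVx j) (hVtc j).deriv
  have hVC := fun j => contDiff_of_partials (f := V j) (f₁ := fun x s =>
    γ j x (max (S.y j x s) τ) + ∑ k, β j k x (S.y j x s) * W k (cl x) (S.y j x s))
    (hVxc j) (hVtc j).cont' (hVx j) (hVtc j).deriv
  have hψin : ∀ j x, x ∉ Ioo (0 : ℝ) 1 → ψ j x = 0 := fun j x hx => by
    simp only [hψ, (hφ j).deriv_eq_zero hx, fun k => (hφ k).eq_zero hx]; simp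
  refine ⟨fun j x t => φ j x + (t - τ) * ψ j x + V j x (S.σ j x t), ?_, ?_, ?_, ?_⟩
  · intro j
    have h1 : ContDiffOn ℝ 1 (fun z : ℝ × ℝ => ψ j z.1) (halfStrip τ) :=
      (hψc j).comp contDiffOn_fst fun z hz => hz.1
    have h2 : ContDiff ℝ 1 fun z : ℝ × ℝ => V j z.1 (S.σ j z.1 z.2) :=
      (hVC j).comp (contDiff_fst.prodMk (S.contDiff_σ j))
    have h3 : ContDiff ℝ 1 fun z : ℝ × ℝ => φ j z.1 := (hφ1 j).comp contDiff_fst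
    have h4 : ContDiff ℝ 1 fun z : ℝ × ℝ => z.2 - τ := contDiff_snd.sub contDiff_const
    exact (h3.contDiffOn.add (h4.contDiffOn.mul h1)).add h2.contDiffOn
  · intro j x hx t ht
    have hx' : x ∈ Icc (0 : ℝ) 1 := Ioo_subset_Icc_self hx
    set Vs := V₀' j x (S.σ j x t) + S.kV' p β β' W Z j x (S.σ j x t) with hVs
    have dT : HasDerivAt (fun s => φ j x + (s - τ) * ψ j x + V j x (S.σ j x s))
        (ψ j x + Vs * S.σt j x t) t := by
      have h1 := (((hasDerivAt_id t).sub_const τ).mul_const (ψ j x)).const_add (φ j x)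
      have h2 := ((hVtc j).deriv x (S.σ j x t)).comp t ((S.tc1_σ j).deriv x t)
      refine (h1.add h2).congr_deriv ?_
      simp [hVs]
    have dψ : HasDerivAt (ψ j) (ψ' j x) x :=
      (((hψc j).differentiableOn one_ne_zero x hx').hasDerivWithinAt).hasDerivAt
        (Icc_mem_nhds hx.1 hx.2)
    have dφ : HasDerivAt (φ j) (deriv (φ j) x) x :=
      ((hφ1 j).differentiable one_ne_zero x).hasDerivAt
    have dX : HasDerivAt (fun y => φ j y + (t - τ) * ψ j y + V j y (S.σ j y t))
        (deriv (φ j) x + (t - τ) * ψ' j x + (γ j x t + ∑ k, β j k x t * W k x t +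
          Vs * (-(a j x t)⁻¹ * S.σt j x t))) x := by
      have h2 := HasFDerivAt.comp_hasDerivAt (l := fun z : ℝ × ℝ => V j z.1 z.2) x
        (hVF j (x, S.σ j x t)) ((hasDerivAt_id' x).prodMk ((S.flow j).σx x t))
      refine ((dφ.add (dψ.const_mul (t - τ))).add h2).congr_deriv ?_
      simp [cl_of_mem hx', (S.flow j).right_inv, max_eq_left ht.le, hVs]
    rw [dT.deriv, dX.deriv]
    have ha := S.a_ne j hx' t
    have e1 : a j x t * ∑ k, β j k x t * W k x t = -∑ k, b j k x t * W k x t := by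
      rw [Finset.mul_sum, ← Finset.sum_neg_distrib]
      refine Finset.sum_congr rfl fun k _ => ?_
      simp only [hβ, cl_of_mem hx']
      field_simp
    have e2 : ∑ k, b j k x t * (φ k x + (t - τ) * ψ k x + V k x (S.σ k x t)) =
        ∑ k, b j k x t * φ k x + (t - τ) * ∑ k, b j k x t * ψ k x + ∑ k, b j k x t * W k x t := by
      rw [Finset.mul_sum, ← Finset.sum_add_distrib, ← Finset.sum_add_distrib]
      refine Finset.sum_congr rfl fun k _ => ?_
      rw [hVW k x hx' t]; ring
    have e3 : a j x t * γ j x t = -(ψ j x + a j x t * deriv (φ j) x + ∑ k, b j k x t * φ k x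
        + (t - τ) * (a j x t * ψ' j x + ∑ k, b j k x t * ψ k x)) := by
      simp only [hγ, cl_of_mem hx']
      field_simp
      ring
    have e4 : a j x t * (Vs * (-(a j x t)⁻¹ * S.σt j x t)) = -(Vs * S.σt j x t) := by
      field_simp
    simp only [e2]
    linear_combination e1 + e3 + e4
  · intro j t ht
    rw [opP_eq]
    have hi := inlet_notMem m j
    simp only [(hφ j).eq_zero hi, hψin j _ hi, mul_zero, zero_add, S.σ_inlet]
    simp only [hV, hV₀, kV, intervalIntegral.integral_same, zero_add, add_zero]
    refine Finset.sum_congr rfl fun k _ => ?_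
    have ho := outlet_notMem m k
    rw [(hφ k).eq_zero ho, hψin k _ ho, mul_zero, zero_add, zero_add]
    have := hVW k _ (outlet_mem m k) t
    simp only [hV, hV₀, kV] at this
    rw [this]
  · intro j x hx
    simp only [sub_self, zero_mul, add_zero]
    rw [hVW j x hx τ, hWz j x hx τ le_rfl, add_zero]

end Setting

end

end Hyp

namespace Hyp

noncomputable section

/-! ### Energy estimates -/

/-- `u` solves `∂ₜu + a ∂ₓu + b u = g` on the half-strip, with partial derivatives `ux`, `ut`, and
satisfies the reflection boundary conditions. -/
structure IsSol {n : ℕ} (m : ℕ) (p : Matrix (Fin n) (Fin n) ℝ)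
    (a : Fin n → ℝ → ℝ → ℝ) (b : Fin n → Fin n → ℝ → ℝ → ℝ) (τ : ℝ)
    (g u ux ut : Fin n → ℝ → ℝ → ℝ) : Prop where
  cx : ∀ j, ContinuousOn (fun z : ℝ × ℝ => ux j z.1 z.2) (halfStrip τ)
  ct : ∀ j, ContinuousOn (fun z : ℝ × ℝ => ut j z.1 z.2) (halfStrip τ)
  hd : ∀ j, ∀ x ∈ Icc (0 : ℝ) 1, ∀ t ∈ Ici τ, HasFDerivWithinAt (fun z : ℝ × ℝ => u j z.1 z.2)
    (ux j x t • ContinuousLinearMap.fst ℝ ℝ ℝ + ut j x t • ContinuousLinearMap.snd ℝ ℝ ℝ)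
    (halfStrip τ) (x, t)
  pde : ∀ j, ∀ x ∈ Icc (0 : ℝ) 1, ∀ t ∈ Ici τ,
    ut j x t + a j x t * ux j x t + ∑ k, b j k x t * u k x t = g j x t
  boundary : ∀ j, ∀ t ∈ Ici τ, u j (inlet m j) t = opP m p u j t

lemma halfStrip_subset_strip (τ : ℝ) : halfStrip τ ⊆ strip := fun _ hz => ⟨hz.1, trivial⟩

lemma halfStrip_anti {τ τ' : ℝ} (h : τ ≤ τ') : halfStrip τ' ⊆ halfStrip τ :=
  fun _ hz => ⟨hz.1, h.trans hz.2⟩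

lemma IsBC1.continuousOn {f : ℝ → ℝ → ℝ} (hf : IsBC1 f) :
    ContinuousOn (fun z : ℝ × ℝ => f z.1 z.2) strip := hf.1.continuousOn

lemma IsCoef.continuousOn {b b' : ℝ → ℝ → ℝ} {K : ℝ} (h : IsCoef b b' K) :
    ContinuousOn (fun z : ℝ × ℝ => b z.1 z.2) strip :=
  h.tc1.cont.continuousOn.congr fun z hz => by simp [cl_of_mem hz.1]

lemma halfStrip_subset_closure (τ : ℝ) :
    halfStrip τ ⊆ closure (Ioo (0 : ℝ) 1 ×ˢ Ioi τ) := by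
  rw [closure_prod_eq, closure_Ioo zero_ne_one, closure_Ioi]; exact subset_rfl

section

variable {n m : ℕ} {p : Matrix (Fin n) (Fin n) ℝ} {a : Fin n → ℝ → ℝ → ℝ}
  {b b' : Fin n → Fin n → ℝ → ℝ → ℝ} {K : Fin n → Fin n → ℝ} {τ : ℝ}
  {g u ux ut : Fin n → ℝ → ℝ → ℝ}

/-- The equation is postulated only in the open half-strip; all its terms are continuous up to the
boundary, so it persists on the closure. -/
lemma IsClassicalSolution.isSol (S : Setting m a) (hb : ∀ j k, IsCoef (b j k) (b' j k) (K j k))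
    {φ : Fin n → ℝ → ℝ} (h : IsClassicalSolution m p a b τ φ u) :
    ∃ ux ut, IsSol m p a b τ (fun _ _ _ => 0) u ux ut := by
  choose ux ut cx ct hd using fun j => exists_partials (uniqueDiffOn_Ici τ) (h.smooth j)
  refine ⟨ux, ut, cx, ct, hd, ?_, fun j t ht => h.boundary j t ht⟩
  intro j x hx t ht
  have hsub := halfStrip_subset_strip τ
  have hc : ContinuousOn (fun z : ℝ × ℝ => ut j z.1 z.2 + a j z.1 z.2 * ux j z.1 z.2 +
      ∑ k, b j k z.1 z.2 * u k z.1 z.2) (halfStrip τ) :=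
    ((ct j).add (((S.bc1 j).continuousOn.mono hsub).mul (cx j))).add
      (continuousOn_finsetSum _ fun k _ =>
        ((hb j k).continuousOn.mono hsub).mul (h.smooth k).continuousOn)
  refine Set.EqOn.of_subset_closure (s := Ioo (0 : ℝ) 1 ×ˢ Ioi τ) (t := halfStrip τ)
    (g := fun _ => (0 : ℝ)) ?_ hc continuousOn_const
    (prod_mono Ioo_subset_Icc_self Ioi_subset_Ici_self) (halfStrip_subset_closure τ)
    (⟨hx, ht⟩ : (x, t) ∈ halfStrip τ)
  rintro ⟨x, t⟩ ⟨hx, ht⟩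
  have hx' := Ioo_subset_Icc_self hx
  have ht' : t ∈ Ici τ := Ioi_subset_Ici_self ht
  have := h.pde j x hx t ht
  rwa [((hasDerivWithinAt_snd (hd j x hx' t ht') hx').hasDerivAt (Ici_mem_nhds ht)).deriv,
    ((hasDerivWithinAt_fst (hd j x hx' t ht') ht').hasDerivAt
      (Icc_mem_nhds hx.1 hx.2)).deriv] at this

namespace IsSol

lemma cu (h : IsSol m p a b τ g u ux ut) (j : Fin n) :
    ContinuousOn (fun z : ℝ × ℝ => u j z.1 z.2) (halfStrip τ) :=
  fun z hz => (h.hd j z.1 hz.1 z.2 hz.2).continuousWithinAt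

lemma cg (S : Setting m a) (hb : ∀ j k, IsCoef (b j k) (b' j k) (K j k))
    (h : IsSol m p a b τ g u ux ut) (j : Fin n) :
    ContinuousOn (fun z : ℝ × ℝ => g j z.1 z.2) (halfStrip τ) := by
  have hsub := halfStrip_subset_strip τ
  refine (((h.ct j).add (((S.bc1 j).continuousOn.mono hsub).mul (h.cx j))).add
      (continuousOn_finsetSum Finset.univ fun k _ =>
        ((hb j k).continuousOn.mono hsub).mul (h.cu k))).congr ?_
  intro z hz
  exact (h.pde j z.1 hz.1 z.2 hz.2).symm

lemma restrict (h : IsSol m p a b τ g u ux ut) {τ' : ℝ} (hτ : τ ≤ τ') :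
    IsSol m p a b τ' g u ux ut where
  cx j := (h.cx j).mono (halfStrip_anti hτ)
  ct j := (h.ct j).mono (halfStrip_anti hτ)
  hd j x hx t ht := (h.hd j x hx t (hτ.trans ht)).mono (halfStrip_anti hτ)
  pde j x hx t ht := h.pde j x hx t (hτ.trans ht)
  boundary j t ht := h.boundary j t (hτ.trans ht)

/-- The difference of solutions for two coefficient matrices. -/
lemma sub (h : IsSol m p a b τ g u ux ut) {c : Fin n → Fin n → ℝ → ℝ → ℝ}
    {f v vx vt : Fin n → ℝ → ℝ → ℝ} (h' : IsSol m p a c τ f v vx vt) :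
    IsSol m p a b τ (fun j x t => g j x t - f j x t + ∑ k, (c j k x t - b j k x t) * v k x t)
      (fun j x t => u j x t - v j x t)
      (fun j x t => ux j x t - vx j x t) (fun j x t => ut j x t - vt j x t) where
  cx j := (h.cx j).sub (h'.cx j)
  ct j := (h.ct j).sub (h'.ct j)
  hd j x hx t ht := ((h.hd j x hx t ht).sub (h'.hd j x hx t ht)).congr_fderiv (by
    ext <;> simp)
  pde j x hx t ht := by
    rw [← h.pde j x hx t ht, ← h'.pde j x hx t ht]
    simp only [mul_sub, sub_mul, Finset.sum_sub_distrib]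
    ring
  boundary j t ht := by
    rw [h.boundary j t ht, h'.boundary j t ht]
    simp only [opP_eq, mul_sub, Finset.sum_sub_distrib]

/-- Continuously differentiable continuation in time. -/
lemma exists_tc1 (h : IsSol m p a b τ g u ux ut) (j : Fin n) :
    ∃ v v' : ℝ → ℝ → ℝ, TC1 v v' ∧
      ∀ x ∈ Icc (0 : ℝ) 1, ∀ t ∈ Ici τ, v x t = u j x t ∧ v' x t = ut j x t := by
  have hm : ∀ z : ℝ × ℝ, (cl z.1, max z.2 τ) ∈ halfStrip τ :=
    fun z => ⟨cl_mem _, mem_Ici.2 (le_max_right _ _)⟩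
  have hc : Continuous fun z : ℝ × ℝ => (cl z.1, max z.2 τ) := by fun_prop
  have c0 : Continuous fun z : ℝ × ℝ => u j (cl z.1) (max z.2 τ) :=
    (h.cu j).comp_continuous hc hm
  have c1 : Continuous fun z : ℝ × ℝ => ut j (cl z.1) (max z.2 τ) :=
    (h.ct j).comp_continuous hc hm
  have c2 : Continuous fun z : ℝ × ℝ => ut j (cl z.1) τ := by
    have := c1.comp (g := fun z : ℝ × ℝ => ut j (cl z.1) (max z.2 τ))
      (f := fun z : ℝ × ℝ => (z.1, τ)) (by fun_prop)
    simpa only [Function.comp_def, max_self] using this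
  -- Before `τ` the function continues affinely with slope `ut` at `τ`; the term with `min` is zero
  -- from `τ` on.
  refine ⟨fun x t => u j (cl x) (max t τ) + min (t - τ) 0 * ut j (cl x) τ,
    fun x t => ut j (cl x) (max t τ), ⟨c0.add (Continuous.mul (by fun_prop) c2), c1, ?_⟩, ?_⟩
  · intro x t
    have hr : ∀ t ∈ Ici τ, HasDerivWithinAt
        (fun t => u j (cl x) (max t τ) + min (t - τ) 0 * ut j (cl x) τ) (ut j (cl x) t) (Ici τ) t := by
      intro t ht
      refine (hasDerivWithinAt_snd (h.hd j (cl x) (cl_mem x) t ht) (cl_mem x)).congr ?_ ?_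
      · intro s hs
        rw [max_eq_left hs, min_eq_right (sub_nonneg.2 hs)]; simp
      · rw [max_eq_left ht, min_eq_right (sub_nonneg.2 ht)]; simp
    have hl : ∀ t ∈ Iic τ, HasDerivWithinAt
        (fun t => u j (cl x) (max t τ) + min (t - τ) 0 * ut j (cl x) τ) (ut j (cl x) τ) (Iic τ) t := by
      intro t ht
      have : HasDerivAt (fun t => u j (cl x) τ + (t - τ) * ut j (cl x) τ) (ut j (cl x) τ) t := by
        simpa using (((hasDerivAt_id t).sub_const τ).mul_const (ut j (cl x) τ)).const_add
          (u j (cl x) τ)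
      refine this.hasDerivWithinAt.congr ?_ ?_
      · intro s hs
        rw [max_eq_right hs, min_eq_left (sub_nonpos.2 hs)]
      · rw [max_eq_right ht, min_eq_left (sub_nonpos.2 ht)]
    rcases lt_trichotomy t τ with h1 | h1 | h1
    · rw [max_eq_right h1.le]
      exact (hl t h1.le).hasDerivAt (Iic_mem_nhds h1)
    · subst h1
      rw [max_self, ← hasDerivWithinAt_univ, ← Iic_union_Ici (a := t)]
      exact (hl t self_mem_Iic).union (hr t self_mem_Ici)
    · rw [max_eq_left h1.le]
      exact (hr t h1.le).hasDerivAt (Ici_mem_nhds h1)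
  · intro x hx t ht
    simp only [cl_of_mem hx, max_eq_left (show τ ≤ t from ht),
      min_eq_right (sub_nonneg.2 (show τ ≤ t from ht)), zero_mul, add_zero, and_self]

end IsSol

/-- The square of the `L²` norm of `u(·, t)`. -/
def sqn (u : Fin n → ℝ → ℝ → ℝ) (t : ℝ) : ℝ := ∑ j, ∫ x in (0 : ℝ)..1, u j x t ^ 2

/-- The sum of the squares of the outgoing traces. -/
def tr (m : ℕ) (u : Fin n → ℝ → ℝ → ℝ) (t : ℝ) : ℝ := ∑ j, u j (outlet m j) t ^ 2

lemma sqn_nonneg (u : Fin n → ℝ → ℝ → ℝ) (t : ℝ) : 0 ≤ sqn u t :=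
  Finset.sum_nonneg fun _ _ => intervalIntegral.integral_nonneg zero_le_one fun _ _ => sq_nonneg _

lemma tr_nonneg (u : Fin n → ℝ → ℝ → ℝ) (t : ℝ) : 0 ≤ tr m u t :=
  Finset.sum_nonneg fun _ _ => sq_nonneg _

lemma abs_mul_sum_le {K : ℝ} {c v : Fin n → ℝ} (hc : ∀ k, |c k| ≤ K) (w : ℝ) :
    |2 * w * ∑ k, c k * v k| ≤ n * K * w ^ 2 + K * ∑ k, v k ^ 2 := by
  have e : n * K * w ^ 2 + K * ∑ k, v k ^ 2 = ∑ k : Fin n, K * (w ^ 2 + v k ^ 2) := by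
    rw [← Finset.mul_sum, Finset.sum_add_distrib]; simp; ring
  rw [e, Finset.mul_sum]
  refine (Finset.abs_sum_le_sum_abs _ _).trans (Finset.sum_le_sum fun k _ => ?_)
  rw [show 2 * w * (c k * v k) = c k * (2 * w * v k) by ring, abs_mul]
  refine mul_le_mul (hc k) ?_ (abs_nonneg _) ((abs_nonneg _).trans (hc k))
  rw [abs_le]; constructor <;> nlinarith [sq_nonneg (w + v k), sq_nonneg (w - v k)]

/-- Weights that are small at the inlet. -/
def rho (m : ℕ) (δ : ℝ) (j : Fin n) (x : ℝ) : ℝ :=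
  δ + (1 - δ) * (Setting.sg m j * (x - inlet m j))

lemma rho_mem {δ : ℝ} (hδ : δ ∈ Icc (0 : ℝ) 1) (j : Fin n) {x : ℝ} (hx : x ∈ Icc (0 : ℝ) 1) :
    rho m δ j x ∈ Icc δ 1 := by
  unfold rho
  rw [Setting.sg_inlet j hx]
  have h1 := Setting.abs_sub_inlet_le (m := m) j hx
  have h0 := abs_nonneg (x - inlet m j)
  constructor <;> nlinarith [hδ.1, hδ.2]

lemma rho_deriv (δ : ℝ) (j : Fin n) (x : ℝ) :
    HasDerivAt (rho m δ j) ((1 - δ) * Setting.sg m j) x := by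
  have := ((((hasDerivAt_id x).sub_const (inlet m j)).const_mul (Setting.sg m j)).const_mul
    (1 - δ)).const_add δ
  rw [mul_one] at this
  exact this

lemma abs_sg (j : Fin n) : |Setting.sg m j| = 1 := by unfold Setting.sg; split_ifs <;> simp

lemma endpoint_diff (j : Fin n) (w : ℝ → ℝ) :
    w 1 - w 0 = Setting.sg m j * (w (outlet m j) - w (inlet m j)) := by
  unfold Setting.sg outlet inlet; split_ifs <;> ring

/-- The equation is multiplied by `2 r U`. The subtracted bracket on the right is the space
derivative of the flux `ρ a u²`, with `(1 - δ) s` as derivative of the weight; it carries the only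
term with `X`, and everything else is quadratic in values. -/
lemma energy_pointwise {δ A K U T X a₀ ax r g : ℝ} {c v : Fin n → ℝ} {s : ℝ} (hδ : δ ∈ Icc (0 : ℝ) 1)
    (hs : |s| = 1) (hr : r ∈ Icc δ 1) (ha : |a₀| ≤ A) (hax : |ax| ≤ A) (hc : ∀ k, |c k| ≤ K)
    (hp : T + a₀ * X + ∑ k, c k * v k = g) :
    2 * r * U * T ≤ -((1 - δ) * s * (a₀ * U ^ 2) + r * (ax * U ^ 2 + a₀ * (2 * U * X))) +
      (2 * A + 1 + n * K) * U ^ 2 + K * ∑ k, v k ^ 2 + g ^ 2 := by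
  have hr0 : 0 ≤ r := hδ.1.trans hr.1
  have h1 := abs_mul_sum_le hc (v := v) U
  have h2 : r * |2 * U * ∑ k, c k * v k| ≤ |2 * U * ∑ k, c k * v k| :=
    mul_le_of_le_one_left (abs_nonneg _) hr.2
  have h3 : -(r * (2 * U * ∑ k, c k * v k)) ≤ r * |2 * U * ∑ k, c k * v k| := by
    rw [← mul_neg]; exact mul_le_mul_of_nonneg_left (neg_le_abs _) hr0
  have h4 : 2 * r * U * g ≤ U ^ 2 + g ^ 2 := by
    have : r * (2 * U * g) ≤ r * (U ^ 2 + g ^ 2) :=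
      mul_le_mul_of_nonneg_left (by nlinarith [sq_nonneg (U - g)]) hr0
    have : r * (U ^ 2 + g ^ 2) ≤ U ^ 2 + g ^ 2 := mul_le_of_le_one_left (by positivity) hr.2
    linarith
  have h5 : (1 - δ) * s * (a₀ * U ^ 2) ≤ A * U ^ 2 := by
    have e : |(1 - δ) * s * a₀| ≤ A := by
      rw [abs_mul, abs_mul, hs, mul_one, abs_of_nonneg (by linarith [hδ.2])]
      exact (mul_le_of_le_one_left (abs_nonneg _) (by linarith [hδ.1])).trans ha
    calc _ = (1 - δ) * s * a₀ * U ^ 2 := by ring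
      _ ≤ A * U ^ 2 := mul_le_mul_of_nonneg_right ((le_abs_self _).trans e) (sq_nonneg _)
  have h6 : r * (ax * U ^ 2) ≤ A * U ^ 2 := by
    have e : |r * ax| ≤ A := by
      rw [abs_mul, abs_of_nonneg hr0]
      exact (mul_le_of_le_one_left (abs_nonneg _) hr.2).trans hax
    calc _ = r * ax * U ^ 2 := by ring
      _ ≤ A * U ^ 2 := mul_le_mul_of_nonneg_right ((le_abs_self _).trans e) (sq_nonneg _)
  have hT : T = g - a₀ * X - ∑ k, c k * v k := by linarith
  rw [hT]
  linarith

lemma continuousOn_slice {f : ℝ → ℝ → ℝ} (hf : ContinuousOn (fun z : ℝ × ℝ => f z.1 z.2) (halfStrip τ))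
    {t : ℝ} (ht : τ ≤ t) : ContinuousOn (fun x => f x t) (Icc 0 1) :=
  hf.comp (f := fun x => (x, t)) (by fun_prop) fun _ hx => ⟨hx, ht⟩

lemma intervalIntegrable_of_Icc {f : ℝ → ℝ} (hf : ContinuousOn f (Icc 0 1)) :
    IntervalIntegrable f volume 0 1 :=
  hf.intervalIntegrable_of_Icc zero_le_one

/-- Integrating the flux leaves its endpoint values. At the outlet the weight is one and the flux
dissipates at least `Λ u²`; at the inlet the weight is `δ`, so what enters counts only with the
factor `δ A`. -/
lemma IsSol.energy_component (S : Setting m a) (hb : ∀ j k, IsCoef (b j k) (b' j k) (K j k))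
    {L : ℝ} (hL : ∀ j k, ∀ x ∈ Icc (0 : ℝ) 1, ∀ t, |b j k x t| ≤ L)
    (h : IsSol m p a b τ g u ux ut) {δ : ℝ} (hδ : δ ∈ Icc (0 : ℝ) 1) {t : ℝ} (ht : τ ≤ t)
    (j : Fin n) :
    ∫ x in (0 : ℝ)..1, 2 * rho m δ j x * u j x t * ut j x t ≤
      -(S.Λ * u j (outlet m j) t ^ 2) + δ * S.A * u j (inlet m j) t ^ 2 +
      (2 * S.A + 1 + n * L) * (∫ x in (0 : ℝ)..1, u j x t ^ 2) + L * sqn u t +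
      ∫ x in (0 : ℝ)..1, g j x t ^ 2 := by
  set w : ℝ → ℝ := fun x => rho m δ j x * (a j x t * u j x t ^ 2) with hw
  set w' : ℝ → ℝ := fun x => (1 - δ) * Setting.sg m j * (a j x t * u j x t ^ 2) +
    rho m δ j x * (dx (a j) x t * u j x t ^ 2 + a j x t * (2 * u j x t * ux j x t)) with hw'
  have cu := fun k => continuousOn_slice (h.cu k) ht
  have cux := continuousOn_slice (h.cx j) ht
  have cut := continuousOn_slice (h.ct j) ht
  have cg := continuousOn_slice (h.cg S hb j) ht
  have cr : ContinuousOn (rho m δ j) (Icc 0 1) := fun x _ =>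
    (rho_deriv δ j x).continuousAt.continuousWithinAt
  have ca := continuousOn_slice ((S.bc1 j).continuousOn.mono (halfStrip_subset_strip τ)) ht
  have cax := continuousOn_slice ((S.bc1 j).partials.1.mono (halfStrip_subset_strip τ)) ht
  have hwd : ∀ x ∈ Icc (0 : ℝ) 1, HasDerivWithinAt w (w' x) (Icc 0 1) x := by
    intro x hx
    have d1 := hasDerivWithinAt_fst (h.hd j x hx t ht) ht
    have d2 := hasDerivWithinAt_fst (J := univ) ((S.bc1 j).partials.2.2 x hx t) trivial
    refine ((rho_deriv δ j x).hasDerivWithinAt.mul (d2.mul (d1.pow 2))).congr_deriv ?_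
    simp [hw']
  have cw : ContinuousOn w (Icc 0 1) := fun x hx => (hwd x hx).continuousWithinAt
  have cw' : ContinuousOn w' (Icc 0 1) :=
    (continuousOn_const.mul (ca.mul ((cu j).pow 2))).add
      (cr.mul ((cax.mul ((cu j).pow 2)).add (ca.mul ((continuousOn_const.mul (cu j)).mul cux))))
  have hFTC : ∫ x in (0 : ℝ)..1, w' x = w 1 - w 0 :=
    intervalIntegral.integral_eq_sub_of_hasDerivAt_of_le zero_le_one cw
      (fun x hx => (hwd x (Ioo_subset_Icc_self hx)).hasDerivAt (Icc_mem_nhds hx.1 hx.2))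
      (intervalIntegrable_of_Icc cw')
  have i1 : IntervalIntegrable (fun x => -w' x) volume 0 1 := intervalIntegrable_of_Icc cw'.neg
  have i2 : ∀ k, IntervalIntegrable (fun x => u k x t ^ 2) volume 0 1 :=
    fun k => intervalIntegrable_of_Icc ((cu k).pow 2)
  have i3 : IntervalIntegrable (fun x => g j x t ^ 2) volume 0 1 :=
    intervalIntegrable_of_Icc (cg.pow 2)
  have i4 : IntervalIntegrable (fun x => ∑ k, u k x t ^ 2) volume 0 1 :=
    intervalIntegrable_of_Icc (continuousOn_finsetSum _ fun k _ => (cu k).pow 2)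
  have key : ∫ x in (0 : ℝ)..1, 2 * rho m δ j x * u j x t * ut j x t ≤
      ∫ x in (0 : ℝ)..1, (-w' x + (2 * S.A + 1 + n * L) * u j x t ^ 2 +
        L * ∑ k, u k x t ^ 2 + g j x t ^ 2) := by
    refine intervalIntegral.integral_mono_on zero_le_one
      (intervalIntegrable_of_Icc (((continuousOn_const.mul cr).mul (cu j)).mul cut))
      (((i1.add ((i2 j).const_mul _)).add (i4.const_mul _)).add i3) fun x hx => ?_
    exact energy_pointwise hδ (abs_sg j) (rho_mem hδ j hx) (S.abs_a_le j x hx t) (S.dx_le j x hx t)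
      (fun k => hL j k x hx t) (h.pde j x hx t ht)
  rw [intervalIntegral.integral_add ((i1.add ((i2 j).const_mul _)).add (i4.const_mul _)) i3,
    intervalIntegral.integral_add (i1.add ((i2 j).const_mul _)) (i4.const_mul _),
    intervalIntegral.integral_add i1 ((i2 j).const_mul _),
    intervalIntegral.integral_neg, intervalIntegral.integral_const_mul,
    intervalIntegral.integral_const_mul,
    intervalIntegral.integral_finsetSum (fun k _ => i2 k), hFTC, endpoint_diff (m := m) j w] at key
  have eo : rho m δ j (outlet m j) = 1 := by
    unfold rho Setting.sg outlet inlet; split_ifs <;> ring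
  have ei : rho m δ j (inlet m j) = δ := by simp [rho]
  have b1 : S.Λ * u j (outlet m j) t ^ 2 ≤ Setting.sg m j * w (outlet m j) := by
    have := mul_le_mul_of_nonneg_right (S.sg_mul_a_ge j (outlet_mem m j) t)
      (sq_nonneg (u j (outlet m j) t))
    simp only [hw, eo]; linarith
  have b2 : Setting.sg m j * w (inlet m j) ≤ δ * S.A * u j (inlet m j) t ^ 2 := by
    simp only [hw, ei]
    have e : Setting.sg m j * a j (inlet m j) t ≤ S.A := by
      refine (le_abs_self _).trans ?_
      rw [abs_mul, abs_sg, one_mul]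
      exact S.abs_a_le j _ (inlet_mem m j) t
    calc _ = δ * u j (inlet m j) t ^ 2 * (Setting.sg m j * a j (inlet m j) t) := by ring
      _ ≤ δ * u j (inlet m j) t ^ 2 * S.A :=
        mul_le_mul_of_nonneg_left e (mul_nonneg hδ.1 (sq_nonneg _))
      _ = _ := by ring
  unfold sqn
  linarith

lemma exists_trace_const (p : Matrix (Fin n) (Fin n) ℝ) : ∃ Q : ℝ, 0 ≤ Q ∧
    ∀ (m : ℕ) (u : Fin n → ℝ → ℝ → ℝ) (t : ℝ), ∑ j, opP m p u j t ^ 2 ≤ Q * tr m u t := by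
  refine ⟨∑ j, ∑ k, p j k ^ 2, by positivity, fun m u t => ?_⟩
  rw [Finset.sum_mul]
  refine Finset.sum_le_sum fun j _ => ?_
  rw [opP_eq]
  exact Finset.sum_mul_sq_le_sq_mul_sq _ _ _

/-- The energy estimate. -/
theorem Setting.exists_energy (S : Setting m a) (p : Matrix (Fin n) (Fin n) ℝ) {L : ℝ}
    (hL0 : 0 ≤ L) : ∃ C κ : ℝ, 1 ≤ C ∧ 0 ≤ κ ∧
    ∀ (b b' : Fin n → Fin n → ℝ → ℝ → ℝ) (K : Fin n → Fin n → ℝ)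
      (_ : ∀ j k, IsCoef (b j k) (b' j k) (K j k))
      (_ : ∀ j k, ∀ x ∈ Icc (0 : ℝ) 1, ∀ t, |b j k x t| ≤ L)
      (τ : ℝ) (g u ux ut : Fin n → ℝ → ℝ → ℝ) (_ : IsSol m p a b τ g u ux ut)
      (N : ℝ → ℝ) (_ : Continuous N) (_ : ∀ t, τ ≤ t → sqn g t ≤ N t),
      ∀ t, τ ≤ t → sqn u t + ∫ s in τ..t, tr m u s ≤
        C * Real.exp (κ * (t - τ)) * (sqn u τ + ∫ s in τ..t, N s) := by
  obtain ⟨Q, hQ0, hQ⟩ := exists_trace_const p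
  have hΛ := S.Λ_pos
  have hA := S.A_pos
  -- Small enough for the reflected inflow `δ A Q tr` to be absorbed by half of the outflow `Λ tr`;
  -- the other half remains and yields the trace bound.
  set δ : ℝ := min 1 (S.Λ / (2 * (S.A * (Q + 1)))) with hδ
  have hδ0 : 0 < δ := lt_min one_pos (by positivity)
  have hδI : δ ∈ Icc (0 : ℝ) 1 := ⟨hδ0.le, min_le_left _ _⟩
  have hδQ : δ * S.A * Q ≤ S.Λ / 2 := by
    have h1 : δ ≤ S.Λ / (2 * (S.A * (Q + 1))) := min_le_right _ _
    rw [le_div_iff₀ (by positivity)] at h1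
    nlinarith [mul_pos hδ0 hA]
  set κ₀ : ℝ := 2 * S.A + 1 + 2 * n * L with hκ₀
  have hκ₀0 : 0 ≤ κ₀ := by positivity
  set κ := κ₀ / δ with hκ
  have hκ0 : 0 ≤ κ := by positivity
  set c := min δ (S.Λ / 2) with hc
  have hc0 : 0 < c := lt_min hδ0 (by positivity)
  -- Both constants are fixed before the coefficient matrix appears and use only its bound `L`;
  -- uniformity over small perturbations rests on this.
  refine ⟨max 1 c⁻¹, κ, le_max_left _ _, hκ0, ?_⟩
  intro b b' K hb hbL τ g u ux ut h N hN hgN t ht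
  choose v v' hv hvu using h.exists_tc1
  set E : ℝ → ℝ := fun t => ∑ j, ∫ x in (0 : ℝ)..1, rho m δ j x * (v j x t * v j x t) with hE
  have hEd : ∀ t, HasDerivAt E (∑ j, ∫ x in (0 : ℝ)..1, (0 * (v j x t * v j x t) + rho m δ j x *
      (v' j x t * v j x t + v j x t * v' j x t))) t := fun t =>
    HasDerivAt.fun_sum fun j _ => (((TC1.of_fst (c := rho m δ j) (continuous_iff_continuousAt.2
      fun x => (rho_deriv δ j x).continuousAt)).mul ((hv j).mul (hv j))).primitive 0).deriv 1 t
  have hEu : ∀ t, τ ≤ t → E t = ∑ j, ∫ x in (0 : ℝ)..1, rho m δ j x * u j x t ^ 2 := by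
    intro t ht
    refine Finset.sum_congr rfl fun j _ => intervalIntegral.integral_congr fun x hx => ?_
    rw [uIcc_of_le zero_le_one] at hx
    simp only [(hvu j x hx t ht).1]; ring
  have hiu : ∀ t, τ ≤ t → ∀ j, IntervalIntegrable (fun x => u j x t ^ 2) volume 0 1 :=
    fun t ht j => intervalIntegrable_of_Icc ((continuousOn_slice (h.cu j) ht).pow 2)
  have hir : ∀ t, τ ≤ t → ∀ j,
      IntervalIntegrable (fun x => rho m δ j x * u j x t ^ 2) volume 0 1 := fun t ht j =>
    intervalIntegrable_of_Icc (ContinuousOn.mul (fun x _ =>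
      (rho_deriv δ j x).continuousAt.continuousWithinAt)
      ((continuousOn_slice (h.cu j) ht).pow 2))
  have hElow : ∀ t, τ ≤ t → δ * sqn u t ≤ E t := by
    intro t ht
    rw [hEu t ht, sqn, Finset.mul_sum]
    refine Finset.sum_le_sum fun j _ => ?_
    rw [← intervalIntegral.integral_const_mul]
    refine intervalIntegral.integral_mono_on zero_le_one ((hiu t ht j).const_mul _) (hir t ht j)
      fun x hx => mul_le_mul_of_nonneg_right (rho_mem hδI j hx).1 (sq_nonneg _)
  have hEup : ∀ t, τ ≤ t → E t ≤ sqn u t := by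
    intro t ht
    rw [hEu t ht, sqn]
    refine Finset.sum_le_sum fun j _ => ?_
    refine intervalIntegral.integral_mono_on zero_le_one (hir t ht j) (hiu t ht j)
      fun x hx => mul_le_of_le_one_left (sq_nonneg _) (rho_mem hδI j hx).2
  have hEde : ∀ t, τ ≤ t → deriv E t ≤ -(S.Λ / 2 * tr m u t) + κ * E t + N t := by
    intro t ht
    rw [(hEd t).deriv]
    have e1 : ∑ j, ∫ x in (0 : ℝ)..1, (0 * (v j x t * v j x t) + rho m δ j x *
        (v' j x t * v j x t + v j x t * v' j x t)) =
        ∑ j, ∫ x in (0 : ℝ)..1, 2 * rho m δ j x * u j x t * ut j x t := by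
      refine Finset.sum_congr rfl fun j _ => intervalIntegral.integral_congr fun x hx => ?_
      rw [uIcc_of_le zero_le_one] at hx
      simp only [(hvu j x hx t ht).1, (hvu j x hx t ht).2]; ring
    rw [e1]
    refine (Finset.sum_le_sum fun j _ => h.energy_component S hb hbL hδI ht j).trans ?_
    simp only [Finset.sum_add_distrib, Finset.sum_neg_distrib, ← Finset.mul_sum]
    have e2 : ∑ j, u j (inlet m j) t ^ 2 ≤ Q * tr m u t := by
      refine le_trans (le_of_eq (Finset.sum_congr rfl fun j _ => ?_)) (hQ m u t)
      rw [h.boundary j t ht]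
    have e3 := mul_le_mul_of_nonneg_left e2 (mul_nonneg hδ0.le hA.le)
    have e4 := mul_le_mul_of_nonneg_right hδQ (tr_nonneg (m := m) u t)
    have e5 : κ₀ * sqn u t ≤ κ * E t := by
      rw [hκ, div_mul_eq_mul_div, le_div_iff₀ hδ0]
      nlinarith [hElow t ht]
    have e6 := hgN t ht
    simp only [Finset.sum_const, Finset.card_univ, Fintype.card_fin, nsmul_eq_mul]
    simp only [hκ₀, sqn, tr] at e4 e5 e6 ⊢
    simp only [tr] at e3
    linarith
  have hdiff : Differentiable ℝ E := fun t => (hEd t).differentiableAt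
  set Tr : ℝ → ℝ := fun t => ∑ j, v j (outlet m j) t ^ 2 with hTr
  have hTrc : Continuous Tr := continuous_finsetSum _ fun j _ =>
    ((hv j).comp_cont continuous_const continuous_id).pow 2
  have hTru : ∀ t, τ ≤ t → Tr t = tr m u t := fun t ht =>
    Finset.sum_congr rfl fun j _ => by rw [(hvu j _ (outlet_mem m j) t ht).1]
  -- The Gronwall functional, with the dissipated traces and the source collected in an integral;
  -- the differential inequality for `E` says that it does not increase.
  set Φ : ℝ → ℝ := fun t => Real.exp (-(κ * (t - τ))) * E t +
    ∫ s in τ..t, Real.exp (-(κ * (s - τ))) * (S.Λ / 2 * Tr s - N s) with hΦ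
  have hcI : Continuous fun s => Real.exp (-(κ * (s - τ))) * (S.Λ / 2 * Tr s - N s) := by
    fun_prop
  have hΦd : ∀ t, HasDerivAt Φ (Real.exp (-(κ * (t - τ))) * (-κ) * E t +
      Real.exp (-(κ * (t - τ))) * deriv E t +
      Real.exp (-(κ * (t - τ))) * (S.Λ / 2 * Tr t - N t)) t := by
    intro t
    have d1 : HasDerivAt (fun t => -(κ * (t - τ))) (-κ) t := by
      have := (((hasDerivAt_id t).sub_const τ).const_mul κ).neg
      rw [mul_one] at this
      exact this
    exact (d1.exp.mul (hdiff t).hasDerivAt).add (hcI.integral_hasStrictDerivAt τ t).hasDerivAt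
  have hanti : AntitoneOn Φ (Ici τ) := by
    refine antitoneOn_of_deriv_nonpos (convex_Ici τ)
      (fun t _ => (hΦd t).continuousAt.continuousWithinAt)
      (fun t _ => (hΦd t).differentiableAt.differentiableWithinAt) fun t ht => ?_
    rw [interior_Ici] at ht
    have ht' : τ ≤ t := le_of_lt ht
    rw [(hΦd t).deriv, hTru t ht']
    have := mul_le_mul_of_nonneg_left (hEde t ht') (Real.exp_pos (-(κ * (t - τ)))).le
    linarith
  have hfin := hanti self_mem_Ici (mem_Ici.2 ht) ht
  have hN0 : ∀ s, τ ≤ s → 0 ≤ N s := fun s hs => (sqn_nonneg g s).trans (hgN s hs)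
  have i1 : ∫ s in τ..t, Real.exp (-(κ * (s - τ))) * N s ≤ ∫ s in τ..t, N s := by
    refine intervalIntegral.integral_mono_on ht (Continuous.intervalIntegrable (by fun_prop) _ _)
      (hN.intervalIntegrable _ _) fun s hs => mul_le_of_le_one_left (hN0 s hs.1) ?_
    rw [Real.exp_le_one_iff]
    have := mul_nonneg hκ0 (sub_nonneg.2 hs.1)
    linarith
  have i2 : Real.exp (-(κ * (t - τ))) * (S.Λ / 2 * ∫ s in τ..t, Tr s) ≤
      ∫ s in τ..t, Real.exp (-(κ * (s - τ))) * (S.Λ / 2 * Tr s) := by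
    rw [← intervalIntegral.integral_const_mul, ← intervalIntegral.integral_const_mul]
    refine intervalIntegral.integral_mono_on ht (Continuous.intervalIntegrable (by fun_prop) _ _)
      (Continuous.intervalIntegrable (by fun_prop) _ _) fun s hs => ?_
    refine mul_le_mul_of_nonneg_right (Real.exp_le_exp.2 ?_) ?_
    · have := mul_le_mul_of_nonneg_left hs.2 hκ0
      linarith
    · rw [hTru s hs.1]; exact mul_nonneg (by positivity) (tr_nonneg u s)
  have i3 : ∫ s in τ..t, Real.exp (-(κ * (s - τ))) * (S.Λ / 2 * Tr s - N s) =
      (∫ s in τ..t, Real.exp (-(κ * (s - τ))) * (S.Λ / 2 * Tr s)) -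
      ∫ s in τ..t, Real.exp (-(κ * (s - τ))) * N s := by
    rw [← intervalIntegral.integral_sub (Continuous.intervalIntegrable (by fun_prop) _ _)
      (Continuous.intervalIntegrable (by fun_prop) _ _)]
    simp only [mul_sub]
  have i4 : ∫ s in τ..t, Tr s = ∫ s in τ..t, tr m u s :=
    intervalIntegral.integral_congr fun s hs => by
      rw [uIcc_of_le ht] at hs; exact hTru s hs.1
  simp only [hΦ, intervalIntegral.integral_same, sub_self, mul_zero, neg_zero, Real.exp_zero,
    one_mul, add_zero, i3] at hfin
  rw [i4] at i2
  set I := ∫ s in τ..t, tr m u s with hI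
  have hI0 : 0 ≤ I := intervalIntegral.integral_nonneg ht fun s _ => tr_nonneg u s
  have e1 : Real.exp (-(κ * (t - τ))) * (E t + S.Λ / 2 * I) ≤ sqn u τ + ∫ s in τ..t, N s := by
    have := hEup τ le_rfl
    linarith
  have e2 : c * (sqn u t + I) ≤ E t + S.Λ / 2 * I := by
    have h1 := mul_le_mul_of_nonneg_right (min_le_left δ (S.Λ / 2)) (sqn_nonneg u t)
    have h2 := mul_le_mul_of_nonneg_right (min_le_right δ (S.Λ / 2)) hI0
    have := hElow t ht
    rw [hc]; linarith
  have hR : 0 ≤ sqn u τ + ∫ s in τ..t, N s :=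
    add_nonneg (sqn_nonneg u τ) (intervalIntegral.integral_nonneg ht fun s hs => hN0 s hs.1)
  have e3 : E t + S.Λ / 2 * I ≤ Real.exp (κ * (t - τ)) * (sqn u τ + ∫ s in τ..t, N s) := by
    have h1 := mul_le_mul_of_nonneg_left e1 (Real.exp_pos (κ * (t - τ))).le
    rwa [← mul_assoc, ← Real.exp_add, add_neg_cancel, Real.exp_zero, one_mul] at h1
  calc sqn u t + I = c⁻¹ * (c * (sqn u t + I)) := by field_simp
    _ ≤ c⁻¹ * (Real.exp (κ * (t - τ)) * (sqn u τ + ∫ s in τ..t, N s)) :=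
      mul_le_mul_of_nonneg_left (e2.trans e3) (inv_pos.2 hc0).le
    _ ≤ max 1 c⁻¹ * (Real.exp (κ * (t - τ)) * (sqn u τ + ∫ s in τ..t, N s)) :=
      mul_le_mul_of_nonneg_right (le_max_right _ _) (by positivity)
    _ = _ := by ring

end

end

end Hyp

namespace Hyp

noncomputable section

/-! ### Evolution families from dense families of curves -/

section Abstract

variable {X : Type*} [NormedAddCommGroup X] [NormedSpace ℝ X] [CompleteSpace X]

/-- Linear families of curves with exponential bounds, defined for a dense set of initial values,
generate an evolution family. -/
theorem exists_evolutionFamily (W : ℝ → Submodule ℝ (ℝ → X)) {C κ : ℝ} (hC : 1 ≤ C) (hκ : 0 ≤ κ)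
    (mono : ∀ τ s, τ ≤ s → W τ ≤ W s)
    (bound : ∀ τ, ∀ c ∈ W τ, ∀ t, τ ≤ t → ‖c t‖ ≤ C * Real.exp (κ * (t - τ)) * ‖c τ‖)
    (cont : ∀ τ, ∀ c ∈ W τ, ContinuousOn c (Ici τ))
    (D : Set X) (dense : Dense D) (start : ∀ φ ∈ D, ∀ τ, ∃ c ∈ W τ, c τ = φ)
    (unif : ∀ φ ∈ D, ∀ ε > 0, ∃ δ > 0, ∀ τ, ∀ c ∈ W τ, c τ = φ → ∀ t, τ ≤ t → t ≤ τ + δ →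
      ‖c t - φ‖ ≤ ε) :
    ∃ U : ℝ → ℝ → X →L[ℝ] X, IsEvolutionFamily U ∧
      (∀ τ, ∀ c ∈ W τ, ∀ t, τ ≤ t → U t τ (c τ) = c t) ∧
      ∀ τ t, τ ≤ t → ‖U t τ‖ ≤ C * Real.exp (κ * (t - τ)) := by
  set e : ∀ (t τ : ℝ), W τ →ₗ[ℝ] X := fun t τ => (LinearMap.proj t).comp (W τ).subtype with he
  have heval : ∀ t τ (c : W τ), e t τ c = (c : ℝ → X) t := fun _ _ _ => rfl
  have hdense : ∀ τ, DenseRange (e τ τ) := fun τ => by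
    refine dense.mono ?_
    intro φ hφ
    obtain ⟨c, hc, hcφ⟩ := start φ hφ τ
    exact ⟨⟨c, hc⟩, hcφ⟩
  have hnorm : ∀ τ t, τ ≤ t → ∀ c : W τ, ‖e t τ c‖ ≤ C * Real.exp (κ * (t - τ)) * ‖e τ τ c‖ :=
    fun τ t ht c => bound τ c c.2 t ht
  -- The map from initial value to value at time `t`, extended by continuity. The norm bound also
  -- shows that it is well defined, since a curve with zero initial value vanishes.
  set U : ℝ → ℝ → X →L[ℝ] X := fun t τ => (e t τ).extendOfNorm (e τ τ) with hU
  have hUc : ∀ τ, ∀ c ∈ W τ, ∀ t, τ ≤ t → U t τ (c τ) = c t := fun τ c hc t ht =>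
    LinearMap.extendOfNorm_eq (hdense τ) ⟨_, hnorm τ t ht⟩ (⟨c, hc⟩ : W τ)
  have hUn : ∀ τ t, τ ≤ t → ‖U t τ‖ ≤ C * Real.exp (κ * (t - τ)) := fun τ t ht =>
    LinearMap.opNorm_extendOfNorm_le (hdense τ) (by positivity) (hnorm τ t ht)
  have hUle : ∀ τ t φ, τ ≤ t → ‖U t τ φ‖ ≤ C * Real.exp (κ * (t - τ)) * ‖φ‖ := fun τ t φ ht =>
    (U t τ).le_of_opNorm_le (hUn τ t ht) φ
  have hrefl : ∀ τ, U τ τ = ContinuousLinearMap.id ℝ X := fun τ => by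
    refine ContinuousLinearMap.coeFn_injective ?_
    refine (U τ τ).continuous.ext_on dense continuous_id ?_
    intro φ hφ
    obtain ⟨c, hc, rfl⟩ := start φ hφ τ
    exact hUc τ c hc τ le_rfl
  have hcomp : ∀ τ s t, τ ≤ s → s ≤ t → (U t s).comp (U s τ) = U t τ := fun τ s t h1 h2 => by
    refine ContinuousLinearMap.coeFn_injective ?_
    refine ((U t s).comp (U s τ)).continuous.ext_on dense (U t τ).continuous ?_
    intro φ hφ
    obtain ⟨c, hc, rfl⟩ := start φ hφ τ
    rw [ContinuousLinearMap.comp_apply, hUc τ c hc s h1, hUc s c (mono τ s h1 hc) t h2,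
      hUc τ c hc t (h1.trans h2)]
  have hcomp' : ∀ τ s t φ, τ ≤ s → s ≤ t → U t s (U s τ φ) = U t τ φ := fun τ s t φ h1 h2 => by
    rw [← hcomp τ s t h1 h2]; rfl
  refine ⟨U, ⟨hrefl, hcomp, ?_⟩, hUc, hUn⟩
  -- strong continuity, first for initial values in `D`
  have hD : ∀ φ ∈ D, ContinuousOn (fun q : ℝ × ℝ => U q.1 q.2 φ) {q | q.2 ≤ q.1} := by
    rintro φ hφ ⟨t₀, τ₀⟩ (h₀ : τ₀ ≤ t₀)
    obtain ⟨c, hc, hcφ⟩ := start φ hφ τ₀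
    -- Joint continuity is reduced to continuity of this single curve, by comparing the start at `τ`
    -- with the start at `τ₀`.
    have hcG : Continuous fun t => U (max t τ₀) τ₀ φ := by
      have : ∀ t, U (max t τ₀) τ₀ φ = c (max t τ₀) := fun t => by
        rw [← hcφ]; exact hUc τ₀ c hc _ (le_max_right _ _)
      simp only [this]
      exact (cont τ₀ c hc).comp_continuous (by fun_prop) fun t => mem_Ici.2 (le_max_right _ _)
    set R : ℝ := C * Real.exp (κ * (t₀ - τ₀ + 2)) with hR
    have hR0 : 0 < R := by positivity
    have hR1 : 1 ≤ R := by
      have : 1 ≤ Real.exp (κ * (t₀ - τ₀ + 2)) :=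
        Real.one_le_exp (mul_nonneg hκ (by linarith))
      nlinarith
    rw [Metric.continuousWithinAt_iff]
    intro ε hε
    obtain ⟨δ, hδ, hδu⟩ := unif φ hφ (ε / (4 * R)) (by positivity)
    obtain ⟨η, hη, hηG⟩ := Metric.continuousAt_iff.1 (hcG.continuousAt (x := t₀)) (ε / 2)
      (by positivity)
    refine ⟨min (min δ η) 1, lt_min (lt_min hδ hη) one_pos, ?_⟩
    rintro ⟨t, τ⟩ (ht : τ ≤ t) hd
    rw [Prod.dist_eq, max_lt_iff] at hd
    obtain ⟨hd1, hd2⟩ := hd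
    simp only at hd1 hd2 ⊢
    have d1 : dist t t₀ < η := hd1.trans_le ((min_le_left _ _).trans (min_le_right _ _))
    have d2 : |t - t₀| < 1 := hd1.trans_le (min_le_right _ _)
    have d3 : |τ - τ₀| < 1 := hd2.trans_le (min_le_right _ _)
    have d4 : |τ - τ₀| < δ := hd2.trans_le ((min_le_left _ _).trans (min_le_left _ _))
    rw [abs_lt] at d2 d3 d4
    have hU1 : ∀ {s ψ}, s ≤ t → t - s ≤ t₀ - τ₀ + 2 → ‖ψ‖ ≤ ε / (4 * R) → ‖U t s ψ‖ ≤ ε / 4 := by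
      intro s ψ hs hts hψ
      refine (hUle s t ψ hs).trans ?_
      calc C * Real.exp (κ * (t - s)) * ‖ψ‖ ≤ R * (ε / (4 * R)) := by
            rw [hR]; gcongr
        _ = ε / 4 := by field_simp
    have hsm : ∀ {s r}, s ≤ r → r ≤ s + δ → ‖U r s φ - φ‖ ≤ ε / (4 * R) := by
      intro s r hs hr
      obtain ⟨c, hc, hcφ⟩ := start φ hφ s
      have := hδu s c hc hcφ r hs hr
      rwa [← hUc s c hc r hs, hcφ] at this
    -- The later of the two starting times is factored out: the difference is a bounded operator
    -- applied to `φ` minus its short evolution, which is small uniformly in the starting time. If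
    -- `t` precedes `τ₀`, the comparison is with `φ` itself.
    have key : ‖U t τ φ - U (max t τ₀) τ₀ φ‖ ≤ ε / 4 := by
      rcases le_or_gt τ₀ τ with h1 | h1
      · rw [max_eq_left (h1.trans ht), ← hcomp' τ₀ τ t φ h1 ht, ← map_sub]
        refine hU1 ht (by linarith) ?_
        rw [norm_sub_rev]; exact hsm h1 (by linarith)
      · rcases le_or_gt τ₀ t with h2 | h2
        · rw [max_eq_left h2, ← hcomp' τ τ₀ t φ h1.le h2, ← map_sub]
          exact hU1 h2 (by linarith) (hsm h1.le (by linarith))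
        · rw [max_eq_right h2.le, hrefl]
          refine (hsm ht (by linarith)).trans ?_
          rw [div_le_div_iff₀ (by positivity) (by positivity)]
          nlinarith
    have hG := hηG d1
    rw [max_eq_left h₀] at hG
    calc dist (U t τ φ) (U t₀ τ₀ φ)
        ≤ dist (U t τ φ) (U (max t τ₀) τ₀ φ) + dist (U (max t τ₀) τ₀ φ) (U t₀ τ₀ φ) :=
          dist_triangle _ _ _
      _ < ε := by rw [dist_eq_norm] at hG; rw [dist_eq_norm, dist_eq_norm]; linarith
  intro φ
  -- For a general initial value, the operators are bounded near `(t₀, τ₀)`, so `U · · φ` is locally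
  -- a uniform limit of the maps `U · · ψ` with `ψ` in `D`.
  refine continuousOn_of_locally_uniform_approx_of_continuousWithinAt ?_
  rintro ⟨t₀, τ₀⟩ (h₀ : τ₀ ≤ t₀) V hV
  obtain ⟨ε, hε, hεV⟩ := Metric.mem_uniformity_dist.1 hV
  set R : ℝ := C * Real.exp (κ * (t₀ - τ₀ + 2)) with hR
  have hR0 : 0 < R := by positivity
  obtain ⟨ψ, hψD, hψ⟩ := dense.exists_dist_lt φ (ε := ε / R) (by positivity)
  refine ⟨_, inter_mem_nhdsWithin _ (Metric.ball_mem_nhds ((t₀, τ₀) : ℝ × ℝ) one_pos),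
    fun q => U q.1 q.2 ψ, hD ψ hψD _ h₀, ?_⟩
  rintro ⟨t, τ⟩ ⟨ht : τ ≤ t, hd⟩
  rw [Metric.mem_ball, Prod.dist_eq, max_lt_iff] at hd
  simp only [Real.dist_eq, abs_lt] at hd
  apply hεV
  rw [dist_eq_norm, ← map_sub]
  refine (hUle τ t _ ht).trans_lt ?_
  rw [dist_eq_norm] at hψ
  calc C * Real.exp (κ * (t - τ)) * ‖φ - ψ‖ ≤ R * ‖φ - ψ‖ := by
        rw [hR]; gcongr; linarith [hd.1.1, hd.1.2, hd.2.1, hd.2.2]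
    _ < R * (ε / R) := by gcongr
    _ = ε := by field_simp

end Abstract

/-! ### Square integrable functions on the unit interval -/

lemma ContinuousOn.memLp_unit {f : ℝ → ℝ} (hf : ContinuousOn f (Icc 0 1)) : MemLp f 2 μ01 := by
  obtain ⟨C, hC⟩ := isCompact_Icc.exists_bound_of_continuousOn hf
  refine MemLp.of_bound ((hf.mono Ioo_subset_Icc_self).aestronglyMeasurable measurableSet_Ioo) C ?_
  exact (ae_restrict_iff' measurableSet_Ioo).2 (Eventually.of_forall fun x hx =>
    hC x (Ioo_subset_Icc_self hx))

lemma norm_toLp_sq {f : ℝ → ℝ} (hf : MemLp f 2 μ01) :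
    ‖hf.toLp f‖ ^ 2 = ∫ x in (0 : ℝ)..1, f x ^ 2 := by
  have h0 : 0 ≤ ∫ x in Ioo (0 : ℝ) 1, f x ^ 2 := integral_nonneg fun _ => sq_nonneg _
  rw [Lp.norm_toLp, hf.eLpNorm_eq_integral_rpow_norm two_ne_zero ENNReal.ofNat_ne_top]
  simp only [ENNReal.toReal_ofNat, Real.rpow_ofNat, Real.norm_eq_abs, sq_abs]
  rw [ENNReal.toReal_ofReal (Real.rpow_nonneg h0 _), ← Real.rpow_natCast, ← Real.rpow_mul h0]
  simp [intervalIntegral.integral_of_le zero_le_one, integral_Ioc_eq_integral_Ioo]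

section

variable {n : ℕ}

open Classical in
/-- The element of `L²(0,1)ⁿ` represented by `v`. -/
def toL2 (v : Fin n → ℝ → ℝ) : L2 n := fun j => if h : MemLp (v j) 2 μ01 then h.toLp (v j) else 0

variable {v w : Fin n → ℝ → ℝ}

lemma toL2_apply (hv : ∀ j, MemLp (v j) 2 μ01) (j : Fin n) : toL2 v j = (hv j).toLp (v j) :=
  dif_pos (hv j)

lemma toL2_coeFn (hv : ∀ j, MemLp (v j) 2 μ01) (j : Fin n) : toL2 v j =ᵐ[μ01] v j := by
  rw [toL2_apply hv]; exact (hv j).coeFn_toLp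

lemma toL2_add (hv : ∀ j, MemLp (v j) 2 μ01) (hw : ∀ j, MemLp (w j) 2 μ01) :
    toL2 (fun j x => v j x + w j x) = toL2 v + toL2 w := by
  funext j
  rw [toL2_apply (v := fun j x => v j x + w j x) (fun j => (hv j).add (hw j)), Pi.add_apply,
    toL2_apply hv, toL2_apply hw]
  rfl

lemma toL2_sub (hv : ∀ j, MemLp (v j) 2 μ01) (hw : ∀ j, MemLp (w j) 2 μ01) :
    toL2 (fun j x => v j x - w j x) = toL2 v - toL2 w := by
  funext j
  rw [toL2_apply (v := fun j x => v j x - w j x) (fun j => (hv j).sub (hw j)), Pi.sub_apply,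
    toL2_apply hv, toL2_apply hw]
  rfl

lemma toL2_smul (hv : ∀ j, MemLp (v j) 2 μ01) (c : ℝ) :
    toL2 (fun j x => c * v j x) = c • toL2 v := by
  funext j
  rw [toL2_apply (fun j => (hv j).const_mul c), Pi.smul_apply, toL2_apply hv]
  rfl

lemma norm_toL2_le (hv : ∀ j, MemLp (v j) 2 μ01) {R : ℝ} (hR : 0 ≤ R)
    (h : ∑ j, ∫ x in (0 : ℝ)..1, v j x ^ 2 ≤ R ^ 2) : ‖toL2 v‖ ≤ R := by
  refine (pi_norm_le_iff_of_nonneg hR).2 fun j => ?_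
  refine le_of_sq_le_sq ?_ hR
  rw [toL2_apply hv, norm_toLp_sq]
  exact (Finset.single_le_sum (f := fun j => ∫ x in (0 : ℝ)..1, v j x ^ 2) (fun j _ =>
    intervalIntegral.integral_nonneg zero_le_one fun _ _ => sq_nonneg _) (Finset.mem_univ j)).trans h

/-- Energy estimates work with the sum over the components, whereas the norm of `L2 n` is a maximum;
passing between them costs the number of components. -/
lemma sum_integral_le (hv : ∀ j, MemLp (v j) 2 μ01) :
    ∑ j, ∫ x in (0 : ℝ)..1, v j x ^ 2 ≤ n * ‖toL2 v‖ ^ 2 := by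
  have : ∀ j, ∫ x in (0 : ℝ)..1, v j x ^ 2 ≤ ‖toL2 v‖ ^ 2 := fun j => by
    rw [← norm_toLp_sq (hv j), ← toL2_apply hv]
    exact pow_le_pow_left₀ (norm_nonneg _) (norm_le_pi_norm _ j) 2
  exact (Finset.sum_le_sum fun j _ => this j).trans (by simp)

end

lemma IsTest.continuous {f : ℝ → ℝ} (hf : IsTest f) : Continuous f := hf.1.continuous

/-- Test functions are dense in `L²(0,1)`. -/
lemma exists_test_near (f : Lp ℝ 2 μ01) {ε : ℝ} (hε : 0 < ε) :
    ∃ g, IsTest g ∧ ∃ hg : MemLp g 2 μ01, ‖f - hg.toLp g‖ ≤ ε := by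
  obtain ⟨g, gc, gs, hg⟩ := (Lp.memLp f).exist_eLpNorm_sub_le ENNReal.ofNat_ne_top
    one_le_two (half_pos hε)
  have hgL : MemLp g 2 μ01 := ContinuousOn.memLp_unit gs.continuous.continuousOn
  -- The smooth approximation need not vanish near the endpoints. By absolute continuity of the
  -- integral it may be cut off there at little cost.
  obtain ⟨δ₀, hδ₀, hδ⟩ := hgL.eLpNorm_indicator_le one_le_two ENNReal.ofNat_ne_top (half_pos hε)
  set δ : ℝ := min (δ₀ / 2) (1 / 4) with hδd
  have hδ0 : 0 < δ := lt_min (by positivity) (by norm_num)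
  have hδ1 : δ ≤ 1 / 4 := min_le_right _ _
  have hδ2 : 2 * δ ≤ δ₀ := by linarith [min_le_left (δ₀ / 2) (1 / 4)]
  -- Equal to one on `[δ, 1 - δ]`, with support `[δ/2, 1 - δ/2]` inside the open interval.
  let χ : ContDiffBump (1 / 2 : ℝ) := ⟨1 / 2 - δ, 1 / 2 - δ / 2, by linarith, by linarith⟩
  set h : ℝ → ℝ := fun x => χ x * g x with hh
  have hts : tsupport h ⊆ Ioo (0 : ℝ) 1 := by
    refine (tsupport_mul_subset_left (f := χ) (g := g)).trans ?_
    rw [χ.tsupport_eq]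
    intro x hx
    rw [Metric.mem_closedBall, Real.dist_eq, abs_le] at hx
    have : χ.rOut = 1 / 2 - δ / 2 := rfl
    rw [this] at hx
    constructor <;> linarith [hx.1, hx.2]
  have hT : IsTest h := ⟨χ.contDiff.mul gs, gc.mul_left, hts⟩
  have hhL : MemLp h 2 μ01 := ContinuousOn.memLp_unit hT.continuous.continuousOn
  refine ⟨h, hT, hhL, ?_⟩
  set s : Set ℝ := (Icc δ (1 - δ))ᶜ with hs
  have hμs : μ01 s ≤ ENNReal.ofReal δ₀ := by
    rw [Measure.restrict_apply measurableSet_Icc.compl]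
    have : s ∩ Ioo 0 1 ⊆ Ioo 0 δ ∪ Ioo (1 - δ) 1 := by
      rintro x ⟨hx, h0, h1⟩
      rw [hs, mem_compl_iff, mem_Icc, not_and_or, not_le, not_le] at hx
      exact hx.imp (fun h => ⟨h0, h⟩) fun h => ⟨h, h1⟩
    refine (measure_mono this).trans ((measure_union_le _ _).trans ?_)
    rw [Real.volume_Ioo, Real.volume_Ioo, ← ENNReal.ofReal_add (by linarith) (by linarith)]
    exact ENNReal.ofReal_le_ofReal (by linarith)
  have h1 : eLpNorm (g - h) 2 μ01 ≤ ENNReal.ofReal (ε / 2) := by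
    refine le_trans (eLpNorm_mono fun x => ?_) (hδ s measurableSet_Icc.compl hμs)
    by_cases hx : x ∈ s
    · rw [indicator_of_mem hx, Pi.sub_apply, hh]
      have : g x - χ x * g x = (1 - χ x) * g x := by ring
      rw [this, norm_mul]
      refine mul_le_of_le_one_left (norm_nonneg _) ?_
      rw [Real.norm_eq_abs, abs_of_nonneg (by linarith [χ.le_one (x := x)])]
      linarith [χ.nonneg (x := x)]
    · rw [indicator_of_notMem hx, Pi.sub_apply, hh]
      rw [hs, mem_compl_iff, not_not] at hx
      have : χ x = 1 := by
        refine χ.one_of_mem_closedBall ?_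
        rw [Metric.mem_closedBall, Real.dist_eq, abs_le]
        have : χ.rIn = 1 / 2 - δ := rfl
        rw [this]; constructor <;> linarith [hx.1, hx.2]
      simp [this]
  have h2 : eLpNorm ((f : ℝ → ℝ) - h) 2 μ01 ≤ ENNReal.ofReal ε := by
    have e : (f : ℝ → ℝ) - h = ((f : ℝ → ℝ) - g) + (g - h) := by simp
    rw [e]
    refine (eLpNorm_add_le ((Lp.memLp f).sub hgL).1 (hgL.sub hhL).1 one_le_two).trans ?_
    refine (add_le_add hg h1).trans ?_
    rw [← ENNReal.ofReal_add (by linarith) (by linarith), add_halves]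
  have e : f - hhL.toLp h = ((Lp.memLp f).sub hhL).toLp _ := by
    rw [MemLp.toLp_sub (Lp.memLp f) hhL, Lp.toLp_coeFn]
  rw [e, Lp.norm_toLp]
  exact ENNReal.toReal_le_of_le_ofReal hε.le h2

end

end Hyp

namespace Hyp

noncomputable section

/-! ### The evolution family generated by the problem -/

section

variable {n m : ℕ} {p : Matrix (Fin n) (Fin n) ℝ} {a : Fin n → ℝ → ℝ → ℝ}
  {b b' : Fin n → Fin n → ℝ → ℝ → ℝ} {K : Fin n → Fin n → ℝ} {τ : ℝ}
  {g u ux ut v vx vt : Fin n → ℝ → ℝ → ℝ}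

namespace IsSol

lemma memLp (h : IsSol m p a b τ g u ux ut) {t : ℝ} (ht : τ ≤ t) (j : Fin n) :
    MemLp (fun x => u j x t) 2 μ01 :=
  ContinuousOn.memLp_unit (continuousOn_slice (h.cu j) ht)

lemma zero : IsSol m p a b τ (fun _ _ _ => 0) (fun _ _ _ => 0) (fun _ _ _ => 0)
    (fun _ _ _ => 0) where
  cx _ := continuousOn_const
  ct _ := continuousOn_const
  hd _ _ _ _ _ := (hasFDerivWithinAt_const (0 : ℝ) _ _).congr_fderiv (by ext <;> simp)
  pde _ _ _ _ _ := by simp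
  boundary j t _ := by simp [opP_eq]

lemma mul_add (r : ℝ) (h : IsSol m p a b τ (fun _ _ _ => 0) u ux ut)
    (h' : IsSol m p a b τ (fun _ _ _ => 0) v vx vt) :
    IsSol m p a b τ (fun _ _ _ => 0) (fun j x t => r * u j x t + v j x t)
      (fun j x t => r * ux j x t + vx j x t) (fun j x t => r * ut j x t + vt j x t) where
  cx j := (continuousOn_const.mul (h.cx j)).add (h'.cx j)
  ct j := (continuousOn_const.mul (h.ct j)).add (h'.ct j)
  hd j x hx t ht := (((h.hd j x hx t ht).const_mul r).add (h'.hd j x hx t ht)).congr_fderiv (by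
    ext <;> simp)
  pde j x hx t ht := by
    have e1 := h.pde j x hx t ht
    have e2 := h'.pde j x hx t ht
    have : ∑ k, b j k x t * (r * u k x t + v k x t) =
        r * ∑ k, b j k x t * u k x t + ∑ k, b j k x t * v k x t := by
      rw [Finset.mul_sum, ← Finset.sum_add_distrib]
      exact Finset.sum_congr rfl fun k _ => by ring
    rw [this]
    linear_combination r * e1 + e2
  boundary j t ht := by
    rw [h.boundary j t ht, h'.boundary j t ht]
    simp only [opP_eq, Finset.mul_sum, ← Finset.sum_add_distrib]
    exact Finset.sum_congr rfl fun k _ => by ring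

/-- Time independent functions. -/
lemma const {φ : Fin n → ℝ → ℝ} (hφ : ∀ j, IsTest (φ j)) :
    IsSol m p a b τ (fun j x t => a j x t * deriv (φ j) x + ∑ k, b j k x t * φ k x)
      (fun j x _ => φ j x) (fun j x _ => deriv (φ j) x) (fun _ _ _ => 0) where
  cx j := (((hφ j).1.continuous_deriv (by simp)).comp continuous_fst).continuousOn
  ct _ := continuousOn_const
  hd j x hx t ht := by
    have h1 : HasDerivAt (φ j) (deriv (φ j) x) x :=
      ((hφ j).1.differentiable (by simp) x).hasDerivAt
    have h2 := h1.hasFDerivAt.comp (x, t) (hasFDerivAt_fst (𝕜 := ℝ) (E := ℝ) (F := ℝ) (p := (x, t)))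
    refine (h2.hasFDerivWithinAt).congr_fderiv ?_
    ext <;> simp
  pde _ _ _ _ _ := by ring
  boundary j t ht := by
    rw [opP_eq, (hφ j).eq_zero (inlet_notMem m j)]
    exact (Finset.sum_eq_zero fun k _ => by rw [(hφ k).eq_zero (outlet_notMem m k), mul_zero]).symm

lemma continuousOn_toL2 (h : IsSol m p a b τ g u ux ut) :
    ContinuousOn (fun t => toL2 fun j x => u j x t) (Ici τ) := by
  intro s hs
  choose v v' hv hvu using h.exists_tc1
  have hc : Continuous fun t => ∑ j, ∫ x in (0 : ℝ)..1, (v j x t - v j x s) ^ 2 := by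
    refine continuous_finsetSum _ fun j _ => ?_
    refine intervalIntegral.continuous_parametric_intervalIntegral_of_continuous'
      (f := fun t x => (v j x t - v j x s) ^ 2) ?_ _ _
    exact (((hv j).comp_cont continuous_snd continuous_fst).sub
      ((hv j).comp_cont continuous_snd continuous_const)).pow 2
  have h0 : Tendsto (fun t => Real.sqrt (∑ j, ∫ x in (0 : ℝ)..1, (v j x t - v j x s) ^ 2))
      (𝓝[Ici τ] s) (𝓝 0) := by
    have := (Real.continuous_sqrt.comp hc).continuousWithinAt (s := Ici τ) (x := s)
    simpa [ContinuousWithinAt, Function.comp_def] using this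
  refine tendsto_iff_norm_sub_tendsto_zero.2 (squeeze_zero' (Eventually.of_forall fun _ =>
    norm_nonneg _) ?_ h0)
  filter_upwards [self_mem_nhdsWithin] with t ht
  rw [← toL2_sub (h.memLp ht) (h.memLp hs)]
  refine norm_toL2_le (fun j => (h.memLp ht j).sub (h.memLp hs j)) (Real.sqrt_nonneg _) ?_
  rw [Real.sq_sqrt (Finset.sum_nonneg fun j _ =>
    intervalIntegral.integral_nonneg zero_le_one fun _ _ => sq_nonneg _)]
  refine le_of_eq (Finset.sum_congr rfl fun j _ => intervalIntegral.integral_congr fun x hx => ?_)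
  rw [uIcc_of_le zero_le_one] at hx
  simp only [(hvu j x hx t ht).1, (hvu j x hx s hs).1, Pi.sub_apply]

end IsSol

/-- The curves in `L²` described by classical solutions. -/
def curves (m : ℕ) (p : Matrix (Fin n) (Fin n) ℝ) (a : Fin n → ℝ → ℝ → ℝ)
    (b : Fin n → Fin n → ℝ → ℝ → ℝ) (τ : ℝ) : Submodule ℝ (ℝ → L2 n) where
  carrier := {c | ∃ u ux ut, IsSol m p a b τ (fun _ _ _ => 0) u ux ut ∧
    ∀ t, τ ≤ t → c t = toL2 fun j x => u j x t}
  zero_mem' := ⟨_, _, _, IsSol.zero, fun t ht => by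
    have := toL2_smul (n := n) (v := fun _ _ => 0) (fun j => MemLp.zero) 0
    simpa using this.symm⟩
  add_mem' := by
    rintro c d ⟨u, ux, ut, hu, huc⟩ ⟨v, vx, vt, hv, hvd⟩
    refine ⟨_, _, _, hu.mul_add 1 hv, fun t ht => ?_⟩
    rw [Pi.add_apply, huc t ht, hvd t ht, ← toL2_add (hu.memLp ht) (hv.memLp ht)]
    simp
  smul_mem' := by
    rintro r c ⟨u, ux, ut, hu, huc⟩
    refine ⟨_, _, _, hu.mul_add r IsSol.zero, fun t ht => ?_⟩
    rw [Pi.smul_apply, huc t ht, ← toL2_smul (hu.memLp ht)]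
    simp

lemma IsTest.memLp {f : ℝ → ℝ} (hf : IsTest f) : MemLp f 2 μ01 :=
  ContinuousOn.memLp_unit hf.continuous.continuousOn

lemma exists_tests_near (φ : L2 n) {ε : ℝ} (hε : 0 < ε) :
    ∃ ψ : Fin n → ℝ → ℝ, (∀ j, IsTest (ψ j)) ∧ ‖φ - toL2 ψ‖ ≤ ε := by
  choose ψ hψ hψL h using fun j => exists_test_near (φ j) hε
  refine ⟨ψ, hψ, (pi_norm_le_iff_of_nonneg hε.le).2 fun j => ?_⟩
  rw [Pi.sub_apply, toL2_apply hψL]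
  exact h j

lemma exists_test_seq (φ : L2 n) : ∃ ψ : ℕ → Fin n → ℝ → ℝ, (∀ l j, IsTest (ψ l j)) ∧
    Tendsto (fun l => toL2 (ψ l)) atTop (𝓝 φ) := by
  choose ψ hψ h using fun l : ℕ => exists_tests_near φ (Nat.one_div_pos_of_nat (n := l) (α := ℝ))
  refine ⟨ψ, hψ, tendsto_iff_norm_sub_tendsto_zero.2 (squeeze_zero (fun _ => norm_nonneg _)
    (fun l => ?_) tendsto_one_div_add_atTop_nhds_zero_nat)⟩
  rw [norm_sub_rev]; exact h l

lemma eLpNorm_sub_toL2 (φ : L2 n) {w : Fin n → ℝ → ℝ} (hw : ∀ j, MemLp (w j) 2 μ01) (j : Fin n) :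
    eLpNorm (fun x => φ j x - w j x) 2 μ01 = ENNReal.ofReal ‖φ j - toL2 w j‖ := by
  rw [Lp.norm_def, ENNReal.ofReal_toReal (Lp.eLpNorm_ne_top _)]
  refine eLpNorm_congr_ae ?_
  filter_upwards [Lp.coeFn_sub (φ j) (toL2 w j), toL2_coeFn hw j] with x h1 h2
  rw [h1, Pi.sub_apply, h2]

lemma tendsto_toL2_iff (φ : L2 n) {w : ℕ → Fin n → ℝ → ℝ} (hw : ∀ l j, MemLp (w l j) 2 μ01) :
    (∀ j, Tendsto (fun l => eLpNorm (fun x => w l j x - φ j x) 2 μ01) atTop (𝓝 0)) ↔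
      Tendsto (fun l => toL2 (w l)) atTop (𝓝 φ) := by
  rw [tendsto_pi_nhds]
  refine forall_congr' fun j => ?_
  rw [tendsto_iff_norm_sub_tendsto_zero, ← ENNReal.tendsto_toReal_zero_iff ?_]
  · refine tendsto_congr fun l => ?_
    rw [show (fun x => w l j x - φ j x) = (w l j) - φ j from rfl, eLpNorm_sub_comm,
      show ((φ j : ℝ → ℝ) - w l j) = (fun x => φ j x - w l j x) from rfl,
      eLpNorm_sub_toL2 φ (hw l) j, ENNReal.toReal_ofReal (norm_nonneg _), norm_sub_rev]
  · intro l
    exact ((hw l j).sub (Lp.memLp (φ j))).eLpNorm_ne_top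

lemma sqn_le_norm {t : ℝ} (h : IsSol m p a b τ g u ux ut) (ht : τ ≤ t) :
    sqn u t ≤ n * ‖toL2 fun j x => u j x t‖ ^ 2 := sum_integral_le (h.memLp ht)

lemma norm_le_of_sqn {t R : ℝ} (h : IsSol m p a b τ g u ux ut) (ht : τ ≤ t) (hR : 0 ≤ R)
    (hs : sqn u t ≤ R ^ 2) : ‖toL2 fun j x => u j x t‖ ≤ R := norm_toL2_le (h.memLp ht) hR hs

lemma coef_bound (hb : ∀ j k, IsCoef (b j k) (b' j k) (K j k)) :
    ∀ j k, ∀ x ∈ Icc (0 : ℝ) 1, ∀ t, |b j k x t| ≤ ∑ j, ∑ k, |K j k| := fun j k x hx t => by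
  refine ((hb j k).bound x hx t).trans ((le_abs_self _).trans ?_)
  refine (Finset.single_le_sum (f := fun k => |K j k|) (fun i _ => abs_nonneg _)
    (Finset.mem_univ k)).trans ?_
  exact Finset.single_le_sum (f := fun j => ∑ k, |K j k|)
    (fun i _ => Finset.sum_nonneg fun _ _ => abs_nonneg _) (Finset.mem_univ j)

lemma integral_tr_nonneg {t : ℝ} (ht : τ ≤ t) (u : Fin n → ℝ → ℝ → ℝ) :
    0 ≤ ∫ s in τ..t, tr m u s :=
  intervalIntegral.integral_nonneg ht fun s _ => tr_nonneg (m := m) u s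

/-- Exponential bounds for homogeneous problems. -/
lemma Setting.exists_norm_bound (S : Setting m a) (p : Matrix (Fin n) (Fin n) ℝ) {L : ℝ}
    (hL0 : 0 ≤ L) : ∃ C κ : ℝ, 1 ≤ C ∧ 0 ≤ κ ∧
    ∀ (b b' : Fin n → Fin n → ℝ → ℝ → ℝ) (K : Fin n → Fin n → ℝ)
      (_ : ∀ j k, IsCoef (b j k) (b' j k) (K j k))
      (_ : ∀ j k, ∀ x ∈ Icc (0 : ℝ) 1, ∀ t, |b j k x t| ≤ L)
      (τ : ℝ) (u ux ut : Fin n → ℝ → ℝ → ℝ) (_ : IsSol m p a b τ (fun _ _ _ => 0) u ux ut),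
      ∀ t, τ ≤ t → ‖toL2 fun j x => u j x t‖ ≤
        C * Real.exp (κ * (t - τ)) * ‖toL2 fun j x => u j x τ‖ := by
  obtain ⟨C, κ, hC, hκ, hE⟩ := S.exists_energy p hL0
  have hn0 : (0 : ℝ) ≤ n := Nat.cast_nonneg n
  refine ⟨C * (n + 1), κ, by nlinarith, hκ, ?_⟩
  intro b b' K hb hL τ u ux ut h t ht
  have hE0 : sqn u t ≤ C * Real.exp (κ * (t - τ)) * sqn u τ := by
    have := hE b b' K hb hL τ _ u ux ut h (fun _ => 0) continuous_const
      (fun t _ => by simp [sqn]) t ht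
    rw [intervalIntegral.integral_zero, add_zero] at this
    linarith [integral_tr_nonneg (m := m) ht u]
  refine norm_le_of_sqn h ht (by positivity) (hE0.trans ?_)
  have h1 := sqn_le_norm h le_rfl
  have h2 : 1 ≤ Real.exp (κ * (t - τ)) :=
    Real.one_le_exp (mul_nonneg hκ (by linarith))
  have h0 : 1 ≤ C * Real.exp (κ * (t - τ)) := by nlinarith
  have h3 : C * Real.exp (κ * (t - τ)) * n ≤ (C * (n + 1) * Real.exp (κ * (t - τ))) ^ 2 := by
    have e : C * (n + 1) * Real.exp (κ * (t - τ)) =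
      C * Real.exp (κ * (t - τ)) * n + C * Real.exp (κ * (t - τ)) := by ring
    rw [e]
    have : 0 ≤ C * Real.exp (κ * (t - τ)) * n := by positivity
    nlinarith
  calc C * Real.exp (κ * (t - τ)) * sqn u τ
      ≤ C * Real.exp (κ * (t - τ)) * (n * ‖toL2 fun j x => u j x τ‖ ^ 2) := by gcongr
    _ = C * Real.exp (κ * (t - τ)) * n * ‖toL2 fun j x => u j x τ‖ ^ 2 := by ring
    _ ≤ (C * (n + 1) * Real.exp (κ * (t - τ))) ^ 2 * ‖toL2 fun j x => u j x τ‖ ^ 2 := by gcongr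
    _ = _ := by ring

/-- Solutions with a given test function as initial value are continuous at the initial time,
uniformly in that time. -/
lemma Setting.exists_modulus (S : Setting m a) (p : Matrix (Fin n) (Fin n) ℝ)
    (hb : ∀ j k, IsCoef (b j k) (b' j k) (K j k)) {ψ : Fin n → ℝ → ℝ} (hψ : ∀ j, IsTest (ψ j))
    {ε : ℝ} (hε : 0 < ε) : ∃ δ > 0, ∀ τ, ∀ c ∈ curves m p a b τ, c τ = toL2 ψ → ∀ t, τ ≤ t →
      t ≤ τ + δ → ‖c t - toL2 ψ‖ ≤ ε := by
  have hL := coef_bound hb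
  set L : ℝ := ∑ j, ∑ k, |K j k| with hLdef
  have hL0 : 0 ≤ L := by positivity
  obtain ⟨C, κ, hC, hκ, hE⟩ := S.exists_energy p hL0
  have hdc : ∀ j, Continuous (deriv (ψ j)) := fun j => (hψ j).1.continuous_deriv (by simp)
  choose M₀ hM₀ using fun j => isCompact_Icc.exists_bound_of_continuousOn
    ((hψ j).continuous.continuousOn (s := Icc (0 : ℝ) 1))
  choose M₁ hM₁ using fun j => isCompact_Icc.exists_bound_of_continuousOn
    ((hdc j).continuousOn (s := Icc (0 : ℝ) 1))
  -- A bound, independent of time, for the source obtained by inserting the stationary function `ψ`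
  -- into the equation. The difference between the solution and `ψ` starts from zero with this
  -- source, so its energy grows at most linearly, with slope `Q`, during the first unit of time.
  set G : Fin n → ℝ := fun j => S.A * M₁ j + ∑ k, L * M₀ k with hG
  set N : ℝ := ∑ j, G j ^ 2 with hN
  have hN0 : 0 ≤ N := by positivity
  set Q : ℝ := C * Real.exp κ * N with hQ
  have hQ0 : 0 ≤ Q := by positivity
  refine ⟨min 1 (ε ^ 2 / (Q + 1)), lt_min one_pos (by positivity), ?_⟩
  rintro τ c ⟨u, ux, ut, hu, huc⟩ hcτ t ht htδ
  obtain ⟨g, w, wx, wt, hv, hw, hgb⟩ : ∃ g w wx wt : Fin n → ℝ → ℝ → ℝ, IsSol m p a b τ g w wx wt ∧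
      (∀ s, (fun j x => w j x s) = fun j x => u j x s - ψ j x) ∧
      ∀ j, ∀ x ∈ Icc (0 : ℝ) 1, ∀ s, |g j x s| ≤ G j := by
    refine ⟨_, _, _, _, hu.sub (IsSol.const (b := b) hψ), fun s => rfl, ?_⟩
    intro j x hx s
    simp only [sub_self, zero_mul, Finset.sum_const_zero, add_zero, zero_sub, abs_neg]
    refine (abs_add_le _ _).trans (add_le_add ?_ ?_)
    · rw [abs_mul]
      exact mul_le_mul (S.abs_a_le j x hx s) (hM₁ j x hx) (abs_nonneg _) S.A_pos.le
    · refine (Finset.abs_sum_le_sum_abs _ _).trans (Finset.sum_le_sum fun k _ => ?_)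
      rw [abs_mul]
      exact mul_le_mul (hL j k x hx s) (hM₀ k x hx) (abs_nonneg _) hL0
  have hcv : ∀ s, τ ≤ s → c s - toL2 ψ = toL2 fun j x => w j x s := fun s hs => by
    rw [huc s hs, hw s, toL2_sub (hu.memLp hs) fun j => (hψ j).memLp]
  have h0 : sqn w τ ≤ 0 := by
    refine (sqn_le_norm hv le_rfl).trans ?_
    rw [← hcv τ le_rfl, hcτ, sub_self, norm_zero]; simp
  have hgN : ∀ s, τ ≤ s → sqn g s ≤ N := by
    intro s hs
    refine Finset.sum_le_sum fun j _ => ?_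
    have hcg := continuousOn_slice (f := g j) (hv.cg S hb j) hs
    refine (intervalIntegral.integral_mono_on zero_le_one
      (intervalIntegrable_of_Icc (hcg.pow 2))
      (intervalIntegrable_const (c := G j ^ 2)) fun x hx => ?_).trans (by simp)
    exact sq_le_sq' (neg_le_of_abs_le (hgb j x hx s)) (le_of_abs_le (hgb j x hx s))
  have := hE b b' K hb hL τ g w wx wt hv (fun _ => N) continuous_const hgN t ht
  rw [hcv t ht]
  refine norm_le_of_sqn hv ht hε.le ?_
  have hI := integral_tr_nonneg (m := m) ht w
  have ht1 : t - τ ≤ 1 := by linarith [min_le_left 1 (ε ^ 2 / (Q + 1))]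
  have ht2 : t - τ ≤ ε ^ 2 / (Q + 1) := by linarith [min_le_right 1 (ε ^ 2 / (Q + 1))]
  have hexp : Real.exp (κ * (t - τ)) ≤ Real.exp κ :=
    Real.exp_le_exp.2 (mul_le_of_le_one_right hκ ht1)
  have h5 : sqn w τ + ∫ s in τ..t, N ≤ N * (t - τ) := by
    rw [intervalIntegral.integral_const, smul_eq_mul]; linarith
  have h6 : C * Real.exp (κ * (t - τ)) * (sqn w τ + ∫ s in τ..t, N) ≤ Q * (t - τ) := by
    refine (mul_le_mul_of_nonneg_left h5 (by positivity)).trans ?_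
    have : 0 ≤ N * (t - τ) := mul_nonneg hN0 (by linarith)
    calc C * Real.exp (κ * (t - τ)) * (N * (t - τ)) ≤ C * Real.exp κ * (N * (t - τ)) := by
          gcongr
      _ = Q * (t - τ) := by rw [hQ]; ring
  rw [le_div_iff₀ (by positivity)] at ht2
  nlinarith

lemma IsClassicalSolution.toL2_initial {φ : Fin n → ℝ → ℝ} (hu : IsClassicalSolution m p a b τ φ u)
    (h : IsSol m p a b τ g u ux ut) (hφ : ∀ j, MemLp (φ j) 2 μ01) :
    (toL2 fun j x => u j x τ) = toL2 φ := by
  funext j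
  rw [toL2_apply (h.memLp le_rfl), toL2_apply hφ]
  exact MemLp.toLp_congr _ _ ((ae_restrict_iff' measurableSet_Ioo).2
    (Eventually.of_forall fun x hx => hu.initial j x (Ioo_subset_Icc_self hx)))

/-- The problem generates an evolution family. -/
theorem Setting.exists_generated (S : Setting m a) (p : Matrix (Fin n) (Fin n) ℝ)
    (hb : ∀ j k, IsCoef (b j k) (b' j k) (K j k)) : ∃ U, IsGenerated m p a b U := by
  obtain ⟨C, κ, hC, hκ, hbd⟩ := S.exists_norm_bound p (L := ∑ j, ∑ k, |K j k|) (by positivity)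
  set D : Set (L2 n) := {φ | ∃ ψ : Fin n → ℝ → ℝ, (∀ j, IsTest (ψ j)) ∧ φ = toL2 ψ} with hD
  have hstart : ∀ ψ : Fin n → ℝ → ℝ, (∀ j, IsTest (ψ j)) → ∀ τ, ∃ u ux ut,
      IsClassicalSolution m p a b τ ψ u ∧ IsSol m p a b τ (fun _ _ _ => 0) u ux ut ∧
      (toL2 fun j x => u j x τ) = toL2 ψ := by
    intro ψ hψ τ
    obtain ⟨u, hu⟩ := S.exists_classical p hb τ hψ
    obtain ⟨ux, ut, h⟩ := hu.isSol S hb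
    exact ⟨u, ux, ut, hu, h, hu.toL2_initial h fun j => (hψ j).memLp⟩
  obtain ⟨U, hU, hUc, hUn⟩ := exists_evolutionFamily (curves m p a b) hC hκ
    (by
      rintro τ s hs c ⟨u, ux, ut, hu, huc⟩
      exact ⟨u, ux, ut, hu.restrict hs, fun t ht => huc t (hs.trans ht)⟩)
    (by
      rintro τ c ⟨u, ux, ut, hu, huc⟩ t ht
      rw [huc t ht, huc τ le_rfl]
      exact hbd b b' K hb (coef_bound hb) τ u ux ut hu t ht)
    (by
      rintro τ c ⟨u, ux, ut, hu, huc⟩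
      exact hu.continuousOn_toL2.congr fun t ht => huc t ht)
    D
    (by
      refine Metric.dense_iff.2 fun φ ε hε => ?_
      obtain ⟨ψ, hψ, h⟩ := exists_tests_near φ (half_pos hε)
      refine ⟨toL2 ψ, ?_, ψ, hψ, rfl⟩
      rw [Metric.mem_ball, dist_comm, dist_eq_norm]; linarith)
    (by
      rintro _ ⟨ψ, hψ, rfl⟩ τ
      obtain ⟨u, ux, ut, -, h, h0⟩ := hstart ψ hψ τ
      exact ⟨fun t => toL2 fun j x => u j x t, ⟨u, ux, ut, h, fun _ _ => rfl⟩, h0⟩)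
    (by
      rintro _ ⟨ψ, hψ, rfl⟩ ε hε
      exact S.exists_modulus p hb hψ hε)
  have hUsol : ∀ {τ : ℝ} {u ux ut : Fin n → ℝ → ℝ → ℝ}, IsSol m p a b τ (fun _ _ _ => 0) u ux ut →
      ∀ t, τ ≤ t → U t τ (toL2 fun j x => u j x τ) = toL2 fun j x => u j x t :=
    fun {τ u ux ut} h t ht => hUc τ (fun t => toL2 fun j x => u j x t)
      ⟨u, ux, ut, h, fun _ _ => rfl⟩ t ht
  refine ⟨U, hU, fun τ φ => ⟨?_, ?_⟩⟩
  · exact (hU.strong_cont φ).comp (f := fun t => (t, τ)) (by fun_prop) fun t ht => ht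
  intro φl hφl hconv
  choose ul uxl utl hcl hsol hini using fun l => hstart (φl l) (hφl l) τ
  refine ⟨ul, hcl, fun T hT ε hε => ?_⟩
  have hconv' := (tendsto_toL2_iff φ fun l j => (hφl l j).memLp).1 hconv
  set R : ℝ := C * Real.exp (κ * (T - τ)) with hR
  have hR0 : 0 < R := by positivity
  filter_upwards [Metric.tendsto_nhds.1 hconv' (ε / R) (by positivity)] with l hl θ hθ j
  rw [eLpNorm_sub_toL2 _ ((hsol l).memLp hθ.1) j]
  refine ENNReal.ofReal_le_ofReal ?_
  have e : U θ τ φ - (toL2 fun j x => ul l j x θ) = U θ τ (φ - toL2 (φl l)) := by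
    rw [map_sub, ← hini l, hUsol (hsol l) θ hθ.1]
  refine (norm_le_pi_norm (U θ τ φ - toL2 fun j x => ul l j x θ) j).trans ?_
  rw [e]
  rw [dist_comm, dist_eq_norm] at hl
  refine ((U θ τ).le_of_opNorm_le (hUn τ θ hθ.1) _).trans ?_
  calc C * Real.exp (κ * (θ - τ)) * ‖φ - toL2 (φl l)‖ ≤ R * (ε / R) := by
        rw [hR]; gcongr; exact hθ.2
    _ = ε := by field_simp

end

end

end Hyp

namespace Hyp

noncomputable section

/-! ### Decay of the evolution family -/

section Abstract

variable {X : Type*} [NormedAddCommGroup X] [NormedSpace ℝ X]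

/-- Periods of length `T` are split off from the start, each contributing `exp (-γ T)`. On the
remaining piece, not longer than `T`, the growth bound is compared with the decay rate, which costs
at most `exp ((κ + γ) T)`. -/
lemma IsEvolutionFamily.exp_decay {U : ℝ → ℝ → X →L[ℝ] X} (hU : IsEvolutionFamily U)
    {C κ γ T : ℝ} (hC : 0 ≤ C) (hκ : 0 ≤ κ) (hγ : 0 ≤ γ) (hT : 0 < T)
    (hb : ∀ τ t, τ ≤ t → ‖U t τ‖ ≤ C * Real.exp (κ * (t - τ)))
    (hd : ∀ τ, ‖U (τ + T) τ‖ ≤ Real.exp (-γ * T)) {τ t : ℝ} (ht : τ ≤ t) :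
    ‖U t τ‖ ≤ C * Real.exp ((κ + γ) * T) * Real.exp (-γ * (t - τ)) := by
  have key : ∀ (l : ℕ) (τ t : ℝ), τ ≤ t → t - τ ≤ (l + 1) * T →
      ‖U t τ‖ ≤ C * Real.exp ((κ + γ) * T) * Real.exp (-γ * (t - τ)) := by
    intro l
    induction l with
    | zero =>
      intro τ t ht h
      refine (hb τ t ht).trans ?_
      rw [mul_assoc, ← Real.exp_add]
      gcongr
      simp only [Nat.cast_zero, zero_add, one_mul] at h
      nlinarith [mul_le_mul_of_nonneg_left h hκ, mul_le_mul_of_nonneg_left h hγ]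
    | succ l ih =>
      intro τ t ht h
      rcases le_or_gt (t - τ) T with h1 | h1
      · refine (hb τ t ht).trans ?_
        rw [mul_assoc, ← Real.exp_add]
        gcongr
        nlinarith [mul_le_mul_of_nonneg_left h1 hκ, mul_le_mul_of_nonneg_left h1 hγ]
      · rw [← hU.comp τ (τ + T) t (by linarith) (by linarith)]
        refine (ContinuousLinearMap.opNorm_comp_le _ _).trans ?_
        have h2 := ih (τ + T) t (by linarith) (by push_cast at h ⊢; linarith)
        calc ‖U t (τ + T)‖ * ‖U (τ + T) τ‖
            ≤ C * Real.exp ((κ + γ) * T) * Real.exp (-γ * (t - (τ + T))) *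
              Real.exp (-γ * T) := mul_le_mul h2 (hd τ) (norm_nonneg _) (by positivity)
          _ = _ := by
            rw [mul_assoc, ← Real.exp_add]; congr 2; ring
  obtain ⟨l, hl⟩ := exists_nat_ge ((t - τ) / T)
  refine key l τ t ht ?_
  rw [div_le_iff₀ hT] at hl
  nlinarith

end Abstract

section

variable {n m : ℕ} {p : Matrix (Fin n) (Fin n) ℝ} {a : Fin n → ℝ → ℝ → ℝ}
  {b b' : Fin n → Fin n → ℝ → ℝ → ℝ} {K : Fin n → Fin n → ℝ} {τ : ℝ}
  {g u ux ut : Fin n → ℝ → ℝ → ℝ}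

/-- Approximation of the evolution family by classical solutions. -/
lemma IsGenerated.exists_approx (S : Setting m a) (hb : ∀ j k, IsCoef (b j k) (b' j k) (K j k))
    {U : ℝ → ℝ → L2 n →L[ℝ] L2 n} (hU : IsGenerated m p a b U) (τ : ℝ) (φ : L2 n) :
    ∃ (φl : ℕ → Fin n → ℝ → ℝ) (ul : ℕ → Fin n → ℝ → ℝ → ℝ), (∀ l j, IsTest (φl l j)) ∧
      (∀ l, IsClassicalSolution m p a b τ (φl l) (ul l)) ∧
      Tendsto (fun l => toL2 (φl l)) atTop (𝓝 φ) ∧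
      ∀ t, τ ≤ t → Tendsto (fun l => toL2 fun j x => ul l j x t) atTop (𝓝 (U t τ φ)) := by
  obtain ⟨φl, hφl, hconv⟩ := exists_test_seq φ
  obtain ⟨ul, hul, hcv⟩ := (hU.2 τ φ).2 φl hφl
    ((tendsto_toL2_iff φ fun l j => (hφl l j).memLp).2 hconv)
  refine ⟨φl, ul, hφl, hul, hconv, fun t ht => ?_⟩
  rw [Metric.tendsto_nhds]
  intro ε hε
  filter_upwards [hcv (t + 1) (by linarith) (ε / 2) (by positivity)] with l hl
  obtain ⟨ux, ut, hs⟩ := (hul l).isSol S hb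
  rw [dist_comm, dist_eq_norm]
  refine lt_of_le_of_lt ((pi_norm_le_iff_of_nonneg (half_pos hε).le).2 fun j => ?_)
    (half_lt_self hε)
  have := hl t ⟨ht, by linarith⟩ j
  rwa [eLpNorm_sub_toL2 _ (hs.memLp ht) j, ENNReal.ofReal_le_ofReal_iff (half_pos hε).le] at this

/-- A generated family is determined by classical solutions with test functions as data, so any
estimate for these passes to the limit. This is why the decay holds for every family generated by
the problem, not only for the constructed one. -/
lemma IsGenerated.norm_le (S : Setting m a) (hb : ∀ j k, IsCoef (b j k) (b' j k) (K j k))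
    {U : ℝ → ℝ → L2 n →L[ℝ] L2 n} (hU : IsGenerated m p a b U) {τ t R : ℝ} (ht : τ ≤ t)
    (hR : 0 ≤ R)
    (h : ∀ (φ : Fin n → ℝ → ℝ) (u : Fin n → ℝ → ℝ → ℝ), (∀ j, IsTest (φ j)) →
      IsClassicalSolution m p a b τ φ u → ‖toL2 fun j x => u j x t‖ ≤ R * ‖toL2 φ‖) :
    ‖U t τ‖ ≤ R := by
  refine ContinuousLinearMap.opNorm_le_bound _ hR fun φ => ?_
  obtain ⟨φl, ul, hφl, hul, hconv, hcv⟩ := hU.exists_approx S hb τ φ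
  exact le_of_tendsto_of_tendsto' (hcv t ht).norm (hconv.norm.const_mul R) fun l =>
    h _ _ (hφl l) (hul l)

lemma IsSol.hasDerivWithinAt_char (S : Setting m a) (h : IsSol m p a b τ g u ux ut) (j : Fin n)
    {s : ℝ} (hs : τ ≤ s) {x : ℝ} (hx : x ∈ Icc (0 : ℝ) 1) :
    HasDerivWithinAt (fun ξ => u j ξ (S.y j ξ s)) ((a j x (S.y j x s))⁻¹ *
      (g j x (S.y j x s) - ∑ k, b j k x (S.y j x s) * u k x (S.y j x s))) (Icc 0 1) x := by
  have hy : τ ≤ S.y j x s := hs.trans (S.le_y j hx s)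
  refine (hasDerivWithinAt_curve (h.hd j x hx _ hy) (S.y_ode j hx s).hasDerivWithinAt rfl
    fun ξ hξ => ⟨hξ, hs.trans (S.le_y j hξ s)⟩).congr_deriv ?_
  have ha := S.a_ne j hx (S.y j x s)
  rw [← h.pde j x hx _ hy]
  field_simp
  ring

/-- The weight `c_j(x_j, x, t)` in terms of the entry time `s`. -/
def Setting.wgt (S : Setting m a) (b : Fin n → ℝ → ℝ → ℝ) (j : Fin n) (x s : ℝ) : ℝ :=
  Real.exp (∫ η in x..inlet m j, b j (cl η) (S.y j η s) * (a j (cl η) (S.y j η s))⁻¹)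

lemma Setting.charWeight_eq (S : Setting m a) (b : Fin n → ℝ → ℝ → ℝ) (j : Fin n) {x : ℝ}
    (hx : x ∈ Icc (0 : ℝ) 1) (t : ℝ) :
    charWeight (a j) (b j) (inlet m j) x t = S.wgt b j x (S.σ j x t) := by
  unfold charWeight Setting.wgt
  congr 1
  refine intervalIntegral.integral_congr fun η hη => ?_
  have hη' : η ∈ Icc (0 : ℝ) 1 := uIcc_subset_Icc hx (inlet_mem m j) hη
  simp only [S.charCurve_eq j hx hη' t, cl_of_mem hη', div_eq_mul_inv]

lemma Setting.opC_eq (S : Setting m a) (b : Fin n → ℝ → ℝ → ℝ) (w : Fin n → ℝ → ℝ) (j : Fin n)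
    {x : ℝ} (hx : x ∈ Icc (0 : ℝ) 1) (t : ℝ) :
    opC m a b w j x t = S.wgt b j x (S.σ j x t) * w j (S.σ j x t) := by
  unfold opC
  rw [S.charWeight_eq b j hx, S.charCurve_eq j hx (inlet_mem m j), (S.flow j).base]

/-- Solutions of a scalar linear equation. -/
lemma eq_exp_of_linear {f c : ℝ → ℝ} (hc : Continuous c) {x₀ : ℝ} (hx₀ : x₀ ∈ Icc (0 : ℝ) 1)
    (hf : ∀ x ∈ Icc (0 : ℝ) 1, HasDerivWithinAt f (-(c x * f x)) (Icc 0 1) x) {x : ℝ}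
    (hx : x ∈ Icc (0 : ℝ) 1) : f x = Real.exp (∫ η in x..x₀, c η) * f x₀ := by
  have hd : ∀ x ∈ Icc (0 : ℝ) 1, HasDerivWithinAt
      (fun x => Real.exp (∫ η in x₀..x, c η) * f x) 0 (Icc 0 1) x := by
    intro x hx
    refine ((hc.integral_hasStrictDerivAt x₀ x).hasDerivAt.exp.hasDerivWithinAt.mul
      (hf x hx)).congr_deriv ?_
    ring
  have hconst : Real.exp (∫ η in x₀..x, c η) * f x = Real.exp (∫ η in x₀..x₀, c η) * f x₀ := by
    refine (convex_Icc (0 : ℝ) 1).is_const_of_fderivWithin_eq_zero (𝕜 := ℝ)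
      (f := fun x => Real.exp (∫ η in x₀..x, c η) * f x)
      (fun x hx => (hd x hx).differentiableWithinAt) (fun x hx => ?_) hx hx₀
    have := (hd x hx).hasFDerivWithinAt.fderivWithin (uniqueDiffOn_Icc zero_lt_one x hx)
    rw [this]; ext; simp
  rw [intervalIntegral.integral_same, Real.exp_zero, one_mul] at hconst
  rw [← hconst, ← mul_assoc, ← Real.exp_add, intervalIntegral.integral_symm, neg_add_cancel,
    Real.exp_zero, one_mul]

variable {bd : Fin n → ℝ → ℝ → ℝ}

lemma Setting.continuous_wgt_integrand (S : Setting m a) (hbd : ∀ j, IsBC1 (bd j)) (j : Fin n)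
    (s : ℝ) : Continuous fun η => bd j (cl η) (S.y j η s) * (a j (cl η) (S.y j η s))⁻¹ :=
  ((hbd j).tc1.comp_cont continuous_id ((S.tc1_y j).comp_cont continuous_id continuous_const)).mul
    ((S.tc1_inv_a j).comp_cont continuous_id
      ((S.tc1_y j).comp_cont continuous_id continuous_const))

/-- Solutions of the decoupled problem are transported along characteristics. -/
lemma IsSol.eq_transport (S : Setting m a) (hbd : ∀ j, IsBC1 (bd j))
    (h : IsSol m p a (perturb bd fun _ _ _ _ => 0) τ (fun _ _ _ => 0) u ux ut) (j : Fin n)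
    {x : ℝ} (hx : x ∈ Icc (0 : ℝ) 1) {t : ℝ} (ht : τ ≤ S.σ j x t) :
    u j x t = S.wgt bd j x (S.σ j x t) * opP m p u j (S.σ j x t) := by
  rw [← h.boundary j _ ht]
  have := eq_exp_of_linear (f := fun ξ => u j ξ (S.y j ξ (S.σ j x t)))
    (S.continuous_wgt_integrand hbd j (S.σ j x t)) (inlet_mem m j) (fun ξ hξ => by
      refine (h.hasDerivWithinAt_char S j ht hξ).congr_deriv ?_
      simp only [perturb, add_zero, ite_mul, zero_mul, Finset.sum_ite_eq, Finset.mem_univ, if_true,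
        cl_of_mem hξ]
      ring) hx
  simpa only [(S.flow j).right_inv, (S.flow j).base, Setting.wgt] using this

/-- Each application of `C P` reaches back in time by at most `1 / Λ`. Hence `(C P)^k` reproduces
the solution from time `τ + k / Λ` on, and the extinction condition annihilates it. -/
lemma Setting.extinction (S : Setting m a) (hbd : ∀ j, IsBC1 (bd j)) {N : ℕ}
    (hN : ∀ u : Fin n → ℝ → ℝ → ℝ, (∀ j, ContinuousOn (fun z : ℝ × ℝ => u j z.1 z.2) strip) →
      ∀ j, ∀ x ∈ Icc (0 : ℝ) 1, ∀ t : ℝ, (fun w => opC m a bd (opP m p w))^[N] u j x t = 0)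
    (h : IsSol m p a (perturb bd fun _ _ _ _ => 0) τ (fun _ _ _ => 0) u ux ut) (j : Fin n)
    {x : ℝ} (hx : x ∈ Icc (0 : ℝ) 1) {t : ℝ} (ht : τ + N * S.Λ⁻¹ ≤ t) : u j x t = 0 := by
  -- Extinction is assumed for functions continuous on the whole strip, so the solution is frozen at
  -- its initial value before `τ`; these values are not seen at the times considered.
  set w : Fin n → ℝ → ℝ → ℝ := fun j x t => u j x (max t τ) with hw
  have hwc : ∀ j, ContinuousOn (fun z : ℝ × ℝ => w j z.1 z.2) strip := fun j =>
    (h.cu j).comp (f := fun z : ℝ × ℝ => (z.1, max z.2 τ)) (by fun_prop) fun z hz =>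
      ⟨hz.1, mem_Ici.2 (le_max_right _ _)⟩
  have key : ∀ (k : ℕ) (j : Fin n), ∀ x ∈ Icc (0 : ℝ) 1, ∀ t, τ + k * S.Λ⁻¹ ≤ t →
      (fun w => opC m a bd (opP m p w))^[k] w j x t = u j x t := by
    intro k
    induction k with
    | zero =>
      intro j x hx t ht
      simp only [Nat.cast_zero, zero_mul, add_zero] at ht
      simp [hw, max_eq_left ht]
    | succ k ih =>
      intro j x hx t ht
      have hσ : τ + k * S.Λ⁻¹ ≤ S.σ j x t := by
        have := (S.σ_bounds j hx t).1
        push_cast at ht; linarith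
      have hσ' : τ ≤ S.σ j x t := by
        have : 0 ≤ k * S.Λ⁻¹ := mul_nonneg (Nat.cast_nonneg k) (inv_nonneg.2 S.Λ_pos.le)
        linarith
      rw [Function.iterate_succ_apply', S.opC_eq bd _ j hx, h.eq_transport S hbd j hx hσ', opP_eq,
        opP_eq]
      congr 1
      exact Finset.sum_congr rfl fun k _ => by rw [ih k _ (outlet_mem m k) _ hσ]
  rw [← key N j x hx t ht]
  exact hN w hwc j x hx t

end

end

end Hyp

/-! ### Small perturbations of a problem with finite time extinction. -/

namespace Hyp

noncomputable section

section

variable {n m : ℕ} {p : Matrix (Fin n) (Fin n) ℝ} {a : Fin n → ℝ → ℝ → ℝ}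
  {bd : Fin n → ℝ → ℝ → ℝ} {bt : Fin n → Fin n → ℝ → ℝ → ℝ} {τ : ℝ}

lemma IsCoef.zero : IsCoef (fun _ _ => 0) (fun _ _ => 0) 0 :=
  ⟨TC1.zero, fun _ => contDiffOn_const, fun _ _ _ => by simp, fun _ _ _ => by simp⟩

lemma IsCoef.add {b b' c c' : ℝ → ℝ → ℝ} {K L : ℝ} (hb : IsCoef b b' K) (hc : IsCoef c c' L) :
    IsCoef (fun x t => b x t + c x t) (fun x t => b' x t + c' x t) (K + L) :=
  ⟨hb.tc1.add hc.tc1, fun t => (hb.contDiffOn t).add (hc.contDiffOn t),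
    fun x hx t => (abs_add_le _ _).trans (add_le_add (hb.bound x hx t) (hc.bound x hx t)),
    fun x hx t => (abs_add_le _ _).trans (add_le_add (hb.bound' x hx t) (hc.bound' x hx t))⟩

lemma exists_isCoef_perturb (hbd : ∀ j, IsBC1 (bd j)) {bt' : Fin n → Fin n → ℝ → ℝ → ℝ}
    {K : Fin n → Fin n → ℝ} (hbt : ∀ j k, IsCoef (bt j k) (bt' j k) (K j k)) :
    ∃ (b' : Fin n → Fin n → ℝ → ℝ → ℝ) (K' : Fin n → Fin n → ℝ),
      ∀ j k, IsCoef (perturb bd bt j k) (b' j k) (K' j k) := by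
  choose L hL using fun j => (hbd j).exists_isCoef
  have h : ∀ j k, ∃ b' K', IsCoef (perturb bd bt j k) b' K' := by
    intro j k
    unfold perturb
    by_cases hjk : j = k
    · simp only [hjk, if_true]
      exact ⟨_, _, (hL k).add (hbt k k)⟩
    · simp only [hjk, if_false]
      exact ⟨_, _, IsCoef.zero.add (hbt j k)⟩
  choose b' K' h using h
  exact ⟨b', K', h⟩

lemma abs_perturb_le (hbd : ∀ j, IsBC1 (bd j)) {ε : ℝ}
    (hε : ∀ j k, ∀ x ∈ Icc (0 : ℝ) 1, ∀ t, |bt j k x t| ≤ ε) (j k : Fin n) {x : ℝ}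
    (hx : x ∈ Icc (0 : ℝ) 1) (t : ℝ) : |perturb bd bt j k x t| ≤ ∑ j, supNorm (bd j) + ε := by
  unfold perturb
  refine (abs_add_le _ _).trans (add_le_add ?_ (hε j k x hx t))
  have h0 : 0 ≤ ∑ j, supNorm (bd j) := Finset.sum_nonneg fun _ _ => supNorm_nonneg _
  split_ifs
  · exact ((hbd j).abs_le_supNorm hx t).trans (Finset.single_le_sum
      (f := fun j => supNorm (bd j)) (fun _ _ => supNorm_nonneg _) (Finset.mem_univ j))
  · simpa using h0

lemma sq_sum_mul_le {ε : ℝ} {c w : Fin n → ℝ} (hc : ∀ k, |c k| ≤ ε) :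
    (∑ k, c k * w k) ^ 2 ≤ n * ε ^ 2 * ∑ k, w k ^ 2 := by
  refine (Finset.sum_mul_sq_le_sq_mul_sq _ _ _).trans ?_
  refine mul_le_mul_of_nonneg_right ?_ (Finset.sum_nonneg fun _ _ => sq_nonneg _)
  refine (Finset.sum_le_sum fun k _ => ?_ : _ ≤ ∑ _k : Fin n, ε ^ 2).trans (by simp)
  exact sq_le_sq' (neg_le_of_abs_le (hc k)) (le_of_abs_le (hc k))

/-- Under the extinction condition, small perturbations leave only a small part of the initial
value after a fixed time. -/
lemma Setting.exists_small (S : Setting m a) (hbd : ∀ j, IsBC1 (bd j))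
    (hext : FiniteExtinction m p a bd) :
    ∃ T C : ℝ, 0 < T ∧ 0 ≤ C ∧ ∀ (bt : Fin n → Fin n → ℝ → ℝ → ℝ) (ε : ℝ), 0 ≤ ε → ε ≤ 1 →
      (∀ j k, IsBC1 (bt j k)) → (∀ j k, ∀ x ∈ Icc (0 : ℝ) 1, ∀ t, |bt j k x t| ≤ ε) →
      ∀ (τ : ℝ) (φ : Fin n → ℝ → ℝ) (w : Fin n → ℝ → ℝ → ℝ), (∀ j, IsTest (φ j)) →
        IsClassicalSolution m p a (perturb bd bt) τ φ w →
        ‖toL2 fun j x => w j x (τ + T)‖ ≤ C * ε * ‖toL2 φ‖ := by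
  obtain ⟨N, hN⟩ := hext
  -- The extinction time of the decoupled problem; the summand `1` makes it positive even for `N =
  -- 0`.
  set T : ℝ := N * S.Λ⁻¹ + 1 with hT
  have hT0 : 0 < T := by have := S.Λ_pos; positivity
  have hL0 : 0 ≤ ∑ j, supNorm (bd j) + 1 := by
    have : 0 ≤ ∑ j, supNorm (bd j) := Finset.sum_nonneg fun _ _ => supNorm_nonneg _
    linarith
  obtain ⟨C, κ, hC, hκ, hE⟩ := S.exists_energy p hL0
  set Q : ℝ := n * n * (C * Real.exp (κ * T)) with hQ
  have hQ0 : 0 ≤ Q := by positivity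
  set Q' : ℝ := C * Real.exp (κ * T) * (T * Q) * n with hQ'
  have hQpos : 0 ≤ Q' := by positivity
  refine ⟨T, Real.sqrt Q', hT0, Real.sqrt_nonneg _, ?_⟩
  intro bt ε hε0 hε1 hbt hbtε τ φ w hφ hw
  choose Kt hKt using fun j k => (hbt j k).exists_isCoef
  obtain ⟨b', K, hb⟩ := exists_isCoef_perturb hbd hKt
  obtain ⟨c', K', hc⟩ := exists_isCoef_perturb hbd (bt := fun _ _ _ _ => (0 : ℝ)) (n := n)
    fun _ _ => IsCoef.zero
  obtain ⟨u, hu⟩ := S.exists_classical p hc τ hφ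
  obtain ⟨ux, ut, hus⟩ := hu.isSol S hc
  obtain ⟨wx, wt, hws⟩ := hw.isSol S hb
  have hbL : ∀ j k, ∀ x ∈ Icc (0 : ℝ) 1, ∀ t, |perturb bd bt j k x t| ≤ ∑ j, supNorm (bd j) + 1 :=
    fun j k x hx t => (abs_perturb_le hbd hbtε j k hx t).trans (by linarith)
  have hcL : ∀ j k, ∀ x ∈ Icc (0 : ℝ) 1, ∀ t,
      |perturb bd (fun _ _ _ _ => (0 : ℝ)) j k x t| ≤ ∑ j, supNorm (bd j) + 1 :=
    fun j k x hx t => (abs_perturb_le hbd (ε := 0) (by simp) j k hx t).trans (by linarith)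
  have hsolu : ∀ t, τ ≤ t → sqn u t ≤ C * Real.exp (κ * (t - τ)) * sqn u τ := by
    intro t ht
    have := hE _ _ _ hc hcL τ _ u ux ut hus (fun _ => 0) continuous_const
      (fun t _ => by simp [sqn]) t ht
    rw [intervalIntegral.integral_zero, add_zero] at this
    linarith [integral_tr_nonneg (m := m) ht u]
  -- The difference of the perturbed and the decoupled solution solves the perturbed problem with
  -- zero initial value. Its source is the perturbation applied to the decoupled solution, which
  -- makes it of order `ε`.
  obtain ⟨g, v, vx, vt, hv, hvw, hgu⟩ : ∃ g v vx vt : Fin n → ℝ → ℝ → ℝ,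
      IsSol m p a (perturb bd bt) τ g v vx vt ∧ (∀ j x t, v j x t = w j x t - u j x t) ∧
      ∀ j x t, g j x t = -∑ k, bt j k x t * u k x t := by
    refine ⟨_, _, _, _, hws.sub hus, fun _ _ _ => rfl, fun j x t => ?_⟩
    simp only [perturb, sub_self, zero_add, add_zero, sub_add_cancel_left, neg_mul,
      Finset.sum_neg_distrib]
  have hgN : ∀ t, τ ≤ t → sqn g t ≤ n * n * ε ^ 2 * (C * Real.exp (κ * (t - τ)) * sqn u τ) := by
    intro t ht
    refine le_trans ?_ (mul_le_mul_of_nonneg_left (hsolu t ht) (by positivity))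
    have i2 : ∀ k, IntervalIntegrable (fun x => u k x t ^ 2) volume 0 1 :=
      fun k => intervalIntegrable_of_Icc ((continuousOn_slice (hus.cu k) ht).pow 2)
    have i1 : IntervalIntegrable (fun x => ∑ k, u k x t ^ 2) volume 0 1 :=
      intervalIntegrable_of_Icc (continuousOn_finsetSum _ fun k _ =>
        (continuousOn_slice (hus.cu k) ht).pow 2)
    have : ∀ j, ∫ x in (0 : ℝ)..1, g j x t ^ 2 ≤ n * ε ^ 2 * sqn u t := by
      intro j
      rw [sqn, ← intervalIntegral.integral_finsetSum (fun k _ => i2 k),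
        ← intervalIntegral.integral_const_mul]
      refine intervalIntegral.integral_mono_on zero_le_one
        (intervalIntegrable_of_Icc ((continuousOn_slice (hv.cg S hb j) ht).pow 2))
        (i1.const_mul _) fun x hx => ?_
      rw [hgu, neg_sq]
      exact sq_sum_mul_le fun k => hbtε j k x hx t
    refine (Finset.sum_le_sum fun j _ => this j).trans (le_of_eq ?_)
    simp; ring
  have hini : (toL2 fun j x => u j x τ) = toL2 φ := hu.toL2_initial hus fun j => (hφ j).memLp
  have hsq : sqn u τ ≤ n * ‖toL2 φ‖ ^ 2 := by rw [← hini]; exact sqn_le_norm hus le_rfl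
  have hv0 : sqn v τ = 0 := by
    unfold sqn
    refine Finset.sum_eq_zero fun j _ => ?_
    rw [intervalIntegral.integral_congr (g := fun _ => (0 : ℝ)), intervalIntegral.integral_zero]
    intro x hx
    rw [uIcc_of_le zero_le_one] at hx
    simp [hvw, hw.initial j x hx, hu.initial j x hx]
  have h1 := hE _ _ _ hb hbL τ g v vx vt hv
    (fun t => n * n * ε ^ 2 * (C * Real.exp (κ * (t - τ)) * sqn u τ)) (by fun_prop) hgN (τ + T)
    (by linarith)
  have h2 : ∫ s in τ..τ + T, n * n * ε ^ 2 * (C * Real.exp (κ * (s - τ)) * sqn u τ) ≤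
      T * Q * ε ^ 2 * sqn u τ := by
    have : ∫ s in τ..τ + T, n * n * ε ^ 2 * (C * Real.exp (κ * (s - τ)) * sqn u τ) ≤
        ∫ _s in τ..τ + T, Q * ε ^ 2 * sqn u τ := by
      refine intervalIntegral.integral_mono_on (by linarith)
        (Continuous.intervalIntegrable (by fun_prop) _ _) intervalIntegrable_const fun s hs => ?_
      have : Real.exp (κ * (s - τ)) ≤ Real.exp (κ * T) :=
        Real.exp_le_exp.2 (mul_le_mul_of_nonneg_left (by linarith [hs.2]) hκ)
      have h0 := sqn_nonneg u τ
      calc n * n * ε ^ 2 * (C * Real.exp (κ * (s - τ)) * sqn u τ)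
          ≤ n * n * ε ^ 2 * (C * Real.exp (κ * T) * sqn u τ) := by gcongr
        _ = Q * ε ^ 2 * sqn u τ := by rw [hQ]; ring
    refine this.trans (le_of_eq ?_)
    rw [intervalIntegral.integral_const, smul_eq_mul]; ring
  -- At this time the decoupled solution is extinct, so the perturbed solution consists of the small
  -- difference alone.
  have hwv : sqn w (τ + T) = sqn v (τ + T) := by
    unfold sqn
    refine Finset.sum_congr rfl fun j _ => intervalIntegral.integral_congr fun x hx => ?_
    rw [uIcc_of_le zero_le_one] at hx
    simp only [hvw]
    rw [S.extinction hbd hN hus j hx (by linarith), sub_zero]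
  refine norm_le_of_sqn hws (by linarith) (by positivity) ?_
  rw [hwv]
  have h3 := integral_tr_nonneg (m := m) (show τ ≤ τ + T by linarith) v
  rw [hv0, zero_add, add_sub_cancel_left] at h1
  calc sqn v (τ + T) ≤ C * Real.exp (κ * T) * (T * Q * ε ^ 2 * sqn u τ) := by
        refine le_trans (by linarith) (h1.trans (mul_le_mul_of_nonneg_left h2 (by positivity)))
    _ ≤ C * Real.exp (κ * T) * (T * Q * ε ^ 2 * (n * ‖toL2 φ‖ ^ 2)) := by gcongr
    _ = Q' * ε ^ 2 * ‖toL2 φ‖ ^ 2 := by rw [hQ']; ring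
    _ = _ := by rw [mul_pow, mul_pow, Real.sq_sqrt hQpos]

/-- Exponential decay with an arbitrary rate, uniformly for small perturbations. -/
theorem Setting.exists_decay (S : Setting m a) (hbd : ∀ j, IsBC1 (bd j))
    (hext : FiniteExtinction m p a bd) {γ : ℝ} (hγ : 0 < γ) :
    ∃ M ε : ℝ, 1 ≤ M ∧ 0 < ε ∧ ∀ bt : Fin n → Fin n → ℝ → ℝ → ℝ, (∀ j k, IsBC1 (bt j k)) →
      (∀ j k, supNorm (bt j k) < ε) → ∀ U, IsGenerated m p a (perturb bd bt) U →
        ∀ τ t : ℝ, τ ≤ t → ‖U t τ‖ ≤ M * Real.exp (-γ * (t - τ)) := by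
  obtain ⟨T, C₀, hT, hC₀, hsm⟩ := S.exists_small hbd hext
  have hL0 : 0 ≤ ∑ j, supNorm (bd j) + 1 := by
    have : 0 ≤ ∑ j, supNorm (bd j) := Finset.sum_nonneg fun _ _ => supNorm_nonneg _
    linarith
  obtain ⟨C, κ, hC, hκ, hE⟩ := S.exists_norm_bound p hL0
  -- One period then contracts by `exp (-γ T)`; the bound by `1` keeps the coefficients within the
  -- range for which the constants were chosen.
  set ε : ℝ := min 1 (Real.exp (-γ * T) / (C₀ + 1)) with hε
  have hε0 : 0 < ε := lt_min one_pos (by positivity)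
  have hC₀ε : C₀ * ε ≤ Real.exp (-γ * T) := by
    have h1 : ε ≤ Real.exp (-γ * T) / (C₀ + 1) := min_le_right _ _
    rw [le_div_iff₀ (by positivity)] at h1
    nlinarith
  refine ⟨C * Real.exp ((κ + γ) * T), ε, ?_, hε0, ?_⟩
  · have : 1 ≤ Real.exp ((κ + γ) * T) := Real.one_le_exp (by positivity)
    nlinarith
  intro bt hbt hbtε U hU τ t ht
  have hbtb : ∀ j k, ∀ x ∈ Icc (0 : ℝ) 1, ∀ t, |bt j k x t| ≤ ε := fun j k x hx t =>
    ((hbt j k).abs_le_supNorm hx t).trans (hbtε j k).le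
  choose Kt hKt using fun j k => (hbt j k).exists_isCoef
  obtain ⟨b', K, hb⟩ := exists_isCoef_perturb hbd hKt
  refine hU.1.exp_decay (by linarith) hκ hγ.le hT (fun τ t ht => ?_) (fun τ => ?_) ht
  · refine hU.norm_le S hb ht (by positivity) fun φ u hφ hu => ?_
    obtain ⟨ux, ut, hus⟩ := hu.isSol S hb
    rw [← hu.toL2_initial hus fun j => (hφ j).memLp]
    exact hE _ _ _ hb (fun j k x hx t => (abs_perturb_le hbd hbtb j k hx t).trans
      (by linarith [min_le_left 1 (Real.exp (-γ * T) / (C₀ + 1))])) τ u ux ut hus t ht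
  · refine hU.norm_le S hb (by linarith) (Real.exp_pos _).le fun φ u hφ hu => ?_
    refine (hsm bt ε hε0.le (min_le_left _ _) hbt hbtb τ φ u hφ hu).trans ?_
    exact mul_le_mul_of_nonneg_right hC₀ε (norm_nonneg _)

end

end

end Hyp

namespace Hyp

noncomputable section

/-! ### Transport of time derivatives -/

lemma TC1.exp {f f' : ℝ → ℝ → ℝ} (hf : TC1 f f') :
    TC1 (fun x t => Real.exp (f x t)) (fun x t => Real.exp (f x t) * f' x t) :=
  ⟨Real.continuous_exp.comp hf.cont, (Real.continuous_exp.comp hf.cont).mul hf.cont',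
    fun x t => (hf.deriv x t).exp⟩

/-- Hermite interpolation: a smooth function with prescribed simple zeros and slopes. -/
lemma exists_slopes (s : Finset ℝ) (c : ℝ → ℝ) :
    ∃ f : ℝ → ℝ, Continuous f ∧ ∀ x ∈ s, f x = 0 ∧ HasDerivAt f (c x) x := by
  classical
  -- The nodal polynomial gives the zeros. At a node only its own derivative survives in the product
  -- rule, and the nodal weight in the interpolated values is the reciprocal of that derivative.
  set P : Polynomial ℝ := Lagrange.nodal s id * Lagrange.interpolate s id
    (fun x => c x * Lagrange.nodalWeight s id x) with hP
  refine ⟨fun x => P.eval x, P.continuous, fun x hx => ?_⟩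
  have h0 : (Lagrange.nodal s id).eval x = 0 := Lagrange.eval_nodal_at_node (v := id) hx
  have hw := Lagrange.nodalWeight_ne_zero (v := id) (injOn_id _) hx
  refine ⟨by simp [hP, h0], ?_⟩
  have h1 := P.hasDerivAt x
  refine h1.congr_deriv ?_
  have h2 : (Lagrange.interpolate s id (fun x => c x * Lagrange.nodalWeight s id x)).eval x =
      c x * Lagrange.nodalWeight s id x :=
    Lagrange.eval_interpolate_at_node _ (v := id) (injOn_id _) hx
  have h3 := Lagrange.nodalWeight_eq_eval_derivative_nodal (v := (id : ℝ → ℝ)) hx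
  rw [hP, Polynomial.derivative_mul, Polynomial.eval_add, Polynomial.eval_mul, Polynomial.eval_mul,
    h0, h2, zero_mul, add_zero]
  have h4 : (Polynomial.derivative (Lagrange.nodal s (id : ℝ → ℝ))).eval x ≠ 0 := by
    intro h; rw [id_eq, h, inv_zero] at h3; exact hw h3
  rw [h3, id_eq]
  field_simp

section

variable {n m : ℕ} {p : Matrix (Fin n) (Fin n) ℝ} {a : Fin n → ℝ → ℝ → ℝ}
  {bd : Fin n → ℝ → ℝ → ℝ}

namespace Setting

lemma exists_tc1_wgt (S : Setting m a) (hbd : ∀ j, IsBC1 (bd j)) (j : Fin n) :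
    ∃ w', TC1 (S.wgt bd j) w' := by
  have h1 := ((hbd j).tc1.comp (S.tc1_y j) continuous_id).mul
    ((S.tc1_inv_a j).comp (S.tc1_y j) continuous_id)
  have h2 := (h1.primitive (inlet m j)).neg.exp
  refine ⟨_, h2.congr (fun x s => ?_) fun _ _ => rfl⟩
  unfold wgt
  rw [intervalIntegral.integral_symm]
  rfl

/-- The transport operator for time derivatives. -/
def trans' (S : Setting m a) (p : Matrix (Fin n) (Fin n) ℝ) (bd : Fin n → ℝ → ℝ → ℝ)
    (z : Fin n → ℝ → ℝ → ℝ) (j : Fin n) (x t : ℝ) : ℝ :=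
  S.wgt bd j x (S.σ j x t) * S.σt j x t * opP m p z j (S.σ j x t)

/-- The time derivatives of `(CP)^k u` at a point depend on the time derivatives of `u` at finitely
many points, if `u` vanishes there. -/
lemma exists_finite_dependence (S : Setting m a) (p : Matrix (Fin n) (Fin n) ℝ)
    (hbd : ∀ j, IsBC1 (bd j)) (z : Fin n → ℝ → ℝ → ℝ) (k : ℕ) :
    ∀ (j : Fin n) (t : ℝ), ∃ s : Finset ℝ, ∀ u : Fin n → ℝ → ℝ → ℝ,
      (∀ i, ∀ r ∈ s, u i (outlet m i) r = 0 ∧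
        HasDerivAt (fun r => u i (outlet m i) r) (z i (outlet m i) r) r) →
      (fun w => opC m a bd (opP m p w))^[k] u j (outlet m j) t = 0 ∧
      HasDerivAt (fun t => (fun w => opC m a bd (opP m p w))^[k] u j (outlet m j) t)
        ((S.trans' p bd)^[k] z j (outlet m j) t) t := by
  classical
  induction k with
  | zero =>
    intro j t
    exact ⟨{t}, fun u hu => hu j t (Finset.mem_singleton_self t)⟩
  | succ k ih =>
    intro j t
    set x := outlet m j with hx
    have hx1 : x ∈ Icc (0 : ℝ) 1 := outlet_mem m j
    set r := S.σ j x t with hr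
    choose s hs using fun i => ih i r
    refine ⟨Finset.univ.biUnion s, fun u hu => ?_⟩
    have h1 := fun i => hs i u fun l q hq => hu l q
      (Finset.mem_biUnion.2 ⟨i, Finset.mem_univ i, hq⟩)
    simp only [Function.iterate_succ_apply']
    set w := (fun w => opC m a bd (opP m p w))^[k] u with hw
    have e : ∀ t, opC m a bd (opP m p w) j x t =
        S.wgt bd j x (S.σ j x t) * ∑ i, p j i * w i (outlet m i) (S.σ j x t) := fun t => by
      rw [S.opC_eq bd _ j hx1, opP_eq]
    have h0 : ∑ i, p j i * w i (outlet m i) r = 0 :=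
      Finset.sum_eq_zero fun i _ => by rw [(h1 i).1, mul_zero]
    refine ⟨by rw [e, ← hr, h0, mul_zero], ?_⟩
    simp only [e]
    obtain ⟨w', hw'⟩ := S.exists_tc1_wgt hbd j
    have d1 := (S.tc1_σ j).deriv x t
    have d2 : HasDerivAt (fun t => S.wgt bd j x (S.σ j x t)) (w' x r * S.σt j x t) t :=
      (hw'.deriv x r).comp t d1
    have d3 : HasDerivAt (fun r => ∑ i, p j i * w i (outlet m i) r)
        (∑ i, p j i * (S.trans' p bd)^[k] z i (outlet m i) r) r :=
      HasDerivAt.fun_sum fun i _ => (h1 i).2.const_mul _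
    have d4 : HasDerivAt (fun t => ∑ i, p j i * w i (outlet m i) (S.σ j x t))
        ((∑ i, p j i * (S.trans' p bd)^[k] z i (outlet m i) r) * S.σt j x t) t :=
      d3.comp t d1
    -- The term with the derivative of the weight is multiplied by the reflected values at `r`,
    -- which vanish; this is why zeros are prescribed along with slopes.
    refine (d2.mul d4).congr_deriv ?_
    rw [← hr, h0, mul_zero, zero_add, trans', opP_eq, ← hr]
    ring

/-- Finite time extinction carries over to the transport of time derivatives. -/
lemma trans'_nilpotent (S : Setting m a) (hbd : ∀ j, IsBC1 (bd j)) {N : ℕ}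
    (hN : ∀ u : Fin n → ℝ → ℝ → ℝ, (∀ j, ContinuousOn (fun z : ℝ × ℝ => u j z.1 z.2) strip) →
      ∀ j, ∀ x ∈ Icc (0 : ℝ) 1, ∀ t : ℝ, (fun w => opC m a bd (opP m p w))^[N] u j x t = 0)
    (z : Fin n → ℝ → ℝ → ℝ) (j : Fin n) (x t : ℝ) : (S.trans' p bd)^[N + 1] z j x t = 0 := by
  have key : ∀ j t, (S.trans' p bd)^[N] z j (outlet m j) t = 0 := by
    intro j t
    obtain ⟨s, hs⟩ := S.exists_finite_dependence p hbd z N j t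
    -- A continuous function, independent of `x`, with zeros and the slopes given by `z` at the
    -- finitely many relevant times. Extinction makes its `N`-th iterate zero identically, so the
    -- derivative, which is the iterate of `trans'` on `z`, is zero. No regularity of `z` is needed.
    choose f hfc hf using fun i => exists_slopes s (z i (outlet m i))
    have h := (hs (fun i _ t => f i t) fun i r hr => hf i r hr).2
    have h0 : (fun t => (fun w => opC m a bd (opP m p w))^[N] (fun i _ t => f i t) j
        (outlet m j) t) = fun _ => 0 := funext fun t =>
      hN _ (fun i => ((hfc i).comp continuous_snd).continuousOn) j _ (outlet_mem m j) t
    rw [h0] at h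
    exact h.unique (hasDerivAt_const t 0)
  -- So far vanishing is known at the outlets only. As `trans'` reads nothing but outlet values, one
  -- more application gives it everywhere; hence the exponent `N + 1`.
  rw [Function.iterate_succ_apply', trans', opP_eq, Finset.sum_eq_zero, mul_zero]
  intro i _
  rw [key, mul_zero]

lemma continuous_trans' (S : Setting m a) (hbd : ∀ j, IsBC1 (bd j)) {z : Fin n → ℝ → ℝ → ℝ}
    (hz : ∀ j, Continuous fun q : ℝ × ℝ => z j q.1 q.2) (j : Fin n) :
    Continuous fun q : ℝ × ℝ => S.trans' p bd z j q.1 q.2 := by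
  obtain ⟨w', hw'⟩ := S.exists_tc1_wgt hbd j
  unfold trans'
  simp only [opP_eq]
  refine ((hw'.comp_cont continuous_fst (S.tc1_σ j).cont).mul (S.tc1_σ j).cont').mul
    (continuous_finsetSum _ fun k _ => continuous_const.mul ?_)
  exact (hz k).comp (continuous_const.prodMk (S.tc1_σ j).cont)

lemma trans'_sub (S : Setting m a) (z w : Fin n → ℝ → ℝ → ℝ) :
    S.trans' p bd (fun j x t => z j x t - w j x t) =
      fun j x t => S.trans' p bd z j x t - S.trans' p bd w j x t := by
  funext j x t
  simp only [trans', opP_eq, mul_sub, Finset.sum_sub_distrib]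

/-- A function is recovered from its defect with respect to the nilpotent transport operator. -/
lemma eq_sum_iterate (S : Setting m a) {N : ℕ} (z : Fin n → ℝ → ℝ → ℝ)
    (hz : ∀ j x t, (S.trans' p bd)^[N] z j x t = 0) (j : Fin n) (x t : ℝ) :
    z j x t = ∑ i ∈ Finset.range N,
      (S.trans' p bd)^[i] (fun j x t => z j x t - S.trans' p bd z j x t) j x t := by
  have h : ∀ i, (S.trans' p bd)^[i] (fun j x t => z j x t - S.trans' p bd z j x t) =
      fun j x t => (S.trans' p bd)^[i] z j x t - (S.trans' p bd)^[i + 1] z j x t := by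
    intro i
    induction i with
    | zero => rfl
    | succ i ih =>
      rw [Function.iterate_succ_apply', ih, trans'_sub, ← Function.iterate_succ_apply' (S.trans' p bd),
        ← Function.iterate_succ_apply' (S.trans' p bd)]
  simp only [h]
  rw [Finset.sum_range_sub' (fun i => (S.trans' p bd)^[i] z j x t), hz, sub_zero]
  rfl

end Setting

end

end

end Hyp

namespace Hyp

noncomputable section

/-! ### The equation for the modified time derivative -/

lemma abs_sum_mul_le {n : ℕ} {R : ℝ} {c w : Fin n → ℝ} (hc : ∀ k, |c k| ≤ R) :
    |∑ k, c k * w k| ≤ R * ∑ k, |w k| := by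
  rw [Finset.mul_sum]
  refine (Finset.abs_sum_le_sum_abs _ _).trans (Finset.sum_le_sum fun k _ => ?_)
  rw [abs_mul]
  exact mul_le_mul_of_nonneg_right (hc k) (abs_nonneg _)

/-- The oscillation of a function is controlled by the integral of a bound of its derivative. -/
lemma abs_sub_le_integral {f f' h : ℝ → ℝ} (hh : Continuous h)
    (hf : ∀ x ∈ Icc (0 : ℝ) 1, HasDerivWithinAt f (f' x) (Icc 0 1) x)
    (hb : ∀ x ∈ Icc (0 : ℝ) 1, |f' x| ≤ h x) {x y : ℝ} (hx : x ∈ Icc (0 : ℝ) 1)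
    (hy : y ∈ Icc (0 : ℝ) 1) : |f x - f y| ≤ ∫ ξ in (0 : ℝ)..1, h ξ := by
  have hI : ∀ x, HasDerivAt (fun x => ∫ ξ in (0 : ℝ)..x, h ξ) (h x) x := fun x =>
    (hh.integral_hasStrictDerivAt 0 x).hasDerivAt
  have hfc : ContinuousOn f (Icc 0 1) := fun x hx => (hf x hx).continuousWithinAt
  have hin : ∀ x ∈ interior (Icc (0 : ℝ) 1), HasDerivAt f (f' x) x := fun x hx =>
    (hf x (interior_subset hx)).hasDerivAt (mem_interior_iff_mem_nhds.1 hx)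
  have m1 : MonotoneOn (fun x => f x + ∫ ξ in (0 : ℝ)..x, h ξ) (Icc 0 1) := by
    refine monotoneOn_of_deriv_nonneg (convex_Icc 0 1)
      (hfc.add fun x _ => (hI x).continuousAt.continuousWithinAt)
      (fun x hx => ((hin x hx).add (hI x)).differentiableAt.differentiableWithinAt) fun x hx => ?_
    have := ((hin x hx).add (hI x)).deriv
    rw [show (fun x => f x + ∫ ξ in (0 : ℝ)..x, h ξ) = (f + fun x => ∫ ξ in (0 : ℝ)..x, h ξ)
      from rfl, this]
    linarith [neg_le_of_abs_le (hb x (interior_subset hx))]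
  have m2 : AntitoneOn (fun x => f x - ∫ ξ in (0 : ℝ)..x, h ξ) (Icc 0 1) := by
    refine antitoneOn_of_deriv_nonpos (convex_Icc 0 1)
      (hfc.sub fun x _ => (hI x).continuousAt.continuousWithinAt)
      (fun x hx => ((hin x hx).sub (hI x)).differentiableAt.differentiableWithinAt) fun x hx => ?_
    have := ((hin x hx).sub (hI x)).deriv
    rw [show (fun x => f x - ∫ ξ in (0 : ℝ)..x, h ξ) = (f - fun x => ∫ ξ in (0 : ℝ)..x, h ξ)
      from rfl, this]
    linarith [le_of_abs_le (hb x (interior_subset hx))]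
  have h0 : ∀ ξ ∈ Icc (0 : ℝ) 1, 0 ≤ h ξ := fun ξ hξ => (abs_nonneg _).trans (hb ξ hξ)
  have hle : ∀ {x y : ℝ}, x ∈ Icc (0 : ℝ) 1 → y ∈ Icc (0 : ℝ) 1 → x ≤ y →
      (∫ ξ in (0 : ℝ)..y, h ξ) - (∫ ξ in (0 : ℝ)..x, h ξ) ≤ ∫ ξ in (0 : ℝ)..1, h ξ := by
    intro x y hx hy hxy
    have i := fun c d => hh.intervalIntegrable (μ := volume) c d
    have e1 := intervalIntegral.integral_add_adjacent_intervals (i 0 y) (i y 1)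
    have e2 : 0 ≤ ∫ ξ in y..1, h ξ := intervalIntegral.integral_nonneg hy.2 fun ξ hξ =>
      h0 ξ ⟨hy.1.trans hξ.1, hξ.2⟩
    have e3 : 0 ≤ ∫ ξ in (0 : ℝ)..x, h ξ := intervalIntegral.integral_nonneg hx.1 fun ξ hξ =>
      h0 ξ ⟨hξ.1, hξ.2.trans hx.2⟩
    linarith
  have main : ∀ {x y : ℝ}, x ∈ Icc (0 : ℝ) 1 → y ∈ Icc (0 : ℝ) 1 → x ≤ y →
      |f x - f y| ≤ ∫ ξ in (0 : ℝ)..1, h ξ := by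
    intro x y hx hy hxy
    have a1 := m1 hx hy hxy
    have a2 := m2 hx hy hxy
    have a3 := hle hx hy hxy
    simp only at a1 a2
    rw [abs_le]; constructor <;> linarith
  rcases le_total x y with hxy | hxy
  · exact main hx hy hxy
  · rw [abs_sub_comm]; exact main hy hx hxy

section

variable {n m : ℕ} {p : Matrix (Fin n) (Fin n) ℝ} {a : Fin n → ℝ → ℝ → ℝ}
  {bd : Fin n → ℝ → ℝ → ℝ} {bt e b' : Fin n → Fin n → ℝ → ℝ → ℝ} {τ : ℝ}
  {g u ux ut : Fin n → ℝ → ℝ → ℝ}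

/-- Every solution coincides on its half-strip with functions that are defined on the plane. -/
lemma IsSol.exists_global {b : Fin n → Fin n → ℝ → ℝ → ℝ} (h : IsSol m p a b τ g u ux ut) :
    ∃ v vt, IsSol m p a b τ g v ux vt ∧ (∀ j, TC1 (v j) (vt j)) ∧
      ∀ j, ∀ x ∈ Icc (0 : ℝ) 1, ∀ t ∈ Ici τ, v j x t = u j x t ∧ vt j x t = ut j x t := by
  choose v vt hv hvu using h.exists_tc1
  refine ⟨v, vt, ⟨h.cx, fun j => (h.ct j).congr fun z hz => (hvu j z.1 hz.1 z.2 hz.2).2, ?_, ?_, ?_⟩,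
    hv, hvu⟩
  · intro j x hx t ht
    rw [(hvu j x hx t ht).2]
    exact (h.hd j x hx t ht).congr (fun z hz => (hvu j z.1 hz.1 z.2 hz.2).1) (hvu j x hx t ht).1
  · intro j x hx t ht
    rw [(hvu j x hx t ht).2, ← h.pde j x hx t ht]
    congr 1
    exact Finset.sum_congr rfl fun k _ => by rw [(hvu k x hx t ht).1]
  · intro j t ht
    rw [(hvu j _ (inlet_mem m j) t ht).1, h.boundary j t ht, opP_eq, opP_eq]
    exact Finset.sum_congr rfl fun k _ => by rw [(hvu k _ (outlet_mem m k) t ht).1]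

/-- The constants of a problem that satisfies the Levy condition: a common bound `R` for the
coefficients, and functions `e` with `bt_{jk} a_k = e_{jk} (a_k - a_j)`. -/
structure LevyData (S : Setting m a) (p : Matrix (Fin n) (Fin n) ℝ) (bd : Fin n → ℝ → ℝ → ℝ)
    (bt e b' : Fin n → Fin n → ℝ → ℝ → ℝ) (R : ℝ) : Prop where
  bd_bc1 : ∀ j, IsBC1 (bd j)
  e_bc1 : ∀ j k, IsBC1 (e j k)
  rel : ∀ j k, ∀ x ∈ Icc (0 : ℝ) 1, ∀ t, bt j k x t * a k x t = e j k x t * (a k x t - a j x t)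
  coef : ∀ j k, IsCoef (perturb bd bt j k) (b' j k) R
  bd_le : ∀ j, ∀ x ∈ Icc (0 : ℝ) 1, ∀ t, |bd j x t| ≤ R
  e_le : ∀ j k, ∀ x ∈ Icc (0 : ℝ) 1, ∀ t,
    |e j k x t| ≤ R ∧ |dx (e j k) x t| ≤ R ∧ |dt (e j k) x t| ≤ R
  inv_le : ∀ j, ∀ x ∈ Icc (0 : ℝ) 1, ∀ t, |(a j x t)⁻¹| ≤ R ∧ |-dt (a j) x t / a j x t ^ 2| ≤ R
  p_le : ∀ j k, |p j k| ≤ R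
  D_le : S.D ≤ R
  wgt_le : ∀ j, ∀ x ∈ Icc (0 : ℝ) 1, ∀ s, S.wgt bd j x s ≤ R ∧ (S.wgt bd j x s)⁻¹ ≤ R

variable {R : ℝ} {S : Setting m a}

lemma LevyData.R_pos (hD : LevyData S p bd bt e b' R) : 1 ≤ R := S.one_le_D.trans hD.D_le

/-- The derivative of the `j`-th component along its characteristics. -/
def charH (a : Fin n → ℝ → ℝ → ℝ) (b : Fin n → Fin n → ℝ → ℝ → ℝ) (u : Fin n → ℝ → ℝ → ℝ)
    (j : Fin n) (x t : ℝ) : ℝ := -((a j (cl x) t)⁻¹ * ∑ k, b j k (cl x) t * u k x t)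

/-- The time derivative of `charH`. -/
def charH' (a : Fin n → ℝ → ℝ → ℝ) (b b' : Fin n → Fin n → ℝ → ℝ → ℝ)
    (u ut : Fin n → ℝ → ℝ → ℝ) (j : Fin n) (x t : ℝ) : ℝ :=
  -((-dt (a j) (cl x) t / a j (cl x) t ^ 2) * ∑ k, b j k (cl x) t * u k x t +
    (a j (cl x) t)⁻¹ * ∑ k, (b' j k (cl x) t * u k x t + b j k (cl x) t * ut k x t))

lemma tc1_charH (S : Setting m a) {b : Fin n → Fin n → ℝ → ℝ → ℝ}
    (hb : ∀ j k, IsCoef (b j k) (b' j k) R) (hu : ∀ j, TC1 (u j) (ut j)) (j : Fin n) :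
    TC1 (charH a b u j) (charH' a b b' u ut j) :=
  ((S.tc1_inv_a j).mul (TC1.sum Finset.univ fun k _ => (hb j k).tc1.mul (hu k))).neg

/-- The first order equation in integrated form. -/
lemma IsSol.eq_integral {b : Fin n → Fin n → ℝ → ℝ → ℝ} (hb : ∀ j k, IsCoef (b j k) (b' j k) R)
    (h : IsSol m p a b τ (fun _ _ _ => 0) u ux ut) (hu : ∀ j, TC1 (u j) (ut j)) (j : Fin n)
    {s : ℝ} (hs : τ ≤ s) {x : ℝ} (hx : x ∈ Icc (0 : ℝ) 1) :
    u j x (S.y j x s) = u j (inlet m j) s + ∫ ξ in inlet m j..x, charH a b u j ξ (S.y j ξ s) := by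
  have hc : Continuous fun ξ => charH a b u j ξ (S.y j ξ s) :=
    (tc1_charH S hb hu j).comp_cont continuous_id
      ((S.tc1_y j).comp_cont continuous_id continuous_const)
  have hd : ∀ x ∈ Icc (0 : ℝ) 1, HasDerivWithinAt (fun x => u j x (S.y j x s) -
      ∫ ξ in inlet m j..x, charH a b u j ξ (S.y j ξ s)) 0 (Icc 0 1) x := by
    intro x hx
    refine ((h.hasDerivWithinAt_char S j hs hx).sub
      (hc.integral_hasStrictDerivAt (inlet m j) x).hasDerivAt.hasDerivWithinAt).congr_deriv ?_
    simp [charH, cl_of_mem hx]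
  have := abs_sub_le_integral (h := fun _ => (0 : ℝ)) continuous_const hd (fun _ _ => by simp) hx
    (inlet_mem m j)
  simp only [intervalIntegral.integral_zero, intervalIntegral.integral_same,
    (S.flow j).base, sub_zero] at this
  have := abs_nonpos_iff.1 this
  linarith

/-- The time derivative in integrated form. -/
lemma IsSol.deriv_eq_integral {b : Fin n → Fin n → ℝ → ℝ → ℝ}
    (hb : ∀ j k, IsCoef (b j k) (b' j k) R)
    (h : IsSol m p a b τ (fun _ _ _ => 0) u ux ut) (hu : ∀ j, TC1 (u j) (ut j)) (j : Fin n)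
    {s : ℝ} (hs : τ < s) {x : ℝ} (hx : x ∈ Icc (0 : ℝ) 1) :
    ut j x (S.y j x s) * S.ys j x s = ut j (inlet m j) s +
      ∫ ξ in inlet m j..x, charH' a b b' u ut j ξ (S.y j ξ s) * S.ys j ξ s := by
  have t1 := ((hu j).comp (S.tc1_y j) continuous_id).deriv x s
  have t2 := (((tc1_charH S hb hu j).comp (S.tc1_y j) continuous_id).primitive (inlet m j)).deriv x s
  have t3 := ((hu j).deriv (inlet m j) s).add t2
  refine t1.unique (t3.congr_of_eventuallyEq ?_)
  filter_upwards [Ici_mem_nhds hs] with r hr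
  exact h.eq_integral hb hu j hr hx

lemma IsSol.deriv_boundary {b : Fin n → Fin n → ℝ → ℝ → ℝ}
    (h : IsSol m p a b τ (fun _ _ _ => 0) u ux ut) (hu : ∀ j, TC1 (u j) (ut j)) (j : Fin n)
    {s : ℝ} (hs : τ < s) : ut j (inlet m j) s = opP m p ut j s := by
  have t1 := (hu j).deriv (inlet m j) s
  have t2 : HasDerivAt (fun s => opP m p u j s) (opP m p ut j s) s := by
    simp only [opP_eq]
    exact HasDerivAt.fun_sum fun k _ => ((hu k).deriv (outlet m k) s).const_mul (p j k)
  refine t1.unique (t2.congr_of_eventuallyEq ?_)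
  filter_upwards [Ici_mem_nhds hs] with r hr
  exact h.boundary j r hr

/-- The modified time derivative. -/
def modD (e : Fin n → Fin n → ℝ → ℝ → ℝ) (u ut : Fin n → ℝ → ℝ → ℝ) (j : Fin n) (x t : ℝ) : ℝ :=
  ut j x t + ∑ k, e j k (cl x) t * u k x t

/-- The source term in the equation for the modified time derivative. -/
lemma LevyData.source_eq (hD : LevyData S p bd bt e b' R)
    (h : IsSol m p a (perturb bd bt) τ (fun _ _ _ => 0) u ux ut) (j : Fin n) {x t : ℝ}
    (hx : x ∈ Icc (0 : ℝ) 1) (ht : τ ≤ t) :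
    bd j x t * (a j x t)⁻¹ * ut j x t + charH' a (perturb bd bt) b' u ut j x t +
      ∑ k, e j k x t * (ux k x t + ut k x t * (a j x t)⁻¹) =
    -(-dt (a j) x t / a j x t ^ 2 * ∑ k, perturb bd bt j k x t * u k x t) -
      (a j x t)⁻¹ * ∑ k, b' j k x t * u k x t -
      ∑ k, (e j k x t * (a k x t)⁻¹) * ∑ l, perturb bd bt k l x t * u l x t := by
  have h4 : ∑ k, perturb bd bt j k x t * ut k x t = bd j x t * ut j x t +
      ∑ k, bt j k x t * ut k x t := by
    simp only [perturb, add_mul, ite_mul, zero_mul, Finset.sum_add_distrib, Finset.sum_ite_eq,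
      Finset.mem_univ, if_true]
  -- The cancellation behind the Levy condition. Eliminating `ux k` by the `k`-th equation leaves
  -- `ut k` with the coefficient `1 / a_j - 1 / a_k`, and `e_{jk}` times this number is `b̃_{jk} /
  -- a_j`, precisely the coupling term of the differentiated `j`-th equation.
  have h6 : ∑ k, e j k x t * (ux k x t + ut k x t * (a j x t)⁻¹) =
      (a j x t)⁻¹ * ∑ k, bt j k x t * ut k x t -
      ∑ k, (e j k x t * (a k x t)⁻¹) * ∑ l, perturb bd bt k l x t * u l x t := by
    rw [Finset.mul_sum, ← Finset.sum_sub_distrib]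
    refine Finset.sum_congr rfl fun k _ => ?_
    have h1 := h.pde k x hx t ht
    have h2 := hD.rel j k x hx t
    have a1 := S.a_ne j hx t
    have a2 := S.a_ne k hx t
    set B := ∑ l, perturb bd bt k l x t * u l x t
    have e1 : ux k x t = -(a k x t)⁻¹ * (ut k x t + B) := by
      field_simp; linarith
    rw [e1]
    field_simp
    linear_combination (-ut k x t) * h2
  unfold charH'
  simp only [cl_of_mem hx, Finset.sum_add_distrib]
  rw [h6, h4]
  ring

end

end

end Hyp

/-! ### The modified time derivative along characteristics. -/

namespace Hyp

noncomputable section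

section

variable {n m : ℕ} {p : Matrix (Fin n) (Fin n) ℝ} {a : Fin n → ℝ → ℝ → ℝ}
  {bd : Fin n → ℝ → ℝ → ℝ} {bt e b' : Fin n → Fin n → ℝ → ℝ → ℝ} {τ R : ℝ} {S : Setting m a}
  {u ux ut : Fin n → ℝ → ℝ → ℝ}

/-- `wgt⁻¹` is the integrating factor that removes the diagonal term `bd j` from the equation along
the characteristic. -/
lemma Setting.wgt_inv_hasDerivAt (S : Setting m a) (hbd : ∀ j, IsBC1 (bd j)) (j : Fin n) {x : ℝ}
    (hx : x ∈ Icc (0 : ℝ) 1) (s : ℝ) :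
    HasDerivAt (fun x => (S.wgt bd j x s)⁻¹)
      ((S.wgt bd j x s)⁻¹ * (bd j x (S.y j x s) * (a j x (S.y j x s))⁻¹)) x := by
  have e : ∀ x, (S.wgt bd j x s)⁻¹ = Real.exp (∫ η in inlet m j..x,
      bd j (cl η) (S.y j η s) * (a j (cl η) (S.y j η s))⁻¹) := fun x => by
    rw [wgt, ← Real.exp_neg, intervalIntegral.integral_symm, neg_neg]
  simp only [e]
  have := ((S.continuous_wgt_integrand hbd j s).integral_hasStrictDerivAt
    (inlet m j) x).hasDerivAt.exp
  rwa [cl_of_mem hx] at this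

lemma Setting.ys_hasDerivAt (S : Setting m a) (j : Fin n) {x : ℝ} (hx : x ∈ Icc (0 : ℝ) 1) (s : ℝ) :
    HasDerivAt (fun x => S.ys j x s)
      (S.ys j x s * (-dt (a j) x (S.y j x s) / a j x (S.y j x s) ^ 2)) x := by
  simp only [(S.flow j).ys_eq]
  have hc : Continuous fun η => -dt (a j) (cl η) (S.y j η s) / a j (cl η) (S.y j η s) ^ 2 :=
    (S.tc1_inv_a j).comp_cont' continuous_id
      ((S.tc1_y j).comp_cont continuous_id continuous_const)
  have := (hc.integral_hasStrictDerivAt (inlet m j) x).hasDerivAt.exp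
  rwa [cl_of_mem hx] at this

lemma Setting.wgt_pos (S : Setting m a) (bd : Fin n → ℝ → ℝ → ℝ) (j : Fin n) (x s : ℝ) :
    0 < S.wgt bd j x s := Real.exp_pos _

/-- The modified time derivative is transported up to terms of order zero. -/
lemma LevyData.char_defect (hD : LevyData S p bd bt e b' R)
    (h : IsSol m p a (perturb bd bt) τ (fun _ _ _ => 0) u ux ut) (hu : ∀ j, TC1 (u j) (ut j))
    (j : Fin n) {s : ℝ} (hs : τ < s) {x : ℝ} (hx : x ∈ Icc (0 : ℝ) 1) :
    |(S.wgt bd j x s)⁻¹ * S.ys j x s * modD e u ut j x (S.y j x s) -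
      modD e u ut j (inlet m j) s| ≤
    ∫ ξ in (0 : ℝ)..1, (R * R * (4 * R ^ 2 + R + (n + 1) * R ^ 3)) *
      ∑ k, |u k ξ (S.y j ξ s)| := by
  have hR := hD.R_pos
  have hcy : Continuous fun ξ => S.y j ξ s := (S.tc1_y j).comp_cont continuous_id continuous_const
  -- `ut` is merely continuous, so it cannot be differentiated along the characteristic by itself.
  -- Multiplied by `ys` it is the derivative in the entry time, for which the integrated equation
  -- provides a derivative in `x`.
  set Θ : ℝ → ℝ := fun x => (S.wgt bd j x s)⁻¹ * (ut j x (S.y j x s) * S.ys j x s +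
    S.ys j x s * ∑ k, e j k x (S.y j x s) * u k x (S.y j x s)) with hΘ
  set f : ℝ → ℝ := fun x => bd j x (S.y j x s) * (a j x (S.y j x s))⁻¹ *
      (∑ k, e j k x (S.y j x s) * u k x (S.y j x s)) +
    -dt (a j) x (S.y j x s) / a j x (S.y j x s) ^ 2 *
      (∑ k, e j k x (S.y j x s) * u k x (S.y j x s)) +
    ∑ k, (dx (e j k) x (S.y j x s) + dt (e j k) x (S.y j x s) * (a j x (S.y j x s))⁻¹) *
      u k x (S.y j x s) +
    (-(-dt (a j) x (S.y j x s) / a j x (S.y j x s) ^ 2 *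
        ∑ k, perturb bd bt j k x (S.y j x s) * u k x (S.y j x s)) -
      (a j x (S.y j x s))⁻¹ * ∑ k, b' j k x (S.y j x s) * u k x (S.y j x s) -
      ∑ k, (e j k x (S.y j x s) * (a k x (S.y j x s))⁻¹) *
        ∑ l, perturb bd bt k l x (S.y j x s) * u l x (S.y j x s)) with hf
  have hder : ∀ x ∈ Icc (0 : ℝ) 1,
      HasDerivWithinAt Θ ((S.wgt bd j x s)⁻¹ * S.ys j x s * f x) (Icc 0 1) x := by
    intro x hx
    have hy : τ ≤ S.y j x s := hs.le.trans (S.le_y j hx s)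
    have hmaps : MapsTo (fun ξ => (ξ, S.y j ξ s)) (Icc (0 : ℝ) 1) (halfStrip τ) :=
      fun ξ hξ => ⟨hξ, hs.le.trans (S.le_y j hξ s)⟩
    have d0 := (S.y_ode j hx s).hasDerivWithinAt (s := Icc (0 : ℝ) 1)
    have d1 : HasDerivWithinAt (fun x => ut j x (S.y j x s) * S.ys j x s)
        (charH' a (perturb bd bt) b' u ut j x (S.y j x s) * S.ys j x s) (Icc 0 1) x := by
      have hc : Continuous fun ξ => charH' a (perturb bd bt) b' u ut j ξ (S.y j ξ s) * S.ys j ξ s :=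
        ((tc1_charH S hD.coef hu j).comp_cont' continuous_id hcy).mul
          ((S.tc1_y j).comp_cont' continuous_id continuous_const)
      refine ((hc.integral_hasStrictDerivAt (inlet m j) x).hasDerivAt.const_add
        (ut j (inlet m j) s)).hasDerivWithinAt.congr (fun ξ hξ => ?_) ?_
      · exact h.deriv_eq_integral hD.coef hu j hs hξ
      · exact h.deriv_eq_integral hD.coef hu j hs hx
    have d2 : ∀ k, HasDerivWithinAt (fun x => e j k x (S.y j x s) * u k x (S.y j x s))
        ((dx (e j k) x (S.y j x s) + dt (e j k) x (S.y j x s) * (a j x (S.y j x s))⁻¹) *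
          u k x (S.y j x s) + e j k x (S.y j x s) *
          (ux k x (S.y j x s) + ut k x (S.y j x s) * (a j x (S.y j x s))⁻¹)) (Icc 0 1) x :=
      fun k => (hasDerivWithinAt_curve (J := univ) ((hD.e_bc1 j k).partials.2.2 x hx _) d0 rfl
        fun ξ hξ => ⟨hξ, trivial⟩).mul (hasDerivWithinAt_curve (h.hd k x hx _ hy) d0 rfl hmaps)
    have d3 := HasDerivWithinAt.fun_sum (u := Finset.univ) fun k _ => d2 k
    have d4 := ((S.wgt_inv_hasDerivAt hD.bd_bc1 j hx s).hasDerivWithinAt (s := Icc (0 : ℝ) 1)).mul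
      (d1.add (((S.ys_hasDerivAt j hx s).hasDerivWithinAt (s := Icc (0 : ℝ) 1)).mul d3))
    refine d4.congr_deriv ?_
    -- Here all derivatives of `u` disappear; `f` contains values of `u` only.
    have hsrc := hD.source_eq h j hx hy
    simp only [hf, Finset.sum_add_distrib, Pi.add_apply, Pi.mul_apply]
    rw [← hsrc]
    ring
  have hΘx : ∀ x ∈ Icc (0 : ℝ) 1,
      Θ x = (S.wgt bd j x s)⁻¹ * S.ys j x s * modD e u ut j x (S.y j x s) := fun x hx => by
    simp only [hΘ, modD, cl_of_mem hx]; ring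
  have hw1 : S.wgt bd j (inlet m j) s = 1 := by simp [Setting.wgt]
  have hy1 : S.ys j (inlet m j) s = 1 := by simp [(S.flow j).ys_eq]
  have hΘ0 : Θ (inlet m j) = modD e u ut j (inlet m j) s := by
    rw [hΘx _ (inlet_mem m j), hw1, hy1, (S.flow j).base]; simp
  rw [← hΘx x hx, ← hΘ0]
  refine abs_sub_le_integral ?_ hder (fun x hx => ?_) hx (inlet_mem m j)
  · exact continuous_const.mul (continuous_finsetSum _ fun k _ =>
      ((hu k).comp_cont continuous_id hcy).abs)
  set t := S.y j x s with ht
  set V := ∑ k, |u k x t| with hV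
  have hV0 : 0 ≤ V := Finset.sum_nonneg fun _ _ => abs_nonneg _
  have hR0 : 0 ≤ R := by linarith
  have m2 : ∀ {y z : ℝ}, |y| ≤ R → |z| ≤ R → |y * z| ≤ R * R := fun hy hz => by
    rw [abs_mul]; exact mul_le_mul hy hz (abs_nonneg _) hR0
  have m3 : ∀ {y z Q : ℝ}, |y| ≤ Q → |z| ≤ R * V → |y * z| ≤ Q * (R * V) := fun hy hz => by
    rw [abs_mul]; exact mul_le_mul hy hz (abs_nonneg _) ((abs_nonneg _).trans hy)
  have se : |∑ k, e j k x t * u k x t| ≤ R * V := abs_sum_mul_le fun k => (hD.e_le j k x hx t).1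
  have sb : ∀ j, |∑ k, perturb bd bt j k x t * u k x t| ≤ R * V := fun j =>
    abs_sum_mul_le fun k => (hD.coef j k).bound x hx t
  have sb' : |∑ k, b' j k x t * u k x t| ≤ R * V := abs_sum_mul_le fun k =>
    (hD.coef j k).bound' x hx t
  have s1 : |bd j x t * (a j x t)⁻¹ * ∑ k, e j k x t * u k x t| ≤ R * R * (R * V) :=
    m3 (m2 (hD.bd_le j x hx t) (hD.inv_le j x hx t).1) se
  have s2 : |-dt (a j) x t / a j x t ^ 2 * ∑ k, e j k x t * u k x t| ≤ R * (R * V) :=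
    m3 (hD.inv_le j x hx t).2 se
  have s3 : |∑ k, (dx (e j k) x t + dt (e j k) x t * (a j x t)⁻¹) * u k x t| ≤ (R + R * R) * V :=
    abs_sum_mul_le fun k => (abs_add_le _ _).trans (add_le_add (hD.e_le j k x hx t).2.1
      (m2 (hD.e_le j k x hx t).2.2 (hD.inv_le j x hx t).1))
  have s4 : |-dt (a j) x t / a j x t ^ 2 * ∑ k, perturb bd bt j k x t * u k x t| ≤ R * (R * V) :=
    m3 (hD.inv_le j x hx t).2 (sb j)
  have s5 : |(a j x t)⁻¹ * ∑ k, b' j k x t * u k x t| ≤ R * (R * V) :=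
    m3 (hD.inv_le j x hx t).1 sb'
  have s6 : |∑ k, (e j k x t * (a k x t)⁻¹) * ∑ l, perturb bd bt k l x t * u l x t| ≤
      n * (R * R * (R * V)) := by
    refine (Finset.abs_sum_le_sum_abs _ _).trans ((Finset.sum_le_sum fun k _ =>
      m3 (m2 (hD.e_le j k x hx t).1 (hD.inv_le k x hx t).1) (sb k)).trans ?_)
    simp
  have hfb : |f x| ≤ (4 * R ^ 2 + R + (n + 1) * R ^ 3) * V := by
    simp only [hf]
    refine (abs_add_le _ _).trans ((add_le_add ((abs_add_le _ _).trans (add_le_add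
      ((abs_add_le _ _).trans (add_le_add s1 s2)) s3)) ((abs_sub _ _).trans (add_le_add
      ((abs_sub _ _).trans (add_le_add ((abs_neg _).le.trans s4) s5)) s6))).trans (le_of_eq ?_))
    ring
  have hw := S.wgt_pos bd j x s
  have hys := S.ys_pos j x s
  rw [abs_mul, abs_mul, abs_of_pos (inv_pos.2 hw), abs_of_pos hys, mul_assoc (R * R)]
  refine mul_le_mul (mul_le_mul (hD.wgt_le j x hx s).2 ((S.ys_le j x hx s).trans hD.D_le) hys.le
    hR0) hfb (abs_nonneg _) (by positivity)

end

end

end Hyp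

namespace Hyp

noncomputable section

/-! ### Integrals along characteristics -/

lemma integral_swap_of_continuous {f : ℝ → ℝ → ℝ} (hf : Continuous fun z : ℝ × ℝ => f z.1 z.2)
    {c d c' d' : ℝ} (h : c ≤ d) (h' : c' ≤ d') :
    ∫ s in c..d, ∫ ξ in c'..d', f s ξ = ∫ ξ in c'..d', ∫ s in c..d, f s ξ := by
  simp only [intervalIntegral.integral_of_le h, intervalIntegral.integral_of_le h']
  refine integral_integral_swap ?_
  rw [Measure.prod_restrict]
  have : IntegrableOn (Function.uncurry f) (Icc c d ×ˢ Icc c' d') (volume.prod volume) :=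
    (hf.continuousOn).integrableOn_compact (isCompact_Icc.prod isCompact_Icc)
  exact this.mono_set (prod_mono Ioc_subset_Icc_self Ioc_subset_Icc_self)

/-- Substitution: the lower bound `1 / D` for the derivative is the bound for the Jacobian, and the
nonnegative integrand allows the image interval to be enlarged. It is applied to both `σ` and `y`.
-/
lemma integral_comp_le {f f' h : ℝ → ℝ} {D c d c' d' : ℝ} (hf : ∀ t, HasDerivAt f (f' t) t)
    (hf' : Continuous f') (hD : 0 < D) (hDf : ∀ t, 1 ≤ D * f' t) (hh : Continuous h)
    (h0 : ∀ t, 0 ≤ h t) (hcd : c ≤ d) (hc : c' ≤ f c) (hd : f d ≤ d') :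
    ∫ t in c..d, h (f t) ≤ D * ∫ s in c'..d', h s := by
  have hfc : Continuous f := continuous_iff_continuousAt.2 fun t => (hf t).continuousAt
  have hpos : ∀ t, 0 < f' t := fun t => by
    by_contra hn
    have := mul_nonpos_of_nonneg_of_nonpos hD.le (not_lt.1 hn)
    linarith [hDf t]
  have hmono : Monotone f := monotone_of_deriv_nonneg (fun t => (hf t).differentiableAt)
    fun t => by rw [(hf t).deriv]; exact (hpos t).le
  have e1 := intervalIntegral.integral_comp_mul_deriv (a := c) (b := d) (fun t _ => hf t)
    hf'.continuousOn hh
  calc ∫ t in c..d, h (f t) ≤ ∫ t in c..d, D * ((h ∘ f) t * f' t) := by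
        refine intervalIntegral.integral_mono_on hcd ((hh.comp hfc).intervalIntegrable _ _)
          ((continuous_const.mul ((hh.comp hfc).mul hf')).intervalIntegrable _ _) fun t _ => ?_
        have := mul_le_mul_of_nonneg_left (hDf t) (h0 (f t))
        simp only [Function.comp_apply]; linarith
    _ = D * ∫ s in f c..f d, h s := by rw [intervalIntegral.integral_const_mul, e1]
    _ ≤ D * ∫ s in c'..d', h s := by
        refine mul_le_mul_of_nonneg_left ?_ hD.le
        exact intervalIntegral.integral_mono_interval hc (hmono hcd) hd
          (Eventually.of_forall h0) (hh.intervalIntegrable _ _)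

lemma sq_integral_le {f : ℝ → ℝ} (hf : Continuous f) :
    (∫ x in (0 : ℝ)..1, f x) ^ 2 ≤ ∫ x in (0 : ℝ)..1, f x ^ 2 := by
  set I := ∫ x in (0 : ℝ)..1, f x with hI
  have h : 0 ≤ ∫ x in (0 : ℝ)..1, (f x - I) ^ 2 :=
    intervalIntegral.integral_nonneg zero_le_one fun _ _ => sq_nonneg _
  have e : ∀ x, (f x - I) ^ 2 = f x ^ 2 - 2 * I * f x + I ^ 2 := fun x => by ring
  simp only [e] at h
  rw [intervalIntegral.integral_add (Continuous.intervalIntegrable (by fun_prop) _ _)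
    intervalIntegrable_const,
    intervalIntegral.integral_sub (Continuous.intervalIntegrable (by fun_prop) _ _)
    (Continuous.intervalIntegrable (by fun_prop) _ _), intervalIntegral.integral_const_mul,
    intervalIntegral.integral_const, ← hI] at h
  simp only [sub_zero, one_smul] at h
  linarith

lemma sq_sum_abs_le {n : ℕ} (w : Fin n → ℝ) : (∑ k, |w k|) ^ 2 ≤ n * ∑ k, w k ^ 2 := by
  have := Finset.sum_mul_sq_le_sq_mul_sq Finset.univ (fun _ : Fin n => (1 : ℝ)) fun k => |w k|
  simpa using this

section

variable {n m : ℕ} {p : Matrix (Fin n) (Fin n) ℝ} {a : Fin n → ℝ → ℝ → ℝ}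
  {bd : Fin n → ℝ → ℝ → ℝ} {bt e b' : Fin n → Fin n → ℝ → ℝ → ℝ} {τ R : ℝ} {S : Setting m a}
  {u ux ut : Fin n → ℝ → ℝ → ℝ}

namespace Setting

lemma D_pos (S : Setting m a) : 0 < S.D := one_pos.trans_le S.one_le_D

lemma integral_comp_σ_le (S : Setting m a) (j : Fin n) {x : ℝ} (hx : x ∈ Icc (0 : ℝ) 1) {h : ℝ → ℝ}
    (hh : Continuous h) (h0 : ∀ t, 0 ≤ h t) {c d : ℝ} (hcd : c ≤ d) :
    ∫ t in c..d, h (S.σ j x t) ≤ S.D * ∫ s in c - S.Λ⁻¹..d, h s := by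
  refine integral_comp_le (fun t => (S.tc1_σ j).deriv x t)
    ((S.tc1_σ j).comp_cont' continuous_const continuous_id) S.D_pos (fun t => ?_) hh h0 hcd
    (S.σ_bounds j hx c).1 (S.σ_le j hx d)
  rw [(S.flow j).σt_eq, ← div_eq_mul_inv, le_div_iff₀ (S.ys_pos j _ _), one_mul]
  exact S.ys_le j x hx _

lemma integral_comp_y_le (S : Setting m a) (j : Fin n) {x : ℝ} (hx : x ∈ Icc (0 : ℝ) 1) {h : ℝ → ℝ}
    (hh : Continuous h) (h0 : ∀ t, 0 ≤ h t) {c d : ℝ} (hcd : c ≤ d) :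
    ∫ s in c..d, h (S.y j x s) ≤ S.D * ∫ t in c..d + S.Λ⁻¹, h t := by
  refine integral_comp_le (fun t => (S.tc1_y j).deriv x t)
    ((S.tc1_y j).comp_cont' continuous_const continuous_id) S.D_pos (fun t => ?_) hh h0 hcd
    (S.le_y j hx c) (S.y_bounds j hx d).2
  have h1 := S.inv_ys_le j x hx t
  rwa [← one_div, div_le_iff₀ (S.ys_pos j _ _)] at h1

/-- The integral of `|u|` along a characteristic. -/
def lineI (S : Setting m a) (u : Fin n → ℝ → ℝ → ℝ) (j : Fin n) (s : ℝ) : ℝ :=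
  ∫ ξ in (0 : ℝ)..1, ∑ k, |u k ξ (S.y j ξ s)|

/-- The integral of `|u|²` along a characteristic. -/
def lineS (S : Setting m a) (u : Fin n → ℝ → ℝ → ℝ) (j : Fin n) (s : ℝ) : ℝ :=
  ∫ ξ in (0 : ℝ)..1, ∑ k, u k ξ (S.y j ξ s) ^ 2

lemma cont_along (S : Setting m a) (hu : ∀ j, TC1 (u j) (ut j)) (j k : Fin n) (s : ℝ) :
    Continuous fun ξ => u k ξ (S.y j ξ s) :=
  (hu k).comp_cont continuous_id ((S.tc1_y j).comp_cont continuous_id continuous_const)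

lemma cont_along₂ (S : Setting m a) (hu : ∀ j, TC1 (u j) (ut j)) (j k : Fin n) :
    Continuous fun z : ℝ × ℝ => u k z.2 (S.y j z.2 z.1) :=
  (hu k).comp_cont continuous_snd ((S.tc1_y j).comp_cont continuous_snd continuous_fst)

lemma lineI_nonneg (S : Setting m a) (u : Fin n → ℝ → ℝ → ℝ) (j : Fin n) (s : ℝ) :
    0 ≤ S.lineI u j s :=
  intervalIntegral.integral_nonneg zero_le_one fun _ _ => Finset.sum_nonneg fun _ _ => abs_nonneg _

lemma lineS_nonneg (S : Setting m a) (u : Fin n → ℝ → ℝ → ℝ) (j : Fin n) (s : ℝ) :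
    0 ≤ S.lineS u j s :=
  intervalIntegral.integral_nonneg zero_le_one fun _ _ => Finset.sum_nonneg fun _ _ => sq_nonneg _

lemma lineI_sq_le (S : Setting m a) (hu : ∀ j, TC1 (u j) (ut j)) (j : Fin n) (s : ℝ) :
    S.lineI u j s ^ 2 ≤ n * S.lineS u j s := by
  have c1 : Continuous fun ξ => ∑ k, |u k ξ (S.y j ξ s)| :=
    continuous_finsetSum _ fun k _ => (S.cont_along hu j k s).abs
  have c2 : Continuous fun ξ => ∑ k, u k ξ (S.y j ξ s) ^ 2 :=
    continuous_finsetSum _ fun k _ => (S.cont_along hu j k s).pow 2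
  refine (sq_integral_le c1).trans ?_
  rw [lineS, ← intervalIntegral.integral_const_mul]
  exact intervalIntegral.integral_mono_on zero_le_one ((c1.pow 2).intervalIntegrable _ _)
    ((continuous_const.mul c2).intervalIntegrable _ _) fun ξ _ => sq_sum_abs_le _

lemma continuous_lineS (S : Setting m a) (hu : ∀ j, TC1 (u j) (ut j)) (j : Fin n) :
    Continuous (S.lineS u j) := by
  refine intervalIntegral.continuous_parametric_intervalIntegral_of_continuous'
    (f := fun s ξ => ∑ k, u k ξ (S.y j ξ s) ^ 2) ?_ _ _
  exact continuous_finsetSum _ fun k _ => (S.cont_along₂ hu j k).pow 2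

lemma integral_sqn_eq (hu : ∀ j, TC1 (u j) (ut j)) {c d : ℝ} (hcd : c ≤ d) :
    ∫ t in c..d, sqn u t = ∑ k, ∫ ξ in (0 : ℝ)..1, ∫ t in c..d, u k ξ t ^ 2 := by
  have c2 : ∀ k, Continuous fun z : ℝ × ℝ => u k z.2 z.1 ^ 2 := fun k =>
    ((hu k).comp_cont continuous_snd continuous_fst).pow 2
  unfold sqn
  rw [intervalIntegral.integral_finsetSum fun k _ => Continuous.intervalIntegrable
    (intervalIntegral.continuous_parametric_intervalIntegral_of_continuous'
      (f := fun t x => u k x t ^ 2) (c2 k) _ _) _ _]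
  exact Finset.sum_congr rfl fun k _ =>
    integral_swap_of_continuous (f := fun t x => u k x t ^ 2) (c2 k) hcd zero_le_one

/-- After exchanging the integrations, the change from entry time to time at fixed `ξ` costs the
Jacobian `D` and a lengthening of the window by one crossing time. -/
lemma integral_lineS_le (S : Setting m a) (hu : ∀ j, TC1 (u j) (ut j)) (j : Fin n) {c d : ℝ}
    (hcd : c ≤ d) : ∫ s in c..d, S.lineS u j s ≤ S.D * ∫ t in c..d + S.Λ⁻¹, sqn u t := by
  have hcd' : c ≤ d + S.Λ⁻¹ := by linarith [inv_pos.2 S.Λ_pos]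
  have c2 : ∀ k, Continuous fun z : ℝ × ℝ => u k z.2 (S.y j z.2 z.1) ^ 2 := fun k =>
    (S.cont_along₂ hu j k).pow 2
  have c3 : ∀ k, Continuous fun ξ => ∫ s in c..d, u k ξ (S.y j ξ s) ^ 2 := fun k =>
    intervalIntegral.continuous_parametric_intervalIntegral_of_continuous'
      (f := fun ξ s => u k ξ (S.y j ξ s) ^ 2) ((c2 k).comp continuous_swap) _ _
  have c4 : ∀ k, Continuous fun ξ => ∫ t in c..d + S.Λ⁻¹, u k ξ t ^ 2 := fun k =>
    intervalIntegral.continuous_parametric_intervalIntegral_of_continuous'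
      (f := fun ξ t => u k ξ t ^ 2)
      (show Continuous fun z : ℝ × ℝ => u k z.1 z.2 ^ 2 from (hu k).cont.pow 2) _ _
  rw [integral_sqn_eq hu hcd', Finset.mul_sum]
  unfold lineS
  rw [integral_swap_of_continuous (f := fun s ξ => ∑ k, u k ξ (S.y j ξ s) ^ 2)
    (continuous_finsetSum _ fun k _ => c2 k) hcd zero_le_one]
  have e : ∀ ξ, ∫ s in c..d, ∑ k, u k ξ (S.y j ξ s) ^ 2 =
      ∑ k, ∫ s in c..d, u k ξ (S.y j ξ s) ^ 2 := fun ξ =>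
    intervalIntegral.integral_finsetSum fun k _ => Continuous.intervalIntegrable
      ((c2 k).comp (continuous_id.prodMk continuous_const)) _ _
  simp only [e]
  rw [intervalIntegral.integral_finsetSum fun k _ => (c3 k).intervalIntegrable _ _]
  refine Finset.sum_le_sum fun k _ => ?_
  rw [← intervalIntegral.integral_const_mul]
  refine intervalIntegral.integral_mono_on zero_le_one ((c3 k).intervalIntegrable _ _)
    ((continuous_const.mul (c4 k)).intervalIntegrable _ _) fun ξ hξ => ?_
  exact S.integral_comp_y_le j hξ (h := fun t => u k ξ t ^ 2)
    (((hu k).comp_cont continuous_const continuous_id).pow 2) (fun _ => sq_nonneg _) hcd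

end Setting

/-! ### Pointwise bounds in terms of traces and line integrals -/

/-- Values at both endpoints. -/
def ends (u : Fin n → ℝ → ℝ → ℝ) (s : ℝ) : ℝ := ∑ k, (|u k 0 s| + |u k 1 s|)

lemma ends_nonneg (u : Fin n → ℝ → ℝ → ℝ) (s : ℝ) : 0 ≤ ends u s :=
  Finset.sum_nonneg fun _ _ => by positivity

lemma sum_abs_le_ends (u : Fin n → ℝ → ℝ → ℝ) {x : ℝ} (hx : x = 0 ∨ x = 1) (s : ℝ) :
    ∑ k, |u k x s| ≤ ends u s := by
  refine Finset.sum_le_sum fun k _ => ?_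
  rcases hx with rfl | rfl
  · linarith [abs_nonneg (u k 1 s)]
  · linarith [abs_nonneg (u k 0 s)]

lemma inlet_eq (m : ℕ) (j : Fin n) : inlet m j = 0 ∨ inlet m j = 1 := by
  unfold inlet; split_ifs <;> simp

lemma outlet_eq (m : ℕ) (j : Fin n) : outlet m j = 0 ∨ outlet m j = 1 := by
  unfold outlet; split_ifs <;> simp

/-- Starting from the inlet, where the boundary condition replaces the value by outgoing traces, the
component changes along its characteristic at a rate of at most `R² ∑ |u_k|`. Both terms have square
means controlled by the energy estimate. -/
lemma LevyData.abs_le (hD : LevyData S p bd bt e b' R)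
    (h : IsSol m p a (perturb bd bt) τ (fun _ _ _ => 0) u ux ut) (hu : ∀ j, TC1 (u j) (ut j))
    (j : Fin n) {x t : ℝ} (hx : x ∈ Icc (0 : ℝ) 1) (hs : τ ≤ S.σ j x t) :
    |u j x t| ≤ R * ∑ k, |u k (outlet m k) (S.σ j x t)| + R * R * S.lineI u j (S.σ j x t) := by
  set s := S.σ j x t with hsd
  have hR := hD.R_pos
  have e1 := abs_sub_le_integral (h := fun ξ => R * R * ∑ k, |u k ξ (S.y j ξ s)|)
    (continuous_const.mul (continuous_finsetSum _ fun k _ => (S.cont_along hu j k s).abs))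
    (fun x hx => h.hasDerivWithinAt_char S j hs hx) (fun x hx => by
      rw [zero_sub, abs_mul, abs_neg, mul_assoc]
      exact mul_le_mul (hD.inv_le j x hx _).1 (abs_sum_mul_le fun k => (hD.coef j k).bound x hx _)
        (abs_nonneg _) (by linarith)) hx (inlet_mem m j)
  rw [intervalIntegral.integral_const_mul] at e1
  simp only [(S.flow j).base, hsd, (S.flow j).right_inv] at e1
  rw [← hsd, h.boundary j s hs, opP_eq] at e1
  have e2 : |∑ k, p j k * u k (outlet m k) s| ≤ R * ∑ k, |u k (outlet m k) s| :=
    abs_sum_mul_le fun k => hD.p_le j k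
  have e3 := abs_sub_abs_le_abs_sub (u j x t) (∑ k, p j k * u k (outlet m k) s)
  unfold Setting.lineI
  linarith

/-- The defect has two sources. In the interior it is `LevyData.char_defect`. At the inlet the
differentiated boundary condition cancels the time derivatives, and only the terms with `e` remain,
which are endpoint values of `u`. -/
lemma LevyData.abs_defect_le (hD : LevyData S p bd bt e b' R)
    (h : IsSol m p a (perturb bd bt) τ (fun _ _ _ => 0) u ux ut) (hu : ∀ j, TC1 (u j) (ut j))
    (j : Fin n) {x t : ℝ} (hx : x ∈ Icc (0 : ℝ) 1) (hs : τ < S.σ j x t) :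
    |modD e u ut j x t - S.trans' p bd (modD e u ut) j x t| ≤
      (R * R * (R * R * (4 * R ^ 2 + R + (n + 1) * R ^ 3) + R + n * (R * R))) *
        (ends u (S.σ j x t) + S.lineI u j (S.σ j x t)) := by
  set s := S.σ j x t with hsd
  have hR := hD.R_pos
  have hR0 : 0 ≤ R := by linarith
  have e1 := hD.char_defect h hu j hs hx
  rw [intervalIntegral.integral_const_mul] at e1
  set Cd := R * R * (4 * R ^ 2 + R + (n + 1) * R ^ 3) with hCd
  have hCd0 : 0 ≤ Cd := by positivity
  have e2 : |modD e u ut j (inlet m j) s - opP m p (modD e u ut) j s| ≤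
      (R + n * (R * R)) * ends u s := by
    have h1 : modD e u ut j (inlet m j) s - opP m p (modD e u ut) j s =
        (∑ k, e j k (inlet m j) s * u k (inlet m j) s) -
        ∑ k, p j k * ∑ l, e k l (outlet m k) s * u l (outlet m k) s := by
      simp only [modD, cl_of_mem (inlet_mem m j), h.deriv_boundary hu j hs, opP_eq,
        cl_of_mem (outlet_mem m _), mul_add, Finset.sum_add_distrib]
      ring
    rw [h1]
    have h2 : |∑ k, e j k (inlet m j) s * u k (inlet m j) s| ≤ R * ends u s :=
      (abs_sum_mul_le fun k => (hD.e_le j k _ (inlet_mem m j) s).1).trans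
        (mul_le_mul_of_nonneg_left (sum_abs_le_ends u (inlet_eq m j) s) hR0)
    have h3 : |∑ k, p j k * ∑ l, e k l (outlet m k) s * u l (outlet m k) s| ≤
        n * (R * R) * ends u s := by
      refine (Finset.abs_sum_le_sum_abs _ _).trans ((Finset.sum_le_sum fun k _ => ?_ :
        _ ≤ ∑ _k : Fin n, R * (R * ends u s)).trans (le_of_eq (by simp; ring)))
      rw [abs_mul]
      refine mul_le_mul (hD.p_le j k) ?_ (abs_nonneg _) hR0
      exact (abs_sum_mul_le fun l => (hD.e_le k l _ (outlet_mem m k) s).1).trans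
        (mul_le_mul_of_nonneg_left (sum_abs_le_ends u (outlet_eq m k) s) hR0)
    refine (abs_sub _ _).trans ?_
    linarith
  have hy : S.y j x s = t := (S.flow j).right_inv x t
  have hw := S.wgt_pos bd j x s
  have hys := S.ys_pos j x s
  have hσt : S.σt j x t = (S.ys j x s)⁻¹ := (S.flow j).σt_eq x t
  rw [hy] at e1
  have e3 : modD e u ut j x t - S.trans' p bd (modD e u ut) j x t =
      S.wgt bd j x s * S.σt j x t * (((S.wgt bd j x s)⁻¹ * S.ys j x s * modD e u ut j x t -
        modD e u ut j (inlet m j) s) +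
        (modD e u ut j (inlet m j) s - opP m p (modD e u ut) j s)) := by
    rw [Setting.trans', ← hsd, hσt]
    field_simp
    ring
  rw [e3, abs_mul, abs_mul, abs_of_pos hw, abs_of_pos (S.σt_pos j x t), mul_assoc (R * R)]
  refine mul_le_mul (mul_le_mul (hD.wgt_le j x hx s).1 ((S.σt_le j hx t).trans hD.D_le)
    (S.σt_pos j x t).le hR0) ?_ (abs_nonneg _) (by positivity)
  refine (abs_add_le _ _).trans ((add_le_add e1 e2).trans ?_)
  have n1 := ends_nonneg u s
  have n2 := S.lineI_nonneg u j s
  have : 0 ≤ (R + n * (R * R)) * S.lineI u j s := by positivity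
  have : 0 ≤ Cd * ends u s := by positivity
  have e4 : (∫ ξ in (0 : ℝ)..1, ∑ k, |u k ξ (S.y j ξ s)|) = S.lineI u j s := rfl
  rw [e4]
  linarith

end

end

end Hyp

namespace Hyp

noncomputable section

/-! ### Smoothing: from square means to uniform bounds of the derivatives -/

lemma integral_mono_set {f : ℝ → ℝ} (hf : Continuous f) (h0 : ∀ t, 0 ≤ f t) {c d c' d' : ℝ}
    (hc : c' ≤ c) (hcd : c ≤ d) (hd : d ≤ d') : ∫ t in c..d, f t ≤ ∫ t in c'..d', f t :=
  intervalIntegral.integral_mono_interval hc hcd hd (Eventually.of_forall h0)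
    (hf.intervalIntegrable _ _)

lemma integral_mul_add_mul {f g : ℝ → ℝ} (hf : Continuous f) (hg : Continuous g) (r s c d : ℝ) :
    ∫ t in c..d, (r * f t + s * g t) = r * (∫ t in c..d, f t) + s * ∫ t in c..d, g t := by
  have h1 : IntervalIntegrable (fun t => r * f t) volume c d :=
    (hf.intervalIntegrable c d).const_mul r
  have h2 : IntervalIntegrable (fun t => s * g t) volume c d :=
    (hg.intervalIntegrable c d).const_mul s
  rw [intervalIntegral.integral_add h1 h2, intervalIntegral.integral_const_mul,
    intervalIntegral.integral_const_mul]

/-- The one-dimensional Sobolev inequality. -/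
lemma sq_le_integral {f f' : ℝ → ℝ} (hf : ∀ t, HasDerivAt f (f' t) t) (hf' : Continuous f')
    {c d t : ℝ} (hcd : c + 1 ≤ d) (ht : t ∈ Icc c d) :
    f t ^ 2 ≤ 2 * (∫ s in c..d, f s ^ 2) + ∫ s in c..d, f' s ^ 2 := by
  have hfc : Continuous f := continuous_iff_continuousAt.2 fun t => (hf t).continuousAt
  set I := ∫ s in c..d, (f s ^ 2 + f' s ^ 2) with hI
  have hcd' : c ≤ d := by linarith
  have i1 : IntervalIntegrable (fun s => f s ^ 2) volume c d := (hfc.pow 2).intervalIntegrable _ _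
  have i2 : IntervalIntegrable (fun s => f' s ^ 2) volume c d := (hf'.pow 2).intervalIntegrable _ _
  have hIe : I = (∫ s in c..d, f s ^ 2) + ∫ s in c..d, f' s ^ 2 :=
    intervalIntegral.integral_add i1 i2
  -- The square varies by at most `I`, because `2 |f f'| ≤ f² + f'²`. Averaging over `s` in an
  -- interval of length at least one gives the claim.
  have key : ∀ s ∈ Icc c d, f t ^ 2 - I ≤ f s ^ 2 := by
    intro s hs
    have h1 : ∫ r in s..t, 2 * f r * f' r = f t ^ 2 - f s ^ 2 := by
      refine intervalIntegral.integral_eq_sub_of_hasDerivAt (f := fun r => f r ^ 2)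
        (fun r _ => ?_) ((by fun_prop : Continuous fun r => 2 * f r * f' r).intervalIntegrable _ _)
      have h := (hf r).mul (hf r)
      rw [show (fun r => f r ^ 2) = f * f from funext fun r => sq (f r)]
      exact h.congr_deriv (by ring)
    have hc2 : Continuous fun r => f r ^ 2 + f' r ^ 2 := by fun_prop
    have h2 : |∫ r in s..t, 2 * f r * f' r| ≤ |∫ r in s..t, (f r ^ 2 + f' r ^ 2)| :=
      intervalIntegral.norm_integral_le_abs_of_norm_le
        (f := fun r => 2 * f r * f' r) (g := fun r => f r ^ 2 + f' r ^ 2) (Eventually.of_forall fun r => by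
          rw [Real.norm_eq_abs, abs_le]
          constructor <;> nlinarith [sq_nonneg (f r - f' r), sq_nonneg (f r + f' r)])
        (hc2.intervalIntegrable _ _)
    have h3 : |∫ r in s..t, (f r ^ 2 + f' r ^ 2)| ≤ I := by
      rcases le_total s t with h | h
      · rw [abs_of_nonneg (intervalIntegral.integral_nonneg h fun _ _ => by positivity)]
        exact integral_mono_set hc2 (fun _ => by positivity) hs.1 h ht.2
      · rw [intervalIntegral.integral_symm, abs_neg,
          abs_of_nonneg (intervalIntegral.integral_nonneg h fun _ _ => by positivity)]
        exact integral_mono_set hc2 (fun _ => by positivity) ht.1 h hs.2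
    rw [h1] at h2
    linarith [le_abs_self (f t ^ 2 - f s ^ 2)]
  have h4 := intervalIntegral.integral_mono_on hcd' intervalIntegrable_const i1 key
  rw [intervalIntegral.integral_const, smul_eq_mul] at h4
  have h5 : 0 ≤ ∫ s in c..d, f s ^ 2 :=
    intervalIntegral.integral_nonneg hcd' fun _ _ => sq_nonneg _
  have h6 : f t ^ 2 - I ≤ ∫ s in c..d, f s ^ 2 := by
    rcases le_total (f t ^ 2 - I) 0 with h | h
    · linarith
    · nlinarith
  linarith

section

variable {n m : ℕ} {p : Matrix (Fin n) (Fin n) ℝ} {a : Fin n → ℝ → ℝ → ℝ}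
  {bd : Fin n → ℝ → ℝ → ℝ} {bt e b' : Fin n → Fin n → ℝ → ℝ → ℝ} {τ R : ℝ} {S : Setting m a}
  {u ux ut z : Fin n → ℝ → ℝ → ℝ}

lemma continuous_tr (hu : ∀ j, TC1 (u j) (ut j)) : Continuous fun t => tr m u t :=
  continuous_finsetSum _ fun k _ => ((hu k).comp_cont continuous_const continuous_id).pow 2

lemma continuous_sqn (hu : ∀ j, TC1 (u j) (ut j)) : Continuous fun t => sqn u t :=
  continuous_finsetSum _ fun k _ =>
    intervalIntegral.continuous_parametric_intervalIntegral_of_continuous'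
      (f := fun t x => u k x t ^ 2)
      (show Continuous fun z : ℝ × ℝ => u k z.2 z.1 ^ 2 from
        ((hu k).comp_cont continuous_snd continuous_fst).pow 2) _ _

/-- The square mean in time of a solution at a fixed point. -/
lemma LevyData.exists_integral_sq_le (hD : LevyData S p bd bt e b' R) {L : ℝ} (hL : 0 ≤ L) :
    ∃ C, 0 ≤ C ∧ ∀ τ u ux ut, IsSol m p a (perturb bd bt) τ (fun _ _ _ => 0) u ux ut →
      (∀ j, TC1 (u j) (ut j)) → ∀ j, ∀ x ∈ Icc (0 : ℝ) 1,
        ∫ t in τ + S.Λ⁻¹..τ + S.Λ⁻¹ + L, u j x t ^ 2 ≤ C * sqn u τ := by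
  have hR := hD.R_pos
  have hR0 : 0 ≤ R := by linarith
  have hl := inv_pos.2 S.Λ_pos
  have hDp := S.D_pos
  obtain ⟨C, κ, hC, hκ, hen⟩ := S.exists_energy p hR0
  -- The time span needed from `τ`: entry times reach back to `τ`, and the line integrals that start
  -- in the window end up to one crossing time after it.
  set L' := S.Λ⁻¹ + L + S.Λ⁻¹ with hL'
  set E := C * Real.exp (κ * L') with hE
  refine ⟨S.D * (2 * n * R ^ 4 * (E + S.D * (L' * E))), by positivity, ?_⟩
  intro τ u ux ut h hu j x hx
  have hen' := hen _ _ _ hD.coef (fun j k x hx t => (hD.coef j k).bound x hx t) τ _ u ux ut h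
    (fun _ => 0) continuous_const (fun t _ => by simp [sqn])
  simp only [intervalIntegral.integral_zero, add_zero] at hen'
  have q0 := sqn_nonneg u τ
  have hen2 : ∀ t, τ ≤ t → t ≤ τ + L' → sqn u t + ∫ s in τ..t, tr m u s ≤ E * sqn u τ := by
    intro t h1 h2
    refine (hen' t h1).trans (mul_le_mul_of_nonneg_right ?_ q0)
    refine mul_le_mul_of_nonneg_left (Real.exp_le_exp.2 ?_) (by linarith)
    exact mul_le_mul_of_nonneg_left (by linarith) hκ
  set d := τ + S.Λ⁻¹ + L with hd
  have ctr := continuous_tr (m := m) hu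
  have clS := S.continuous_lineS hu j
  have hpt : ∀ t ∈ Icc (τ + S.Λ⁻¹) d, u j x t ^ 2 ≤
      2 * n * R ^ 4 * (tr m u (S.σ j x t) + S.lineS u j (S.σ j x t)) := by
    intro t ht
    have hs : τ ≤ S.σ j x t := by linarith [(S.σ_bounds j hx t).1, ht.1]
    have h1 := hD.abs_le h hu j hx hs
    set s := S.σ j x t
    have h2 := sq_sum_abs_le fun k => u k (outlet m k) s
    have h3 := S.lineI_sq_le hu j s
    have n1 : 0 ≤ ∑ k, |u k (outlet m k) s| := Finset.sum_nonneg fun _ _ => abs_nonneg _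
    have n2 := S.lineI_nonneg u j s
    have h4 : u j x t ^ 2 ≤ (R * ∑ k, |u k (outlet m k) s| + R * R * S.lineI u j s) ^ 2 :=
      sq_le_sq' (by linarith [neg_abs_le (u j x t)]) ((le_abs_self _).trans h1)
    have h5 : R ^ 2 ≤ R ^ 4 := pow_le_pow_right₀ hR (by norm_num)
    have h6 : (R * ∑ k, |u k (outlet m k) s| + R * R * S.lineI u j s) ^ 2 ≤
        2 * (R ^ 2 * (∑ k, |u k (outlet m k) s|) ^ 2) + 2 * (R ^ 4 * S.lineI u j s ^ 2) := by
      nlinarith [sq_nonneg (R * ∑ k, |u k (outlet m k) s| - R * R * S.lineI u j s)]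
    have h7 : R ^ 2 * (∑ k, |u k (outlet m k) s|) ^ 2 ≤ R ^ 4 * (n * tr m u s) :=
      mul_le_mul h5 h2 (sq_nonneg _) (by positivity)
    have h8 : R ^ 4 * S.lineI u j s ^ 2 ≤ R ^ 4 * (n * S.lineS u j s) :=
      mul_le_mul_of_nonneg_left h3 (by positivity)
    linarith
  have hcd : τ + S.Λ⁻¹ ≤ d := by linarith
  have hcσ : Continuous fun t => S.σ j x t := (S.tc1_σ j).comp_cont continuous_const continuous_id
  have hch : Continuous fun s => 2 * n * R ^ 4 * (tr m u s + S.lineS u j s) :=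
    continuous_const.mul (ctr.add clS)
  have i1 := intervalIntegral.integral_mono_on (μ := volume) hcd (f := fun t => u j x t ^ 2)
    ((((hu j).comp_cont continuous_const continuous_id).pow 2).intervalIntegrable _ _)
    ((hch.comp hcσ).intervalIntegrable _ _) hpt
  have i2 := S.integral_comp_σ_le j hx hch (fun s => by
    have := tr_nonneg (m := m) u s
    have := S.lineS_nonneg u j s
    positivity) hcd
  refine i1.trans (i2.trans ?_)
  rw [mul_assoc S.D]
  refine mul_le_mul_of_nonneg_left ?_ hDp.le
  rw [add_sub_cancel_right, intervalIntegral.integral_const_mul, mul_assoc _ _ (sqn u τ)]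
  refine mul_le_mul_of_nonneg_left ?_ (by positivity)
  rw [intervalIntegral.integral_add (ctr.intervalIntegrable _ _) (clS.intervalIntegrable _ _),
    add_mul, mul_assoc S.D]
  have hτd : τ ≤ d := by linarith
  refine add_le_add ?_ ((S.integral_lineS_le hu j hτd).trans (mul_le_mul_of_nonneg_left ?_ hDp.le))
  · linarith [hen2 d hτd (by linarith), sqn_nonneg u d]
  · have i3 := intervalIntegral.integral_mono_on (μ := volume) (a := τ) (b := d + S.Λ⁻¹) (by linarith)
      ((continuous_sqn hu).intervalIntegrable _ _) (g := fun _ => E * sqn u τ)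
      intervalIntegrable_const fun t ht => by
        have := hen2 t ht.1 (by linarith [ht.2])
        have h9 : 0 ≤ ∫ s in τ..t, tr m u s :=
          intervalIntegral.integral_nonneg ht.1 fun s _ => tr_nonneg u s
        linarith
    rw [intervalIntegral.integral_const, smul_eq_mul] at i3
    refine i3.trans (le_of_eq ?_)
    rw [hL', hd]; ring

lemma LevyData.abs_trans'_le (hD : LevyData S p bd bt e b' R) (z : Fin n → ℝ → ℝ → ℝ) (j : Fin n)
    {x : ℝ} (hx : x ∈ Icc (0 : ℝ) 1) (t : ℝ) :
    |S.trans' p bd z j x t| ≤ R ^ 3 * ∑ k, |z k (outlet m k) (S.σ j x t)| := by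
  have hR := hD.R_pos
  have hR0 : 0 ≤ R := by linarith
  rw [Setting.trans', abs_mul, abs_mul, abs_of_pos (S.wgt_pos bd j x _),
    abs_of_pos (S.σt_pos j x t), opP_eq, show R ^ 3 = R * R * R by ring, mul_assoc (R * R)]
  exact mul_le_mul (mul_le_mul (hD.wgt_le j x hx _).1 ((S.σt_le j hx t).trans hD.D_le)
    (S.σt_pos j x t).le hR0) (abs_sum_mul_le fun k => hD.p_le j k) (abs_nonneg _) (by positivity)

/-- Every application looks back by at most `1 / Λ`, so it shortens the admissible window by this
length at its left end. -/
lemma LevyData.abs_iterate_le (hD : LevyData S p bd bt e b' R) {c d Q : ℝ}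
    (hz : ∀ j, ∀ x ∈ Icc (0 : ℝ) 1, ∀ t ∈ Icc c d, |z j x t| ≤ Q) (i : ℕ) :
    ∀ j, ∀ x ∈ Icc (0 : ℝ) 1, ∀ t ∈ Icc (c + i * S.Λ⁻¹) d,
      |(S.trans' p bd)^[i] z j x t| ≤ (R ^ 3 * n) ^ i * Q := by
  induction i with
  | zero => simpa using hz
  | succ i ih =>
    intro j x hx t ht
    have hR := hD.R_pos
    push_cast at ht
    rw [Function.iterate_succ_apply']
    refine (hD.abs_trans'_le _ j hx t).trans ?_
    have : ∑ k, |(S.trans' p bd)^[i] z k (outlet m k) (S.σ j x t)| ≤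
        ∑ _k : Fin n, (R ^ 3 * n) ^ i * Q := Finset.sum_le_sum fun k _ =>
      ih k _ (outlet_mem m k) _ ⟨by linarith [(S.σ_bounds j hx t).1, ht.1],
        (S.σ_le j hx t).trans ht.2⟩
    refine (mul_le_mul_of_nonneg_left this (by positivity)).trans (le_of_eq ?_)
    simp
    ring

lemma continuous_iterate (hbd : ∀ j, IsBC1 (bd j))
    (hz : ∀ j, Continuous fun q : ℝ × ℝ => z j q.1 q.2) (i : ℕ) :
    ∀ j, Continuous fun q : ℝ × ℝ => (S.trans' p bd)^[i] z j q.1 q.2 := by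
  induction i with
  | zero => exact hz
  | succ i ih =>
    rw [Function.iterate_succ']
    exact S.continuous_trans' hbd ih

/-- The analogue of `LevyData.abs_iterate_le` for square means. One step costs `R⁶ n` for squaring
the pointwise bound, `n` for summing over the outlets and `D ≤ R` for the substitution by `σ`. -/
lemma LevyData.integral_iterate_le (hD : LevyData S p bd bt e b' R)
    (hzc : ∀ j, Continuous fun q : ℝ × ℝ => z j q.1 q.2) {c d Q : ℝ}
    (hz : ∀ j, ∀ x ∈ Icc (0 : ℝ) 1, ∫ t in c..d, z j x t ^ 2 ≤ Q) (i : ℕ)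
    (hcd : c + i * S.Λ⁻¹ ≤ d) :
    ∀ j, ∀ x ∈ Icc (0 : ℝ) 1, ∫ t in c + i * S.Λ⁻¹..d, (S.trans' p bd)^[i] z j x t ^ 2 ≤
      (R ^ 7 * n ^ 2) ^ i * Q := by
  induction i with
  | zero => simpa using hz
  | succ i ih =>
    intro j x hx
    have hR := hD.R_pos
    have hl := inv_pos.2 S.Λ_pos
    push_cast at hcd
    have ih := ih (by linarith)
    have hw := continuous_iterate (S := S) (p := p) hD.bd_bc1 hzc i
    rw [Function.iterate_succ_apply']
    set w := (S.trans' p bd)^[i] z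
    have hcσ : Continuous fun t => S.σ j x t := (S.tc1_σ j).comp_cont continuous_const continuous_id
    have hck : ∀ k, Continuous fun s => w k (outlet m k) s ^ 2 := fun k =>
      ((hw k).comp (continuous_const.prodMk continuous_id)).pow 2
    have hcS : Continuous fun s => R ^ 6 * (n * ∑ k, w k (outlet m k) s ^ 2) :=
      continuous_const.mul (continuous_const.mul (continuous_finsetSum _ fun k _ => hck k))
    push_cast
    have hcd' : c + (i + 1) * S.Λ⁻¹ ≤ d := by linarith
    have i1 := intervalIntegral.integral_mono_on (μ := volume) hcd'
      ((((S.continuous_trans' (p := p) hD.bd_bc1 hw j).comp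
        (continuous_const.prodMk continuous_id)).pow 2).intervalIntegrable _ _)
      ((hcS.comp hcσ).intervalIntegrable _ _) (f := fun t => S.trans' p bd w j x t ^ 2) fun t _ => by
        have h1 := hD.abs_trans'_le w j hx t
        have h2 := sq_sum_abs_le fun k => w k (outlet m k) (S.σ j x t)
        rw [← sq_abs]
        refine (pow_le_pow_left₀ (abs_nonneg _) h1 2).trans ?_
        rw [mul_pow, ← pow_mul]
        exact mul_le_mul_of_nonneg_left h2 (by positivity)
    refine i1.trans ((S.integral_comp_σ_le j hx hcS (fun s => by positivity) hcd').trans ?_)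
    rw [show c + (i + 1) * S.Λ⁻¹ - S.Λ⁻¹ = c + i * S.Λ⁻¹ by ring,
      intervalIntegral.integral_const_mul, intervalIntegral.integral_const_mul,
      intervalIntegral.integral_finsetSum fun k _ => (hck k).intervalIntegrable _ _]
    have h3 : ∑ k, ∫ s in c + i * S.Λ⁻¹..d, w k (outlet m k) s ^ 2 ≤
        n * ((R ^ 7 * n ^ 2) ^ i * Q) := by
      refine (Finset.sum_le_sum fun k _ => ih k _ (outlet_mem m k)).trans (le_of_eq (by simp))
    have h4 : 0 ≤ ∑ k, ∫ s in c + i * S.Λ⁻¹..d, w k (outlet m k) s ^ 2 :=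
      Finset.sum_nonneg fun k _ => intervalIntegral.integral_nonneg (by linarith) fun _ _ =>
        sq_nonneg _
    calc _ ≤ R * (R ^ 6 * (n * (n * ((R ^ 7 * n ^ 2) ^ i * Q)))) := by
          refine mul_le_mul hD.D_le ?_ (by positivity) (by linarith)
          gcongr
      _ = _ := by ring

end

end

end Hyp

/-! ### Gain of one derivative and the smoothing estimate. -/

namespace Hyp

noncomputable section

section

variable {n m : ℕ} {p : Matrix (Fin n) (Fin n) ℝ} {a : Fin n → ℝ → ℝ → ℝ}
  {bd : Fin n → ℝ → ℝ → ℝ} {bt e b' : Fin n → Fin n → ℝ → ℝ → ℝ} {τ R : ℝ} {S : Setting m a}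
  {u ux ut z : Fin n → ℝ → ℝ → ℝ}

lemma LevyData.continuous_modD (hD : LevyData S p bd bt e b' R) (hu : ∀ j, TC1 (u j) (ut j))
    (j : Fin n) : Continuous fun q : ℝ × ℝ => modD e u ut j q.1 q.2 :=
  (hu j).cont'.add (continuous_finsetSum _ fun k _ => (hD.e_bc1 j k).tc1.cont.mul (hu k).cont)

lemma LevyData.continuous_defect (hD : LevyData S p bd bt e b' R) (hu : ∀ j, TC1 (u j) (ut j))
    (j : Fin n) : Continuous fun q : ℝ × ℝ =>
      modD e u ut j q.1 q.2 - S.trans' p bd (modD e u ut) j q.1 q.2 :=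
  (hD.continuous_modD hu j).sub (S.continuous_trans' hD.bd_bc1 (hD.continuous_modD hu) j)

/-- A uniform bound of a solution gives a uniform bound of its modified time derivative at later
times. -/
lemma LevyData.exists_abs_modD_le (hD : LevyData S p bd bt e b' R) {N : ℕ}
    (hN : ∀ z j x t, (S.trans' p bd)^[N] z j x t = 0) :
    ∃ C, 0 ≤ C ∧ ∀ τ u ux ut, IsSol m p a (perturb bd bt) τ (fun _ _ _ => 0) u ux ut →
      (∀ j, TC1 (u j) (ut j)) → ∀ c d Q, τ < c → 0 ≤ Q →
      (∀ j, ∀ x ∈ Icc (0 : ℝ) 1, ∀ t ∈ Icc c (d + S.Λ⁻¹), |u j x t| ≤ Q) →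
        ∀ j, ∀ x ∈ Icc (0 : ℝ) 1, ∀ t ∈ Icc (c + S.Λ⁻¹ + N * S.Λ⁻¹) d,
          |modD e u ut j x t| ≤ C * Q := by
  have hR := hD.R_pos
  have hl := inv_pos.2 S.Λ_pos
  set Cd := R * R * (R * R * (4 * R ^ 2 + R + (n + 1) * R ^ 3) + R + n * (R * R)) with hCd
  have hCd0 : 0 ≤ Cd := by positivity
  refine ⟨(∑ i ∈ Finset.range N, (R ^ 3 * n) ^ i) * (Cd * (n * 2 + n)), by positivity, ?_⟩
  intro τ u ux ut h hu c d Q hc hQ hb j x hx t ht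
  have hw : ∀ j, ∀ x ∈ Icc (0 : ℝ) 1, ∀ t ∈ Icc (c + S.Λ⁻¹) d,
      |modD e u ut j x t - S.trans' p bd (modD e u ut) j x t| ≤ Cd * (n * 2 + n) * Q := by
    intro j x hx t ht
    have hs : c ≤ S.σ j x t := by linarith [(S.σ_bounds j hx t).1, ht.1]
    have hs' : S.σ j x t ≤ d := (S.σ_le j hx t).trans ht.2
    refine (hD.abs_defect_le h hu j hx (hc.trans_le hs)).trans ?_
    rw [mul_assoc Cd]
    refine mul_le_mul_of_nonneg_left ?_ hCd0
    set s := S.σ j x t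
    have h1 : ends u s ≤ ∑ _k : Fin n, (Q + Q) := Finset.sum_le_sum fun k _ =>
      add_le_add (hb k 0 (by simp) s ⟨hs, by linarith⟩) (hb k 1 (by simp) s ⟨hs, by linarith⟩)
    have h2 : S.lineI u j s ≤ ∫ _ξ in (0 : ℝ)..1, n * Q := by
      refine intervalIntegral.integral_mono_on zero_le_one
        ((continuous_finsetSum _ fun k _ => (S.cont_along hu j k s).abs).intervalIntegrable _ _)
        intervalIntegrable_const fun ξ hξ => ?_
      refine (Finset.sum_le_sum fun k _ => hb k ξ hξ _ ⟨?_, ?_⟩ : _ ≤ ∑ _k : Fin n, Q).trans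
        (le_of_eq (by simp))
      · linarith [S.le_y j hξ s]
      · linarith [(S.y_bounds j hξ s).2]
    simp only [Finset.sum_const, Finset.card_univ, Fintype.card_fin, nsmul_eq_mul] at h1
    simp only [intervalIntegral.integral_const, sub_zero, one_smul] at h2
    linarith
  -- Nilpotency replaces the derivative by finitely many iterates of its defect, and the defect is
  -- bounded by values of `u`. No information on derivatives at earlier times enters.
  rw [S.eq_sum_iterate (modD e u ut) (hN _) j x t, mul_assoc, Finset.sum_mul]
  refine (Finset.abs_sum_le_sum_abs _ _).trans (Finset.sum_le_sum fun i hi => ?_)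
  have hi' : (i : ℝ) ≤ N := by exact_mod_cast (Finset.mem_range.1 hi).le
  exact hD.abs_iterate_le hw i j x hx t
    ⟨by linarith [ht.1, mul_le_mul_of_nonneg_right hi' hl.le], ht.2⟩

/-- The square mean of a solution controls the square mean of its modified time derivative at later
times. -/
lemma LevyData.exists_integral_modD_le (hD : LevyData S p bd bt e b' R) {N : ℕ}
    (hN : ∀ z j x t, (S.trans' p bd)^[N] z j x t = 0) :
    ∃ C, 0 ≤ C ∧ ∀ τ u ux ut, IsSol m p a (perturb bd bt) τ (fun _ _ _ => 0) u ux ut →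
      (∀ j, TC1 (u j) (ut j)) → ∀ c d Q, τ < c → 0 ≤ Q → c + S.Λ⁻¹ + N * S.Λ⁻¹ ≤ d →
      (∀ j, ∀ x ∈ Icc (0 : ℝ) 1, ∫ t in c..d + S.Λ⁻¹, u j x t ^ 2 ≤ Q) →
        ∀ j, ∀ x ∈ Icc (0 : ℝ) 1,
          ∫ t in c + S.Λ⁻¹ + N * S.Λ⁻¹..d, modD e u ut j x t ^ 2 ≤ C * Q := by
  have hR := hD.R_pos
  have hl := inv_pos.2 S.Λ_pos
  have hDp := S.D_pos
  set Cd := R * R * (R * R * (4 * R ^ 2 + R + (n + 1) * R ^ 3) + R + n * (R * R)) with hCd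
  have hCd0 : 0 ≤ Cd := by positivity
  -- The outer `D` is the Jacobian of `σ`, and `2 Cd²` comes from squaring a sum of two terms. The
  -- summands belong to the endpoint values and to the line integrals.
  set C' := S.D * (2 * Cd ^ 2 * (n * (4 * n) + n * (S.D * n))) with hC'
  refine ⟨N * ((∑ i ∈ Finset.range N, (R ^ 7 * n ^ 2) ^ i) * C'), by positivity, ?_⟩
  intro τ u ux ut h hu c d Q hc hQ hcd hb j x hx
  have hNl : 0 ≤ N * S.Λ⁻¹ := by positivity
  have hcu : ∀ k x, Continuous fun t => u k x t ^ 2 := fun k x =>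
    ((hu k).comp_cont continuous_const continuous_id).pow 2
  have hw : ∀ j, ∀ x ∈ Icc (0 : ℝ) 1, ∫ t in c + S.Λ⁻¹..d,
      (modD e u ut j x t - S.trans' p bd (modD e u ut) j x t) ^ 2 ≤ C' * Q := by
    intro j x hx
    have hcσ : Continuous fun t => S.σ j x t := (S.tc1_σ j).comp_cont continuous_const continuous_id
    have clS := S.continuous_lineS hu j
    have cE : Continuous fun s => ∑ k, (2 * u k 0 s ^ 2 + 2 * u k 1 s ^ 2) :=
      continuous_finsetSum _ fun k _ =>
        (continuous_const.mul (hcu k 0)).add (continuous_const.mul (hcu k 1))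
    have hch : Continuous fun s => 2 * Cd ^ 2 *
        (n * (∑ k, (2 * u k 0 s ^ 2 + 2 * u k 1 s ^ 2)) + n * S.lineS u j s) :=
      continuous_const.mul ((continuous_const.mul cE).add (continuous_const.mul clS))
    have hcd1 : c + S.Λ⁻¹ ≤ d := by linarith
    have hcd2 : c ≤ d := by linarith
    have i1 := intervalIntegral.integral_mono_on (μ := volume) hcd1
      (f := fun t => (modD e u ut j x t - S.trans' p bd (modD e u ut) j x t) ^ 2)
      ((((hD.continuous_defect hu j).comp
        (continuous_const.prodMk continuous_id)).pow 2).intervalIntegrable _ _)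
      ((hch.comp hcσ).intervalIntegrable _ _) fun t ht => by
        have hs : c ≤ S.σ j x t := by linarith [(S.σ_bounds j hx t).1, ht.1]
        have h1 := hD.abs_defect_le h hu j hx (hc.trans_le hs)
        have h2 := S.lineI_sq_le hu j (S.σ j x t)
        have h3 : ends u (S.σ j x t) ^ 2 ≤
            n * ∑ k, (2 * u k 0 (S.σ j x t) ^ 2 + 2 * u k 1 (S.σ j x t) ^ 2) := by
          have h4 := sq_sum_abs_le fun k => |u k 0 (S.σ j x t)| + |u k 1 (S.σ j x t)|
          refine (le_of_eq ?_).trans (h4.trans (mul_le_mul_of_nonneg_left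
            (Finset.sum_le_sum fun k _ => ?_) (Nat.cast_nonneg n)))
          · unfold ends
            congr 1
            exact Finset.sum_congr rfl fun k _ => (abs_of_nonneg (by positivity)).symm
          · rw [← sq_abs (u k 0 _), ← sq_abs (u k 1 _)]
            nlinarith [sq_nonneg (|u k 0 (S.σ j x t)| - |u k 1 (S.σ j x t)|)]
        simp only [Function.comp_apply]
        rw [← sq_abs]
        refine (pow_le_pow_left₀ (abs_nonneg _) h1 2).trans ?_
        rw [mul_pow, mul_comm 2 (Cd ^ 2), mul_assoc (Cd ^ 2)]
        refine mul_le_mul_of_nonneg_left ?_ (sq_nonneg _)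
        nlinarith [sq_nonneg (ends u (S.σ j x t) - S.lineI u j (S.σ j x t))]
    refine i1.trans ((S.integral_comp_σ_le j hx hch (fun s => ?_) hcd1).trans ?_)
    · have := S.lineS_nonneg u j s
      positivity
    rw [hC', mul_assoc S.D, add_sub_cancel_right]
    refine mul_le_mul_of_nonneg_left ?_ hDp.le
    rw [intervalIntegral.integral_const_mul, mul_assoc _ _ Q]
    refine mul_le_mul_of_nonneg_left ?_ (by positivity)
    rw [integral_mul_add_mul cE clS, add_mul, mul_assoc, mul_assoc (n : ℝ) (S.D * n)]
    refine add_le_add (mul_le_mul_of_nonneg_left ?_ (Nat.cast_nonneg n))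
      (mul_le_mul_of_nonneg_left ?_ (Nat.cast_nonneg n))
    · have i2 : ∀ k, IntervalIntegrable (fun s => 2 * u k 0 s ^ 2 + 2 * u k 1 s ^ 2) volume c d :=
        fun k => Continuous.intervalIntegrable
          ((continuous_const.mul (hcu k 0)).add (continuous_const.mul (hcu k 1))) _ _
      rw [intervalIntegral.integral_finsetSum fun k _ => i2 k]
      refine (Finset.sum_le_sum fun k _ => ?_ : _ ≤ ∑ _k : Fin n, 4 * Q).trans
        (le_of_eq (by simp; ring))
      rw [integral_mul_add_mul (hcu k 0) (hcu k 1)]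
      have h0 := (integral_mono_set (hcu k 0) (fun _ => sq_nonneg _) le_rfl hcd2
        (by linarith : d ≤ d + S.Λ⁻¹)).trans (hb k 0 (by simp))
      have h1 := (integral_mono_set (hcu k 1) (fun _ => sq_nonneg _) le_rfl hcd2
        (by linarith : d ≤ d + S.Λ⁻¹)).trans (hb k 1 (by simp))
      linarith
    · refine (S.integral_lineS_le hu j hcd2).trans ?_
      rw [mul_assoc]
      refine mul_le_mul_of_nonneg_left ?_ hDp.le
      rw [Setting.integral_sqn_eq hu (by linarith)]
      refine (Finset.sum_le_sum fun k _ => ?_ : _ ≤ ∑ _k : Fin n, Q).trans (le_of_eq (by simp))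
      have c4 : Continuous fun ξ => ∫ t in c..d + S.Λ⁻¹, u k ξ t ^ 2 :=
        intervalIntegral.continuous_parametric_intervalIntegral_of_continuous'
          (f := fun ξ t => u k ξ t ^ 2)
          (show Continuous fun z : ℝ × ℝ => u k z.1 z.2 ^ 2 from (hu k).cont.pow 2) _ _
      refine (intervalIntegral.integral_mono_on zero_le_one (c4.intervalIntegrable _ _)
        intervalIntegrable_const fun ξ hξ => hb k ξ hξ).trans (le_of_eq (by simp))
  have hci := fun i => continuous_iterate (S := S) (p := p) hD.bd_bc1
    (z := fun j x t => modD e u ut j x t - S.trans' p bd (modD e u ut) j x t)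
    (hD.continuous_defect hu) i j
  have hcx : ∀ i, Continuous fun t => (S.trans' p bd)^[i]
      (fun j x t => modD e u ut j x t - S.trans' p bd (modD e u ut) j x t) j x t ^ 2 := fun i =>
    ((hci i).comp (continuous_const.prodMk continuous_id)).pow 2
  have i2 := intervalIntegral.integral_mono_on (μ := volume) hcd
    (f := fun t => modD e u ut j x t ^ 2)
    ((((hD.continuous_modD hu j).comp
      (continuous_const.prodMk continuous_id)).pow 2).intervalIntegrable _ _)
    ((continuous_const.mul (continuous_finsetSum _ fun i _ => hcx i)).intervalIntegrable _ _)
    (g := fun t => N * ∑ i ∈ Finset.range N, (S.trans' p bd)^[i]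
      (fun j x t => modD e u ut j x t - S.trans' p bd (modD e u ut) j x t) j x t ^ 2) fun t _ => by
      rw [S.eq_sum_iterate (modD e u ut) (hN _) j x t]
      exact (sq_sum_le_card_mul_sum_sq).trans (le_of_eq (by simp))
  refine i2.trans ?_
  rw [intervalIntegral.integral_const_mul,
    intervalIntegral.integral_finsetSum fun i _ => (hcx i).intervalIntegrable _ _, mul_assoc,
    mul_assoc, Finset.sum_mul]
  refine mul_le_mul_of_nonneg_left (Finset.sum_le_sum fun i hi => ?_) (Nat.cast_nonneg N)
  have hi' : (i : ℝ) ≤ N := by exact_mod_cast (Finset.mem_range.1 hi).le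
  have hi2 := mul_le_mul_of_nonneg_right hi' hl.le
  exact (integral_mono_set (hcx i) (fun _ => sq_nonneg _) (by linarith) hcd le_rfl).trans
    (hD.integral_iterate_le
      (z := fun j x t => modD e u ut j x t - S.trans' p bd (modD e u ut) j x t) (hD.continuous_defect hu) hw i (by linarith) j x hx)

/-- The smoothing estimate: after a time that depends only on the unperturbed problem, a solution
is bounded in `C¹` by the square mean of its initial value. -/
theorem LevyData.exists_smoothing (hD : LevyData S p bd bt e b' R) {N : ℕ}
    (hN : ∀ z j x t, (S.trans' p bd)^[N] z j x t = 0) :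
    ∃ C, 0 ≤ C ∧ ∀ τ u ux ut, IsSol m p a (perturb bd bt) τ (fun _ _ _ => 0) u ux ut →
      ∀ j, ∀ x ∈ Icc (0 : ℝ) 1,
        |u j x (τ + (2 * N + 3) * S.Λ⁻¹)| ≤ C * Real.sqrt (sqn u τ) ∧
        |ux j x (τ + (2 * N + 3) * S.Λ⁻¹)| ≤ C * Real.sqrt (sqn u τ) := by
  have hR := hD.R_pos
  have hl := inv_pos.2 S.Λ_pos
  -- The window runs from `τ + 1/Λ` to `T + 2/Λ + 1`. On the left, each of the two gains of a
  -- derivative uses up `(N + 1) / Λ`. On the right, each uses up `1 / Λ`, and the extra unit gives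
  -- the Sobolev inequality an interval of length at least one.
  obtain ⟨C₁, hC₁, h₁⟩ := hD.exists_integral_sq_le (L := (2 * N + 4) * S.Λ⁻¹ + 1) (by positivity)
  obtain ⟨C₂, hC₂, h₂⟩ := hD.exists_integral_modD_le hN
  obtain ⟨C₃, hC₃, h₃⟩ := hD.exists_abs_modD_le hN
  -- The Sobolev constant: `2 C₁` for the square mean of `u`, the rest for that of `ut`, recovered
  -- as the modified derivative minus the terms with `e`.
  set q := Real.sqrt (2 * C₁ + (2 * (C₂ * C₁) + 2 * (n * R ^ 2 * (n * C₁)))) with hq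
  have hq0 : 0 ≤ q := Real.sqrt_nonneg _
  refine ⟨q + R * (C₃ * q + R * (n * q) + R * (n * q)), by positivity, ?_⟩
  intro τ u₀ ux ut₀ h₀ j x hx
  obtain ⟨u, ut, h, hu, he⟩ := h₀.exists_global
  set T := τ + (2 * N + 3) * S.Λ⁻¹ with hT
  have hNl : 0 ≤ N * S.Λ⁻¹ := by positivity
  have hTτ : T = τ + S.Λ⁻¹ + S.Λ⁻¹ + N * S.Λ⁻¹ + S.Λ⁻¹ + N * S.Λ⁻¹ := by rw [hT]; ring
  have hτT : τ ≤ T := by linarith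
  have hsq : sqn u τ = sqn u₀ τ := Finset.sum_congr rfl fun j _ =>
    intervalIntegral.integral_congr fun x hx => by
      rw [uIcc_of_le zero_le_one] at hx
      simp only [(he j x hx τ self_mem_Ici).1]
  rw [← (he j x hx T hτT).1, ← hsq]
  have q0 := sqn_nonneg u τ
  set E := sqn u τ with hE
  set r := Real.sqrt E with hr
  have hr0 : 0 ≤ r := Real.sqrt_nonneg _
  have h₁' := h₁ τ u ux ut h hu
  set d := T + S.Λ⁻¹ + 1 with hd
  have hdd : τ + S.Λ⁻¹ + ((2 * N + 4) * S.Λ⁻¹ + 1) = d + S.Λ⁻¹ := by rw [hd, hT]; ring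
  rw [hdd] at h₁'
  set c := τ + S.Λ⁻¹ + S.Λ⁻¹ + N * S.Λ⁻¹ with hc
  have hcd : c + 1 ≤ d := by linarith
  have h₂' := h₂ τ u ux ut h hu (τ + S.Λ⁻¹) d (C₁ * E) (by linarith) (by positivity)
    (by linarith) h₁'
  rw [← hc] at h₂'
  have hcu : ∀ k x, Continuous fun t => u k x t ^ 2 := fun k x =>
    ((hu k).comp_cont continuous_const continuous_id).pow 2
  have hcm : ∀ k x, Continuous fun t => modD e u ut k x t ^ 2 := fun k x =>
    ((hD.continuous_modD hu k).comp (continuous_const.prodMk continuous_id)).pow 2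
  have hu2 : ∀ k, ∀ x ∈ Icc (0 : ℝ) 1, ∫ t in c..d, u k x t ^ 2 ≤ C₁ * E := fun k x hx =>
    (integral_mono_set (hcu k x) (fun _ => sq_nonneg _) (by linarith) (by linarith)
      (by linarith)).trans (h₁' k x hx)
  have hsum : ∀ k, ∀ x ∈ Icc (0 : ℝ) 1, ∀ t, |∑ l, e k l x t * u l x t| ≤ R * ∑ l, |u l x t| :=
    fun k x hx t => abs_sum_mul_le fun l => (hD.e_le k l x hx t).1
  have hsup : ∀ k, ∀ x ∈ Icc (0 : ℝ) 1, ∀ t ∈ Icc c d, |u k x t| ≤ q * r := by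
    intro k x hx t ht
    have hct : Continuous fun t => ut k x t := (hu k).comp_cont' continuous_const continuous_id
    have h1 := sq_le_integral (fun t => (hu k).deriv x t) hct hcd ht
    have csum : Continuous fun t => ∑ l, u l x t ^ 2 := continuous_finsetSum _ fun l _ => hcu l x
    have h2 : ∫ s in c..d, ut k x s ^ 2 ≤ 2 * (C₂ * (C₁ * E)) + 2 * (n * R ^ 2 * (n * (C₁ * E))) := by
      have i1 := intervalIntegral.integral_mono_on (μ := volume) (by linarith : c ≤ d)
        (f := fun t => ut k x t ^ 2)
        (g := fun t => 2 * modD e u ut k x t ^ 2 + 2 * (n * R ^ 2) * ∑ l, u l x t ^ 2)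
        ((hct.pow 2).intervalIntegrable _ _)
        (((continuous_const.mul (hcm k x)).add
          (continuous_const.mul csum)).intervalIntegrable _ _) fun t _ => by
          have e1 : ut k x t = modD e u ut k x t - ∑ l, e k l x t * u l x t := by
            simp [modD, cl_of_mem hx]
          have e2 : (∑ l, e k l x t * u l x t) ^ 2 ≤ n * R ^ 2 * ∑ l, u l x t ^ 2 := by
            rw [← sq_abs]
            refine (pow_le_pow_left₀ (abs_nonneg _) (hsum k x hx t) 2).trans ?_
            rw [mul_pow]
            nlinarith [sq_sum_abs_le fun l => u l x t, sq_nonneg R]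
          rw [e1]
          nlinarith [sq_nonneg (modD e u ut k x t + ∑ l, e k l x t * u l x t)]
      refine i1.trans ?_
      rw [integral_mul_add_mul (hcm k x) csum,
        intervalIntegral.integral_finsetSum fun l _ => (hcu l x).intervalIntegrable _ _]
      have h3 : ∑ l, ∫ t in c..d, u l x t ^ 2 ≤ n * (C₁ * E) :=
        (Finset.sum_le_sum fun l _ => hu2 l x hx).trans (le_of_eq (by simp))
      have h4 := mul_le_mul_of_nonneg_left h3 (by positivity : 0 ≤ 2 * (n * R ^ 2))
      linarith [h₂' k x hx]
    refine abs_le_of_sq_le_sq ?_ (by positivity)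
    rw [mul_pow, hq, hr, Real.sq_sqrt (by positivity), Real.sq_sqrt q0]
    linarith [hu2 k x hx]
  have hTm : T ∈ Icc c d := ⟨by linarith, by linarith⟩
  -- The second gain, now in the supremum norm. Its window begins exactly at `c + 1/Λ + N/Λ = T`,
  -- which fixes the time in the statement.
  have hmod := h₃ τ u ux ut h hu c (T + 1) (q * r) (by linarith) (by positivity)
    (fun k x hx t ht => hsup k x hx t ⟨ht.1, by linarith [ht.2]⟩) j x hx T
    ⟨by linarith, by linarith⟩
  have hs1 : ∑ l, |u l x T| ≤ n * (q * r) :=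
    (Finset.sum_le_sum fun l _ => hsup l x hx T hTm).trans (le_of_eq (by simp))
  have hs2 := mul_le_mul_of_nonneg_left hs1 (by linarith : 0 ≤ R)
  constructor
  · refine (hsup j x hx T hTm).trans (mul_le_mul_of_nonneg_right ?_ hr0)
    have : 0 ≤ R * (C₃ * q + R * (n * q) + R * (n * q)) := by positivity
    linarith
  · have e1 : ut j x T = modD e u ut j x T - ∑ l, e j l x T * u l x T := by
      simp [modD, cl_of_mem hx]
    have e2 := h.pde j x hx T hτT
    have e3 : ux j x T = (a j x T)⁻¹ * (-(modD e u ut j x T) + (∑ l, e j l x T * u l x T) -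
        ∑ l, perturb bd bt j l x T * u l x T) := by
      rw [eq_inv_mul_iff_mul_eq₀ (S.a_ne j hx T)]
      rw [e1] at e2
      linarith
    rw [e3, abs_mul]
    have b1 := abs_sub (-(modD e u ut j x T) + ∑ l, e j l x T * u l x T)
      (∑ l, perturb bd bt j l x T * u l x T)
    have b2 := abs_add_le (-(modD e u ut j x T)) (∑ l, e j l x T * u l x T)
    rw [abs_neg] at b2
    have b3 : |∑ l, perturb bd bt j l x T * u l x T| ≤ R * ∑ l, |u l x T| :=
      abs_sum_mul_le fun l => (hD.coef j l).bound x hx T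
    have b4 := hsum j x hx T
    refine (mul_le_mul (hD.inv_le j x hx T).1 (b1.trans (add_le_add b2 le_rfl)) (abs_nonneg _)
      (by linarith)).trans ?_
    have : 0 ≤ q * r := by positivity
    calc _ ≤ R * (C₃ * (q * r) + R * (n * (q * r)) + R * (n * (q * r))) := by
          refine mul_le_mul_of_nonneg_left ?_ (by linarith)
          linarith
      _ ≤ _ := by linarith [this, (by ring : R * (C₃ * (q * r) + R * (n * (q * r)) +
          R * (n * (q * r))) = R * (C₃ * q + R * (n * q) + R * (n * q)) * r)]

end

end

end Hyp

namespace Hyp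

noncomputable section

/-! ### The Levy condition -/

lemma isBC1_zero : IsBC1 fun _ _ => 0 :=
  ⟨contDiffOn_const, 0, fun x _ t => by simp [dx, dt]⟩

lemma IsBC1.hasDerivWithinAt_dx {f : ℝ → ℝ → ℝ} (hf : IsBC1 f) {x : ℝ} (hx : x ∈ Icc (0 : ℝ) 1)
    (t : ℝ) : HasDerivWithinAt (fun y => f y t) (dx f x t) (Icc 0 1) x :=
  hasDerivWithinAt_fst (J := univ) (hf.partials.2.2 x hx t) trivial

lemma IsBC1.mul {f g : ℝ → ℝ → ℝ} (hf : IsBC1 f) (hg : IsBC1 g) :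
    IsBC1 fun x t => f x t * g x t := by
  refine ⟨hf.1.mul hg.1, ?_⟩
  obtain ⟨K, hK⟩ := hf.2
  obtain ⟨L, hL⟩ := hg.2
  have hle : ∀ {r s r' s' : ℝ}, |r| ≤ K → |s| ≤ L → |r'| ≤ K → |s'| ≤ L →
      |r * s + r' * s'| ≤ K * L + K * L := by
    intro r s r' s' h1 h2 h3 h4
    refine (abs_add_le _ _).trans (add_le_add ?_ ?_) <;> rw [abs_mul]
    · exact mul_le_mul h1 h2 (abs_nonneg _) ((abs_nonneg _).trans h1)
    · exact mul_le_mul h3 h4 (abs_nonneg _) ((abs_nonneg _).trans h3)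
  refine ⟨K * L + K * L, fun x hx t => ?_⟩
  obtain ⟨f0, f1, f2⟩ := hK x hx t
  obtain ⟨g0, g1, g2⟩ := hL x hx t
  have hK0 := (abs_nonneg _).trans f0
  have hL0 := (abs_nonneg _).trans g0
  refine ⟨?_, ?_, ?_⟩
  · have h1 := hle f0 g0 (r' := 0) (s' := 0) (by simpa) (by simpa)
    simpa using h1
  · have h1 := ((hf.hasDerivWithinAt_dx hx t).mul (hg.hasDerivWithinAt_dx hx t)).derivWithin
      (uniqueDiffOn_Icc zero_lt_one x hx)
    unfold dx at f1 g1 h1 ⊢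
    rw [show (fun y => f y t * g y t) = (fun y => f y t) * fun y => g y t from rfl, h1]
    exact hle f1 g0 f0 g1
  · have h1 := ((hf.hasDerivAt_dt hx t).mul (hg.hasDerivAt_dt hx t)).deriv
    unfold dt at f2 g2 h1 ⊢
    rw [show (fun s => f x s * g x s) = (fun s => f x s) * fun s => g x s from rfl, h1]
    exact hle f2 g0 f0 g2

section

variable {n m : ℕ} {p : Matrix (Fin n) (Fin n) ℝ} {a : Fin n → ℝ → ℝ → ℝ}
  {bd : Fin n → ℝ → ℝ → ℝ} {bt : Fin n → Fin n → ℝ → ℝ → ℝ} {R : ℝ}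

lemma Setting.wgt_le (S : Setting m a) (hR : ∀ j, ∀ x ∈ Icc (0 : ℝ) 1, ∀ t, |bd j x t| ≤ R)
    (j : Fin n) {x : ℝ} (hx : x ∈ Icc (0 : ℝ) 1) (s : ℝ) :
    S.wgt bd j x s ≤ Real.exp (R * S.Λ⁻¹) ∧ (S.wgt bd j x s)⁻¹ ≤ Real.exp (R * S.Λ⁻¹) := by
  have h1 : |∫ η in x..inlet m j, bd j (cl η) (S.y j η s) * (a j (cl η) (S.y j η s))⁻¹| ≤
      R * S.Λ⁻¹ := by
    have hR0 : 0 ≤ R := (abs_nonneg _).trans (hR j x hx 0)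
    have hl := inv_pos.2 S.Λ_pos
    refine (intervalIntegral.norm_integral_le_of_norm_le_const (C := R * S.Λ⁻¹)
      (f := fun η => bd j (cl η) (S.y j η s) * (a j (cl η) (S.y j η s))⁻¹) fun η _ => ?_).trans
      (mul_le_of_le_one_right (by positivity) ?_)
    · rw [Real.norm_eq_abs, abs_mul]
      exact mul_le_mul (hR j _ (cl_mem η) _) (S.abs_inv_a_le j (cl_mem η) _) (abs_nonneg _) hR0
    · have := inlet_mem m j
      rw [abs_le]
      constructor <;> linarith [hx.1, hx.2, this.1, this.2]
  unfold Setting.wgt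
  rw [← Real.exp_neg]
  exact ⟨Real.exp_le_exp.2 (le_of_abs_le h1), Real.exp_le_exp.2 (neg_le_of_neg_le (neg_le_of_abs_le h1))⟩

lemma exists_le_of_finite {ι : Type*} [Finite ι] (f : ι → ℝ) : ∃ R, ∀ i, f i ≤ R := by
  obtain ⟨R, hR⟩ := (finite_range f).bddAbove
  exact ⟨R, fun i => hR ⟨i, rfl⟩⟩

/-- Admissible perturbations satisfy the requirements of the smoothing estimate. -/
lemma AdmissibleC1.exists_levyData (S : Setting m a) (p : Matrix (Fin n) (Fin n) ℝ)
    (hbd : ∀ j, IsBC1 (bd j)) {ε : ℝ} (h : AdmissibleC1 a ε bt) :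
    ∃ e b' R, LevyData S p bd bt e b' R := by
  -- Off the diagonal `e = β a_k`. On the diagonal the factor `a_k - a_j` is zero, so the relation
  -- forces the perturbation to vanish there, and `e = 0` will do.
  have he : ∀ j k, ∃ e, IsBC1 e ∧ ∀ x ∈ Icc (0 : ℝ) 1, ∀ t,
      bt j k x t * a k x t = e x t * (a k x t - a j x t) := by
    intro j k
    by_cases hjk : j = k
    · subst hjk
      exact ⟨_, isBC1_zero, fun x hx t => by simp [h.diag j x hx t]⟩
    · obtain ⟨β, hβ, hr⟩ := h.levy j k hjk
      exact ⟨_, hβ.mul (S.bc1 k), fun x hx t => by rw [hr x hx t]; ring⟩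
  choose e he hrel using he
  choose Kt hKt using fun j k => (h.bc1 j k).exists_isCoef
  obtain ⟨b', K', hb'⟩ := exists_isCoef_perturb hbd hKt
  choose Ke hKe using fun j k => (he j k).2
  choose Kd hKd using fun j => (hbd j).2
  obtain ⟨R₁, h₁⟩ := exists_le_of_finite fun q : Fin n × Fin n => K' q.1 q.2
  obtain ⟨R₂, h₂⟩ := exists_le_of_finite fun q : Fin n × Fin n => Ke q.1 q.2
  obtain ⟨R₃, h₃⟩ := exists_le_of_finite Kd
  obtain ⟨R₄, h₄⟩ := exists_le_of_finite fun q : Fin n × Fin n => |p q.1 q.2|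
  have hR₃ : ∀ j, ∀ x ∈ Icc (0 : ℝ) 1, ∀ t, |bd j x t| ≤ R₃ := fun j x hx t =>
    (hKd j x hx t).1.trans (h₃ j)
  -- The bound `R₃` of the diagonal coefficients is fixed beforehand, since the estimate of the
  -- weights is exponential in it and `R` has to dominate that as well.
  obtain ⟨R, hR⟩ := exists_le_of_finite
    ![R₁, R₂, R₃, R₄, S.D, S.Λ⁻¹, S.A * S.Λ⁻¹ ^ 2, Real.exp (R₃ * S.Λ⁻¹)]
  have r1 : R₁ ≤ R := hR 0
  have r2 : R₂ ≤ R := hR 1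
  have r3 : R₃ ≤ R := hR 2
  have r4 : R₄ ≤ R := hR 3
  have r5 : S.D ≤ R := hR 4
  have r6 : S.Λ⁻¹ ≤ R := hR 5
  have r7 : S.A * S.Λ⁻¹ ^ 2 ≤ R := hR 6
  have r8 : Real.exp (R₃ * S.Λ⁻¹) ≤ R := hR 7
  refine ⟨e, b', R, hbd, he, hrel, fun j k => (hb' j k).mono ((h₁ (j, k)).trans r1),
    fun j x hx t => (hR₃ j x hx t).trans r3, fun j k x hx t => ?_, fun j x hx t => ⟨?_, ?_⟩,
    fun j k => (h₄ (j, k)).trans r4, r5, fun j x hx s => ?_⟩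
  · obtain ⟨e0, e1, e2⟩ := hKe j k x hx t
    have := (h₂ (j, k)).trans r2
    exact ⟨e0.trans this, e1.trans this, e2.trans this⟩
  · exact (S.abs_inv_a_le j hx t).trans r6
  · refine le_trans ?_ r7
    rw [div_eq_mul_inv, abs_mul, abs_neg, ← inv_pow, abs_pow]
    exact mul_le_mul (S.dt_le j x hx t)
      (pow_le_pow_left₀ (abs_nonneg _) (S.abs_inv_a_le j hx t) 2) (by positivity) S.A_pos.le
  · obtain ⟨w1, w2⟩ := S.wgt_le hR₃ j hx s
    exact ⟨w1.trans r8, w2.trans r8⟩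

end

end

end Hyp

namespace Hyp

noncomputable section

/-! ### Smoothing of the evolution family -/

/-- Convergence of values at `0` and of derivatives, uniformly, implies convergence in
`C¹[0,1]`. -/
lemma exists_c1_limit {f f' : ℕ → ℝ → ℝ} {δ : ℕ → ℝ} {K : ℝ}
    (hc : ∀ l, ContinuousOn (f' l) (Icc 0 1))
    (hd : ∀ l, ∀ x ∈ Icc (0 : ℝ) 1, HasDerivWithinAt (f l) (f' l x) (Icc 0 1) x)
    {q : ℕ → ℕ → ℝ} (hq : Tendsto (fun i : ℕ × ℕ => q i.1 i.2) atTop (𝓝 0))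
    (h0 : ∀ l k, |f l 0 - f k 0| ≤ q l k)
    (h1 : ∀ l k, ∀ x ∈ Icc (0 : ℝ) 1, |f' l x - f' k x| ≤ q l k)
    (hδ : Tendsto δ atTop (𝓝 K))
    (hb : ∀ l, ∀ x ∈ Icc (0 : ℝ) 1, |f l x| ≤ δ l ∧ |f' l x| ≤ δ l) :
    ∃ (v : ℝ → ℝ) (r : ℕ → ℝ), ContDiffOn ℝ 1 v (Icc 0 1) ∧ c1Norm v ≤ 2 * K ∧
      Tendsto r atTop (𝓝 0) ∧ ∀ l, ∀ x ∈ Icc (0 : ℝ) 1, |f l x - v x| ≤ r l := by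
  have hm0 : (0 : ℝ) ∈ Icc (0 : ℝ) 1 := left_mem_Icc.2 zero_le_one
  have hq0 : ∀ l k, 0 ≤ q l k := fun l k => (abs_nonneg _).trans (h0 l k)
  -- The derivatives converge in the complete space of continuous functions; the limit function is
  -- then defined as a primitive of their limit.
  obtain ⟨W, hW⟩ : ∃ W : ℕ → C(Icc (0 : ℝ) 1, ℝ), ∀ l x, W l x = f' l x :=
    ⟨fun l => ⟨fun x => f' l x, (hc l).domRestrict⟩, fun _ _ => rfl⟩
  have cW : CauchySeq W := by
    rw [Metric.cauchySeq_iff]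
    intro ε hε
    have := hq.eventually (gt_mem_nhds hε)
    rw [eventually_atTop] at this
    obtain ⟨⟨N, N'⟩, hN⟩ := this
    refine ⟨max N N', fun l hl k hk => ?_⟩
    rw [dist_eq_norm]
    refine lt_of_le_of_lt ((ContinuousMap.norm_le _ (hq0 l k)).2 fun x => ?_)
      (hN (l, k) ⟨(le_max_left _ _).trans hl, (le_max_right _ _).trans hk⟩)
    rw [ContinuousMap.sub_apply, hW, hW]
    exact h1 l k x x.2
  have c0 : CauchySeq fun l => f l 0 := by
    rw [Metric.cauchySeq_iff]
    intro ε hε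
    have := hq.eventually (gt_mem_nhds hε)
    rw [eventually_atTop] at this
    obtain ⟨⟨N, N'⟩, hN⟩ := this
    exact ⟨max N N', fun l hl k hk => (h0 l k).trans_lt
      (hN (l, k) ⟨(le_max_left _ _).trans hl, (le_max_right _ _).trans hk⟩)⟩
  obtain ⟨w, hw⟩ := cauchySeq_tendsto_of_complete cW
  obtain ⟨v₀, hv₀⟩ := cauchySeq_tendsto_of_complete c0
  set g : ℝ → ℝ := IccExtend zero_le_one w with hg
  have hgc : Continuous g := w.continuous.Icc_extend'
  have hgw : ∀ x (hx : x ∈ Icc (0 : ℝ) 1), g x = w ⟨x, hx⟩ := fun x hx =>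
    IccExtend_of_mem zero_le_one _ hx
  set v : ℝ → ℝ := fun x => v₀ + ∫ ξ in (0 : ℝ)..x, g ξ with hv
  have hvd : ∀ x, HasDerivAt v (g x) x := fun x =>
    ((hgc.integral_hasStrictDerivAt 0 x).hasDerivAt).const_add v₀
  have hr : Tendsto (fun l => |f l 0 - v₀| + ‖W l - w‖) atTop (𝓝 0) := by
    have e1 := (tendsto_iff_norm_sub_tendsto_zero.1 hv₀)
    have e2 := (tendsto_iff_norm_sub_tendsto_zero.1 hw)
    simpa using e1.add e2
  have hfv : ∀ l, ∀ x ∈ Icc (0 : ℝ) 1, |f l x - v x| ≤ |f l 0 - v₀| + ‖W l - w‖ := by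
    intro l x hx
    have h2 := abs_sub_le_integral (h := fun _ => ‖W l - w‖) continuous_const
      (fun x hx => (hd l x hx).sub (hvd x).hasDerivWithinAt) (fun x hx => by
        have := (W l - w).norm_coe_le_norm ⟨x, hx⟩
        rwa [ContinuousMap.sub_apply, hW, ← hgw x hx] at this) hx hm0
    have hv0 : v 0 = v₀ := by simp [hv]
    simp only [Pi.sub_apply, hv0, intervalIntegral.integral_const, sub_zero, one_smul] at h2
    have h3 := abs_add_le (f l x - v x - (f l 0 - v₀)) (f l 0 - v₀)
    rw [sub_add_cancel] at h3
    linarith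
  refine ⟨v, _, ?_, ?_, hr, hfv⟩
  · refine ContDiff.contDiffOn (contDiff_one_iff_deriv.2 ⟨fun x => (hvd x).differentiableAt, ?_⟩)
    rw [show deriv v = g from funext fun x => (hvd x).deriv]
    exact hgc
  · have hvx : ∀ x ∈ Icc (0 : ℝ) 1, |v x| ≤ K := fun x hx => by
      have : Tendsto (fun l => f l x) atTop (𝓝 (v x)) :=
        tendsto_iff_norm_sub_tendsto_zero.2
          (squeeze_zero (fun _ => norm_nonneg _) (fun l => hfv l x hx) hr)
      exact le_of_tendsto_of_tendsto' this.abs hδ fun l => (hb l x hx).1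
    have hgx : ∀ x ∈ Icc (0 : ℝ) 1, |g x| ≤ K := fun x hx => by
      have h2 : Tendsto (fun l => W l ⟨x, hx⟩) atTop (𝓝 (w ⟨x, hx⟩)) :=
        tendsto_iff_norm_sub_tendsto_zero.2 (squeeze_zero (fun _ => norm_nonneg _)
          (fun l => (W l - w).norm_coe_le_norm ⟨x, hx⟩) (tendsto_iff_norm_sub_tendsto_zero.1 hw))
      rw [hgw x hx]
      refine le_of_tendsto_of_tendsto' h2.abs hδ fun l => ?_
      rw [hW]
      exact (hb l x hx).2
    have : Nonempty (Icc (0 : ℝ) 1) := ⟨⟨0, hm0⟩⟩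
    unfold c1Norm
    rw [two_mul]
    refine add_le_add (ciSup_le fun x => hvx x x.2) (ciSup_le fun x => ?_)
    rw [(hvd x).hasDerivWithinAt.derivWithin (uniqueDiffOn_Icc zero_lt_one x x.2)]
    exact hgx x x.2

section

variable {n m : ℕ} {p : Matrix (Fin n) (Fin n) ℝ} {a : Fin n → ℝ → ℝ → ℝ}
  {b b' : Fin n → Fin n → ℝ → ℝ → ℝ} {K : Fin n → Fin n → ℝ}

lemma norm_toL2_le_of_abs_le {v : Fin n → ℝ → ℝ} (hv : ∀ j, MemLp (v j) 2 μ01) {r : ℝ} (hr : 0 ≤ r)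
    (h : ∀ j, ∀ x ∈ Icc (0 : ℝ) 1, |v j x| ≤ r) : ‖toL2 v‖ ≤ Real.sqrt n * r := by
  refine norm_toL2_le hv (by positivity) ?_
  rw [mul_pow, Real.sq_sqrt (Nat.cast_nonneg n)]
  refine (Finset.sum_le_sum fun j _ => ?_ : _ ≤ ∑ _j : Fin n, r ^ 2).trans (le_of_eq (by simp))
  have := intervalIntegral.norm_integral_le_of_norm_le_const (a := 0) (b := 1) (C := r ^ 2)
    (f := fun x => v j x ^ 2) fun x hx => by
      rw [uIoc_of_le zero_le_one] at hx
      rw [Real.norm_eq_abs, abs_of_nonneg (sq_nonneg _), ← sq_abs]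
      exact pow_le_pow_left₀ (abs_nonneg _) (h j x (Ioc_subset_Icc_self hx)) 2
  simpa using (le_abs_self _).trans this

/-- A `C¹` estimate for classical solutions carries over to the evolution family. -/
lemma IsGenerated.opNormL2C1Le (S : Setting m a) (hb : ∀ j k, IsCoef (b j k) (b' j k) (K j k))
    {U : ℝ → ℝ → L2 n →L[ℝ] L2 n} (hU : IsGenerated m p a b U) {τ t C : ℝ} (ht : τ ≤ t)
    (hC : 0 ≤ C) (h : ∀ u ux ut, IsSol m p a b τ (fun _ _ _ => 0) u ux ut →
      ∀ j, ∀ x ∈ Icc (0 : ℝ) 1, |u j x t| ≤ C * Real.sqrt (sqn u τ) ∧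
        |ux j x t| ≤ C * Real.sqrt (sqn u τ)) (φ : L2 n) :
    ∃ v : Fin n → ℝ → ℝ, ∀ j, ContDiffOn ℝ 1 (v j) (Icc (0 : ℝ) 1) ∧ U t τ φ j =ᵐ[μ01] v j ∧
      c1Norm (v j) ≤ 2 * (C * Real.sqrt n) * ‖φ‖ := by
  obtain ⟨φl, ul, hφl, hul, hconv, hcv⟩ := hU.exists_approx S hb τ φ
  choose ux ut hs using fun l => (hul l).isSol S hb
  have hnorm : ∀ u ux ut, IsSol m p a b τ (fun _ _ _ => 0) u ux ut →
      ∀ j, ∀ x ∈ Icc (0 : ℝ) 1,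
        |u j x t| ≤ C * Real.sqrt n * ‖toL2 fun j x => u j x τ‖ ∧
        |ux j x t| ≤ C * Real.sqrt n * ‖toL2 fun j x => u j x τ‖ := by
    intro u ux ut hu j x hx
    have h1 : Real.sqrt (sqn u τ) ≤ Real.sqrt n * ‖toL2 fun j x => u j x τ‖ := by
      refine (Real.sqrt_le_sqrt (sqn_le_norm hu le_rfl)).trans (le_of_eq ?_)
      rw [Real.sqrt_mul (Nat.cast_nonneg n), Real.sqrt_sq (norm_nonneg _)]
    have h2 := mul_le_mul_of_nonneg_left h1 hC
    rw [← mul_assoc] at h2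
    exact ⟨(h u ux ut hu j x hx).1.trans h2, (h u ux ut hu j x hx).2.trans h2⟩
  have hini : ∀ l, (toL2 fun j x => ul l j x τ) = toL2 (φl l) := fun l =>
    (hul l).toL2_initial (hs l) fun j => (hφl l j).memLp
  have hdiff : ∀ l k j, ∀ x ∈ Icc (0 : ℝ) 1,
      |ul l j x t - ul k j x t| ≤ C * Real.sqrt n * ‖toL2 (φl l) - toL2 (φl k)‖ ∧
      |ux l j x t - ux k j x t| ≤ C * Real.sqrt n * ‖toL2 (φl l) - toL2 (φl k)‖ := by
    intro l k j x hx
    -- Differences of solutions are solutions, so the estimate makes the approximating sequence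
    -- Cauchy in `C¹`.
    have h1 := hnorm _ _ _ ((hs k).mul_add (-1) (hs l)) j x hx
    have h2 : (toL2 fun j x => -1 * ul k j x τ + ul l j x τ) = toL2 (φl l) - toL2 (φl k) := by
      rw [← hini l, ← hini k, ← toL2_sub ((hs l).memLp le_rfl) ((hs k).memLp le_rfl)]
      congr 1
      funext j x
      ring
    rw [h2] at h1
    refine ⟨le_trans (le_of_eq ?_) h1.1, le_trans (le_of_eq ?_) h1.2⟩ <;> congr 1 <;> ring
  have hq : Tendsto (fun i : ℕ × ℕ => C * Real.sqrt n * ‖toL2 (φl i.1) - toL2 (φl i.2)‖) atTop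
      (𝓝 0) := by
    have h1 : Tendsto (fun i : ℕ × ℕ => toL2 (φl i.1) - toL2 (φl i.2)) atTop (𝓝 (φ - φ)) := by
      rw [← prod_atTop_atTop_eq]
      exact (hconv.comp tendsto_fst).sub (hconv.comp tendsto_snd)
    simpa using (h1.norm).const_mul (C * Real.sqrt n)
  choose v r hv hvK hr hvr using fun j => exists_c1_limit (f := fun l x => ul l j x t)
    (f' := fun l x => ux l j x t) (fun l => continuousOn_slice ((hs l).cx j) ht)
    (fun l x hx => hasDerivWithinAt_fst (J := Ici τ) ((hs l).hd j x hx t ht) ht) hq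
    (fun l k => (hdiff l k j 0 (left_mem_Icc.2 zero_le_one)).1)
    (fun l k x hx => (hdiff l k j x hx).2) (hconv.norm.const_mul (C * Real.sqrt n))
    (fun l x hx => by
      have := hnorm _ _ _ (hs l) j x hx
      rwa [hini l] at this)
  have hvL : ∀ j, MemLp (v j) 2 μ01 := fun j => ContinuousOn.memLp_unit (hv j).continuousOn
  have hlim : Tendsto (fun l => toL2 fun j x => ul l j x t) atTop (𝓝 (toL2 v)) := by
    have hsum : Tendsto (fun l => Real.sqrt n * ∑ j, r j l) atTop (𝓝 0) := by
      simpa using (tendsto_finsetSum Finset.univ fun j _ => hr j).const_mul (Real.sqrt n)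
    refine tendsto_iff_norm_sub_tendsto_zero.2
      (squeeze_zero (fun _ => norm_nonneg _) (fun l => ?_) hsum)
    have hr0 : ∀ j, 0 ≤ r j l := fun j =>
      (abs_nonneg _).trans (hvr j l 0 (left_mem_Icc.2 zero_le_one))
    rw [← toL2_sub ((hs l).memLp ht) hvL]
    refine norm_toL2_le_of_abs_le (fun j => ((hs l).memLp ht j).sub (hvL j))
      (Finset.sum_nonneg fun j _ => hr0 j) fun j x hx => ?_
    exact (hvr j l x hx).trans (Finset.single_le_sum (f := fun j => r j l) (fun j _ => hr0 j)
      (Finset.mem_univ j))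
  have hUv : U t τ φ = toL2 v := tendsto_nhds_unique (hcv t ht) hlim
  refine ⟨v, fun j => ⟨hv j, ?_, (hvK j).trans (le_of_eq (by ring))⟩⟩
  rw [hUv]
  exact toL2_coeFn hvL j

end

end

end Hyp

/-! ### Combination of smoothing and decay, and the theorem. -/

namespace Hyp

noncomputable section

section

variable {n m : ℕ} {p : Matrix (Fin n) (Fin n) ℝ} {a : Fin n → ℝ → ℝ → ℝ}
  {bd : Fin n → ℝ → ℝ → ℝ}

lemma OpNormL2C1Le.mono {V : L2 n →L[ℝ] L2 n} {K L : ℝ} (h : OpNormL2C1Le V K) (hKL : K ≤ L) :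
    OpNormL2C1Le V L := fun φ => by
  obtain ⟨v, hv⟩ := h φ
  exact ⟨v, fun j => ⟨(hv j).1, (hv j).2.1,
    (hv j).2.2.trans (mul_le_mul_of_nonneg_right hKL (norm_nonneg _))⟩⟩

lemma OpNormL2C1Le.comp {V W : L2 n →L[ℝ] L2 n} {K : ℝ} (h : OpNormL2C1Le V K) (hK : 0 ≤ K) :
    OpNormL2C1Le (V.comp W) (K * ‖W‖) := fun φ => by
  obtain ⟨v, hv⟩ := h (W φ)
  refine ⟨v, fun j => ⟨(hv j).1, (hv j).2.1, (hv j).2.2.trans ?_⟩⟩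
  rw [mul_assoc]
  exact mul_le_mul_of_nonneg_left (W.le_opNorm φ) hK

/-- Smoothing after a time that depends only on the unperturbed problem, for the evolution
families of admissible perturbations. -/
theorem Setting.exists_smoothing (S : Setting m a) (hbd : ∀ j, IsBC1 (bd j))
    (hext : FiniteExtinction m p a bd) :
    ∃ T, 0 < T ∧ ∀ ε bt, AdmissibleC1 a ε bt → ∃ C, 0 ≤ C ∧
      ∀ U, IsGenerated m p a (perturb bd bt) U → ∀ τ, OpNormL2C1Le (U (τ + T) τ) C := by
  obtain ⟨N, hN⟩ := hext
  have hl := inv_pos.2 S.Λ_pos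
  -- `N + 1` is the nilpotency exponent of `trans'`. It is determined by the unperturbed problem, so
  -- the time is common to all admissible perturbations, whereas `C` depends on the perturbation.
  refine ⟨(2 * (N + 1 : ℕ) + 3) * S.Λ⁻¹, by positivity, fun ε bt hbt => ?_⟩
  obtain ⟨e, b', R, hD⟩ := hbt.exists_levyData S p hbd
  obtain ⟨C, hC, h⟩ := hD.exists_smoothing (S.trans'_nilpotent hbd hN)
  refine ⟨2 * (C * Real.sqrt n), by positivity, fun U hU τ φ => ?_⟩
  exact hU.opNormL2C1Le S hD.coef (by simp only [le_add_iff_nonneg_right]; positivity) hC (h τ) φ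

/-- Smoothing and decay combined. -/
lemma IsGenerated.opNormL2C1Le_of_decay {b : Fin n → Fin n → ℝ → ℝ → ℝ}
    {U : ℝ → ℝ → L2 n →L[ℝ] L2 n} (hU : IsGenerated m p a b U) {T C M γ : ℝ} (hC : 0 ≤ C)
    (hT : 0 < T) (hs : ∀ τ, OpNormL2C1Le (U (τ + T) τ) C)
    (hd : ∀ τ t, τ ≤ t → ‖U t τ‖ ≤ M * Real.exp (-γ * (t - τ))) {τ t : ℝ} (ht : τ + T ≤ t) :
    OpNormL2C1Le (U t τ) (C * M * Real.exp (γ * T) * Real.exp (-γ * (t - τ))) := by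
  have h1 := hs (t - T)
  rw [sub_add_cancel] at h1
  rw [← hU.1.comp τ (t - T) t (by linarith) (by linarith)]
  refine (h1.comp hC).mono ((mul_le_mul_of_nonneg_left (hd τ (t - T) (by linarith)) hC).trans
    (le_of_eq ?_))
  rw [mul_assoc (C * M), ← Real.exp_add, mul_assoc]
  congr 3
  ring

end

end

end Hyp
theorem theorem2p3 (n m : ℕ) (hn : 2 ≤ n) (hm : m ≤ n)
    (p : Matrix (Fin n) (Fin n) ℝ) (a b : Fin n → ℝ → ℝ → ℝ)
    (ha : ∀ j, Hyp.IsBC1 (a j)) (hb : ∀ j, Hyp.IsBC1 (b j))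
    (hnd : Hyp.NonDegenerate m a) (hext : Hyp.FiniteExtinction m p a b) :
    ∀ γ : ℝ, 0 < γ → ∃ M : ℝ, 1 ≤ M ∧
      (∃ ε : ℝ, 0 < ε ∧ ∀ bt : Fin n → Fin n → ℝ → ℝ → ℝ,
        (∀ j k, Hyp.IsBC1 (bt j k)) → (∀ j k, Hyp.supNorm (bt j k) < ε) →
          (∃ U, Hyp.IsGenerated m p a (Hyp.perturb b bt) U) ∧
          ∀ U, Hyp.IsGenerated m p a (Hyp.perturb b bt) U →
            ∀ τ t : ℝ, τ ≤ t → ‖U t τ‖ ≤ M * Real.exp (-γ * (t - τ))) ∧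
      (∃ ε : ℝ, 0 < ε ∧
        (∀ bt, Hyp.AdmissibleC1 a ε bt → ∃ U, Hyp.IsGenerated m p a (Hyp.perturb b bt) U) ∧
        (∃ M₁ : ℝ, M ≤ M₁ ∧ ∀ bt, Hyp.AdmissibleC1 a ε bt → ∃ T₁ : ℝ, 0 < T₁ ∧
          ∀ U, Hyp.IsGenerated m p a (Hyp.perturb b bt) U →
            ∀ τ t : ℝ, τ + T₁ ≤ t →
              Hyp.OpNormL2C1Le (U t τ) (M₁ * Real.exp (-γ * (t - τ)))) ∧
        (∃ T₁ : ℝ, 0 < T₁ ∧ ∀ bt, Hyp.AdmissibleC1 a ε bt → ∃ M₁ : ℝ, M ≤ M₁ ∧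
          ∀ U, Hyp.IsGenerated m p a (Hyp.perturb b bt) U →
            ∀ τ t : ℝ, τ + T₁ ≤ t →
              Hyp.OpNormL2C1Le (U t τ) (M₁ * Real.exp (-γ * (t - τ))))) := by
  intro γ hγ
  obtain ⟨S⟩ := Hyp.exists_setting ha hnd
  obtain ⟨M, ε₁, hM, hε₁, hdec⟩ := S.exists_decay hb hext hγ
  -- A faster rate, kept in reserve for the version with a common `M₁`.
  obtain ⟨M', ε₂, hM', hε₂, hdec'⟩ := S.exists_decay hb hext (by linarith : 0 < γ + 1)
  obtain ⟨T, hT, hsm⟩ := S.exists_smoothing hb hext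
  have hgen : ∀ bt : Fin n → Fin n → ℝ → ℝ → ℝ, (∀ j k, Hyp.IsBC1 (bt j k)) →
      ∃ U, Hyp.IsGenerated m p a (Hyp.perturb b bt) U := by
    intro bt hbt
    choose K hK using fun j k => (hbt j k).exists_isCoef
    obtain ⟨b', K', hb'⟩ := Hyp.exists_isCoef_perturb hb hK
    exact S.exists_generated p hb'
  refine ⟨M, hM, ⟨ε₁, hε₁, fun bt hbt hs => ⟨hgen bt hbt, hdec bt hbt hs⟩⟩, min ε₁ ε₂,
    lt_min hε₁ hε₂, fun bt hbt => hgen bt hbt.bc1, ⟨M, le_rfl, fun bt hbt => ?_⟩,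
    T, hT, fun bt hbt => ?_⟩
  · obtain ⟨C, hC, hs⟩ := hsm _ bt hbt
    have hd := hdec' bt hbt.bc1 fun j k =>
      ((Hyp.supNorm_le_bc1Norm _).trans_lt (hbt.small j k)).trans_le (min_le_right _ _)
    set Q := C * M' * Real.exp ((γ + 1) * T) with hQ
    have hQ0 : 0 ≤ Q := by positivity
    -- After the additional waiting time `Q` the surplus factor `exp (-(t - τ))` outweighs the
    -- constant `Q`, so `M₁ = M` serves all admissible perturbations at once.
    refine ⟨T + Q, by linarith, fun U hU τ t ht => ?_⟩
    refine (hU.opNormL2C1Le_of_decay hC hT (hs U hU) (hd U hU) (by linarith)).mono ?_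
    rw [show -(γ + 1) * (t - τ) = -(t - τ) + -γ * (t - τ) by ring, Real.exp_add, ← mul_assoc]
    refine mul_le_mul_of_nonneg_right (le_trans ?_ hM) (Real.exp_pos _).le
    rw [Real.exp_neg, ← div_eq_mul_inv, div_le_one (Real.exp_pos _)]
    linarith [Real.add_one_le_exp (t - τ)]
  · obtain ⟨C, hC, hs⟩ := hsm _ bt hbt
    have hd := hdec bt hbt.bc1 fun j k =>
      ((Hyp.supNorm_le_bc1Norm _).trans_lt (hbt.small j k)).trans_le (min_le_left _ _)
    refine ⟨max M (C * M * Real.exp (γ * T)), le_max_left _ _, fun U hU τ t ht => ?_⟩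
    exact (hU.opNormL2C1Le_of_decay hC hT (hs U hU) (hd U hU) ht).mono
      (mul_le_mul_of_nonneg_right (le_max_right _ _) (Real.exp_pos _).le)
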